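/- Let $X$ be a compact manifold with boundary, let $\Phi:\partial X\to Y$ be a smooth fibre bundle with fibre $Z$ (with $Y$, $Z$ manifolds without boundary), let $x:X\to[0,\infty)$ be a boundary defining function (smooth, with $\{x=0\}=\partial X$ and $dx\neq0$ on $\partial X$), and let $\varepsilon_0>0$. Write $[M;S]$ for the real (spherical, inward-pointing) blow-up of a manifold with corners $M$ along a p-submanifold $S$, and, in an iterated blow-up, denote lifts (proper transforms: closures of preimages of complements of the centres) by the same letters. Put $$X_\varepsilon=[X\times[0,\varepsilon_0];\ \partial X\times\{0\}],$$ $$X^2_{(2)}=[X^2\times[0,\varepsilon_0];\ (\partial X)^2\times\{0\};\ X\times\partial X\times\{0\};\ \partial X\times X\times\{0\}],$$ $$X^2_{\varepsilon\Phi}=[X^2_{(2)};\ D_B;\ D_F].$$ Here $D_B\subset X^2_{(2)}$ is the lift of the fibre diagonal $\{(p,p',\varepsilon): p,p'\in\partial X,\ \Phi(p)=\Phi(p')\}$, and $D_F\subset X^2_{(2)}$ is the set of the points of the front face (the lift of $(\partial X)^2\times\{0\}$) that lie on the lift of $\{(p,p',\varepsilon): x(p)=x(p')\}$ and are mapped into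 the fibre diagonal by the blow-down map to $X^2\times[0,\varepsilon_0]$. Then these iterated blow-ups exist, that is, each centre is a p-submanifold at the stage at which it is blown up. Moreover: 1. The diagonal $\{(p,p,\varepsilon)\}\subset X^2\times[0,\varepsilon_0]$ lifts to an interior p-submanifold $\mathrm{diag}_{\varepsilon\Phi}$ of $X^2_{\varepsilon\Phi}$. 2. The projections $(p,p',\varepsilon)\mapsto(p,\varepsilon)$ and $(p,p',\varepsilon)\mapsto(p',\varepsilon)$ lift to maps $\pi_L,\pi_R:X^2_{\varepsilon\Phi}\to X_\varepsilon$ that are b-fibrations: smooth interior b-maps whose b-differential is surjective at every point and which map no boundary hypersurface into a corner of codimension at least $2$. 3. Both maps are transverse to the lifted diagonal: for $\pi=\pi_L$ and $\pi=\pi_R$, and for every $p\in\mathrm{diag}_{\varepsilon\Phi}$, $\ker({}^b\pi_*|_p)+{}^bT_p\,\mathrm{diag}_{\varepsilon\Phi}={}^bT_pX^2_{\varepsilon\Phi}$. -/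

import Mathlib

open Set Topology
open scoped Manifold ContDiff

universe u

/-- The model with corners `[0,∞)^m ⊆ ℝ^m` of an `m`-dimensional manifold with corners. -/
noncomputable abbrev 𝓠 (m : ℕ) :
    ModelWithCorners ℝ (EuclideanSpace ℝ (Fin m)) (EuclideanQuadrant m) :=
  modelWithCornersEuclideanQuadrant m

/-- A smooth manifold with corners of dimension `m`, as a bundled object. -/
structure CornerManifold (m : ℕ) : Type (u + 1) where
  carrier : Type u
  [top : TopologicalSpace carrier]
  [charted : ChartedSpace (EuclideanQuadrant m) carrier]
  [smooth : IsManifold (𝓠 m) ∞ carrier]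
  [hausdorff : T2Space carrier]
  [countable : SecondCountableTopology carrier]

instance (m : ℕ) : CoeSort (CornerManifold.{u} m) (Type u) := ⟨CornerManifold.carrier⟩

attribute [instance] CornerManifold.top CornerManifold.charted CornerManifold.smooth
  CornerManifold.hausdorff CornerManifold.countable

section Submanifolds

variable {E : Type*} [NormedAddCommGroup E] [NormedSpace ℝ E] {H : Type*} [TopologicalSpace H]
  (I : ModelWithCorners ℝ E H) {M : Type*} [TopologicalSpace M] [ChartedSpace H M]

/-- A system of local coordinates on `M` with values in `[0,∞)^m`: a diffeomorphism of an open
subset of `M` onto an open subset of `[0,∞)^m`. At a point `p`, the coordinates that vanish at `p`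
are local defining functions of the boundary hypersurfaces through `p`, the other coordinates
are interior coordinates (which are not required to be centred at `p`). -/
abbrev CornerChart (M : Type*) [TopologicalSpace M] [ChartedSpace H M] (m : ℕ) :=
  PartialDiffeomorph I (𝓠 m) M (EuclideanQuadrant m) ∞

variable {I} {m : ℕ}

/-- The `i`-th coordinate function of a chart. -/
def CornerChart.coord (φ : CornerChart I M m) (i : Fin m) (q : M) : ℝ := (φ q).val i

/-- The chart `φ` is adapted to `S` at `p`: in the domain of `φ`, the set `S` is given by fixing
the coordinates with index in `A` to their values at `p`. -/
def IsAdaptedChart (S : Set M) (p : M) (φ : CornerChart I M m) (A : Finset (Fin m)) : Prop :=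
  p ∈ φ.source ∧ ∀ q ∈ φ.source, q ∈ S ↔ ∀ i ∈ A, φ.coord i q = φ.coord i p

variable (I m)

/-- `S` is a (closed, embedded) p-submanifold of the `m`-dimensional manifold with corners `M`:
near each of its points there are coordinates in which `S` is a coordinate submanifold. -/
def IsPSubmanifold (S : Set M) : Prop :=
  IsClosed S ∧ ∀ p ∈ S, ∃ (φ : CornerChart I M m) (A : Finset (Fin m)), IsAdaptedChart S p φ A

/-- An interior p-submanifold: only interior coordinates are fixed on `S`, so that no piece of `S`
lies in the boundary of `M`. -/
def IsInteriorPSubmanifold (S : Set M) : Prop :=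
  IsClosed S ∧ ∀ p ∈ S, ∃ (φ : CornerChart I M m) (A : Finset (Fin m)),
    IsAdaptedChart S p φ A ∧ ∀ i ∈ A, φ.coord i p ≠ 0

end Submanifolds

section BlowUp

/-- A diffeomorphism, with inverse `g`, between the (not necessarily open) subsets `s` and `t`. -/
def IsDiffeoOn {E : Type*} [NormedAddCommGroup E] [NormedSpace ℝ E] {H : Type*}
    [TopologicalSpace H] (I : ModelWithCorners ℝ E H) {E' : Type*} [NormedAddCommGroup E']
    [NormedSpace ℝ E'] {H' : Type*} [TopologicalSpace H'] (J : ModelWithCorners ℝ E' H')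
    {M : Type*} [TopologicalSpace M] [ChartedSpace H M]
    {N : Type*} [TopologicalSpace N] [ChartedSpace H' N]
    (f : M → N) (g : N → M) (s : Set M) (t : Set N) : Prop :=
  ContMDiffOn I J ∞ f s ∧ ContMDiffOn J I ∞ g t ∧ MapsTo f s t ∧ MapsTo g t s ∧ InvOn g f s t

/-- Polar coordinates about `{x | ∀ i ∈ A, x i = c i}`: the pair `(r, u)` encodes the radius `r`, the
direction `(u i)_{i ∈ A}` in the normal sphere and the remaining coordinates `(u i)_{i ∉ A}`, and
is sent to the point `x` with `x i = c i + r u i` for `i ∈ A` and `x i = u i` for `i ∉ A`. -/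
noncomputable def polarMap {m : ℕ} (c : EuclideanSpace ℝ (Fin m)) (A : Finset (Fin m))
    (w : ℝ × EuclideanSpace ℝ (Fin m)) : EuclideanSpace ℝ (Fin m) :=
  WithLp.toLp 2 fun i => if i ∈ A then c i + w.1 * w.2 i else w.2 i

/-- The model of the blow-up, inside the set `V ⊆ [0,∞)^m`, of `{x | ∀ i ∈ A, x i = c i}`: the
polar coordinates `(r, u)` with `r ≥ 0`, with direction in the inward-pointing part of the unit
sphere, and with image in `V`. -/
def polarDomain {m : ℕ} (c : EuclideanSpace ℝ (Fin m)) (A : Finset (Fin m))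
    (V : Set (EuclideanSpace ℝ (Fin m))) : Set (ℝ × EuclideanSpace ℝ (Fin m)) :=
  {w | 0 ≤ w.1 ∧ ∑ i ∈ A, w.2 i ^ 2 = 1 ∧ (∀ i ∈ A, c i = 0 → 0 ≤ w.2 i) ∧ polarMap c A w ∈ V}

variable {E : Type*} [NormedAddCommGroup E] [NormedSpace ℝ E] {H : Type*} [TopologicalSpace H]
  (I : ModelWithCorners ℝ E H) {M : Type*} [TopologicalSpace M] [ChartedSpace H M] {m : ℕ}

/-- `β : M' → M` is the (real, spherical) blow-down map of the blow-up `[M; S]` of the manifold with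
corners `M` along the p-submanifold `S`: it is smooth, a diffeomorphism away from `S`, and, over
the domain of each coordinate system adapted to `S`, polar coordinates in the normal variables
identify `β` with the polar coordinate map. This determines `(M', β)` up to a unique
diffeomorphism. -/
structure IsBlowup {M' : Type*} [TopologicalSpace M'] [ChartedSpace (EuclideanQuadrant m) M']
    (S : Set M) (β : M' → M) : Prop where
  isPSubmanifold : IsPSubmanifold I m S
  contMDiff : ContMDiff (𝓠 m) I ∞ β
  bijOn : BijOn β (β ⁻¹' S)ᶜ Sᶜ
  isLocalDiffeomorphOn : IsLocalDiffeomorphOn (𝓠 m) I ∞ β (β ⁻¹' S)ᶜ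
  polar : ∀ p ∈ S, ∀ (φ : CornerChart I M m) (A : Finset (Fin m)), IsAdaptedChart S p φ A →
    ∃ (Ψ : M' → ℝ × EuclideanSpace ℝ (Fin m)) (Θ : ℝ × EuclideanSpace ℝ (Fin m) → M'),
      IsDiffeoOn (𝓠 m) 𝓘(ℝ, ℝ × EuclideanSpace ℝ (Fin m)) Ψ Θ (β ⁻¹' φ.source)
        (polarDomain (φ p).val A (Subtype.val '' φ.target)) ∧
      ∀ q ∈ β ⁻¹' φ.source, (φ (β q)).val = polarMap (φ p).val A (Ψ q)

variable (m) in
/-- A blow-up `[M; S]`, with its blow-down map. -/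
structure Blowup {M : Type u} [TopologicalSpace M] [ChartedSpace H M] (S : Set M) :
    Type (u + 1) where
  total : CornerManifold.{u} m
  down : total → M
  isBlowup : IsBlowup (m := m) I S down

variable {I}

/-- The lift (proper transform) to `[M; S]` of a closed subset `T` of `M` that is the
closure of `T \ S` (as is every set lifted below): the closure of the preimage of `T \ S`. -/
def Blowup.lift {M : Type u} [TopologicalSpace M] [ChartedSpace H M] {S : Set M}
    (B : Blowup I m S) (T : Set M) : Set B.total :=
  closure (B.down ⁻¹' (T \ S))

end BlowUp

section BMaps

variable {m k : ℕ} {M : Type*} [TopologicalSpace M] [ChartedSpace (EuclideanQuadrant m) M]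
  {N : Type*} [TopologicalSpace N] [ChartedSpace (EuclideanQuadrant k) N]

/-- The indices of the coordinates that vanish at `p` (those of the boundary hypersurfaces
through `p`). Its cardinality is the codimension of the corner containing `p`. -/
noncomputable def CornerChart.bdryIdx (φ : CornerChart (𝓠 m) M m) (p : M) : Finset (Fin m) :=
  open Classical in Finset.univ.filter fun i => φ.coord i p = 0

/-- The partial derivative at `p` of the function `g` in the `i`-th coordinate direction. -/
noncomputable def CornerChart.partialDeriv (φ : CornerChart (𝓠 m) M m) (g : M → ℝ) (p : M)
    (i : Fin m) : ℝ :=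
  fderivWithin ℝ (fun z => g (φ.symm ((𝓠 m).symm z))) (range (𝓠 m)) (φ p).val
    (EuclideanSpace.single i 1)

/-- `f` is, near `p`, an interior b-map, with b-differential `L` at `p`.

In coordinates `x = φ` near `p` and `y = ψ` near `f p`, the pull-back of each boundary coordinate
`y_j` has to be `a · ∏ x_i ^ e_i`, the product being over the boundary coordinates at `p`, with `a`
smooth and positive. The map `L` is the matrix of `ᵇf_* : ᵇT_p M → ᵇT_{f p} N` in the
bases given by `x_i ∂_{x_i}` for the boundary coordinates and `∂_{x_i}` for the interior ones, and
likewise for `y`. -/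
def HasBDifferentialAt (φ : CornerChart (𝓠 m) M m) (ψ : CornerChart (𝓠 k) N k) (f : M → N) (p : M)
    (L : (Fin m → ℝ) →ₗ[ℝ] (Fin k → ℝ)) : Prop :=
  p ∈ φ.source ∧ f p ∈ ψ.source ∧
  (∀ j ∉ ψ.bdryIdx (f p), ∀ v,
    L v j = ∑ i ∈ (φ.bdryIdx p)ᶜ, φ.partialDeriv (fun q => ψ.coord j (f q)) p i * v i) ∧
  ∀ j ∈ ψ.bdryIdx (f p), ∃ (e : Fin m → ℕ) (a : M → ℝ), ContMDiffAt (𝓠 m) 𝓘(ℝ) ∞ a p ∧ 0 < a p ∧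
    (∀ᶠ q in 𝓝 p, ψ.coord j (f q) = a q * ∏ i ∈ φ.bdryIdx p, φ.coord i q ^ e i) ∧
    ∀ v, L v j = ∑ i ∈ φ.bdryIdx p, (e i : ℝ) * v i +
      ∑ i ∈ (φ.bdryIdx p)ᶜ, φ.partialDeriv a p i / a p * v i

variable (m k) in
/-- A b-fibration: a smooth interior b-map whose b-differential is surjective at each point (a
b-submersion), and which maps no boundary hypersurface into a corner of codimension two or more,
that is, which maps points on exactly one boundary hypersurface to points on at most one. (The
conditions at `p` do not depend on the choice of coordinates.) -/
def IsBFibration (f : M → N) : Prop :=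
  ContMDiff (𝓠 m) (𝓠 k) ∞ f ∧
  ∀ p, ∃ (φ : CornerChart (𝓠 m) M m) (ψ : CornerChart (𝓠 k) N k)
    (L : (Fin m → ℝ) →ₗ[ℝ] (Fin k → ℝ)), HasBDifferentialAt φ ψ f p L ∧
      Function.Surjective L ∧ ((φ.bdryIdx p).card = 1 → (ψ.bdryIdx (f p)).card ≤ 1)

variable (m k) in
/-- The b-map `f` is transverse to the interior p-submanifold `S` of its domain:
`ker ᵇf_* + ᵇT_p S = ᵇT_p M` for all `p ∈ S`. In adapted coordinates `ᵇT_p S` consists of the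
b-tangent vectors without components in the directions that are normal to `S`. -/
def IsBTransverse (f : M → N) (S : Set M) : Prop :=
  ∀ p ∈ S, ∃ (φ : CornerChart (𝓠 m) M m) (A : Finset (Fin m)) (ψ : CornerChart (𝓠 k) N k)
    (L : (Fin m → ℝ) →ₗ[ℝ] (Fin k → ℝ)), IsAdaptedChart S p φ A ∧
      (∀ i ∈ A, φ.coord i p ≠ 0) ∧ HasBDifferentialAt φ ψ f p L ∧
      ∀ v, ∃ t n, v = t + n ∧ (∀ i ∈ A, t i = 0) ∧ L n = 0

end BMaps

/-- `Φ : D → Y` is a smooth fibre bundle with fibre `Z` (manifolds without boundary). -/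
def IsSmoothFibration (d h v : ℕ) {D Y : Type*} (Z : Type*)
    [TopologicalSpace D] [ChartedSpace (EuclideanSpace ℝ (Fin d)) D]
    [TopologicalSpace Y] [ChartedSpace (EuclideanSpace ℝ (Fin h)) Y]
    [TopologicalSpace Z] [ChartedSpace (EuclideanSpace ℝ (Fin v)) Z] (Φ : D → Y) : Prop :=
  ∀ y, ∃ (V : Set Y) (e : PartialDiffeomorph (𝓡 d) ((𝓡 h).prod (𝓡 v)) D (Y × Z) ∞),
    IsOpen V ∧ y ∈ V ∧ e.source = Φ ⁻¹' V ∧ e.target = V ×ˢ univ ∧ ∀ q ∈ e.source, (e q).1 = Φ q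

section Adiabatic

variable {n : ℕ} [NeZero n] {X : Type u} [TopologicalSpace X]
  [ChartedSpace (EuclideanHalfSpace n) X]

variable (n) in
/-- A boundary defining function: smooth, non-negative, with zero set `∂X`, and with non-zero
differential at the boundary. -/
def IsBdryDefiningFunction (x : X → ℝ) : Prop :=
  ContMDiff (𝓡∂ n) 𝓘(ℝ) ∞ x ∧ (∀ p, 0 ≤ x p) ∧ (∀ p, x p = 0 ↔ p ∈ (𝓡∂ n).boundary X) ∧
    ∀ p ∈ (𝓡∂ n).boundary X, mfderiv (𝓡∂ n) 𝓘(ℝ) x p ≠ 0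

variable (n X) (ε₀ : ℝ) [Fact (0 < ε₀)]

/-- The subset `A × {0}` of `X × [0,ε₀]`. -/
def atZero {X : Type*} (A : Set X) : Set (X × Icc (0 : ℝ) ε₀) := {q | q.1 ∈ A ∧ q.2.val = 0}

/-- The subset `A × B × {0}` of `X × X × [0,ε₀]`. -/
def atZero₂ {X : Type*} (A B : Set X) : Set (X × X × Icc (0 : ℝ) ε₀) :=
  {q | q.1 ∈ A ∧ q.2.1 ∈ B ∧ q.2.2.val = 0}

/-- The adiabatic single space `X_ε = [X × [0,ε₀]; ∂X × {0}]`. -/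
abbrev AdiabaticSingleSpace : Type (u + 1) :=
  Blowup ((𝓡∂ n).prod (𝓡∂ 1)) (n + 1) (atZero ε₀ ((𝓡∂ n).boundary X))

variable {X} {D Y : Type*} (ι : D → X) (Φ : D → Y) (x : X → ℝ)

/-- The pairs of boundary points in the same fibre of `Φ`, times `[0,ε₀]`. The boundary of `X` is
given as the image of `ι : D → X`. -/
def fibreDiagonal : Set (X × X × Icc (0 : ℝ) ε₀) :=
  {q | ∃ d d', ι d = q.1 ∧ ι d' = q.2.1 ∧ Φ d = Φ d'}

/-- The adiabatic double space `X²_{εΦ}`, as the iterated blow-up of `X² × [0,ε₀]`: first of the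
corner `(∂X)² × {0}`, then of the two sides `X × ∂X × {0}` and `∂X × X × {0}`, giving `X²_(2)`, then
of the (lifts of the) fibred diagonals `D_B` and `D_F`. -/
structure AdiabaticDoubleSpace : Type (u + 1) where
  /-- `[X² × [0,ε₀]; (∂X)² × {0}]`. -/
  B₁ : Blowup ((𝓡∂ n).prod ((𝓡∂ n).prod (𝓡∂ 1))) (n + n + 1)
    (atZero₂ ε₀ ((𝓡∂ n).boundary X) ((𝓡∂ n).boundary X))
  B₂ : Blowup (𝓠 (n + n + 1)) (n + n + 1) (B₁.lift (atZero₂ ε₀ univ ((𝓡∂ n).boundary X)))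
  /-- The total space of `B₃` is `X²_(2)`. -/
  B₃ : Blowup (𝓠 (n + n + 1)) (n + n + 1)
    (B₂.lift (B₁.lift (atZero₂ ε₀ ((𝓡∂ n).boundary X) univ)))
  /-- The blow-up of `X²_(2)` along `D_B`, the lift of the fibre diagonal of `(∂X)² × [0,ε₀]`. -/
  B₄ : Blowup (𝓠 (n + n + 1)) (n + n + 1) (B₃.lift (B₂.lift (B₁.lift (fibreDiagonal ε₀ ι Φ))))
  /-- The blow-up of the lift of `D_F`, which is the set of points of `X²_(2)` that lie on the
  front face (the lift of `(∂X)² × {0}`), on the lift of the hypersurface `x = x'`, and over the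
  fibre diagonal. -/
  B₅ : Blowup (𝓠 (n + n + 1)) (n + n + 1) (B₄.lift
    (B₃.lift (B₂.lift (B₁.down ⁻¹' atZero₂ ε₀ ((𝓡∂ n).boundary X) ((𝓡∂ n).boundary X))) ∩
      B₃.lift (B₂.lift (B₁.lift {q | x q.1 = x q.2.1})) ∩
      (B₁.down ∘ B₂.down ∘ B₃.down) ⁻¹' fibreDiagonal ε₀ ι Φ))

namespace AdiabaticDoubleSpace

variable {n ε₀ ι Φ x} (W : AdiabaticDoubleSpace n ε₀ ι Φ x)

/-- The space `X²_{εΦ}`. -/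
abbrev total : CornerManifold.{u} (n + n + 1) := W.B₅.total

/-- The blow-down map `X²_{εΦ} → X² × [0,ε₀]`. -/
def down : W.total → X × X × Icc (0 : ℝ) ε₀ :=
  W.B₁.down ∘ W.B₂.down ∘ W.B₃.down ∘ W.B₄.down ∘ W.B₅.down

/-- The lift to `X²_{εΦ}` of the diagonal `diag × [0,ε₀]` of `X² × [0,ε₀]`. -/
def diag : Set W.total :=
  W.B₅.lift (W.B₄.lift (W.B₃.lift (W.B₂.lift (W.B₁.lift {q | q.1 = q.2.1}))))

end AdiabaticDoubleSpace

end Adiabatic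

/-!
All statements are local: near each point of each space there are coordinates in which the centres,
the projections and the diagonal are given by monomials and by equations `r_j = 1`. Interior
coordinates are kept positive (by an exponential), so that quotients of coordinates make sense
everywhere and every chart takes values in the quadrant `[0,∞)^m`.

*Existence of blow-ups.* In a chart of `M` where the centre `S` is `{x_j = c_j for j ∈ A}`, each
choice of `i ∈ A` and of a sign gives projective coordinates: the signed difference `±(x_i - c_i)`
and the slopes `(x_j - c_j) / (±(x_i - c_i))`. The blow-up is glued from their domains. Off the
exceptional divisor such coordinates parametrize `M \ S`, and a point of the blow-up is represented
by a filter on `M`, the image of the neighbourhoods of a point of a projective domain, so that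
points of different domains are identified exactly when they carry the same filter. Two projective
charts related by a change of coordinates of `M` have smooth transition maps by Hadamard's lemma
(`exists_polarLift`). This yields `nonempty_blowup`. Conversely any space with the defining property
of a blow-up, which is stated with polar coordinates, has all projective charts
(`Blowup.exists_projChart`, `Blowup.exists_projChart_mem`).

*Monomial maps.* A map `f` to the base of a blow-up that lifts locally, in some chart of the blow-up,
to a map whose components are products of disjoint nonempty sets of coordinates (`MonoLift`) lifts
globally (`exists_lift_of_monoLift`): two local lifts agree where all coordinates are positive, which
is a dense set. In logarithmic coordinates the lift is linear and onto, and its components have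
disjoint supports; hence it is a b-fibration (`isBFibration_of_monoLift`). If a submanifold is given
by equations `r_j = 1` in coordinates that no monomial involves, then its b-tangent space alone is
mapped onto the b-tangent space of the target, which is transversality (`isBTransverse_of_monoLift`).

*Coordinates on the double space.* Near any two points of `X` there are charts in which the boundary
defining function is the first coordinate near the boundary and the fibre diagonal, the diagonal and
the hypersurface `x = x'` of `X²` are given by equalities of coordinates, or are empty
(`exists_fibrePair`). After the blow-ups of the corner `(∂X)² × {0}` and of the two sides, the triple
`(x, x', ε)` is given by monomials in three coordinates, in the ways listed in `DoubleForm`; the two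
projections have the same form because exchanging the factors permutes this list
(`DoubleForms.swap`). In the homogeneous coordinates `[x : x' : ε]` of the front face, `D_B`, `D_F`
and the lifted diagonal lie in `x = x'`, and the lifts of the two sides at `[1 : 0 : 0]` and
`[0 : 1 : 0]`. So only the charts off the sides matter for those three sets.

*The fibred diagonals.* In those charts the coordinates of the right factor, other than the
boundary coordinate in the case of `D_B`, are replaced by their quotients `r_j` by those of the left
factor, so that the projection to the left factor does not involve them. The centre `D_B` is given by
`x = x' = 0` and `r_j = 1` for the coordinates of the base of the fibration; its blow-up makes
`r_0 = x' / x` a coordinate near the next centre. Then `D_F` is given by `r_0 = 1`, `r_j = 1` for the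
coordinates of the base, and the vanishing of the defining function of the front face. Each blow-up
keeps the projections monomial (`Blowup.exists_monoLift`), since the centre involves only one
coordinate that enters a monomial. In the projective chart of a boundary direction the slopes take the
place of the coordinates `r_j`, and the lift of the diagonal is again `r_j = 1` for all `j`. This is
carried out in `FibredDiagonals`.
-/

/-- Euclidean space of dimension `m`. -/
notation:max "ℝ^" m:max => EuclideanSpace ℝ (Fin m)

/-- The quadrant `[0,∞)^m`, as a model space. -/
notation:max "ℝ₊^" m:max => EuclideanQuadrant m

/-- The charts of `N` with values in the quadrant of dimension `m`, for a manifold `N` modelled on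
that quadrant. -/
notation:max "𝓒[" m "]" N:max => CornerChart (𝓠 m) N m

/-- The boundary of an `n`-dimensional manifold with boundary. -/
notation:max "∂[" n "]" X:max => ModelWithCorners.boundary (I := 𝓡∂ n) X

/-! ### Coordinates on quadrants and corner charts -/

/-- The quadrant `[0,∞)^m`, as a subset of `ℝ^m`. -/
def quad (m : ℕ) : Set ℝ^m := {z | ∀ i, 0 ≤ z i}

/-- The coordinatewise positive part, the retraction of `ℝ^m` onto `[0,∞)^m`. -/
noncomputable def toQuad {m : ℕ} (z : ℝ^m) : ℝ₊^m := (𝓠 m).symm z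

lemma toQuad_val {m : ℕ} {z : ℝ^m} (hz : z ∈ quad m) : (toQuad z).val = z := by
  have : z ∈ range (𝓠 m) := by
    rw [show range (𝓠 m) = quad m from range_euclideanQuadrant m]; exact hz
  exact (𝓠 m).right_inv this

lemma val_toQuad {m : ℕ} (z : ℝ₊^m) : toQuad z.val = z := (𝓠 m).left_inv z

lemma range_model_quadrant (m : ℕ) : range (𝓠 m) = quad m := range_euclideanQuadrant m

lemma continuous_toQuad {m : ℕ} : Continuous (toQuad (m := m)) := (𝓠 m).continuous_symm

lemma uniqueDiffOn_quad (m : ℕ) : UniqueDiffOn ℝ (quad m) := by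
  rw [← range_model_quadrant]; exact (𝓠 m).uniqueDiffOn

lemma contMDiff_quadrant_val (m : ℕ) :
    ContMDiff (𝓠 m) 𝓘(ℝ, ℝ^m) ∞ (fun z : ℝ₊^m => z.val) := (𝓠 m).contMDiff

lemma contMDiffOn_toQuad (m : ℕ) : ContMDiffOn 𝓘(ℝ, ℝ^m) (𝓠 m) ∞ (toQuad (m := m)) (quad m) := by
  rw [← range_model_quadrant]; exact (𝓠 m).contMDiffOn_symm

section

variable {E : Type*} [NormedAddCommGroup E] [NormedSpace ℝ E] {H : Type*} [TopologicalSpace H]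
  {I : ModelWithCorners ℝ E H} {M : Type*} [TopologicalSpace M] [ChartedSpace H M] {m : ℕ}

lemma contMDiffOn_euclidean_iff {f : M → ℝ^m} {s : Set M} : ContMDiffOn I 𝓘(ℝ, ℝ^m) ∞ f s ↔
      ∀ i, ContMDiffOn I 𝓘(ℝ) ∞ (fun q => f q i) s := by
  constructor
  · intro h i
    exact ((EuclideanSpace.proj i : ℝ^m →L[ℝ] ℝ).contMDiff (n := ∞)).comp_contMDiffOn h
  · intro h
    have h1 : ContMDiffOn I 𝓘(ℝ, Fin m → ℝ) ∞ (fun q i => f q i) s := contMDiffOn_pi_space.2 h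
    exact ((EuclideanSpace.equiv (Fin m) ℝ).symm.toContinuousLinearMap.contMDiff
      (n := ∞)).comp_contMDiffOn h1

/-- Smoothness of a map into a quadrant is smoothness of its coordinates. -/
lemma contMDiffOn_quadrant_iff {f : M → ℝ₊^m} {s : Set M} :
    ContMDiffOn I (𝓠 m) ∞ f s ↔ ContMDiffOn I 𝓘(ℝ, ℝ^m) ∞ (fun q => (f q).val) s := by
  constructor
  · intro h
    exact (contMDiff_quadrant_val m).comp_contMDiffOn h
  · intro h
    have := (contMDiffOn_toQuad m).comp h (fun q _ => (f q).2)
    refine this.congr fun q _ => ?_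
    exact (val_toQuad _).symm

lemma CornerChart.contMDiffOn_val (φ : CornerChart I M m) :
    ContMDiffOn I 𝓘(ℝ, ℝ^m) ∞ (fun q => (φ q).val) φ.source :=
  contMDiffOn_quadrant_iff.1 φ.contMDiffOn_toFun

lemma CornerChart.contMDiffOn_coord (φ : CornerChart I M m) (i : Fin m) :
    ContMDiffOn I 𝓘(ℝ) ∞ (φ.coord i) φ.source := contMDiffOn_euclidean_iff.1 φ.contMDiffOn_val i

lemma CornerChart.coord_nonneg (φ : CornerChart I M m) (i : Fin m) (q : M) : 0 ≤ φ.coord i q :=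
  (φ q).2 i

lemma CornerChart.val_apply (φ : CornerChart I M m) (i : Fin m) (q : M) :
    (φ q).val i = φ.coord i q := rfl

lemma CornerChart.ext_coord (φ : CornerChart I M m) {q q' : M} (hq : q ∈ φ.source)
    (hq' : q' ∈ φ.source) (h : ∀ i, φ.coord i q = φ.coord i q') : q = q' := by
  apply φ.injOn hq hq'
  apply Subtype.ext
  ext i
  exact h i

/-- The open subset of `ℝ^m` whose trace on the quadrant is the target of a chart. -/
lemma CornerChart.exists_open_target (φ : CornerChart I M m) :
    ∃ O : Set ℝ^m, IsOpen O ∧ φ.target = Subtype.val ⁻¹' O := by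
  obtain ⟨O, hO, h⟩ := isOpen_induced_iff.1 φ.open_target
  exact ⟨O, hO, h.symm⟩

/-- The inverse of a chart as a map on `ℝ^m`, smooth on the image of the chart. -/
lemma CornerChart.contMDiffOn_symm_toQuad (φ : CornerChart I M m) :
    ContMDiffOn 𝓘(ℝ, ℝ^m) I ∞ (fun z => φ.symm (toQuad z)) (Subtype.val '' φ.target) := by
  refine φ.contMDiffOn_invFun.comp ((contMDiffOn_toQuad m).mono ?_) ?_
  · rintro _ ⟨z, -, rfl⟩; exact z.2
  · rintro _ ⟨z, hz, rfl⟩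
    show toQuad z.val ∈ φ.target
    rwa [val_toQuad]

/-- A corner chart from a pair of mutually inverse smooth maps between an open set `U` of the
manifold and the trace on the quadrant of an open set `O` of `ℝ^m`. -/
noncomputable def CornerChart.ofMaps (U : Set M) (hU : IsOpen U) (O : Set ℝ^m) (hO : IsOpen O)
    (f : M → ℝ^m) (g : ℝ^m → M) (hf : ContMDiffOn I 𝓘(ℝ, ℝ^m) ∞ f U)
    (hg : ContMDiffOn 𝓘(ℝ, ℝ^m) I ∞ g (quad m ∩ O))
    (hfm : MapsTo f U (quad m ∩ O)) (hgm : MapsTo g (quad m ∩ O) U)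
    (hgf : ∀ q ∈ U, g (f q) = q) (hfg : ∀ z ∈ quad m ∩ O, f (g z) = z) : CornerChart I M m where
  toFun q := toQuad (f q)
  invFun z := g z.val
  source := U
  target := Subtype.val ⁻¹' O
  map_source' q hq := by
    show (toQuad (f q)).val ∈ O
    rw [toQuad_val (hfm hq).1]; exact (hfm hq).2
  map_target' z hz := hgm ⟨z.2, hz⟩
  left_inv' q hq := by rw [toQuad_val (hfm hq).1]; exact hgf q hq
  right_inv' z hz := by rw [hfg _ ⟨z.2, hz⟩, val_toQuad]
  open_source := hU
  open_target := hO.preimage continuous_subtype_val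
  contMDiffOn_toFun := by
    rw [contMDiffOn_quadrant_iff]
    exact hf.congr fun q hq => toQuad_val (hfm hq).1
  contMDiffOn_invFun := hg.comp (contMDiff_quadrant_val m).contMDiffOn fun z hz => ⟨z.2, hz⟩

section ofMaps

variable {U : Set M} {hU : IsOpen U} {O : Set ℝ^m} {hO : IsOpen O} {f : M → ℝ^m} {g : ℝ^m → M}
    {hf : ContMDiffOn I 𝓘(ℝ, ℝ^m) ∞ f U} {hg : ContMDiffOn 𝓘(ℝ, ℝ^m) I ∞ g (quad m ∩ O)}
    {hfm : MapsTo f U (quad m ∩ O)} {hgm : MapsTo g (quad m ∩ O) U}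
    {hgf : ∀ q ∈ U, g (f q) = q} {hfg : ∀ z ∈ quad m ∩ O, f (g z) = z}

lemma CornerChart.ofMaps_val {q : M} (hq : q ∈ U) :
    (CornerChart.ofMaps (I := I) U hU O hO f g hf hg hfm hgm hgf hfg q).val = f q :=
  toQuad_val (hfm hq).1

end ofMaps

/-- The restriction of a chart to an open subset. -/
noncomputable def CornerChart.restrOpen (φ : CornerChart I M m) (O : Set M) (hO : IsOpen O) :
    CornerChart I M m where
  toPartialEquiv := (φ.toOpenPartialHomeomorph.restrOpen O hO).toPartialEquiv
  open_source := (φ.toOpenPartialHomeomorph.restrOpen O hO).open_source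
  open_target := (φ.toOpenPartialHomeomorph.restrOpen O hO).open_target
  contMDiffOn_toFun := φ.contMDiffOn_toFun.mono inter_subset_left
  contMDiffOn_invFun := φ.contMDiffOn_invFun.mono inter_subset_left

@[simp] lemma CornerChart.restrOpen_coord (φ : CornerChart I M m) (O : Set M) (hO : IsOpen O)
    (i : Fin m) : (φ.restrOpen O hO).coord i = φ.coord i := rfl

lemma CornerChart.symm_mem (φ : CornerChart I M m) {z : ℝ₊^m} (hz : z ∈ φ.target) :
    φ.symm z ∈ φ.source := φ.map_target hz

lemma CornerChart.apply_symm (φ : CornerChart I M m) {z : ℝ₊^m}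
    (hz : z ∈ φ.target) : φ (φ.symm z) = z := φ.right_inv hz

lemma CornerChart.symm_apply (φ : CornerChart I M m) {q : M}
    (hq : q ∈ φ.source) : φ.symm (φ q) = q := φ.left_inv hq

/-- A change of coordinates, by mutually inverse smooth maps between the traces on the quadrant
of two open subsets of `ℝ^m`. -/
lemma CornerChart.exists_change (φ : CornerChart I M m)
    (O₁ O₂ : Set ℝ^m) (h₁ : IsOpen O₁) (h₂ : IsOpen O₂) (f g : ℝ^m → ℝ^m)
    (hf : ContDiffOn ℝ ∞ f (quad m ∩ O₁)) (hg : ContDiffOn ℝ ∞ g (quad m ∩ O₂))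
    (hfm : MapsTo f (quad m ∩ O₁) (quad m ∩ O₂)) (hgm : MapsTo g (quad m ∩ O₂) (quad m ∩ O₁))
    (hgf : ∀ z ∈ quad m ∩ O₁, g (f z) = z) (hfg : ∀ z ∈ quad m ∩ O₂, f (g z) = z) :
    ∃ ψ : CornerChart I M m, ψ.source = {q ∈ φ.source | (φ q).val ∈ O₁} ∧
      ∀ q ∈ ψ.source, (ψ q).val = f (φ q).val := by
  obtain ⟨O, hO, hOt⟩ := φ.exists_open_target
  have hU : IsOpen {q ∈ φ.source | (φ q).val ∈ O₁} :=
    φ.contMDiffOn_val.continuousOn.isOpen_inter_preimage φ.open_source h₁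
  -- the target of the new chart is the trace of an open set, as `g` is continuous on `quad ∩ O₂`
  have hopen : IsOpen {z : ℝ₊^m | z.val ∈ O₂ ∧ g z.val ∈ O} := by
    have h3 : IsOpen {z : ℝ₊^m | z.val ∈ O₂} := h₂.preimage continuous_subtype_val
    have hc : ContinuousOn (fun z : ℝ₊^m => g z.val) {z | z.val ∈ O₂} :=
      hg.continuousOn.comp continuous_subtype_val.continuousOn fun z hz => ⟨z.2, hz⟩
    exact hc.isOpen_inter_preimage h3 hO
  obtain ⟨O₃, hO₃, h₃⟩ := isOpen_induced_iff.1 hopen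
  have hiff : ∀ z ∈ quad m, z ∈ O₃ ↔ z ∈ O₂ ∧ g z ∈ O := by
    intro z hz
    have := Set.ext_iff.1 h₃ ⟨z, hz⟩
    exact this
  have htq : ∀ z ∈ quad m, z ∈ O → toQuad z ∈ φ.target := by
    intro z hz hzO
    rw [hOt]; show (toQuad z).val ∈ O; rwa [toQuad_val hz]
  refine ⟨CornerChart.ofMaps {q ∈ φ.source | (φ q).val ∈ O₁} hU O₃ hO₃ (fun q => f (φ q).val)
    (fun z => φ.symm (toQuad (g z))) ?_ ?_ ?_ ?_ ?_ ?_, rfl, ?_⟩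
  · exact hf.contMDiffOn.comp (φ.contMDiffOn_val.mono fun q hq => hq.1) fun q hq => ⟨(φ q).2, hq.2⟩
  · refine φ.contMDiffOn_symm_toQuad.comp (hg.contMDiffOn.mono ?_) ?_
    · intro z hz; exact ⟨hz.1, ((hiff z hz.1).1 hz.2).1⟩
    · intro z hz
      have h := (hiff z hz.1).1 hz.2
      have hq := hgm ⟨hz.1, h.1⟩
      exact ⟨toQuad (g z), htq _ hq.1 h.2, toQuad_val hq.1⟩
  · rintro q ⟨hq, hq1⟩
    have h2 := hfm ⟨(φ q).2, hq1⟩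
    refine ⟨h2.1, (hiff _ h2.1).2 ⟨h2.2, ?_⟩⟩
    rw [hgf _ ⟨(φ q).2, hq1⟩]
    have := φ.map_source hq
    rw [hOt] at this; exact this
  · intro z hz
    have h := (hiff z hz.1).1 hz.2
    have hq := hgm ⟨hz.1, h.1⟩
    have ht := htq _ hq.1 h.2
    refine ⟨φ.symm_mem ht, ?_⟩
    show (φ (φ.symm (toQuad (g z)))).val ∈ O₁
    rw [φ.apply_symm ht, toQuad_val hq.1]
    exact hq.2
  · rintro q ⟨hq, hq1⟩
    rw [hgf _ ⟨(φ q).2, hq1⟩, val_toQuad, φ.symm_apply hq]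
  · intro z hz
    have h := (hiff z hz.1).1 hz.2
    have hq := hgm ⟨hz.1, h.1⟩
    have ht := htq _ hq.1 h.2
    rw [φ.apply_symm ht, toQuad_val hq.1]
    exact hfg z ⟨hz.1, h.1⟩
  · intro q hq
    exact CornerChart.ofMaps_val hq

lemma contDiffOn_toLp {s : Set ℝ^m} {f : ℝ^m → Fin m → ℝ}
    (h : ∀ i, ContDiffOn ℝ ∞ (fun z => f z i) s) :
    ContDiffOn ℝ ∞ (fun z => (WithLp.toLp 2 (f z) : ℝ^m)) s := by
  rw [← contMDiffOn_iff_contDiffOn, contMDiffOn_euclidean_iff]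
  intro i
  exact (h i).contMDiffOn

lemma contDiff_coord (i : Fin m) : ContDiff ℝ ∞ (fun z : ℝ^m => z i) :=
  (EuclideanSpace.proj i : ℝ^m →L[ℝ] ℝ).contDiff

lemma continuous_coord (i : Fin m) : Continuous (fun z : ℝ^m => z i) :=
  (contDiff_coord i).continuous

lemma isOpen_forall_imp_pos {T : Type*} [TopologicalSpace T] (A : Finset (Fin m)) {p : Fin m → Prop}
    {f : Fin m → T → ℝ} (hf : ∀ j, Continuous (f j)) : IsOpen (⋂ j ∈ A, {x | p j → 0 < f j x}) :=
  isOpen_biInter_finset fun j _ => by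
    by_cases h : p j
    · simpa only [h, forall_const] using isOpen_lt continuous_const (hf j)
    · simp [h]

/-- Division of the coordinates with index in `J` by positive coordinates. -/
lemma CornerChart.exists_divide (φ : CornerChart I M m) (J : Finset (Fin m)) (κ : Fin m → Fin m)
    (hκ : ∀ j ∈ J, κ j ∉ J) :
    ∃ ψ : CornerChart I M m, ψ.source = {q ∈ φ.source | ∀ j ∈ J, 0 < φ.coord (κ j) q} ∧
      (∀ q ∈ ψ.source, ∀ j ∈ J, ψ.coord j q = φ.coord j q / φ.coord (κ j) q) ∧
      ∀ q ∈ ψ.source, ∀ j ∉ J, ψ.coord j q = φ.coord j q := by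
  set O : Set ℝ^m := {z | ∀ j ∈ J, 0 < z (κ j)} with hO
  have hOo : IsOpen O := by
    rw [hO, ofPred_forall]
    simp only [ofPred_forall]
    exact isOpen_biInter_finset fun j _ => isOpen_lt continuous_const (continuous_coord _)
  obtain ⟨ψ, hs, hψ⟩ := φ.exists_change O O hOo hOo
    (fun z => WithLp.toLp 2 fun j => if j ∈ J then z j / z (κ j) else z j)
    (fun z => WithLp.toLp 2 fun j => if j ∈ J then z j * z (κ j) else z j)
    (contDiffOn_toLp fun i => by
      by_cases hi : i ∈ J
      · simp only [hi, if_true]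
        exact (contDiff_coord i).contDiffOn.div (contDiff_coord _).contDiffOn
          fun z hz => (hz.2 i hi).ne'
      · simp only [hi, if_false]; exact (contDiff_coord i).contDiffOn) (contDiffOn_toLp fun i => by
      by_cases hi : i ∈ J
      · simp only [hi, if_true]
        exact (contDiff_coord i).contDiffOn.mul (contDiff_coord _).contDiffOn
      · simp only [hi, if_false]; exact (contDiff_coord i).contDiffOn) (fun z hz => ⟨fun i => by
        by_cases hi : i ∈ J
        · simp only [hi, if_true]; exact div_nonneg (hz.1 _) (hz.1 _)
        · simp only [hi, if_false]; exact hz.1 i, fun j hj => by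
        simp only [hκ j hj, if_false]; exact hz.2 j hj⟩) (fun z hz => ⟨fun i => by
        by_cases hi : i ∈ J
        · simp only [hi, if_true]; exact mul_nonneg (hz.1 _) (hz.1 _)
        · simp only [hi, if_false]; exact hz.1 i, fun j hj => by
        simp only [hκ j hj, if_false]; exact hz.2 j hj⟩) (fun z hz => by
      ext i
      by_cases hi : i ∈ J
      · simp only [hi, if_true, hκ i hi, if_false]
        exact div_mul_cancel₀ _ (hz.2 i hi).ne'
      · simp only [hi, if_false]) (fun z hz => by
      ext i
      by_cases hi : i ∈ J
      · simp only [hi, if_true, hκ i hi, if_false]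
        exact mul_div_cancel_right₀ _ (hz.2 i hi).ne'
      · simp only [hi, if_false])
  refine ⟨ψ, hs, fun q hq j hj => ?_, fun q hq j hj => ?_⟩
  · rw [← CornerChart.val_apply, hψ q hq]; simp only [hj, if_true]; rfl
  · rw [← CornerChart.val_apply, hψ q hq]; simp only [hj, if_false]; rfl

end

/-! ### Projective coordinates on the blow-up model -/

section Projective

variable {m : ℕ} (c : ℝ^m) (A : Finset (Fin m)) (i : Fin m) (σ : ℝ)

/-- The slopes of a point in the projective coordinates `z` with leading normal direction `±e_i`:
`σ = ±1` for the index `i` itself, the coordinate for a boundary direction, and the logarithm of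
the coordinate for an interior direction (whose coordinate is thus kept positive). -/
noncomputable def projSlope (z : ℝ^m) (j : Fin m) : ℝ :=
  if j = i then σ else if c j = 0 then z j else Real.log (z j)

/-- The blow-down map about `{x | ∀ j ∈ A, x j = c j}` in projective coordinates. -/
noncomputable def projMap (z : ℝ^m) : ℝ^m :=
  WithLp.toLp 2 fun j => if j ∈ A then c j + z i * projSlope c i σ z j else z j

/-- The set on which the logarithms in `projSlope` are taken of positive numbers. -/
def projPos : Set ℝ^m := {z | ∀ j ∈ A, j ≠ i → c j ≠ 0 → 0 < z j}

/-- The domain of projective coordinates: the part of `projPos` where the coordinates normal to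
the centre that are interior on the centre stay positive. -/
def projDom : Set ℝ^m := {z | z ∈ projPos c A i ∧ ∀ j ∈ A, c j ≠ 0 → 0 < projMap c A i σ z j}

/-- The inverse of `projMap` away from the exceptional divisor. -/
noncomputable def projInv (x : ℝ^m) : ℝ^m := WithLp.toLp 2 fun j => if j = i then σ * (x i - c i)
    else if j ∈ A then
      if c j = 0 then x j / (σ * (x i - c i)) else Real.exp ((x j - c j) / (σ * (x i - c i)))
    else x j

/-- The Euclidean length of the vector of slopes. -/
noncomputable def projNorm (z : ℝ^m) : ℝ := √(∑ j ∈ A, projSlope c i σ z j ^ 2)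

/-- The change from projective to polar coordinates. -/
noncomputable def polarOfProj (z : ℝ^m) : ℝ × ℝ^m := (z i * projNorm c A i σ z,
    WithLp.toLp 2 fun j => if j ∈ A then projSlope c i σ z j / projNorm c A i σ z else z j)

/-- The change from polar to projective coordinates. -/
noncomputable def projOfPolar (w : ℝ × ℝ^m) : ℝ^m := WithLp.toLp 2 fun j =>
    if j = i then w.1 * (σ * w.2 i) else if j ∈ A then
      if c j = 0 then w.2 j / (σ * w.2 i) else Real.exp (w.2 j / (σ * w.2 i)) else w.2 j

variable {c A i σ}

lemma projSlope_self (z : ℝ^m) : projSlope c i σ z i = σ := by simp [projSlope]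

lemma projSlope_bdry {z : ℝ^m} {j : Fin m} (hj : j ≠ i) (hc : c j = 0) :
    projSlope c i σ z j = z j := by simp [projSlope, hj, hc]

lemma projSlope_int {z : ℝ^m} {j : Fin m} (hj : j ≠ i) (hc : c j ≠ 0) :
    projSlope c i σ z j = Real.log (z j) := by simp [projSlope, hj, hc]

lemma projMap_mem {z : ℝ^m} {j : Fin m} (hj : j ∈ A) :
    projMap c A i σ z j = c j + z i * projSlope c i σ z j := by simp [projMap, hj]

lemma projMap_notMem {z : ℝ^m} {j : Fin m} (hj : j ∉ A) :
    projMap c A i σ z j = z j := by simp [projMap, hj]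

lemma isOpen_projPos : IsOpen (projPos c A i) := by
  have : projPos c A i = ⋂ j ∈ A, {z | j ≠ i ∧ c j ≠ 0 → 0 < z j} := by ext z; simp [projPos]
  rw [this]
  exact isOpen_forall_imp_pos A continuous_coord

lemma contDiffOn_projSlope {j : Fin m} (hj : j ∈ A) :
    ContDiffOn ℝ ∞ (fun z => projSlope c i σ z j) (projPos c A i) := by
  by_cases h1 : j = i
  · simp only [projSlope, h1, if_true]; exact contDiffOn_const
  by_cases h2 : c j = 0
  · simp only [projSlope, h1, h2, if_true, if_false]; exact (contDiff_coord j).contDiffOn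
  simp only [projSlope, h1, h2, if_false]
  exact (contDiff_coord j).contDiffOn.log fun z hz => (hz j hj h1 h2).ne'

lemma contDiffOn_projMap : ContDiffOn ℝ ∞ (projMap c A i σ) (projPos c A i) := by
  refine contDiffOn_toLp fun j => ?_
  by_cases hj : j ∈ A
  · simp only [hj, if_true]
    exact contDiffOn_const.add ((contDiff_coord i).contDiffOn.mul (contDiffOn_projSlope hj))
  · simp only [hj, if_false]; exact (contDiff_coord j).contDiffOn

lemma isOpen_projDom : IsOpen (projDom c A i σ) := by
  have h : projDom c A i σ = projPos c A i ∩ projMap c A i σ ⁻¹'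
      (⋂ j ∈ A, {x : ℝ^m | c j ≠ 0 → 0 < x j}) := by ext z; simp [projDom]
  rw [h]
  refine contDiffOn_projMap.continuousOn.isOpen_inter_preimage isOpen_projPos
    (isOpen_forall_imp_pos A continuous_coord)

lemma projMap_mem_quad (hσ0 : c i = 0 → σ = 1) {z : ℝ^m} (hz : z ∈ quad m)
    (hzd : z ∈ projDom c A i σ) : projMap c A i σ z ∈ quad m := by
  intro j
  by_cases hj : j ∈ A
  · by_cases hc : c j = 0
    · rw [projMap_mem hj, hc, zero_add]
      refine mul_nonneg (hz i) ?_
      by_cases h1 : j = i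
      · subst h1; rw [projSlope_self, hσ0 hc]; exact zero_le_one
      · rw [projSlope_bdry h1 hc]; exact hz j
    · exact (hzd.2 j hj hc).le
  · rw [projMap_notMem hj]; exact hz j

lemma sq_sign_eq_one (hσ : σ = 1 ∨ σ = -1) : σ * σ = 1 := by rcases hσ with h | h <;> simp [h]

lemma sign_mul_projMap_sub (hσ : σ = 1 ∨ σ = -1) (hi : i ∈ A) (z : ℝ^m) :
    σ * (projMap c A i σ z i - c i) = z i := by
  rw [projMap_mem hi, projSlope_self]; linear_combination z i * sq_sign_eq_one hσ

lemma projInv_projMap (hσ : σ = 1 ∨ σ = -1) (hi : i ∈ A) {z : ℝ^m}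
    (hz : z ∈ projPos c A i) (hzi : 0 < z i) : projInv c A i σ (projMap c A i σ z) = z := by
  ext j
  by_cases h1 : j = i
  · subst h1
    simp only [projInv, if_true]
    exact sign_mul_projMap_sub hσ hi z
  by_cases hj : j ∈ A
  · by_cases hc : c j = 0
    · simp only [projInv, h1, hj, hc, if_true, if_false, sign_mul_projMap_sub hσ hi]
      rw [projMap_mem hj, projSlope_bdry h1 hc, hc, zero_add, mul_div_cancel_left₀ _ hzi.ne']
    · simp only [projInv, h1, hj, hc, if_true, if_false, sign_mul_projMap_sub hσ hi]
      rw [projMap_mem hj, projSlope_int h1 hc, add_sub_cancel_left,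
        mul_div_cancel_left₀ _ hzi.ne', Real.exp_log (hz j hj h1 hc)]
  · simp only [projInv, h1, hj, if_false]
    exact projMap_notMem hj

lemma projInv_self (x : ℝ^m) : projInv c A i σ x i = σ * (x i - c i) := by simp [projInv]

lemma projMap_projInv (hσ : σ = 1 ∨ σ = -1) {x : ℝ^m}
    (hx : 0 < σ * (x i - c i)) (hi : i ∈ A) : projMap c A i σ (projInv c A i σ x) = x := by
  ext j
  by_cases hj : j ∈ A
  · rw [projMap_mem hj, projInv_self]
    by_cases h1 : j = i
    · subst h1; rw [projSlope_self]; linear_combination (x j - c j) * sq_sign_eq_one hσ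
    by_cases hc : c j = 0
    · rw [projSlope_bdry h1 hc]
      simp only [projInv, h1, hj, hc, if_true, if_false]
      rw [mul_div_cancel₀ _ hx.ne', zero_add]
    · rw [projSlope_int h1 hc]
      simp only [projInv, h1, hj, hc, if_true, if_false, Real.log_exp]
      rw [mul_div_cancel₀ _ hx.ne']; ring
  · rw [projMap_notMem hj]
    have h1 : j ≠ i := fun h => hj (h ▸ hi)
    simp [projInv, h1, hj]

lemma projInv_mem_quad {x : ℝ^m} (hxq : x ∈ quad m)
    (hx : 0 < σ * (x i - c i)) : projInv c A i σ x ∈ quad m := by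
  intro j
  simp only [projInv]
  split_ifs with h1 h2 h3
  · exact hx.le
  · exact div_nonneg (hxq j) hx.le
  · exact (Real.exp_pos _).le
  · exact hxq j

lemma projInv_mem_projPos (x : ℝ^m) : projInv c A i σ x ∈ projPos c A i := by
  intro j hj h1 hc
  simp only [projInv, h1, hj, hc, if_true, if_false]
  exact Real.exp_pos _

lemma projInv_mem_projDom (hσ : σ = 1 ∨ σ = -1) {x : ℝ^m}
    (hx : 0 < σ * (x i - c i)) (hi : i ∈ A) (hxA : ∀ j ∈ A, c j ≠ 0 → 0 < x j) :
    projInv c A i σ x ∈ projDom c A i σ := by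
  refine ⟨projInv_mem_projPos x, ?_⟩
  rw [projMap_projInv hσ hx hi]; exact hxA

lemma contDiffOn_projInv : ContDiffOn ℝ ∞ (projInv c A i σ) {x | 0 < σ * (x i - c i)} := by
  have h0 : ContDiff ℝ ∞ fun x : ℝ^m => σ * (x i - c i) :=
    contDiff_const.mul ((contDiff_coord i).sub contDiff_const)
  refine contDiffOn_toLp fun j => ?_
  split_ifs with h1 h2 h3
  · exact h0.contDiffOn
  · exact (contDiff_coord j).contDiffOn.div h0.contDiffOn fun x hx => (ne_of_gt hx)
  · exact (((contDiff_coord j).sub contDiff_const).contDiffOn.div h0.contDiffOn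
      fun x hx => (ne_of_gt hx)).exp
  · exact (contDiff_coord j).contDiffOn

lemma projNorm_sq_pos (hσ : σ = 1 ∨ σ = -1) (hi : i ∈ A) (z : ℝ^m) :
    0 < ∑ j ∈ A, projSlope c i σ z j ^ 2 := by
  refine Finset.sum_pos' (fun j _ => sq_nonneg _) ⟨i, hi, ?_⟩
  rw [projSlope_self, sq, sq_sign_eq_one hσ]; exact zero_lt_one

lemma projNorm_pos (hσ : σ = 1 ∨ σ = -1) (hi : i ∈ A) (z : ℝ^m) :
    0 < projNorm c A i σ z := Real.sqrt_pos.2 (projNorm_sq_pos hσ hi z)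

lemma polarMap_polarOfProj (hσ : σ = 1 ∨ σ = -1) (hi : i ∈ A) (z : ℝ^m) :
    polarMap c A (polarOfProj c A i σ z) = projMap c A i σ z := by
  ext j
  by_cases hj : j ∈ A
  · rw [projMap_mem hj]
    simp only [polarMap, polarOfProj, hj, if_true]
    field_simp [(projNorm_pos hσ hi z).ne']
  · rw [projMap_notMem hj]
    simp [polarMap, polarOfProj, hj]

lemma polarOfProj_mem {V : Set ℝ^m} (hσ : σ = 1 ∨ σ = -1) (hi : i ∈ A)
    (hσ0 : c i = 0 → σ = 1) {z : ℝ^m} (hz : z ∈ quad m)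
    (hV : projMap c A i σ z ∈ V) : polarOfProj c A i σ z ∈ polarDomain c A V := by
  have hN := projNorm_pos (c := c) hσ hi z
  refine ⟨mul_nonneg (hz i) hN.le, ?_, ?_, by rwa [polarMap_polarOfProj hσ hi]⟩
  · have h1 : ∑ j ∈ A, (polarOfProj c A i σ z).2 j ^ 2 =
        ∑ j ∈ A, projSlope c i σ z j ^ 2 / projNorm c A i σ z ^ 2 :=
      Finset.sum_congr rfl fun j hj => by simp only [polarOfProj, hj, if_true, div_pow]
    rw [h1, ← Finset.sum_div, projNorm, Real.sq_sqrt (projNorm_sq_pos hσ hi z).le,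
      div_self (projNorm_sq_pos hσ hi z).ne']
  · intro j hj hc
    simp only [polarOfProj, hj, if_true]
    refine div_nonneg ?_ hN.le
    by_cases h1 : j = i
    · subst h1; rw [projSlope_self, hσ0 hc]; exact zero_le_one
    · rw [projSlope_bdry h1 hc]; exact hz j

lemma sign_mul_polarOfProj (hσ : σ = 1 ∨ σ = -1) (hi : i ∈ A) (z : ℝ^m) :
    σ * (polarOfProj c A i σ z).2 i = (projNorm c A i σ z)⁻¹ := by
  simp only [polarOfProj, hi, if_true, projSlope_self]
  rw [← mul_div_assoc, sq_sign_eq_one hσ, one_div]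

lemma projOfPolar_polarOfProj (hσ : σ = 1 ∨ σ = -1) (hi : i ∈ A) {z : ℝ^m}
    (hz : z ∈ projPos c A i) : projOfPolar c A i σ (polarOfProj c A i σ z) = z := by
  have hN := projNorm_pos (c := c) hσ hi z
  ext j
  simp only [projOfPolar, sign_mul_polarOfProj hσ hi]
  by_cases h1 : j = i
  · subst h1
    simp only [if_true, polarOfProj]
    field_simp
  by_cases hj : j ∈ A
  · by_cases hc : c j = 0
    · simp only [h1, hj, hc, if_true, if_false, polarOfProj]
      rw [projSlope_bdry h1 hc]; field_simp
    · simp only [h1, hj, hc, if_true, if_false, polarOfProj]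
      rw [projSlope_int h1 hc, div_inv_eq_mul, div_mul_cancel₀ _ hN.ne',
        Real.exp_log (hz j hj h1 hc)]
  · simp [h1, hj, polarOfProj]

lemma projSlope_projOfPolar (hσ : σ = 1 ∨ σ = -1) {w : ℝ × ℝ^m}
    (hw : 0 < σ * w.2 i) {j : Fin m} (hj : j ∈ A) :
    projSlope c i σ (projOfPolar c A i σ w) j = w.2 j / (σ * w.2 i) := by
  by_cases h1 : j = i
  · subst h1
    rw [projSlope_self, eq_div_iff hw.ne', ← mul_assoc, sq_sign_eq_one hσ, one_mul]
  by_cases hc : c j = 0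
  · rw [projSlope_bdry h1 hc]; simp [projOfPolar, h1, hj, hc]
  · rw [projSlope_int h1 hc]; simp [projOfPolar, h1, hj, hc]

lemma polarOfProj_projOfPolar (hσ : σ = 1 ∨ σ = -1) (hi : i ∈ A)
    {w : ℝ × ℝ^m} (hw : 0 < σ * w.2 i) (hs : ∑ j ∈ A, w.2 j ^ 2 = 1) :
    polarOfProj c A i σ (projOfPolar c A i σ w) = w := by
  have hN : projNorm c A i σ (projOfPolar c A i σ w) = (σ * w.2 i)⁻¹ := by
    rw [projNorm, Finset.sum_congr rfl (fun j hj => by rw [projSlope_projOfPolar hσ hw hj, div_pow]),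
      ← Finset.sum_div, hs, Real.sqrt_div zero_le_one, Real.sqrt_one, Real.sqrt_sq hw.le, one_div]
  refine Prod.ext ?_ ?_
  · show projOfPolar c A i σ w i * projNorm c A i σ (projOfPolar c A i σ w) = w.1
    rw [hN]
    simp only [projOfPolar, if_true]
    exact mul_inv_cancel_right₀ hw.ne' _
  · ext j
    by_cases hj : j ∈ A
    · simp only [polarOfProj, hN, hj, if_true, projSlope_projOfPolar hσ hw hj]
      rw [div_div, mul_inv_cancel₀ hw.ne', div_one]
    · have h1 : j ≠ i := fun h => hj (h ▸ hi)
      simp [polarOfProj, hj, projOfPolar, h1]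

lemma projMap_projOfPolar (hσ : σ = 1 ∨ σ = -1) (hi : i ∈ A) {w : ℝ × ℝ^m} (hw : 0 < σ * w.2 i) :
    projMap c A i σ (projOfPolar c A i σ w) = polarMap c A w := by
  ext j
  by_cases hj : j ∈ A
  · rw [projMap_mem hj, projSlope_projOfPolar hσ hw hj]
    simp only [projOfPolar, polarMap, hj, if_true]
    rw [mul_assoc, mul_div_cancel₀ _ hw.ne']
  · have h1 : j ≠ i := fun h => hj (h ▸ hi)
    rw [projMap_notMem hj]
    simp [polarMap, hj, projOfPolar, h1]

lemma projOfPolar_mem_projPos (w : ℝ × ℝ^m) : projOfPolar c A i σ w ∈ projPos c A i := by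
  intro j hj h1 hc
  simp only [projOfPolar, h1, hj, hc, if_true, if_false]
  exact Real.exp_pos _

lemma projOfPolar_mem_quad {w : ℝ × ℝ^m} (hw : 0 < σ * w.2 i)
    (hw1 : 0 ≤ w.1) (hw2 : ∀ j ∈ A, c j = 0 → 0 ≤ w.2 j) (hw3 : polarMap c A w ∈ quad m) :
    projOfPolar c A i σ w ∈ quad m := by
  intro j
  simp only [projOfPolar]
  split_ifs with h1 h2 h3
  · exact mul_nonneg hw1 hw.le
  · exact div_nonneg (hw2 j h2 h3) hw.le
  · exact (Real.exp_pos _).le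
  · have := hw3 j
    simpa [polarMap, h2] using this

lemma contDiffOn_projOfPolar : ContDiffOn ℝ ∞ (projOfPolar c A i σ) {w | 0 < σ * w.2 i} := by
  have hc : ∀ j, ContDiff ℝ ∞ fun w : ℝ × ℝ^m => w.2 j :=
    fun j => (contDiff_coord j).comp contDiff_snd
  have h0 : ContDiff ℝ ∞ fun w : ℝ × ℝ^m => σ * w.2 i := contDiff_const.mul (hc i)
  rw [← contMDiffOn_iff_contDiffOn, contMDiffOn_euclidean_iff]
  intro j
  rw [contMDiffOn_iff_contDiffOn]
  simp only [projOfPolar]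
  split_ifs with h1 h2 h3
  · exact (contDiff_fst.mul h0).contDiffOn
  · exact (hc j).contDiffOn.div h0.contDiffOn fun x hx => (ne_of_gt hx)
  · exact ((hc j).contDiffOn.div h0.contDiffOn fun x hx => (ne_of_gt hx)).exp
  · exact (hc j).contDiffOn

lemma contDiffOn_polarOfProj (hσ : σ = 1 ∨ σ = -1) (hi : i ∈ A) :
    ContDiffOn ℝ ∞ (polarOfProj c A i σ) (projPos c A i) := by
  have hN : ContDiffOn ℝ ∞ (projNorm c A i σ) (projPos c A i) :=
    (ContDiffOn.sum fun j hj => (contDiffOn_projSlope hj).pow 2).sqrt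
      fun z _ => (projNorm_sq_pos hσ hi z).ne'
  refine ((contDiff_coord i).contDiffOn.mul hN).prodMk (contDiffOn_toLp fun j => ?_)
  split_ifs with hj
  · exact (contDiffOn_projSlope hj).div hN fun z _ => (projNorm_pos hσ hi z).ne'
  · exact (contDiff_coord j).contDiffOn

/-- At a point of the polar model, some normal direction does not vanish. -/
lemma exists_ne_zero_of_sum_sq {w : ℝ^m} (hs : ∑ j ∈ A, w j ^ 2 = 1) : ∃ j ∈ A, w j ≠ 0 := by
  by_contra h
  push Not at h
  rw [Finset.sum_eq_zero fun j hj => by rw [h j hj]; simp] at hs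
  exact zero_ne_one hs

end Projective

/-! ### Hadamard's lemma on quadrants -/

section Hadamard

open intervalIntegral MeasureTheory

variable {E : Type} [NormedAddCommGroup E] [NormedSpace ℝ E]

/-- The homotopy `x + (t - 1) π (x - x₀)`, which at `t = 0` replaces the `π`-component of `x` by that
of `x₀` when `π` is a projection. -/
def affContract (π : E →L[ℝ] E) (x₀ : E) (t : ℝ) (x : E) : E := x + (t - 1) • π (x - x₀)

variable {π : E →L[ℝ] E} {x₀ : E} {s : Set E}

lemma continuous_affContract : Continuous fun p : ℝ × E => affContract π x₀ p.1 p.2 := by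
  unfold affContract; fun_prop

lemma hasFDerivAt_affContract (t : ℝ) (x : E) :
    HasFDerivAt (affContract π x₀ t) (ContinuousLinearMap.id ℝ E + (t - 1) • π) x := by
  unfold affContract
  exact (hasFDerivAt_id x).add
    ((π.hasFDerivAt.comp x ((hasFDerivAt_id x).sub_const x₀)).const_smul (t - 1))

lemma continuousOn_comp_affContract (hL : ∀ t ∈ Icc (0 : ℝ) 1, MapsTo (affContract π x₀ t) s s)
    {F : Type*} [TopologicalSpace F] {h : E → F} (hh : ContinuousOn h s) :
    ContinuousOn (fun p : ℝ × E => h (affContract π x₀ p.1 p.2)) (Icc (0 : ℝ) 1 ×ˢ s) :=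
  hh.comp continuous_affContract.continuousOn fun p hp => hL p.1 hp.1 hp.2

lemma continuousOn_comp_affContract_left (hL : ∀ t ∈ Icc (0 : ℝ) 1, MapsTo (affContract π x₀ t) s s)
    {F : Type*} [TopologicalSpace F] {h : E → F} (hh : ContinuousOn h s) {x : E} (hx : x ∈ s) :
    ContinuousOn (fun t : ℝ => h (affContract π x₀ t x)) (Icc (0 : ℝ) 1) :=
  (continuousOn_comp_affContract hL hh).comp
    (Continuous.prodMk continuous_id continuous_const).continuousOn fun _ ht => ⟨ht, hx⟩

variable {F : Type} [NormedAddCommGroup F] [NormedSpace ℝ F]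

/-- The average of `h` along the homotopy `affContract`, with weight `a`. -/
noncomputable def contractAverage (π : E →L[ℝ] E) (x₀ : E) (a : ℝ → ℝ) (h : E → F) (x : E) : F :=
  ∫ t in (0 : ℝ)..1, a t • h (affContract π x₀ t x)

lemma intervalIntegrable_smul_affContract
    (hL : ∀ t ∈ Icc (0 : ℝ) 1, MapsTo (affContract π x₀ t) s s)
    {h : E → F} (hh : ContinuousOn h s) {a : ℝ → ℝ} (ha : Continuous a) {x : E} (hx : x ∈ s) :
    IntervalIntegrable (fun t => a t • h (affContract π x₀ t x)) volume 0 1 := by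
  apply ContinuousOn.intervalIntegrable
  rw [uIcc_of_le zero_le_one]
  exact ha.continuousOn.smul (continuousOn_comp_affContract_left hL hh hx)

lemma continuousOn_contractAverage (hL : ∀ t ∈ Icc (0 : ℝ) 1, MapsTo (affContract π x₀ t) s s)
    {h : E → F} (hh : ContinuousOn h s) {a : ℝ → ℝ} (ha : Continuous a) :
    ContinuousOn (contractAverage π x₀ a h) s := by
  rw [continuousOn_iff_continuous_domRestrict]
  have hcl : ∀ t : ℝ, (projIcc 0 1 zero_le_one t : ℝ) ∈ Icc (0 : ℝ) 1 := fun t => Subtype.prop _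
  have h1 : Continuous fun p : s × ℝ =>
      a p.2 • h (affContract π x₀ (projIcc 0 1 zero_le_one p.2 : ℝ) p.1) := by
    refine (ha.comp continuous_snd).smul ?_
    refine (continuousOn_comp_affContract hL hh).comp_continuous
      (f := fun p : s × ℝ => ((projIcc 0 1 zero_le_one p.2 : ℝ), (p.1 : E))) ?_ ?_
    · exact (continuous_subtype_val.comp (continuous_projIcc.comp continuous_snd)).prodMk
        (continuous_subtype_val.comp continuous_fst)
    · exact fun p => ⟨hcl _, p.1.2⟩
  have h2 := continuous_parametric_intervalIntegral_of_continuous' (μ := volume)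
    (f := fun (x : s) (t : ℝ) => a t • h (affContract π x₀ (projIcc 0 1 zero_le_one t : ℝ) x))
    h1 0 1
  refine h2.congr fun x => ?_
  refine integral_congr fun t ht => ?_
  rw [uIcc_of_le zero_le_one] at ht
  simp only [projIcc_of_mem zero_le_one ht]

lemma hasFDerivWithinAt_contractAverage [CompleteSpace F] (hs : Convex ℝ s)
    (hL : ∀ t ∈ Icc (0 : ℝ) 1, MapsTo (affContract π x₀ t) s s) {h : E → F} {h' : E → E →L[ℝ] F}
    (hh : ∀ x ∈ s, HasFDerivWithinAt h (h' x) s x) (hh' : ContinuousOn h' s)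
    {a : ℝ → ℝ} (ha : Continuous a) {x : E} (hx : x ∈ s) :
    HasFDerivWithinAt (contractAverage π x₀ a h) (contractAverage π x₀ a h' x +
        (contractAverage π x₀ (fun t => a t * (t - 1)) h' x).comp π) s x := by
  have hhc : ContinuousOn h s := fun y hy => (hh y hy).continuousWithinAt
  set D : ℝ → E → E →L[ℝ] F := fun t y =>
    (h' (affContract π x₀ t y)).comp (ContinuousLinearMap.id ℝ E + (t - 1) • π) with hD
  have hDc : ContinuousOn (fun p : ℝ × E => D p.1 p.2) (Icc (0 : ℝ) 1 ×ˢ s) := by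
    refine (continuousOn_comp_affContract hL hh').clm_comp (Continuous.continuousOn ?_)
    fun_prop
  have hDx : ContinuousOn (fun t => D t x) (Icc (0 : ℝ) 1) :=
    hDc.comp (Continuous.prodMk continuous_id continuous_const).continuousOn fun _ ht => ⟨ht, hx⟩
  have hint : contractAverage π x₀ a h' x +
        (contractAverage π x₀ (fun t => a t * (t - 1)) h' x).comp π =
      ∫ t in (0 : ℝ)..1, a t • D t x := by
    have e1 : (contractAverage π x₀ (fun t => a t * (t - 1)) h' x).comp π =
        ∫ t in (0 : ℝ)..1, ((a t * (t - 1)) • h' (affContract π x₀ t x)).comp π := by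
      exact (((ContinuousLinearMap.compL ℝ E E F).flip π).intervalIntegral_comp_comm
        (intervalIntegrable_smul_affContract hL hh' (by fun_prop) hx)).symm
    rw [e1, contractAverage, ← intervalIntegral.integral_add]
    · refine integral_congr fun t _ => ?_
      ext v
      simp only [hD, add_apply, smul_apply,
        ContinuousLinearMap.comp_apply, ContinuousLinearMap.id_apply, map_add, map_smul, smul_add,
        mul_smul]
    · exact intervalIntegrable_smul_affContract hL hh' ha hx
    · apply ContinuousOn.intervalIntegrable
      rw [uIcc_of_le zero_le_one]
      refine ContinuousOn.clm_comp ?_ continuousOn_const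
      exact ContinuousOn.smul (f := fun t => a t * (t - 1)) (by fun_prop) (continuousOn_comp_affContract_left hL hh' hx)
  rw [hint]
  obtain ⟨Ca, hCa⟩ := isCompact_Icc.exists_bound_of_continuousOn
    (ha.continuousOn : ContinuousOn a (Icc (0 : ℝ) 1))
  have hCa0 : 0 ≤ Ca := (norm_nonneg _).trans (hCa 0 (left_mem_Icc.2 zero_le_one))
  rw [hasFDerivWithinAt_iff_isLittleO, Asymptotics.isLittleO_iff]
  intro ε hε
  have hε' : 0 < ε / (Ca + 1) := div_pos hε (by linarith)
  -- by compactness of `[0,1]`, the derivatives along the homotopy are uniformly close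
  have hunif : ∀ᶠ y in 𝓝 x, ∀ t ∈ Icc (0 : ℝ) 1, t ∈ Icc (0 : ℝ) 1 → y ∈ s →
      ‖D t y - D t x‖ ≤ ε / (Ca + 1) := by
    refine isCompact_Icc.eventually_forall_of_forall_eventually fun t ht => ?_
    have h1 : ContinuousWithinAt (fun p : E × ℝ => D p.2 p.1 - D p.2 x) (s ×ˢ Icc (0 : ℝ) 1)
        (x, t) := by
      have h2 : ContinuousOn (fun p : E × ℝ => D p.2 p.1) (s ×ˢ Icc (0 : ℝ) 1) :=
        hDc.comp continuous_swap.continuousOn fun p hp => ⟨hp.2, hp.1⟩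
      have h3 : ContinuousOn (fun p : E × ℝ => D p.2 x) (s ×ˢ Icc (0 : ℝ) 1) :=
        hDx.comp continuous_snd.continuousOn fun p hp => hp.2
      exact (h2.sub h3) _ ⟨hx, ht⟩
    have h4 := h1.norm.eventually_lt_const (u := ε / (Ca + 1)) (by simpa using hε')
    have h5 : ∀ᶠ p : E × ℝ in 𝓝 (x, t), p ∈ s ×ˢ Icc (0 : ℝ) 1 →
        ‖D p.2 p.1 - D p.2 x‖ < ε / (Ca + 1) := eventually_nhdsWithin_iff.1 h4
    exact h5.mono fun p hp h1 h2 => (hp ⟨h2, h1⟩).le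
  obtain ⟨δ, hδ, hball⟩ := Metric.eventually_nhds_iff_ball.1 hunif
  have hmem : s ∩ Metric.ball x δ ∈ 𝓝[s] x :=
    Filter.inter_mem self_mem_nhdsWithin (mem_nhdsWithin_of_mem_nhds (Metric.ball_mem_nhds x hδ))
  filter_upwards [hmem] with y hy
  have hest : ∀ t ∈ Icc (0 : ℝ) 1, ‖h (affContract π x₀ t y) - h (affContract π x₀ t x) -
      D t x (y - x)‖ ≤ ε / (Ca + 1) * ‖y - x‖ := by
    intro t ht
    refine (hs.inter (convex_ball x δ)).norm_image_sub_le_of_norm_hasFDerivWithin_le'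
      (f := fun z => h (affContract π x₀ t z)) (f' := D t) ?_ ?_ ⟨hx, Metric.mem_ball_self hδ⟩ hy
    · intro z hz
      exact ((hh _ (hL t ht hz.1)).comp z (hasFDerivAt_affContract t z).hasFDerivWithinAt
        (hL t ht)).mono inter_subset_left
    · intro z hz
      exact hball z hz.2 t ht ht hz.1
  have hrew : contractAverage π x₀ a h y - contractAverage π x₀ a h x -
      (∫ t in (0 : ℝ)..1, a t • D t x) (y - x) =
      ∫ t in (0 : ℝ)..1, a t • (h (affContract π x₀ t y) - h (affContract π x₀ t x) -
        D t x (y - x)) := by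
    have hi : IntervalIntegrable (fun t => a t • D t x) volume 0 1 := by
      apply ContinuousOn.intervalIntegrable
      rw [uIcc_of_le zero_le_one]
      exact ha.continuousOn.smul hDx
    rw [ContinuousLinearMap.intervalIntegral_apply hi, contractAverage, contractAverage,
      ← intervalIntegral.integral_sub, ← intervalIntegral.integral_sub]
    · refine integral_congr fun t _ => ?_
      simp [smul_sub]
    · exact (intervalIntegrable_smul_affContract hL hhc ha hy.1).sub
        (intervalIntegrable_smul_affContract hL hhc ha hx)
    · apply ContinuousOn.intervalIntegrable
      rw [uIcc_of_le zero_le_one]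
      exact (ha.continuousOn.smul hDx).clm_apply continuousOn_const
    · exact intervalIntegrable_smul_affContract hL hhc ha hy.1
    · exact intervalIntegrable_smul_affContract hL hhc ha hx
  rw [hrew]
  have hb := norm_integral_le_of_norm_le_const (a := (0 : ℝ)) (b := 1)
    (C := Ca * (ε / (Ca + 1) * ‖y - x‖))
    (f := fun t => a t • (h (affContract π x₀ t y) - h (affContract π x₀ t x) -
        D t x (y - x))) (fun t ht => by
      rw [uIoc_of_le zero_le_one] at ht
      have ht' : t ∈ Icc (0 : ℝ) 1 := ⟨ht.1.le, ht.2⟩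
      rw [norm_smul]
      exact mul_le_mul (hCa t ht') (hest t ht') (norm_nonneg _) hCa0)
  refine hb.trans ?_
  rw [sub_zero, abs_one, mul_one, ← mul_assoc]
  refine mul_le_mul_of_nonneg_right ?_ (norm_nonneg _)
  rw [mul_div_assoc', div_le_iff₀ (by linarith)]
  nlinarith

/-- Averages along the homotopy of smooth functions are smooth. -/
lemma contDiffOn_contractAverage (hs : Convex ℝ s) (hsu : UniqueDiffOn ℝ s)
    (hL : ∀ t ∈ Icc (0 : ℝ) 1, MapsTo (affContract π x₀ t) s s) (n : ℕ) :
    ∀ {F : Type} [NormedAddCommGroup F] [NormedSpace ℝ F] [CompleteSpace F] {h : E → F}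
      {a : ℝ → ℝ}, ContDiffOn ℝ ∞ h s → Continuous a →
      ContDiffOn ℝ n (contractAverage π x₀ a h) s := by
  induction n with
  | zero =>
    intro F _ _ _ h a hh ha
    exact contDiffOn_zero.2 (continuousOn_contractAverage hL hh.continuousOn ha)
  | succ n ih =>
    intro F _ _ _ h a hh ha
    have hh' : ContDiffOn ℝ ∞ (fderivWithin ℝ h s) s := hh.fderivWithin hsu (by simp)
    have hder := fun x hx => hasFDerivWithinAt_contractAverage hs hL
      (fun x hx => ((hh.differentiableOn (by simp)) x hx).hasFDerivWithinAt) hh'.continuousOn ha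
      (x := x) hx
    push_cast
    refine contDiffOn_succ_of_fderivWithin (fun x hx => (hder x hx).differentiableWithinAt)
      (by simp) ?_
    have : ContDiffOn ℝ n (fun x => contractAverage π x₀ a (fderivWithin ℝ h s) x +
        (contractAverage π x₀ (fun t => a t * (t - 1)) (fderivWithin ℝ h s) x).comp π) s :=
      (ih hh' ha).add ((ih hh' (by fun_prop)).clm_comp contDiffOn_const)
    exact this.congr fun x hx => (hder x hx).fderivWithin (hsu x hx)

end Hadamard

section HadamardQuad

variable {m : ℕ}

/-- The projection onto the coordinates with index in `A`. -/
noncomputable def coordProj (A : Finset (Fin m)) : ℝ^m →L[ℝ] ℝ^m :=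
  ∑ k ∈ A, (EuclideanSpace.proj k : ℝ^m →L[ℝ] ℝ).smulRight (EuclideanSpace.single k (1 : ℝ))

lemma coordProj_eq_sum (A : Finset (Fin m)) (v : ℝ^m) :
    coordProj A v = ∑ k ∈ A, v k • EuclideanSpace.single k (1 : ℝ) := by simp [coordProj]

lemma coordProj_apply (A : Finset (Fin m)) (v : ℝ^m) (j : Fin m) :
    coordProj A v j = if j ∈ A then v j else 0 := by
  rw [coordProj_eq_sum]
  simp [Finset.sum_apply, Pi.single_apply]

/-- Hadamard's lemma: near a point of a coordinate submanifold of the quadrant, a smooth function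
that vanishes on the submanifold is a combination, with smooth coefficients, of the coordinates
that define it. -/
theorem exists_hadamard_quad (A : Finset (Fin m)) {f : ℝ^m → ℝ}
    {O : Set ℝ^m} (hO : IsOpen O) {x₀ : ℝ^m}
    (hx₀ : x₀ ∈ quad m) (hx₀O : x₀ ∈ O) (hf : ContDiffOn ℝ ∞ f (quad m ∩ O))
    (hz : ∀ x ∈ quad m ∩ O, (∀ k ∈ A, x k = x₀ k) → f x = 0) :
    ∃ (O' : Set ℝ^m) (G : Fin m → ℝ^m → ℝ),
      IsOpen O' ∧ x₀ ∈ O' ∧ O' ⊆ O ∧ (∀ k, ContDiffOn ℝ ∞ (G k) (quad m ∩ O')) ∧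
      ∀ x ∈ quad m ∩ O', f x = ∑ k ∈ A, (x k - x₀ k) * G k x := by
  obtain ⟨r, hr, hball⟩ := Metric.isOpen_iff.1 hO x₀ hx₀O
  set s := quad m ∩ Metric.ball x₀ r with hs
  have hsO : s ⊆ quad m ∩ O := inter_subset_inter_right _ hball
  have hconv : Convex ℝ s := EuclideanQuadrant.convex.inter (convex_ball x₀ r)
  have hsu : UniqueDiffOn ℝ s := (uniqueDiffOn_quad m).inter Metric.isOpen_ball
  have hfs : ContDiffOn ℝ ∞ f s := hf.mono hsO
  have hLj : ∀ (t : ℝ) (x : ℝ^m) (j : Fin m),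
      affContract (coordProj A) x₀ t x j = if j ∈ A then x₀ j + t * (x j - x₀ j) else x j := by
    intro t x j
    simp only [affContract, PiLp.add_apply, PiLp.smul_apply, coordProj_apply, PiLp.sub_apply,
      smul_eq_mul]
    split_ifs <;> ring
  have hL : ∀ t ∈ Icc (0 : ℝ) 1, MapsTo (affContract (coordProj A) x₀ t) s s := by
    intro t ht x hx
    refine ⟨fun j => ?_, ?_⟩
    · rw [hLj]
      split_ifs
      · have h1 := hx.1 j
        have h2 := hx₀ j
        nlinarith [mul_nonneg ht.1 h1, mul_nonneg (sub_nonneg.2 ht.2) h2]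
      · exact hx.1 j
    · have hxb := hx.2
      rw [Metric.mem_ball, dist_eq_norm, EuclideanSpace.norm_eq] at hxb ⊢
      refine lt_of_le_of_lt (Real.sqrt_le_sqrt (Finset.sum_le_sum fun j _ => ?_)) hxb
      simp only [PiLp.sub_apply, hLj, Real.norm_eq_abs, sq_abs]
      split_ifs
      · rw [add_sub_cancel_left, mul_pow]
        exact mul_le_of_le_one_left (sq_nonneg _) (pow_le_one₀ ht.1 ht.2)
      · exact le_rfl
  set h' := fderivWithin ℝ f s with hh'
  have hh's : ContDiffOn ℝ ∞ h' s := hfs.fderivWithin hsu (by simp)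
  refine ⟨Metric.ball x₀ r, fun k => contractAverage (coordProj A) x₀ (fun _ => 1)
    (fun y => h' y (EuclideanSpace.single k 1)), Metric.isOpen_ball, Metric.mem_ball_self hr,
    hball, fun k => ?_, fun x hx => ?_⟩
  · refine contDiffOn_infty.2 fun n => ?_
    exact contDiffOn_contractAverage hconv hsu hL n (hh's.clm_apply contDiffOn_const)
      continuous_const
  · have h0 : f (affContract (coordProj A) x₀ 0 x) = 0 := by
      refine hz _ (hsO (hL 0 (left_mem_Icc.2 zero_le_one) hx)) fun k hk => ?_
      rw [hLj]; simp [hk]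
    have h1 : affContract (coordProj A) x₀ 1 x = x := by simp [affContract]
    have hcurve : ∀ t ∈ Icc (0 : ℝ) 1, HasDerivWithinAt
        (fun t => f (affContract (coordProj A) x₀ t x))
        (h' (affContract (coordProj A) x₀ t x) (coordProj A (x - x₀))) (Icc 0 1) t := by
      intro t ht
      have hc : HasDerivWithinAt (fun t => affContract (coordProj A) x₀ t x)
          (coordProj A (x - x₀)) (Icc 0 1) t := by
        have := (((hasDerivAt_id t).sub_const 1).smul_const (coordProj A (x - x₀))).const_add x
        simpa [affContract] using this.hasDerivWithinAt
      exact ((hfs.differentiableOn (by simp) _ (hL t ht hx)).hasFDerivWithinAt).comp_hasDerivWithinAt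
        t hc fun τ hτ => hL τ hτ hx
    have hcont : ContinuousOn (fun t => h' (affContract (coordProj A) x₀ t x)
        (coordProj A (x - x₀))) (Icc 0 1) :=
      (continuousOn_comp_affContract_left hL hh's.continuousOn hx).clm_apply continuousOn_const
    have hftc := intervalIntegral.integral_eq_sub_of_hasDerivAt_of_le (zero_le_one' ℝ)
      (f := fun t => f (affContract (coordProj A) x₀ t x))
      (fun t ht => (hcurve t ht).continuousWithinAt)
      (fun t ht => (hcurve t (Ioo_subset_Icc_self ht)).hasDerivAt (Icc_mem_nhds ht.1 ht.2))
      (by apply ContinuousOn.intervalIntegrable; rwa [uIcc_of_le zero_le_one])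
    simp only [h0, h1, sub_zero] at hftc
    rw [← hftc]
    simp only [contractAverage, one_smul]
    rw [Finset.sum_congr rfl fun k _ => (intervalIntegral.integral_const_mul (x k - x₀ k) _).symm]
    rw [← intervalIntegral.integral_finsetSum]
    · refine intervalIntegral.integral_congr fun t _ => ?_
      simp only [coordProj_eq_sum, map_sum, map_smul, smul_eq_mul, PiLp.sub_apply]
    · intro k _
      apply ContinuousOn.intervalIntegrable
      rw [uIcc_of_le zero_le_one]
      exact continuousOn_const.mul ((continuousOn_comp_affContract_left hL hh's.continuousOn
        hx).clm_apply continuousOn_const)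

end HadamardQuad

/-! ### Gluing a manifold from partial compactifications of a space -/

section Gluing

/-- Data for gluing a manifold from open subsets `W a` of the model space. Each `W a` has a dense
open part `W₀ a` which is identified by `P a` with an open part of the space `M`, and `P a` extends
continuously to `W a`. Transition maps have to extend smoothly to those pairs of points of
`W a` and `W b` that are limits of common points. -/
structure GluingData {E : Type*} [NormedAddCommGroup E] [NormedSpace ℝ E] {H : Type*}
    [TopologicalSpace H] (J : ModelWithCorners ℝ E H) (ι : Type*) (M : Type u)
    [TopologicalSpace M] where
  W : ι → Set H
  W₀ : ι → Set H
  P : ι → H → M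
  p : ι → M → H
  nonempty : ∀ a, (W a).Nonempty
  isOpen_W : ∀ a, IsOpen (W a)
  subset : ∀ a, W₀ a ⊆ W a
  dense : ∀ a, W a ⊆ closure (W₀ a)
  continuousOn_P : ∀ a, ContinuousOn (P a) (W a)
  left_inv : ∀ a, ∀ w ∈ W₀ a, p a (P a w) = w
  compat : ∀ a b, ∀ w ∈ W a, ∀ w' ∈ W b,
    (Filter.map (P a) (𝓝[W₀ a] w) ⊓ Filter.map (P b) (𝓝[W₀ b] w')).NeBot →
    ∃ (τ : H → H) (U : Set H), IsOpen U ∧ w ∈ U ∧ ContMDiffOn J J ∞ τ U ∧ τ w = w' ∧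
      ∀ v ∈ U, v ∈ W₀ a → τ v ∈ W₀ b ∧ P b (τ v) = P a v

namespace GluingData

variable {E : Type*} [NormedAddCommGroup E] [NormedSpace ℝ E] {H : Type*}
    [TopologicalSpace H] {J : ModelWithCorners ℝ E H} {ι : Type*} {M : Type u}
    [TopologicalSpace M] (D : GluingData J ι M)

/-- The filter on `M` that represents the point `w` of `W a`. -/
def pt (a : ι) (w : H) : Filter M := Filter.map (D.P a) (𝓝[D.W₀ a] w)

lemma neBot_nhdsWithin {a : ι} {w : H} (hw : w ∈ D.W a) : (𝓝[D.W₀ a] w).NeBot :=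
  mem_closure_iff_nhdsWithin_neBot.1 (D.dense a hw)

lemma neBot_pt {a : ι} {w : H} (hw : w ∈ D.W a) : (D.pt a w).NeBot :=
  have := D.neBot_nhdsWithin hw
  Filter.map_neBot

lemma pt_le_nhds {a : ι} {w : H} (hw : w ∈ D.W a) : D.pt a w ≤ 𝓝 (D.P a w) :=
  (D.continuousOn_P a w hw).mono_left (nhdsWithin_mono _ (D.subset a))

lemma tendsto_p (a : ι) (w : H) : Filter.Tendsto (D.p a) (D.pt a w) (𝓝 w) := by
  rw [pt, Filter.tendsto_map'_iff]
  refine (Filter.tendsto_id.mono_left nhdsWithin_le_nhds).congr' ?_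
  filter_upwards [self_mem_nhdsWithin] with v hv using (D.left_inv a v hv).symm

lemma eq_of_pt_le [T2Space H] {a : ι} {w w' : H} (hw : w ∈ D.W a)
    (h : D.pt a w ≤ D.pt a w') : w = w' :=
  have := D.neBot_pt hw
  tendsto_nhds_unique (D.tendsto_p a w) ((D.tendsto_p a w').mono_left h)

lemma pt_le_pt {a b : ι} {τ : H → H} {U : Set H} (hU : IsOpen U) (hτ : ContinuousOn τ U)
    (hP : ∀ v ∈ U, v ∈ D.W₀ a → τ v ∈ D.W₀ b ∧ D.P b (τ v) = D.P a v) {v : H} (hv : v ∈ U) :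
    D.pt a v ≤ D.pt b (τ v) := by
  have h1 : Filter.Tendsto τ (𝓝[D.W₀ a] v) (𝓝[D.W₀ b] (τ v)) := by
    refine tendsto_nhdsWithin_iff.2
      ⟨(hτ.continuousAt (hU.mem_nhds hv)).mono_left nhdsWithin_le_nhds, ?_⟩
    filter_upwards [self_mem_nhdsWithin, mem_nhdsWithin_of_mem_nhds (hU.mem_nhds hv)] with z hz hzU
      using (hP z hzU hz).1
  have h2 : D.pt a v = Filter.map (D.P b) (Filter.map τ (𝓝[D.W₀ a] v)) := by
    rw [Filter.map_map]
    refine Filter.map_congr ?_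
    filter_upwards [self_mem_nhdsWithin, mem_nhdsWithin_of_mem_nhds (hU.mem_nhds hv)] with z hz hzU
      using ((hP z hzU hz).2).symm
  rw [h2]
  exact Filter.map_mono h1

/-- Points of two charts that are limits of common points are identified, together with
neighbourhoods, by a smooth transition map. -/
lemma exists_transition [T2Space H] {a b : ι} {w w' : H} (hw : w ∈ D.W a) (hw' : w' ∈ D.W b)
    (h : (D.pt a w ⊓ D.pt b w').NeBot) :
    ∃ (τ : H → H) (U : Set H), IsOpen U ∧ w ∈ U ∧ U ⊆ D.W a ∧ ContMDiffOn J J ∞ τ U ∧ τ w = w' ∧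
      ∀ v ∈ U, τ v ∈ D.W b ∧ D.pt a v = D.pt b (τ v) := by
  obtain ⟨τ, U, hU, hwU, hτ, hτw, hP⟩ := D.compat a b w hw w' hw' h
  obtain ⟨τ', U', hU', hwU', hτ', hτw', hP'⟩ := D.compat b a w' hw' w hw (by rwa [inf_comm])
  have hO : IsOpen (U ∩ τ ⁻¹' (U' ∩ D.W b)) :=
    hτ.continuousOn.isOpen_inter_preimage hU (hU'.inter (D.isOpen_W b))
  refine ⟨τ, U ∩ τ ⁻¹' (U' ∩ D.W b) ∩ D.W a, hO.inter (D.isOpen_W a),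
    ⟨⟨hwU, ?_, ?_⟩, hw⟩, inter_subset_right, hτ.mono fun v hv => hv.1.1, hτw, ?_⟩
  · rw [hτw]; exact hwU'
  · rw [hτw]; exact hw'
  · rintro v ⟨⟨hvU, hvU', hvW⟩, hva⟩
    refine ⟨hvW, le_antisymm (D.pt_le_pt hU hτ.continuousOn hP hvU) ?_⟩
    have h1 := D.pt_le_pt hU' hτ'.continuousOn hP' hvU'
    have h2 := D.eq_of_pt_le hva ((D.pt_le_pt hU hτ.continuousOn hP hvU).trans h1)
    rwa [← h2] at h1

lemma pt_eq_of_neBot [T2Space H] {a b : ι} {w w' : H} (hw : w ∈ D.W a) (hw' : w' ∈ D.W b)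
    (h : (D.pt a w ⊓ D.pt b w').NeBot) : D.pt a w = D.pt b w' := by
  obtain ⟨τ, U, -, hwU, -, -, hτ, hP⟩ := D.exists_transition hw hw' h
  rw [← hτ]; exact (hP w hwU).2

/-- The glued space: the set of the filters that represent points of the `W a`. -/
@[ext] structure Glued : Type u where
  toFilter : Filter M
  exists_rep : ∃ a, ∃ w ∈ D.W a, toFilter = D.pt a w

/-- The point of the glued space represented by a point of `W a`. -/
def point (a : ι) (w : H) (hw : w ∈ D.W a) : D.Glued := ⟨D.pt a w, a, w, hw, rfl⟩

/-- The map from the glued space to `M`: the limit of the filter. -/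
noncomputable def base (G : D.Glued) : M := D.P G.2.choose G.2.choose_spec.choose

lemma base_eq [T2Space M] {G : D.Glued} {a : ι} {w : H} (hw : w ∈ D.W a) (hG : G.1 = D.pt a w) :
    D.base G = D.P a w := by
  have h := G.2.choose_spec.choose_spec
  have := D.neBot_pt hw
  refine tendsto_nhds_unique (f := id) (l := D.pt a w) ?_ (D.pt_le_nhds hw)
  rw [← hG]
  conv_lhs => rw [h.2]
  exact D.pt_le_nhds h.1

open Classical in
/-- The inclusion of `W a` into the glued space, inverted, as a partial equivalence. -/
noncomputable def partialEquiv [T2Space H] (a : ι) : PartialEquiv D.Glued H where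
  toFun G := if h : ∃ w ∈ D.W a, G.1 = D.pt a w then h.choose else (D.nonempty a).some
  invFun w := if h : w ∈ D.W a then D.point a w h else D.point a _ (D.nonempty a).some_mem
  source := {G | ∃ w ∈ D.W a, G.1 = D.pt a w}
  target := D.W a
  map_source' G hG := by
    have hG' : ∃ w ∈ D.W a, G.1 = D.pt a w := hG
    rw [dif_pos hG']; exact hG'.choose_spec.1
  map_target' w hw := by rw [dif_pos hw]; exact ⟨w, hw, rfl⟩
  left_inv' G hG := by
    have hG' : ∃ w ∈ D.W a, G.1 = D.pt a w := hG
    rw [dif_pos hG', dif_pos hG'.choose_spec.1]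
    exact Glued.ext hG'.choose_spec.2.symm
  right_inv' w hw := by
    have hG : ∃ w' ∈ D.W a, (D.point a w hw).1 = D.pt a w' := ⟨w, hw, rfl⟩
    rw [dif_pos hw, dif_pos hG]
    exact (D.eq_of_pt_le hw hG.choose_spec.2.le).symm

variable [T2Space H]

lemma partialEquiv_symm {a : ι} {w : H} (hw : w ∈ D.W a) :
    (D.partialEquiv a).symm w = D.point a w hw := dif_pos hw

lemma partialEquiv_apply {a : ι} {w : H} (hw : w ∈ D.W a) {G : D.Glued} (hG : G.1 = D.pt a w) :
    D.partialEquiv a G = w := by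
  have : G = (D.partialEquiv a).symm w := by rw [D.partialEquiv_symm hw]; exact Glued.ext hG
  rw [this]
  exact (D.partialEquiv a).right_inv hw

lemma exists_open_transition (a b : ι) {w : H}
    (hw : w ∈ ((D.partialEquiv a).symm.trans (D.partialEquiv b)).source) :
    ∃ (τ : H → H) (U : Set H), IsOpen U ∧ w ∈ U ∧ ContMDiffOn J J ∞ τ U ∧
      U ⊆ ((D.partialEquiv a).symm.trans (D.partialEquiv b)).source ∧
      ∀ v ∈ U, (D.partialEquiv a).symm.trans (D.partialEquiv b) v = τ v := by
  rw [PartialEquiv.trans_source] at hw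
  obtain ⟨hwa, w', hw', hww'⟩ := hw
  rw [D.partialEquiv_symm hwa] at hww'
  change D.pt a w = D.pt b w' at hww'
  obtain ⟨τ, U, hU, hwU, hUW, hτ, -, hP⟩ := D.exists_transition hwa hw' (by
    rw [← hww', inf_idem]; exact D.neBot_pt hwa)
  refine ⟨τ, U, hU, hwU, hτ, fun v hv => ?_, fun v hv => ?_⟩
  · rw [PartialEquiv.trans_source]
    refine ⟨hUW hv, τ v, (hP v hv).1, ?_⟩
    rw [D.partialEquiv_symm (hUW hv)]; exact (hP v hv).2
  · rw [PartialEquiv.trans_apply, D.partialEquiv_symm (hUW hv)]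
    exact D.partialEquiv_apply (hP v hv).1 (hP v hv).2

/-- The charts of the glued space. -/
noncomputable def core : ChartedSpaceCore H D.Glued where
  atlas := range D.partialEquiv
  chartAt G := D.partialEquiv G.2.choose
  mem_chart_source G := G.2.choose_spec
  chart_mem_atlas G := mem_range_self _
  open_source := by
    rintro _ _ ⟨a, rfl⟩ ⟨b, rfl⟩
    rw [isOpen_iff_mem_nhds]
    intro w hw
    obtain ⟨τ, U, hU, hwU, -, hUs, -⟩ := D.exists_open_transition a b hw
    exact Filter.mem_of_superset (hU.mem_nhds hwU) hUs
  continuousOn_toFun := by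
    rintro _ _ ⟨a, rfl⟩ ⟨b, rfl⟩ w hw
    obtain ⟨τ, U, hU, hwU, hτ, hUs, heq⟩ := D.exists_open_transition a b hw
    refine ContinuousAt.continuousWithinAt ?_
    refine (hτ.continuousOn.continuousAt (hU.mem_nhds hwU)).congr ?_
    filter_upwards [hU.mem_nhds hwU] with v hv using (heq v hv).symm

noncomputable instance : TopologicalSpace D.Glued := D.core.toTopologicalSpace

noncomputable instance : ChartedSpace H D.Glued := D.core.toChartedSpace

/-- The chart of the glued space with target `W a`. -/
noncomputable def chart (a : ι) : OpenPartialHomeomorph D.Glued H :=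
  D.core.openPartialHomeomorph (D.partialEquiv a) (mem_range_self a)

lemma atlas_eq : atlas H D.Glued = range D.chart := by
  ext e
  constructor
  · intro he
    obtain ⟨e', ⟨⟨a, rfl⟩, h⟩⟩ := by simpa using (mem_iUnion₂.1 he)
    exact ⟨a, h.symm⟩
  · rintro ⟨a, rfl⟩
    exact mem_iUnion₂.2 ⟨D.partialEquiv a, mem_range_self a, rfl⟩

instance : IsManifold J ∞ D.Glued := by
  refine isManifold_of_contDiffOn J ∞ _ fun e e' he he' => ?_
  rw [atlas_eq] at he he'
  obtain ⟨a, rfl⟩ := he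
  obtain ⟨b, rfl⟩ := he'
  have h : ContMDiffOn J J ∞ ((D.chart a).symm ≫ₕ D.chart b)
      ((D.chart a).symm ≫ₕ D.chart b).source := by
    intro w hw
    obtain ⟨τ, U, hU, hwU, hτ, hUs, heq⟩ := D.exists_open_transition a b hw
    refine ContMDiffAt.contMDiffWithinAt ?_
    refine (hτ.contMDiffAt (hU.mem_nhds hwU)).congr_of_eventuallyEq ?_
    filter_upwards [hU.mem_nhds hwU] with v hv using heq v hv
  rw [← contMDiffOn_iff_contDiffOn]
  exact J.contMDiff.comp_contMDiffOn
    (h.comp (J.contMDiffOn_symm.mono inter_subset_right) fun x hx => hx.1)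

lemma chart_mem_maximalAtlas (a : ι) : D.chart a ∈ IsManifold.maximalAtlas J ∞ D.Glued :=
  IsManifold.subset_maximalAtlas (by rw [atlas_eq]; exact mem_range_self a)

lemma exists_mem_source (G : D.Glued) : ∃ a, G ∈ (D.chart a).source := G.2

lemma isOpen_setOf_mem (O : Set M) : IsOpen {G : D.Glued | O ∈ G.1} := by
  rw [isOpen_iff_mem_nhds]
  intro G hG
  obtain ⟨a, w, hw, hGw⟩ := G.2
  have hO : O ∈ D.pt a w := by rw [← hGw]; exact hG
  have h1 : ∀ᶠ v in 𝓝 w, O ∈ D.pt a v := by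
    obtain ⟨U, hU, hwU, hUO⟩ := mem_nhdsWithin.1 hO
    filter_upwards [hU.mem_nhds hwU] with v hv
    exact mem_nhdsWithin.2 ⟨U, hU, hv, hUO⟩
  have hGs : G ∈ (D.chart a).source := ⟨w, hw, hGw⟩
  have hGw' : D.chart a G = w := D.partialEquiv_apply hw hGw
  have h2 : ∀ᶠ G' in 𝓝 G, O ∈ D.pt a (D.chart a G') :=
    ((D.chart a).continuousAt hGs).eventually (by rw [hGw']; exact h1)
  filter_upwards [h2, (D.chart a).open_source.mem_nhds hGs] with G' hG' hG's
  obtain ⟨w', hw', hGw'⟩ := hG's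
  rw [show D.chart a G' = w' from D.partialEquiv_apply hw' hGw', ← hGw'] at hG'
  exact hG'

instance : T2Space D.Glued := by
  refine ⟨fun G G' hne => ?_⟩
  obtain ⟨a, w, hw, hGw⟩ := G.2
  obtain ⟨b, w', hw', hGw'⟩ := G'.2
  have hbot : ¬ (G.1 ⊓ G'.1).NeBot := by
    intro h
    rw [hGw, hGw'] at h
    refine hne (Glued.ext ?_)
    rw [hGw, hGw']
    exact D.pt_eq_of_neBot hw hw' h
  rw [Filter.not_neBot, ← disjoint_iff, Filter.disjoint_iff] at hbot
  obtain ⟨O, hO, O', hO', hd⟩ := hbot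
  refine ⟨{G | O ∈ G.1}, {G | O' ∈ G.1}, D.isOpen_setOf_mem O, D.isOpen_setOf_mem O', hO, hO', ?_⟩
  rw [disjoint_left]
  intro G'' h h'
  obtain ⟨c, z, hz, hGz⟩ := G''.2
  have hnb : (G''.1).NeBot := by rw [hGz]; exact D.neBot_pt hz
  have := Filter.inter_mem h h'
  rw [hd.inter_eq] at this
  exact hnb.ne (Filter.empty_mem_iff_bot.1 this)

lemma secondCountableTopology [SecondCountableTopology H] {s : Set ι} (hs : s.Countable)
    (hcov : ∀ G : D.Glued, ∃ a ∈ s, G ∈ (D.chart a).source) : SecondCountableTopology D.Glued := by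
  have := hs.to_subtype
  have : ∀ a : s, SecondCountableTopology (D.chart (a : ι)).source :=
    fun a => (D.chart (a : ι)).secondCountableTopology_source
  refine TopologicalSpace.secondCountableTopology_of_countable_cover (ι := s)
    (U := fun a => (D.chart (a : ι)).source) (fun a => (D.chart (a : ι)).open_source) ?_
  refine eq_univ_of_forall fun G => ?_
  obtain ⟨a, ha, hG⟩ := hcov G
  exact mem_iUnion.2 ⟨⟨a, ha⟩, hG⟩

lemma base_eq_chart [T2Space M] {G : D.Glued} {a : ι} (hG : G ∈ (D.chart a).source) :
    D.base G = D.P a (D.chart a G) := by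
  obtain ⟨w, hw, hGw⟩ := hG
  rw [D.base_eq hw hGw, show D.chart a G = w from D.partialEquiv_apply hw hGw]

lemma val_eq_pt_chart {G : D.Glued} {a : ι} (hG : G ∈ (D.chart a).source) :
    G.1 = D.pt a (D.chart a G) := by
  obtain ⟨w, hw, hGw⟩ := hG
  rw [hGw, show D.chart a G = w from D.partialEquiv_apply hw hGw]

end GluingData

end Gluing

/-! ### Projective charts over an adapted chart -/

section ProjIdx

lemma EuclideanQuadrant.mem_closure_pos {m : ℕ} {W : Set ℝ₊^m} (hW : IsOpen W)
    (L : Finset (Fin m)) {z : ℝ₊^m} (hz : z ∈ W) :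
    z ∈ closure {z' ∈ W | (∀ l ∈ L, 0 < z'.val l) ∧ ∀ j ∉ L, z'.val j = z.val j} := by
  set f : ℝ → ℝ^m := fun t => WithLp.toLp 2 fun j => if j ∈ L then z.val j + t else z.val j with hf
  have hfc : Continuous f := by
    refine (PiLp.continuous_toLp 2 _).comp (continuous_pi fun j => ?_)
    split_ifs <;> fun_prop
  have h0 : toQuad (f 0) = z := by
    have : f 0 = z.val := by ext j; simp [hf]
    rw [this, val_toQuad]
  have ht : Filter.Tendsto (fun t => toQuad (f t)) (𝓝[>] (0 : ℝ)) (𝓝 z) := by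
    have := (continuous_toQuad.comp hfc).tendsto 0
    simp only [Function.comp_apply, h0] at this
    exact this.mono_left nhdsWithin_le_nhds
  refine mem_closure_of_tendsto ht ?_
  filter_upwards [self_mem_nhdsWithin, ht.eventually (hW.mem_nhds hz)] with t ht0 htW
  have ht0' : (0 : ℝ) < t := ht0
  have hq : f t ∈ quad m := by
    intro j
    simp only [hf]
    split_ifs
    · exact add_nonneg (z.2 j) ht0'.le
    · exact z.2 j
  refine ⟨htW, fun l hl => ?_, fun j hj => ?_⟩
  · rw [toQuad_val hq]; simp only [hf, hl, if_true]; exact add_pos_of_nonneg_of_pos (z.2 l) ht0'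
  · rw [toQuad_val hq]; simp only [hf, hj, if_false]

variable {E : Type*} [NormedAddCommGroup E] [NormedSpace ℝ E] {H : Type*} [TopologicalSpace H]
  (I : ModelWithCorners ℝ E H) {M : Type u} [TopologicalSpace M] [ChartedSpace H M] (m : ℕ)

/-- The choices that determine a projective chart of the blow-up of `S`: a chart adapted to `S` at
a point, and a normal direction `±e_i`, inward-pointing if the `i`-th coordinate is a boundary
coordinate. -/
structure ProjIdx (S : Set M) where
  pt : M
  φ : CornerChart I M m
  A : Finset (Fin m)
  i : Fin m
  σ : ℝ
  pt_mem : pt ∈ S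
  adapted : IsAdaptedChart S pt φ A
  i_mem : i ∈ A
  sign : σ = 1 ∨ σ = -1
  inward : (φ pt).val i = 0 → σ = 1

namespace ProjIdx

variable {I m} {S : Set M} (a : ProjIdx I m S)

/-- The coordinates of the base point. -/
def c : ℝ^m := (a.φ a.pt).val

/-- The blow-down map in projective coordinates. -/
notation:max "projMap[" a "]" => projMap (c a) (A a) (i a) (σ a)

/-- The domain of the projective coordinates. -/
notation:max "projDom[" a "]" => projDom (c a) (A a) (i a) (σ a)

/-- The projective coordinates, as functions of the polar ones. -/
notation:max "projOfPolar[" a "]" => projOfPolar (c a) (A a) (i a) (σ a)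

/-- The polar coordinates, as functions of the projective ones. -/
notation:max "polarOfProj[" a "]" => polarOfProj (c a) (A a) (i a) (σ a)

lemma c_nonneg (j : Fin m) : 0 ≤ a.c j := (a.φ a.pt).2 j

/-- The blow-down map in projective coordinates, with values in the quadrant. -/
noncomputable def mapQ (z : ℝ₊^m) : ℝ₊^m := toQuad (projMap[a] z.val)

/-- The range of the projective coordinates. -/
def W : Set ℝ₊^m := {z | z.val ∈ projDom[a] ∧ a.mapQ z ∈ a.φ.target}

/-- The range of the projective coordinates, away from the exceptional divisor. -/
def W₀ : Set ℝ₊^m := {z | z ∈ a.W ∧ 0 < z.val a.i}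

/-- The blow-down map in projective coordinates. -/
noncomputable def P (z : ℝ₊^m) : M := a.φ.symm (a.mapQ z)

/-- The projective coordinates, away from the exceptional divisor. -/
noncomputable def p (q : M) : ℝ₊^m := toQuad (projInv a.c a.A a.i a.σ (a.φ q).val)

/-- The image of `W₀` under the blow-down map. -/
def D₀ : Set M := {q ∈ a.φ.source | 0 < a.σ * (a.φ.coord a.i q - a.c a.i) ∧
  ∀ j ∈ a.A, a.c j ≠ 0 → 0 < a.φ.coord j q}

lemma mapQ_val {z : ℝ₊^m} (hz : z.val ∈ projDom[a]) :
    (a.mapQ z).val = projMap[a] z.val := toQuad_val (projMap_mem_quad a.inward z.2 hz)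

lemma continuousOn_mapQ : ContinuousOn a.mapQ {z | z.val ∈ projDom[a]} :=
  continuous_toQuad.comp_continuousOn ((contDiffOn_projMap.continuousOn.mono fun _ h => h.1).comp
      continuous_subtype_val.continuousOn fun _ h => h)

lemma isOpen_W : IsOpen a.W :=
  a.continuousOn_mapQ.isOpen_inter_preimage (isOpen_projDom.preimage continuous_subtype_val)
    a.φ.open_target

lemma isOpen_W₀ : IsOpen a.W₀ :=
  a.isOpen_W.inter (isOpen_lt continuous_const ((continuous_coord _).comp continuous_subtype_val))

lemma dense : a.W ⊆ closure a.W₀ := by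
  intro z hz
  refine closure_mono ?_ (EuclideanQuadrant.mem_closure_pos a.isOpen_W {a.i} hz)
  rintro z' ⟨h1, h2, -⟩
  exact ⟨h1, h2 _ (by simp)⟩

lemma P_mem {z : ℝ₊^m} (hz : z ∈ a.W) : a.P z ∈ a.φ.source := a.φ.symm_mem hz.2

lemma φ_P {z : ℝ₊^m} (hz : z ∈ a.W) : (a.φ (a.P z)).val = projMap[a] z.val := by
  rw [P, a.φ.apply_symm hz.2, a.mapQ_val hz.1]

lemma coord_P {z : ℝ₊^m} (hz : z ∈ a.W) (j : Fin m) :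
    a.φ.coord j (a.P z) = projMap[a] z.val j := by rw [← a.φ_P hz]; rfl

lemma P_mem_S_iff {z : ℝ₊^m} (hz : z ∈ a.W) : a.P z ∈ S ↔ z.val a.i = 0 := by
  rw [a.adapted.2 _ (a.P_mem hz)]
  constructor
  · intro h
    have h1 := h a.i a.i_mem
    rw [a.coord_P hz] at h1
    rw [← sign_mul_projMap_sub (c := a.c) (A := a.A) a.sign a.i_mem z.val, h1]
    show a.σ * (a.c a.i - a.c a.i) = 0
    ring
  · intro h j hj
    rw [a.coord_P hz, projMap_mem hj, h, zero_mul, add_zero]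
    rfl

lemma mem_W₀_iff {z : ℝ₊^m} (hz : z ∈ a.W) : z ∈ a.W₀ ↔ a.P z ∉ S := by
  rw [a.P_mem_S_iff hz]
  exact ⟨fun h => h.2.ne', fun h => ⟨hz, lt_of_le_of_ne (z.2 _) (Ne.symm h)⟩⟩

lemma contMDiffOn_P : ContMDiffOn (𝓠 m) I ∞ a.P a.W := by
  refine a.φ.contMDiffOn_invFun.comp ?_ fun z hz => hz.2
  rw [contMDiffOn_quadrant_iff]
  refine ContMDiffOn.congr (f := fun z => projMap[a] z.val) ?_ fun z hz => a.mapQ_val hz.1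
  exact contDiffOn_projMap.contMDiffOn.comp (contMDiff_quadrant_val m).contMDiffOn
    fun z hz => hz.1.1

lemma p_val {q : M} (hq : 0 < a.σ * (a.φ.coord a.i q - a.c a.i)) :
    (a.p q).val = projInv a.c a.A a.i a.σ (a.φ q).val := toQuad_val (projInv_mem_quad (a.φ q).2 hq)

lemma p_mem {q : M} (hq : q ∈ a.D₀) : a.p q ∈ a.W₀ := by
  have hm : projMap[a] (projInv a.c a.A a.i a.σ (a.φ q).val) = (a.φ q).val :=
    projMap_projInv a.sign hq.2.1 a.i_mem
  refine ⟨⟨?_, ?_⟩, ?_⟩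
  · rw [a.p_val hq.2.1]
    exact projInv_mem_projDom a.sign hq.2.1 a.i_mem hq.2.2
  · rw [mapQ, a.p_val hq.2.1, hm, val_toQuad]
    exact a.φ.map_source hq.1
  · rw [a.p_val hq.2.1, projInv_self]; exact hq.2.1

lemma P_p {q : M} (hq : q ∈ a.D₀) : a.P (a.p q) = q := by
  rw [P, mapQ, a.p_val hq.2.1, projMap_projInv a.sign hq.2.1 a.i_mem, val_toQuad,
    a.φ.symm_apply hq.1]

lemma p_P {z : ℝ₊^m} (hz : z ∈ a.W₀) : a.p (a.P z) = z := by
  rw [p, a.φ_P hz.1, projInv_projMap a.sign a.i_mem hz.1.1.1 hz.2, val_toQuad]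

lemma P_mem_D₀ {z : ℝ₊^m} (hz : z ∈ a.W₀) : a.P z ∈ a.D₀ := by
  refine ⟨a.P_mem hz.1, ?_, fun j hj hc => ?_⟩
  · rw [a.coord_P hz.1, sign_mul_projMap_sub a.sign a.i_mem]; exact hz.2
  · rw [a.coord_P hz.1]; exact hz.1.1.2 j hj hc

lemma isOpen_D₀ : IsOpen a.D₀ := by
  have h : a.D₀ = a.φ.source ∩ (fun q => (a.φ q).val) ⁻¹' ({x | 0 < a.σ * (x a.i - a.c a.i)} ∩
      ⋂ j ∈ a.A, {x : ℝ^m | a.c j ≠ 0 → 0 < x j}) := by ext q; simp [D₀, CornerChart.coord]; tauto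
  rw [h]
  refine a.φ.contMDiffOn_val.continuousOn.isOpen_inter_preimage a.φ.open_source (IsOpen.inter ?_ ?_)
  · exact isOpen_lt continuous_const (by fun_prop)
  · exact isOpen_forall_imp_pos _ continuous_coord

lemma contMDiffOn_p : ContMDiffOn I (𝓠 m) ∞ a.p a.D₀ := by
  rw [contMDiffOn_quadrant_iff]
  refine ContMDiffOn.congr (f := fun q => projInv a.c a.A a.i a.σ (a.φ q).val) ?_
    fun q hq => a.p_val hq.2.1
  exact contDiffOn_projInv.contMDiffOn.comp (a.φ.contMDiffOn_val.mono fun q hq => hq.1)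
    fun q hq => hq.2.1

/-- The point of the exceptional divisor with prescribed boundary slopes, over the base point. -/
lemma exists_mem_W (s : ℝ^m) (hs : s ∈ quad m)
    (hi : s a.i = 0) (hA : ∀ j ∈ a.A, a.c j ≠ 0 → j ≠ a.i → 0 < s j)
    (hA' : ∀ j ∉ a.A, s j = a.c j) : toQuad s ∈ a.W ∧ a.P (toQuad s) = a.pt := by
  have hm : projMap[a] s = a.c := by
    ext j
    by_cases hj : j ∈ a.A
    · rw [projMap_mem hj, hi, zero_mul, add_zero]
    · rw [projMap_notMem hj, hA' j hj]
  have hd : (toQuad s).val ∈ projDom[a] := by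
    rw [toQuad_val hs]
    refine ⟨fun j hj h1 hc => hA j hj hc h1, fun j hj hc => ?_⟩
    rw [hm]; exact lt_of_le_of_ne (a.c_nonneg j) (Ne.symm hc)
  have hq : a.mapQ (toQuad s) = a.φ a.pt := by rw [mapQ, toQuad_val hs, hm]; exact val_toQuad _
  refine ⟨⟨hd, ?_⟩, ?_⟩
  · rw [hq]; exact a.φ.map_source a.adapted.1
  · rw [P, hq, a.φ.symm_apply a.adapted.1]

lemma nonempty_W : a.W.Nonempty := by
  refine ⟨_, (a.exists_mem_W (WithLp.toLp 2 fun j => if j = a.i then 0 else if j ∈ a.A then 1 else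
    a.c j) (fun j => ?_) (by simp) (fun j hj _ h1 => by simp [h1, hj]) (fun j hj => ?_)).1⟩
  · simp only
    split_ifs
    · exact le_rfl
    · exact zero_le_one
    · exact a.c_nonneg j
  · have : j ≠ a.i := fun h => hj (h ▸ a.i_mem)
    simp [this, hj]

end ProjIdx

end ProjIdx

/-! ### Lifting transition maps to the blow-up -/

section Transition

lemma exists_open_quad_preimage {m : ℕ} {X : Type*} [TopologicalSpace X]
    {f : ℝ^m → X} {O : Set ℝ^m} (hO : IsOpen O)
    (hf : ContinuousOn f (quad m ∩ O)) {V : Set X} (hV : IsOpen V) :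
    ∃ O' : Set ℝ^m, IsOpen O' ∧ O' ⊆ O ∧ ∀ z ∈ quad m, z ∈ O' ↔ z ∈ O ∧ f z ∈ V := by
  obtain ⟨U, hU, h⟩ := continuousOn_iff'.1 hf V hV
  refine ⟨U ∩ O, hU.inter hO, inter_subset_right, fun z hz => ?_⟩
  have h1 := Set.ext_iff.1 h z
  simp only [mem_inter_iff, mem_preimage] at h1 ⊢
  tauto

variable {E : Type*} [NormedAddCommGroup E] [NormedSpace ℝ E] {H : Type*} [TopologicalSpace H]
  {I : ModelWithCorners ℝ E H} {M : Type u} [TopologicalSpace M] [ChartedSpace H M] {m : ℕ}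

/-- The change of coordinates between two charts, as a map on `ℝ^m`. -/
noncomputable def CornerChart.changeMap (φ' φ : CornerChart I M m)
    (x : ℝ^m) : ℝ^m := (φ (φ'.symm (toQuad x))).val

lemma CornerChart.exists_open_changeMap (φ' φ : CornerChart I M m) : ∃ O : Set ℝ^m, IsOpen O ∧
      (∀ x ∈ quad m, x ∈ O ↔ toQuad x ∈ φ'.target ∧ φ'.symm (toQuad x) ∈ φ.source) ∧
      ContDiffOn ℝ ∞ (φ'.changeMap φ) (quad m ∩ O) := by
  obtain ⟨O₁, hO₁, hO₁t⟩ := φ'.exists_open_target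
  have himg : quad m ∩ O₁ ⊆ Subtype.val '' φ'.target := by
    rintro x ⟨hx, hx1⟩
    refine ⟨toQuad x, ?_, toQuad_val hx⟩
    rw [hO₁t]; show (toQuad x).val ∈ O₁; rwa [toQuad_val hx]
  obtain ⟨O, hO, -, h⟩ := exists_open_quad_preimage hO₁
    (φ'.contMDiffOn_symm_toQuad.continuousOn.mono himg) φ.open_source
  have hiff : ∀ x ∈ quad m, x ∈ O ↔ toQuad x ∈ φ'.target ∧ φ'.symm (toQuad x) ∈ φ.source := by
    intro x hx
    rw [h x hx, hO₁t]
    show _ ↔ (toQuad x).val ∈ O₁ ∧ _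
    rw [toQuad_val hx]
  refine ⟨O, hO, hiff, ?_⟩
  rw [← contMDiffOn_iff_contDiffOn]
  refine φ.contMDiffOn_val.comp (φ'.contMDiffOn_symm_toQuad.mono fun x hx => himg ⟨hx.1, ?_⟩)
    fun x hx => ((hiff x hx.1).1 hx.2).2
  exact ((h x hx.1).1 hx.2).1

namespace ProjIdx

variable {S : Set M}

/-- A smooth map `θ`, near the point `w` of a projective chart `b`, that expresses the blow-down map
in terms of (not necessarily normalized) polar coordinates with respect to a chart `φ` in which `S`
is given by fixing the coordinates with index in `A` to the values `c`. -/
structure PolarLift (b : ProjIdx I m S) (φ : CornerChart I M m) (A : Finset (Fin m))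
    (c : ℝ^m) (w : ℝ₊^m) (O : Set ℝ^m) (θ : ℝ^m → ℝ × ℝ^m) : Prop where
  isOpen : IsOpen O
  mem : w.val ∈ O
  contDiffOn : ContDiffOn ℝ ∞ θ (quad m ∩ O)
  mem_source : ∀ z : ℝ₊^m, z.val ∈ O → b.P z ∈ φ.source
  eq_polarMap : ∀ z : ℝ₊^m, z.val ∈ O → (φ (b.P z)).val = polarMap c A (θ z.val)
  radius_nonneg : ∀ z : ℝ₊^m, z.val ∈ O → 0 ≤ (θ z.val).1
  radius_pos : ∀ z : ℝ₊^m, z.val ∈ O → 0 < z.val b.i → 0 < (θ z.val).1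
  inward : ∀ z : ℝ₊^m, z.val ∈ O → ∀ j ∈ A, c j = 0 → 0 ≤ (θ z.val).2 j
  interior : ∀ z : ℝ₊^m, z.val ∈ O → ∀ j ∈ A, c j ≠ 0 → 0 < φ.coord j (b.P z)
  ne_zero : ∃ j ∈ A, (θ w.val).2 j ≠ 0

/-- Over the centre, polar coordinates with respect to any adapted chart are smooth, and their
directions do not degenerate. Both follow from Hadamard's lemma, applied to the change of coordinates
and to its inverse. -/
lemma exists_polarLift (b : ProjIdx I m S) {w : ℝ₊^m} (hw : w ∈ b.W)
    (hwS : b.P w ∈ S) {p : M} {φ : CornerChart I M m} {A : Finset (Fin m)}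
    (had : IsAdaptedChart S p φ A) (hφ : b.P w ∈ φ.source) :
    ∃ O θ, b.PolarLift φ A (φ p).val w O θ := by
  set c := (φ p).val with hc
  set x₀ : ℝ^m := (b.φ (b.P w)).val with hx₀
  set y₀ : ℝ^m := (φ (b.P w)).val with hy₀
  have hx₀A : ∀ k ∈ b.A, x₀ k = b.c k := (b.adapted.2 _ (b.P_mem hw)).1 hwS
  have hy₀A : ∀ k ∈ A, y₀ k = c k := (had.2 _ hφ).1 hwS
  have hx₀proj : projMap[b] w.val = x₀ := (b.φ_P hw).symm
  obtain ⟨O₁, hO₁, hO₁iff, hT⟩ := b.φ.exists_open_changeMap φ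
  set T := b.φ.changeMap φ with hTdef
  have hx₀O₁ : x₀ ∈ O₁ := by
    refine (hO₁iff x₀ (b.φ (b.P w)).2).2 ?_
    rw [hx₀, val_toQuad, b.φ.symm_apply (b.P_mem hw)]
    exact ⟨b.φ.map_source (b.P_mem hw), hφ⟩
  have hTP : ∀ z ∈ b.W, T (projMap[b] z.val) = (φ (b.P z)).val := by
    intro z hz
    rw [hTdef, CornerChart.changeMap, ← b.φ_P hz, val_toQuad, b.φ.symm_apply (b.P_mem hz)]
  -- Hadamard coefficients of the change of coordinates
  have hHad : ∀ j, ∃ (O' : Set ℝ^m) (G : Fin m → ℝ^m → ℝ), IsOpen O' ∧ x₀ ∈ O' ∧ O' ⊆ O₁ ∧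
      (∀ k, ContDiffOn ℝ ∞ (G k) (quad m ∩ O')) ∧
      (j ∈ A → ∀ x ∈ quad m ∩ O', T x j - c j = ∑ k ∈ b.A, (x k - x₀ k) * G k x) := by
    intro j
    by_cases hj : j ∈ A
    · have hd : ContDiffOn ℝ ∞ (fun x => T x j - c j) (quad m ∩ O₁) :=
        ((contDiff_coord j).comp_contDiffOn hT).sub contDiffOn_const
      obtain ⟨O', G, h1, h2, h3, h4, h5⟩ := exists_hadamard_quad b.A hO₁ (x₀ := x₀)
        (b.φ (b.P w)).2 hx₀O₁ hd (fun x hx hxA => by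
          have hx' := (hO₁iff x hx.1).1 hx.2
          have hxs := b.φ.symm_mem hx'.1
          have hS : b.φ.symm (toQuad x) ∈ S := by
            rw [b.adapted.2 _ hxs]
            intro k hk
            show (b.φ (b.φ.symm (toQuad x))).val k = _
            rw [b.φ.apply_symm hx'.1, toQuad_val hx.1, hxA k hk]
            exact hx₀A k hk
          exact sub_eq_zero.2 ((had.2 _ hx'.2).1 hS j hj))
      exact ⟨O', G, h1, h2, h3, h4, fun _ => h5⟩
    · exact ⟨O₁, fun _ _ => 0, hO₁, hx₀O₁, subset_rfl, fun _ => contDiffOn_const,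
        fun h => absurd h hj⟩
  choose OG G hOG hxOG hOGs hGd hGeq using hHad
  have hO₂ : IsOpen (O₁ ∩ ⋂ j, OG j) := hO₁.inter (isOpen_iInter_of_finite hOG)
  -- shrink so that the interior normal coordinates stay positive
  obtain ⟨O₃, hO₃, hO₃s, hO₃iff⟩ := exists_open_quad_preimage hO₂
    (hT.continuousOn.mono (inter_subset_inter_right _ inter_subset_left))
    (V := ⋂ j ∈ A, {y : ℝ^m | c j ≠ 0 → 0 < y j}) (isOpen_forall_imp_pos A continuous_coord)
  set O : Set ℝ^m := projDom[b] ∩ projMap[b] ⁻¹' O₃ with hOdef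
  have hO : IsOpen O := (contDiffOn_projMap.continuousOn.mono fun _ h => h.1).isOpen_inter_preimage
    isOpen_projDom hO₃
  have hproj : ∀ z ∈ quad m ∩ O, projMap[b] z ∈ quad m ∩ O₃ := fun z hz =>
    ⟨projMap_mem_quad b.inward hz.1 hz.2.1, hz.2.2⟩
  have hprojG : ∀ j, ∀ z ∈ quad m ∩ O, projMap[b] z ∈ quad m ∩ OG j := fun j z hz =>
    ⟨(hproj z hz).1, mem_iInter.1 (hO₃s (hproj z hz).2).2 j⟩
  have hmapd : ContDiffOn ℝ ∞ (projMap[b]) (quad m ∩ O) :=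
    contDiffOn_projMap.mono fun z hz => hz.2.1.1
  set θ : ℝ^m → ℝ × ℝ^m := fun z => (z b.i, WithLp.toLp 2 fun j => if j ∈ A then
      ∑ k ∈ b.A, projSlope b.c b.i b.σ z k * G j k (projMap[b] z) else T (projMap[b] z) j) with hθ
  have hθd : ContDiffOn ℝ ∞ θ (quad m ∩ O) := by
    refine (contDiff_coord b.i).contDiffOn.prodMk (contDiffOn_toLp fun j => ?_)
    split_ifs with hj
    · refine ContDiffOn.sum fun k hk => ?_
      exact ((contDiffOn_projSlope hk).mono fun z hz => hz.2.1.1).mul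
        ((hGd j k).comp hmapd (hprojG j))
    · refine (contDiff_coord j).comp_contDiffOn (hT.comp hmapd fun z hz => ?_)
      exact ⟨(hproj z hz).1, (hO₃s (hproj z hz).2).1⟩
  have hW : ∀ z : ℝ₊^m, z.val ∈ O → z ∈ b.W ∧ b.P z ∈ φ.source := by
    intro z hz
    have h1 := hproj z.val ⟨z.2, hz⟩
    exact ⟨⟨hz.1, ((hO₁iff _ h1.1).1 (hO₃s h1.2).1).1⟩, ((hO₁iff _ h1.1).1 (hO₃s h1.2).1).2⟩
  have hθeq : ∀ z : ℝ₊^m, z.val ∈ O → ∀ j ∈ A,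
      φ.coord j (b.P z) - c j = z.val b.i * (θ z.val).2 j := by
    intro z hz j hj
    have h1 := hprojG j z.val ⟨z.2, hz⟩
    have h2 := hGeq j hj _ h1
    rw [hTP z (hW z hz).1] at h2
    show (φ (b.P z)).val j - c j = _
    rw [h2, hθ]
    simp only [hj, if_true]
    rw [Finset.mul_sum]
    refine Finset.sum_congr rfl fun k hk => ?_
    rw [projMap_mem hk, hx₀A k hk]; ring
  have hθc : ∀ j, ContinuousOn (fun z : ℝ₊^m => (θ z.val).2 j) {z | z.val ∈ O} := fun j =>
    ((continuous_coord j).comp_continuousOn (continuous_snd.comp_continuousOn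
      hθd.continuousOn)).comp continuous_subtype_val.continuousOn fun z hz => ⟨z.2, hz⟩
  have hOQ : IsOpen {z : ℝ₊^m | z.val ∈ O} := hO.preimage continuous_subtype_val
  have hwO : w.val ∈ O := by
    refine ⟨hw.1, ?_⟩
    show projMap[b] w.val ∈ O₃
    rw [hx₀proj]
    refine (hO₃iff x₀ (b.φ (b.P w)).2).2 ⟨⟨hx₀O₁, mem_iInter.2 hxOG⟩, ?_⟩
    rw [← hx₀proj, hTP w hw]
    simp only [mem_iInter]
    intro j hj hcj
    show 0 < y₀ j
    rw [hy₀A j hj]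
    exact lt_of_le_of_ne ((φ p).2 j) (Ne.symm hcj)
  refine ⟨O, θ, hO, hwO, hθd, fun z hz => (hW z hz).2, ?_,
    fun z _ => z.2 _, fun z _ h => h, ?_, ?_, ?_⟩
  · intro z hz
    ext j
    by_cases hj : j ∈ A
    · have := hθeq z hz j hj
      simp only [polarMap, hj, if_true]
      have h3 : (θ z.val).1 = z.val b.i := rfl
      rw [h3, ← this]
      show _ = c j + ((φ (b.P z)).val j - c j)
      ring
    · simp only [polarMap, hj, if_false, hθ]
      rw [hTP z (hW z hz).1]
  · -- where the radius is positive this is the sign of a boundary coordinate; pass to the closure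
    intro z hz j hj hcj
    by_contra hneg
    push Not at hneg
    have hopen := (hθc j).isOpen_inter_preimage hOQ (isOpen_Iio (a := (0 : ℝ)))
    obtain ⟨z', ⟨⟨hz'O, hz'⟩, h1, -⟩⟩ := closure_nonempty_iff.1
      ⟨z, EuclideanQuadrant.mem_closure_pos hopen {b.i} ⟨hz, hneg⟩⟩
    have h2 := hθeq z' hz'O j hj
    have h3 : 0 < z'.val b.i := h1 _ (by simp)
    have h4 : (0 : ℝ) ≤ φ.coord j (b.P z') := φ.coord_nonneg _ _
    rw [hcj, sub_zero] at h2
    rw [h2] at h4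
    exact absurd h4 (not_le.2 (mul_neg_of_pos_of_neg h3 hz'))
  · intro z hz j hj hcj
    have h1 := hproj z.val ⟨z.2, hz⟩
    have h2 := ((hO₃iff _ h1.1).1 h1.2).2
    rw [hTP z (hW z hz).1] at h2
    simp only [mem_iInter] at h2
    exact h2 j hj hcj
  · -- the inverse change of coordinates recovers the leading slope `σ = ±1` from the new slopes
    obtain ⟨O₄, hO₄, hO₄iff, hT'⟩ := φ.exists_open_changeMap b.φ
    have hy₀O₄ : y₀ ∈ O₄ := by
      refine (hO₄iff y₀ (φ (b.P w)).2).2 ?_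
      rw [hy₀, val_toQuad, φ.symm_apply hφ]
      exact ⟨φ.map_source hφ, b.P_mem hw⟩
    obtain ⟨O₅, K, hO₅, hy₀O₅, hO₅s, hKd, hKeq⟩ := exists_hadamard_quad A hO₄ (x₀ := y₀)
      (f := fun y => φ.changeMap b.φ y b.i - b.c b.i) (φ (b.P w)).2 hy₀O₄
      (((contDiff_coord _).comp_contDiffOn hT').sub contDiffOn_const) (fun y hy hyA => by
        have hy' := (hO₄iff y hy.1).1 hy.2
        have hS : φ.symm (toQuad y) ∈ S := by
          rw [had.2 _ (φ.symm_mem hy'.1)]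
          intro k hk
          show (φ (φ.symm (toQuad y))).val k = _
          rw [φ.apply_symm hy'.1, toQuad_val hy.1, hyA k hk]
          exact hy₀A k hk
        exact sub_eq_zero.2 ((b.adapted.2 _ hy'.2).1 hS b.i b.i_mem))
    by_contra hall
    push Not at hall
    have hyc : ContinuousOn (fun z : ℝ₊^m => (φ (b.P z)).val) {z | z.val ∈ O} :=
      φ.contMDiffOn_val.continuousOn.comp
        (b.contMDiffOn_P.continuousOn.mono fun z hz => (hW z hz).1) fun z hz => (hW z hz).2
    have hO₆ := hyc.isOpen_inter_preimage hOQ hO₅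
    have hgc : ContinuousOn (fun z : ℝ₊^m => (∑ k ∈ A, (θ z.val).2 k * K k (φ (b.P z)).val) * b.σ)
        ({z | z.val ∈ O} ∩ (fun z : ℝ₊^m => (φ (b.P z)).val) ⁻¹' O₅) := by
      refine ContinuousOn.mul (continuousOn_finsetSum _ fun k _ => ?_) continuousOn_const
      exact ((hθc k).mono inter_subset_left).mul ((hKd k).continuousOn.comp
        (hyc.mono inter_subset_left) fun z hz => ⟨(φ (b.P z)).2, hz.2⟩)
    have hopen := hgc.isOpen_inter_preimage hO₆ (isOpen_Iio (a := (1 : ℝ)))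
    obtain ⟨z', ⟨⟨⟨hz'O, hz'5⟩, hz'⟩, h1, -⟩⟩ := closure_nonempty_iff.1
      ⟨w, EuclideanQuadrant.mem_closure_pos hopen {b.i} ⟨⟨hwO, hy₀O₅⟩, by
        simp only [mem_preimage, mem_Iio]
        rw [Finset.sum_eq_zero fun k hk => by rw [hall k hk, zero_mul], zero_mul]
        exact zero_lt_one⟩⟩
    have h3 : 0 < z'.val b.i := h1 _ (by simp)
    have h4 := hKeq (φ (b.P z')).val ⟨(φ (b.P z')).2, hz'5⟩
    have h5 : φ.changeMap b.φ (φ (b.P z')).val = projMap[b] z'.val := by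
      rw [CornerChart.changeMap, val_toQuad, φ.symm_apply (hW z' hz'O).2, b.φ_P (hW z' hz'O).1]
    simp only [h5, projMap_mem b.i_mem, projSlope_self, add_sub_cancel_left] at h4
    have h6 : ∑ k ∈ A, ((φ (b.P z')).val k - y₀ k) * K k (φ (b.P z')).val =
        z'.val b.i * ∑ k ∈ A, (θ z'.val).2 k * K k (φ (b.P z')).val := by
      rw [Finset.mul_sum]
      refine Finset.sum_congr rfl fun k hk => ?_
      have := hθeq z' hz'O k hk
      rw [hy₀A k hk, ← mul_assoc, ← this]
      rfl
    rw [h6] at h4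
    have h7 := mul_left_cancel₀ h3.ne' h4
    have h8 : (∑ k ∈ A, (θ z'.val).2 k * K k (φ (b.P z')).val) * b.σ < 1 := hz'
    rw [← h7, sq_sign_eq_one b.sign] at h8
    exact lt_irrefl _ h8

/-- The transition map from a projective chart `b` to a projective chart `a`, through polar
coordinates. -/
noncomputable def transition (a : ProjIdx I m S) (θ : ℝ^m → ℝ × ℝ^m) (z : ℝ₊^m) :
    ℝ₊^m := toQuad (projOfPolar[a] (θ z.val))

variable {a b : ProjIdx I m S} {w : ℝ₊^m} {O : Set ℝ^m} {θ : ℝ^m → ℝ × ℝ^m}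

lemma PolarLift.continuousOn {φ : CornerChart I M m} {A : Finset (Fin m)} {c : ℝ^m}
    (L : b.PolarLift φ A c w O θ) : ContinuousOn (fun z : ℝ₊^m => θ z.val) {z | z.val ∈ O} :=
  L.contDiffOn.continuousOn.comp continuous_subtype_val.continuousOn fun z hz => ⟨z.2, hz⟩

lemma PolarLift.transition_val (L : b.PolarLift a.φ a.A a.c w O θ) {z : ℝ₊^m} (hz : z.val ∈ O)
    (hpos : 0 < a.σ * (θ z.val).2 a.i) : (a.transition θ z).val = projOfPolar[a] (θ z.val) :=
  toQuad_val (projOfPolar_mem_quad hpos (L.radius_nonneg z hz) (L.inward z hz)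
    (by rw [← L.eq_polarMap z hz]; exact (a.φ (b.P z)).2))

lemma PolarLift.transition_mem (L : b.PolarLift a.φ a.A a.c w O θ) {z : ℝ₊^m} (hz : z.val ∈ O)
    (hpos : 0 < a.σ * (θ z.val).2 a.i) : a.transition θ z ∈ a.W ∧ a.P (a.transition θ z) = b.P z ∧
      (z ∈ b.W₀ → a.transition θ z ∈ a.W₀) := by
  have h1 := L.transition_val hz hpos
  have hmap : projMap[a] (a.transition θ z).val = (a.φ (b.P z)).val := by
    rw [h1, projMap_projOfPolar a.sign a.i_mem hpos, L.eq_polarMap z hz]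
  have hQ : a.mapQ (a.transition θ z) = a.φ (b.P z) := by rw [mapQ, hmap]; exact val_toQuad _
  have hWm : a.transition θ z ∈ a.W := by
    refine ⟨⟨?_, ?_⟩, ?_⟩
    · rw [h1]; exact projOfPolar_mem_projPos _
    · rw [hmap]; exact L.interior z hz
    · rw [hQ]; exact a.φ.map_source (L.mem_source z hz)
  refine ⟨hWm, ?_, fun hz0 => ⟨hWm, ?_⟩⟩
  · rw [P, hQ, a.φ.symm_apply (L.mem_source z hz)]
  · rw [h1]
    simp only [projOfPolar, if_true]
    exact mul_pos (L.radius_pos z hz hz0.2) hpos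

lemma PolarLift.exists_smooth (L : b.PolarLift a.φ a.A a.c w O θ) (hpos : 0 < a.σ * (θ w.val).2 a.i) :
    ∃ U : Set ℝ₊^m, IsOpen U ∧ w ∈ U ∧ ContMDiffOn (𝓠 m) (𝓠 m) ∞ (a.transition θ) U ∧
      ∀ z ∈ U, z.val ∈ O ∧ 0 < a.σ * (θ z.val).2 a.i := by
  have hc : ContinuousOn (fun z : ℝ₊^m => a.σ * (θ z.val).2 a.i) {z | z.val ∈ O} :=
    continuousOn_const.mul ((continuous_coord a.i).comp_continuousOn
      (continuous_snd.comp_continuousOn L.continuousOn))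
  refine ⟨{z | z.val ∈ O} ∩ (fun z : ℝ₊^m => a.σ * (θ z.val).2 a.i) ⁻¹' Ioi 0,
    hc.isOpen_inter_preimage (L.isOpen.preimage continuous_subtype_val) isOpen_Ioi,
    ⟨L.mem, hpos⟩, ?_, fun z hz => hz⟩
  rw [contMDiffOn_quadrant_iff]
  refine ContMDiffOn.congr (f := fun z => projOfPolar[a] (θ z.val)) ?_
    fun z hz => L.transition_val hz.1 hz.2
  refine (contDiffOn_projOfPolar.contMDiffOn (n := ∞)).comp
    (L.contDiffOn.contMDiffOn.comp ((contMDiff_quadrant_val m).contMDiffOn) fun z hz => ?_)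
    fun z hz => hz.2
  exact ⟨z.2, hz.1⟩

end ProjIdx

end Transition

/-! ### Polar coordinates off the centre -/

section PolarCoord

variable {m : ℕ} (c : ℝ^m) (A : Finset (Fin m))

/-- Polar coordinates about `{x | ∀ j ∈ A, x j = c j}`, away from that set. -/
noncomputable def normalPolar (x : ℝ^m) : ℝ × ℝ^m :=
  (√(∑ j ∈ A, (x j - c j) ^ 2), WithLp.toLp 2 fun j =>
    if j ∈ A then (x j - c j) / √(∑ j ∈ A, (x j - c j) ^ 2) else x j)

/-- Scale the direction to unit length, without changing the image under `polarMap`. -/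
noncomputable def polarNormalize (w : ℝ × ℝ^m) : ℝ × ℝ^m :=
  (w.1 * √(∑ j ∈ A, w.2 j ^ 2), WithLp.toLp 2 fun j =>
    if j ∈ A then w.2 j / √(∑ j ∈ A, w.2 j ^ 2) else w.2 j)

variable {c A}

lemma normalPolar_polarMap {w : ℝ × ℝ^m} (hw : 0 < w.1) :
    normalPolar c A (polarMap c A w) = polarNormalize A w := by
  have h : √(∑ j ∈ A, (polarMap c A w j - c j) ^ 2) = w.1 * √(∑ j ∈ A, w.2 j ^ 2) := by
    have : ∑ j ∈ A, (polarMap c A w j - c j) ^ 2 = w.1 ^ 2 * ∑ j ∈ A, w.2 j ^ 2 := by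
      rw [Finset.mul_sum]
      refine Finset.sum_congr rfl fun j hj => ?_
      simp only [polarMap, hj, if_true]; ring
    rw [this, Real.sqrt_mul (sq_nonneg _), Real.sqrt_sq hw.le]
  refine Prod.ext h ?_
  ext j
  simp only [normalPolar, polarNormalize, h]
  by_cases hj : j ∈ A
  · simp only [hj, if_true, polarMap, add_sub_cancel_left]
    exact mul_div_mul_left _ _ hw.ne'
  · simp [hj, polarMap]

lemma polarNormalize_eq {w : ℝ × ℝ^m} (hw : ∑ j ∈ A, w.2 j ^ 2 = 1) : polarNormalize A w = w := by
  refine Prod.ext (by simp [polarNormalize, hw]) ?_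
  ext j
  simp [polarNormalize, hw]

lemma normalPolar_projMap {i : Fin m} {σ : ℝ} (hσ : σ = 1 ∨ σ = -1) (hi : i ∈ A)
    (hσ0 : c i = 0 → σ = 1) {z : ℝ^m} (hz : z ∈ quad m) (hzi : 0 < z i) :
    normalPolar c A (projMap c A i σ z) = polarOfProj c A i σ z := by
  rw [← polarMap_polarOfProj hσ hi, normalPolar_polarMap, polarNormalize_eq]
  · exact (polarOfProj_mem (V := univ) hσ hi hσ0 hz (mem_univ _)).2.1
  · exact mul_pos hzi (projNorm_pos hσ hi z)

lemma contDiffOn_polarNormalize : ContDiffOn ℝ ∞ (polarNormalize A)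
      {w : ℝ × ℝ^m | 0 < ∑ j ∈ A, w.2 j ^ 2} := by
  have hc : ∀ j, ContDiff ℝ ∞ fun w : ℝ × ℝ^m => w.2 j :=
    fun j => (contDiff_coord j).comp contDiff_snd
  have hN : ContDiffOn ℝ ∞ (fun w : ℝ × ℝ^m => √(∑ j ∈ A, w.2 j ^ 2))
      {w | 0 < ∑ j ∈ A, w.2 j ^ 2} :=
    ContDiffOn.sqrt (ContDiff.sum fun j _ => (hc j).pow 2).contDiffOn fun w hw => ne_of_gt hw
  refine (contDiff_fst.contDiffOn.mul hN).prodMk ?_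
  rw [contDiffOn_euclidean]
  intro j
  by_cases hj : j ∈ A
  · simp only [hj, if_true]
    exact (hc j).contDiffOn.div hN fun w hw => (Real.sqrt_pos.2 hw).ne'
  · simp only [hj, if_false]
    exact (hc j).contDiffOn

lemma contDiffOn_normalPolar : ContDiffOn ℝ ∞ (normalPolar c A)
      {x : ℝ^m | 0 < ∑ j ∈ A, (x j - c j) ^ 2} := by
  have hc : ∀ j, ContDiff ℝ ∞ fun x : ℝ^m => x j - c j :=
    fun j => (contDiff_coord j).sub contDiff_const
  have hN : ContDiffOn ℝ ∞ (fun x : ℝ^m => √(∑ j ∈ A, (x j - c j) ^ 2))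
      {x | 0 < ∑ j ∈ A, (x j - c j) ^ 2} :=
    ContDiffOn.sqrt (ContDiff.sum fun j _ => (hc j).pow 2).contDiffOn fun w hw => ne_of_gt hw
  refine hN.prodMk (contDiffOn_toLp fun j => ?_)
  by_cases hj : j ∈ A
  · simp only [hj, if_true]
    exact (hc j).contDiffOn.div hN fun w hw => (Real.sqrt_pos.2 hw).ne'
  · simp only [hj, if_false]
    exact (contDiff_coord j).contDiffOn

lemma sum_sq_sub_pos {x : ℝ^m} (hx : ∃ j ∈ A, x j ≠ c j) : 0 < ∑ j ∈ A, (x j - c j) ^ 2 := by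
  obtain ⟨j, hj, h⟩ := hx
  exact Finset.sum_pos' (fun j _ => sq_nonneg _) ⟨j, hj, by positivity [sub_ne_zero.2 h]⟩

lemma polarMap_normalPolar {x : ℝ^m} (hx : ∃ j ∈ A, x j ≠ c j) :
    polarMap c A (normalPolar c A x) = x := by
  have h := Real.sqrt_pos.2 (sum_sq_sub_pos hx)
  ext j
  by_cases hj : j ∈ A
  · simp only [polarMap, normalPolar, hj, if_true]; field_simp; ring
  · simp [polarMap, normalPolar, hj]

lemma normalPolar_mem {V : Set ℝ^m} {x : ℝ^m}
    (hx : ∃ j ∈ A, x j ≠ c j) (hq : x ∈ quad m) (hV : x ∈ V) :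
    normalPolar c A x ∈ polarDomain c A V := by
  have h := sum_sq_sub_pos hx
  refine ⟨Real.sqrt_nonneg _, ?_, fun j hj hc => ?_, by rwa [polarMap_normalPolar hx]⟩
  · have h1 : ∑ j ∈ A, (normalPolar c A x).2 j ^ 2 =
        ∑ j ∈ A, (x j - c j) ^ 2 / √(∑ j ∈ A, (x j - c j) ^ 2) ^ 2 :=
      Finset.sum_congr rfl fun j hj => by simp only [normalPolar, hj, if_true, div_pow]
    rw [h1, ← Finset.sum_div, Real.sq_sqrt h.le, div_self h.ne']
  · simp only [normalPolar, hj, if_true, hc, sub_zero]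
    exact div_nonneg (hq j) (Real.sqrt_nonneg _)

end PolarCoord

/-! ### Existence of blow-ups -/

instance (m : ℕ) : T2Space ℝ₊^m := inferInstanceAs (T2Space {x : ℝ^m // ∀ i, 0 ≤ x i})

instance (m : ℕ) : SecondCountableTopology ℝ₊^m :=
  inferInstanceAs (SecondCountableTopology {x : ℝ^m // ∀ i, 0 ≤ x i})

section Existence

variable {E : Type*} [NormedAddCommGroup E] [NormedSpace ℝ E] {H : Type*} [TopologicalSpace H]
  {I : ModelWithCorners ℝ E H} {M : Type u} [TopologicalSpace M] [ChartedSpace H M] {m : ℕ}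

variable (I m) in
/-- The charts of a blow-up: the charts of `M`, used away from `S`, and the projective charts. -/
abbrev BlowupIdx (S : Set M) := {φ : CornerChart I M m // (φ.source \ S).Nonempty} ⊕ ProjIdx I m S

namespace BlowupIdx

variable {S : Set M}

/-- The range of a chart. -/
def W (a : BlowupIdx I m S) : Set ℝ₊^m :=
  Sum.elim (fun φ => {z | z ∈ φ.1.target ∧ φ.1.symm z ∉ S}) ProjIdx.W a

/-- The range of a chart, away from the exceptional divisor. -/
def W₀ (a : BlowupIdx I m S) : Set ℝ₊^m :=
  Sum.elim (fun φ => {z | z ∈ φ.1.target ∧ φ.1.symm z ∉ S}) ProjIdx.W₀ a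

/-- The blow-down map in a chart. -/
noncomputable def P (a : BlowupIdx I m S) : ℝ₊^m → M := Sum.elim (fun φ z => φ.1.symm z) ProjIdx.P a

/-- The coordinates of a chart, away from the exceptional divisor. -/
noncomputable def p (a : BlowupIdx I m S) : M → ℝ₊^m := Sum.elim (fun φ q => φ.1 q) ProjIdx.p a

/-- The domain of the coordinates of a chart away from the exceptional divisor. -/
def D₀ (a : BlowupIdx I m S) : Set M := Sum.elim (fun φ => φ.1.source \ S) ProjIdx.D₀ a

lemma contMDiffOn_P (a : BlowupIdx I m S) : ContMDiffOn (𝓠 m) I ∞ a.P a.W := by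
  rcases a with φ | a
  · exact φ.1.contMDiffOn_invFun.mono fun z hz => hz.1
  · exact a.contMDiffOn_P

lemma isOpen_W (hS : IsClosed S) (a : BlowupIdx I m S) : IsOpen a.W := by
  rcases a with φ | a
  · exact φ.1.contMDiffOn_invFun.continuousOn.isOpen_inter_preimage φ.1.open_target hS.isOpen_compl
  · exact a.isOpen_W

lemma isOpen_W₀ (hS : IsClosed S) (a : BlowupIdx I m S) : IsOpen a.W₀ := by
  rcases a with φ | a
  · exact isOpen_W hS (Sum.inl φ)
  · exact a.isOpen_W₀

lemma isOpen_D₀ (hS : IsClosed S) (a : BlowupIdx I m S) : IsOpen a.D₀ := by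
  rcases a with φ | a
  · exact φ.1.open_source.sdiff hS
  · exact a.isOpen_D₀

lemma W₀_subset (a : BlowupIdx I m S) : a.W₀ ⊆ a.W := by
  rcases a with φ | a
  · exact subset_rfl
  · exact fun z hz => hz.1

lemma mem_W₀_iff {a : BlowupIdx I m S} {z : ℝ₊^m} (hz : z ∈ a.W) : z ∈ a.W₀ ↔ a.P z ∉ S := by
  rcases a with φ | a
  · exact ⟨fun _ => hz.2, fun _ => hz⟩
  · exact a.mem_W₀_iff hz

lemma contMDiffOn_p (a : BlowupIdx I m S) : ContMDiffOn I (𝓠 m) ∞ a.p a.D₀ := by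
  rcases a with φ | a
  · exact φ.1.contMDiffOn_toFun.mono sdiff_subset
  · exact a.contMDiffOn_p

lemma p_mem {a : BlowupIdx I m S} {q : M} (hq : q ∈ a.D₀) : a.p q ∈ a.W₀ := by
  rcases a with φ | a
  · exact ⟨φ.1.map_source hq.1, by show φ.1.symm (φ.1 q) ∉ S; rw [φ.1.symm_apply hq.1]; exact hq.2⟩
  · exact a.p_mem hq

lemma P_p {a : BlowupIdx I m S} {q : M} (hq : q ∈ a.D₀) : a.P (a.p q) = q := by
  rcases a with φ | a
  · exact φ.1.symm_apply hq.1
  · exact a.P_p hq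

lemma p_P {a : BlowupIdx I m S} {z : ℝ₊^m} (hz : z ∈ a.W₀) : a.p (a.P z) = z := by
  rcases a with φ | a
  · exact φ.1.apply_symm hz.1
  · exact a.p_P hz

lemma P_mem_D₀ {a : BlowupIdx I m S} {z : ℝ₊^m} (hz : z ∈ a.W₀) : a.P z ∈ a.D₀ := by
  rcases a with φ | a
  · exact ⟨φ.1.symm_mem hz.1, hz.2⟩
  · exact a.P_mem_D₀ hz

lemma map_P_le {a : BlowupIdx I m S} {w : ℝ₊^m} (hw : w ∈ a.W) :
    Filter.map a.P (𝓝[a.W₀] w) ≤ 𝓝 (a.P w) :=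
  (a.contMDiffOn_P.continuousOn w hw).mono_left (nhdsWithin_mono _ a.W₀_subset)

lemma tendsto_p {a : BlowupIdx I m S} (w : ℝ₊^m) :
    Filter.Tendsto a.p (Filter.map a.P (𝓝[a.W₀] w)) (𝓝 w) := by
  rw [Filter.tendsto_map'_iff]
  refine (Filter.tendsto_id.mono_left nhdsWithin_le_nhds).congr' ?_
  filter_upwards [self_mem_nhdsWithin] with v hv using (p_P hv).symm

/-- Two projective charts have a smooth transition map at a pair of points over the centre which
are limits of common points: in the limit, the slopes in one chart are proportional, by a positive
factor, to the directions given by the polar coordinates in the other one. -/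
lemma exists_transition_proj {a b : ProjIdx I m S} {w w' : ℝ₊^m} (hw : w ∈ a.W)
    (hw' : w' ∈ b.W) (hb : a.P w = b.P w') (hwS : a.P w ∈ S)
    (hF : (Filter.map a.P (𝓝[a.W₀] w) ⊓ Filter.map b.P (𝓝[b.W₀] w')).NeBot) :
    ∃ (τ : ℝ₊^m → ℝ₊^m) (U : Set ℝ₊^m),
      IsOpen U ∧ w ∈ U ∧ ContMDiffOn (𝓠 m) (𝓠 m) ∞ τ U ∧ τ w = w' ∧
      ∀ v ∈ U, v ∈ a.W₀ → τ v ∈ b.W₀ ∧ b.P (τ v) = a.P v := by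
  obtain ⟨O, θ, L⟩ := a.exists_polarLift hw hwS b.adapted (by rw [hb]; exact b.P_mem hw')
  set F := Filter.map a.P (𝓝[a.W₀] w) ⊓ Filter.map b.P (𝓝[b.W₀] w') with hFdef
  have hpa : Filter.Tendsto a.p F (𝓝 w) :=
    (tendsto_p (a := (Sum.inr a : BlowupIdx I m S)) w).mono_left inf_le_left
  have hpb : Filter.Tendsto b.p F (𝓝 w') :=
    (tendsto_p (a := (Sum.inr b : BlowupIdx I m S)) w').mono_left inf_le_right
  have hOQ : IsOpen {z : ℝ₊^m | z.val ∈ O} := L.isOpen.preimage continuous_subtype_val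
  have hev : ∀ (a : ProjIdx I m S) w, ∀ᶠ q in Filter.map a.P (𝓝[a.W₀] w),
      a.p q ∈ a.W₀ ∧ a.P (a.p q) = q := fun a w => by
    rw [Filter.eventually_map]
    filter_upwards [self_mem_nhdsWithin] with v hv
    rw [a.p_P hv]; exact ⟨hv, rfl⟩
  have hea := (hev a w).filter_mono (inf_le_left : F ≤ _)
  have heb := (hev b w').filter_mono (inf_le_right : F ≤ _)
  have heO : ∀ᶠ q in F, (a.p q).val ∈ O := hpa.eventually (hOQ.mem_nhds L.mem)
  have hkey : ∀ᶠ q in F, 0 < b.σ * (θ (a.p q).val).2 b.i ∧ ∀ j ∈ b.A, (θ (a.p q).val).2 j =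
      b.σ * (θ (a.p q).val).2 b.i * projSlope b.c b.i b.σ (b.p q).val j := by
    filter_upwards [hea, heb, heO] with q ha hbq hO
    have h1 := L.eq_polarMap _ hO
    rw [ha.2] at h1
    have h2 := b.φ_P hbq.1.1
    rw [hbq.2, h1] at h2
    have hr := L.radius_pos _ hO ha.1.2
    have h3 : ∀ j ∈ b.A, (θ (a.p q).val).1 * (θ (a.p q).val).2 j =
        (b.p q).val b.i * projSlope b.c b.i b.σ (b.p q).val j := by
      intro j hj
      have := congrArg (fun x : ℝ^m => x j) h2
      simp only [projMap_mem hj, polarMap, hj, if_true] at this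
      exact add_left_cancel this
    have h4 := h3 b.i b.i_mem
    rw [projSlope_self] at h4
    have h5 : (θ (a.p q).val).1 * (b.σ * (θ (a.p q).val).2 b.i) = (b.p q).val b.i := by
      linear_combination b.σ * h4 + (b.p q).val b.i * sq_sign_eq_one b.sign
    refine ⟨?_, fun j hj => ?_⟩
    · refine pos_of_mul_pos_right (a := (θ (a.p q).val).1) ?_ hr.le
      rw [h5]; exact hbq.1.2
    · refine mul_left_cancel₀ hr.ne' ?_
      rw [h3 j hj, ← h5]; ring
  have hθ : Filter.Tendsto (fun q => θ (a.p q).val) F (𝓝 (θ w.val)) := 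
    (L.continuousOn.continuousAt (hOQ.mem_nhds L.mem)).tendsto.comp hpa
  have hθj : ∀ j, Filter.Tendsto (fun q => (θ (a.p q).val).2 j) F (𝓝 ((θ w.val).2 j)) := fun j =>
    (((continuous_coord j).comp continuous_snd).tendsto _).comp hθ
  have hslope : ∀ j ∈ b.A, Filter.Tendsto (fun q => projSlope b.c b.i b.σ (b.p q).val j) F
      (𝓝 (projSlope b.c b.i b.σ w'.val j)) := by
    intro j hj
    have h1 := (contDiffOn_projSlope (c := b.c) (i := b.i) (σ := b.σ) hj).continuousOn.continuousAt
      (isOpen_projPos.mem_nhds hw'.1.1)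
    exact h1.tendsto.comp ((continuous_subtype_val.tendsto _).comp hpb)
  have hlim : ∀ j ∈ b.A, (θ w.val).2 j =
      b.σ * (θ w.val).2 b.i * projSlope b.c b.i b.σ w'.val j := by
    intro j hj
    refine tendsto_nhds_unique_of_eventuallyEq (hθj j)
      (((hθj b.i).const_mul b.σ).mul (hslope j hj)) ?_
    filter_upwards [hkey] with q hq using hq.2 j hj
  have hpos : 0 < b.σ * (θ w.val).2 b.i := by
    have h0 : 0 ≤ b.σ * (θ w.val).2 b.i :=
      ge_of_tendsto ((hθj b.i).const_mul b.σ) (hkey.mono fun q hq => hq.1.le)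
    refine lt_of_le_of_ne h0 fun h => ?_
    obtain ⟨j, hj, hne⟩ := L.ne_zero
    exact hne (by rw [hlim j hj, ← h, zero_mul])
  obtain ⟨U, hU, hwU, hτ, hUO⟩ := L.exists_smooth hpos
  refine ⟨b.transition θ, U, hU, hwU, hτ, ?_, fun v hv hva => ?_⟩
  · have h1 : Filter.Tendsto (fun q => b.transition θ (a.p q)) F (𝓝 (b.transition θ w)) :=
      ((hτ.continuousOn.continuousAt (hU.mem_nhds hwU)).tendsto).comp hpa
    refine tendsto_nhds_unique_of_eventuallyEq h1 hpb ?_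
    filter_upwards [hea, hpa.eventually (hU.mem_nhds hwU)] with q ha hqU
    have h2 := L.transition_mem (hUO _ hqU).1 (hUO _ hqU).2
    rw [← b.p_P (h2.2.2 ha.1), h2.2.1, ha.2]
  · have h2 := L.transition_mem (hUO _ hv).1 (hUO _ hv).2
    exact ⟨h2.2.2 hva, h2.2.1⟩

/-- The gluing data of the blow-up of a closed set `S`. -/
noncomputable def gluing [T2Space M] (hS : IsClosed S) : GluingData (𝓠 m) (BlowupIdx I m S) M where
  W := W
  W₀ := W₀
  P := P
  p := p
  nonempty a := by
    rcases a with φ | a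
    · obtain ⟨q, hq⟩ := φ.2
      exact ⟨_, (p_mem (a := (Sum.inl φ : BlowupIdx I m S)) hq)⟩
    · exact a.nonempty_W
  isOpen_W := isOpen_W hS
  subset := W₀_subset
  dense a := by
    rcases a with φ | a
    · exact subset_closure
    · exact a.dense
  continuousOn_P a := a.contMDiffOn_P.continuousOn
  left_inv a w hw := p_P hw
  compat a b w hw w' hw' hF := by
    have hbase : a.P w = b.P w' := by
      have := hF
      refine tendsto_nhds_unique (f := id)
        (l := Filter.map a.P (𝓝[a.W₀] w) ⊓ Filter.map b.P (𝓝[b.W₀] w')) ?_ ?_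
      · exact inf_le_left.trans (map_P_le hw)
      · exact inf_le_right.trans (map_P_le hw')
    by_cases hwS : a.P w ∈ S
    · rcases a with φ | a
      · exact absurd hwS hw.2
      have hwS' : b.P w' ∈ S := by rw [← hbase]; exact hwS
      rcases b with φ | b
      · exact absurd hwS' hw'.2
      exact exists_transition_proj hw hw' hbase hwS hF
    · have hw0 : w' ∈ b.W₀ := (mem_W₀_iff hw').2 (by rw [← hbase]; exact hwS)
      have hsub : a.W ∩ a.P ⁻¹' b.D₀ ⊆ a.W := inter_subset_left
      refine ⟨b.p ∘ a.P, a.W ∩ a.P ⁻¹' b.D₀,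
        a.contMDiffOn_P.continuousOn.isOpen_inter_preimage (isOpen_W hS a) (isOpen_D₀ hS b),
        ⟨hw, ?_⟩, b.contMDiffOn_p.comp (a.contMDiffOn_P.mono hsub) fun z hz => hz.2, ?_, ?_⟩
      · show a.P w ∈ b.D₀
        rw [hbase]; exact P_mem_D₀ hw0
      · show b.p (a.P w) = w'
        rw [hbase, p_P hw0]
      · intro v hv _
        exact ⟨p_mem hv.2, P_p hv.2⟩

lemma exists_ne_of_notMem {S : Set M} {p : M} {φ : CornerChart I M m} {A : Finset (Fin m)}
    (had : IsAdaptedChart S p φ A) {q : M} (hq : q ∈ φ.source)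
    (hqS : q ∉ S) : ∃ j ∈ A, (φ q).val j ≠ (φ p).val j := by
  have h := hqS
  rw [had.2 q hq] at h
  push Not at h
  exact h

/-- A direction that points inward, with non-vanishing component, determines a projective chart. -/
lemma exists_projIdx {S : Set M} {p : M} {φ : CornerChart I M m} {A : Finset (Fin m)}
    (had : IsAdaptedChart S p φ A) (hp : p ∈ S) {v : ℝ^m} (hv : ∃ j ∈ A, v j ≠ 0)
    (hin : ∀ j ∈ A, (φ p).val j = 0 → 0 ≤ v j) :
    ∃ a : ProjIdx I m S, a.φ = φ ∧ a.A = A ∧ a.pt = p ∧ 0 < a.σ * v a.i := by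
  obtain ⟨j, hj, hne⟩ := hv
  rcases lt_or_gt_of_ne hne with h | h
  · exact ⟨⟨p, φ, A, j, -1, hp, had, hj, Or.inr rfl, fun hc => absurd (hin j hj hc) (not_le.2 h)⟩,
      rfl, rfl, rfl, by show 0 < -1 * v j; linarith⟩
  · exact ⟨⟨p, φ, A, j, 1, hp, had, hj, Or.inl rfl, fun _ => rfl⟩, rfl, rfl, rfl,
      by show 0 < 1 * v j; linarith⟩

lemma projOfPolar_mem_W {S : Set M} {a : ProjIdx I m S} {y : ℝ × ℝ^m}
    (hy : y ∈ polarDomain a.c a.A (Subtype.val '' a.φ.target)) (hpos : 0 < a.σ * y.2 a.i)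
    (hint : ∀ j ∈ a.A, a.c j ≠ 0 → 0 < polarMap a.c a.A y j) :
    projOfPolar[a] y ∈ quad m ∧ toQuad (projOfPolar[a] y) ∈ a.W := by
  obtain ⟨z, hz, hzy⟩ := hy.2.2.2
  have hq : projOfPolar[a] y ∈ quad m :=
    projOfPolar_mem_quad hpos hy.1 hy.2.2.1 (by rw [← hzy]; exact z.2)
  have hm := projMap_projOfPolar (c := a.c) a.sign a.i_mem hpos
  refine ⟨hq, ⟨?_, ?_⟩, ?_⟩
  · rw [toQuad_val hq]; exact projOfPolar_mem_projPos _
  · rw [toQuad_val hq, hm]; exact hint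
  · rw [ProjIdx.mapQ, toQuad_val hq, hm, ← hzy, val_toQuad]; exact hz

variable {S : Set M} [T2Space M] (hS : IsClosed S)

lemma gluing_pt (a : BlowupIdx I m S) (w : ℝ₊^m) :
    (gluing hS).pt a w = Filter.map a.P (𝓝[a.W₀] w) := rfl

/-- The gluing data of the blow-up along `S`. -/
local notation "𝒢" => gluing (I := I) (m := m) hS

/-- The projective chart with index `a`. -/
local notation:max "χ[" a "]" => GluingData.chart 𝒢 a

/-- Away from the exceptional divisor, points are represented by neighbourhood filters. -/
lemma gluing_pt_eq_nhds {a : BlowupIdx I m S} {w : ℝ₊^m} (hw : w ∈ a.W₀) :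
    (𝒢).pt a w = 𝓝 (a.P w) := by
  rw [gluing_pt]
  refine le_antisymm (map_P_le (a.W₀_subset hw)) ?_
  have hq := P_mem_D₀ hw
  have h1 : Filter.map a.p (𝓝 (a.P w)) ≤ 𝓝[a.W₀] w := by
    refine tendsto_nhdsWithin_iff.2 ⟨?_, ?_⟩
    · have := a.contMDiffOn_p.continuousOn.continuousAt ((isOpen_D₀ hS a).mem_nhds hq)
      rw [ContinuousAt, p_P hw] at this
      exact this
    · filter_upwards [(isOpen_D₀ hS a).mem_nhds hq] with q hq using p_mem hq
  refine le_trans (le_of_eq ?_) (Filter.map_mono h1)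
  rw [Filter.map_map]
  refine (Filter.map_id.symm.trans (Filter.map_congr ?_))
  filter_upwards [(isOpen_D₀ hS a).mem_nhds hq] with q hq using (P_p hq).symm

variable (I m) in
/-- The blow-up of `M` along the closed set `S`. -/
abbrev Space := (𝒢).Glued

variable (I m) in
/-- The blow-down map. -/
noncomputable abbrev down : Space I m hS → M := (𝒢).base

/-- The blow-down map, with the data fixed in this section. -/
local notation "β" => down I m hS

variable {hS}

lemma down_eq {a : BlowupIdx I m S} {w : ℝ₊^m} (hw : w ∈ a.W) {G : Space I m hS}
    (hG : G.1 = (𝒢).pt a w) : β G = a.P w := (𝒢).base_eq hw hG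

lemma toFilter_eq_nhds {G : Space I m hS} (hG : β G ∉ S) : G.1 = 𝓝 (β G) := by
  obtain ⟨a, w, hw, hGw⟩ := G.2
  rw [down_eq hw hGw] at hG ⊢
  rw [hGw]
  exact gluing_pt_eq_nhds hS ((mem_W₀_iff hw).2 hG)

lemma down_mem_source {a : BlowupIdx I m S} {G : Space I m hS}
    (hG : G ∈ χ[a].source) : β G = a.P (χ[a] G) := (𝒢).base_eq_chart hG

lemma chart_mem_W {a : BlowupIdx I m S} {G : Space I m hS} (hG : G ∈ χ[a].source) : χ[a] G ∈ a.W :=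
  χ[a].map_source hG

lemma mem_chart_source {a : BlowupIdx I m S} {G : Space I m hS} (hG : β G ∈ a.D₀)
    (hGS : β G ∉ S) : G ∈ χ[a].source := by
  refine ⟨a.p (β G), a.W₀_subset (p_mem hG), ?_⟩
  rw [toFilter_eq_nhds hGS, gluing_pt_eq_nhds hS (p_mem hG), P_p hG]

lemma contMDiff_down : ContMDiff (𝓠 m) I ∞ (β) := by
  intro G
  obtain ⟨a, hG⟩ := (𝒢).exists_mem_source G
  have h1 : ContMDiffOn (𝓠 m) I ∞ (fun G => a.P (χ[a] G)) χ[a].source :=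
    a.contMDiffOn_P.comp (contMDiffOn_of_mem_maximalAtlas ((𝒢).chart_mem_maximalAtlas a))
      fun G hG => chart_mem_W hG
  exact (h1.congr fun G hG => down_mem_source hG).contMDiffAt (χ[a].open_source.mem_nhds hG)

lemma bijOn_down (hM : ∀ q : M, ∃ φ : CornerChart I M m, q ∈ φ.source) :
    BijOn (β) (β ⁻¹' S)ᶜ Sᶜ := by
  refine ⟨fun G hG => hG, fun G hG G' hG' h => ?_, fun q hq => ?_⟩
  · apply GluingData.Glued.ext
    rw [toFilter_eq_nhds hG, toFilter_eq_nhds hG', h]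
  · obtain ⟨φ, hφ⟩ := hM q
    set a : BlowupIdx I m S := Sum.inl ⟨φ, q, hφ, hq⟩
    have hw : a.p q ∈ a.W₀ := p_mem (a := a) (q := q) ⟨hφ, hq⟩
    have h1 : β ((𝒢).point a (a.p q) (W₀_subset a hw)) = q := by
      rw [down_eq (a.W₀_subset hw) rfl]
      exact P_p (a := a) (q := q) ⟨hφ, hq⟩
    exact ⟨_, by show _ ∉ S; rwa [h1], h1⟩

/-- The chart of the blow-up, and its base coordinates, away from the exceptional divisor. -/
noncomputable def offCentre (a : BlowupIdx I m S) :
    PartialDiffeomorph (𝓠 m) I (Space I m hS) M ∞ where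
  toFun := β
  invFun q := χ[a].symm (a.p q)
  source := χ[a].source ∩ χ[a] ⁻¹' a.W₀
  target := a.D₀
  map_source' G hG := by rw [down_mem_source hG.1]; exact P_mem_D₀ hG.2
  map_target' q hq := by
    have h := a.W₀_subset (p_mem hq)
    refine ⟨χ[a].map_target h, ?_⟩
    show χ[a] _ ∈ a.W₀
    rw [χ[a].right_inv h]
    exact p_mem hq
  left_inv' G hG := by rw [down_mem_source hG.1, p_P hG.2, χ[a].left_inv hG.1]
  right_inv' q hq := by
    have h := a.W₀_subset (p_mem hq)
    rw [down_mem_source (χ[a].map_target h), χ[a].right_inv h, P_p hq]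
  open_source := χ[a].isOpen_inter_preimage (isOpen_W₀ hS a)
  open_target := isOpen_D₀ hS a
  contMDiffOn_toFun := contMDiff_down.contMDiffOn
  contMDiffOn_invFun := (contMDiffOn_symm_of_mem_maximalAtlas ((𝒢).chart_mem_maximalAtlas a)).comp
      a.contMDiffOn_p fun q hq => a.W₀_subset (p_mem hq)

lemma isLocalDiffeomorphOn_down : IsLocalDiffeomorphOn (𝓠 m) I ∞ (β) (β ⁻¹' S)ᶜ := by
  rintro ⟨G, hG⟩
  obtain ⟨a, hGa⟩ := (𝒢).exists_mem_source G
  refine ⟨offCentre a, ⟨hGa, ?_⟩, fun _ _ => rfl⟩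
  have h2 : β G ∉ S := hG
  rw [down_mem_source hGa] at h2
  exact (mem_W₀_iff (chart_mem_W hGa)).2 h2

section Polar

variable {p : M} {φ : CornerChart I M m} {A : Finset (Fin m)}

variable (φ A) in
/-- Polar coordinates on the blow-up, as limits of polar coordinates away from the centre. -/
noncomputable def polar (c : ℝ^m) (G : Space I m hS) : ℝ × ℝ^m :=
  Filter.limUnder G.1 fun q => normalPolar c A (φ q).val

/-- The domain of the polar coordinates over the chart `φ`. -/
local notation "𝒟" => polarDomain (Subtype.val (φ p)) A (Set.image Subtype.val φ.target)

lemma polar_eq {c : ℝ^m} {G : Space I m hS} {y : ℝ × ℝ^m}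
    (h : Filter.Tendsto (fun q => normalPolar c A (φ q).val) G.1 (𝓝 y)) : polar φ A c G = y := by
  obtain ⟨a, w, hw, hGw⟩ := G.2
  have : G.1.NeBot := by rw [hGw]; exact (𝒢).neBot_pt hw
  exact h.limUnder_eq

lemma polar_off (had : IsAdaptedChart S p φ A) {G : Space I m hS}
    (hG : β G ∈ φ.source) (hGS : β G ∉ S) :
    polar φ A (φ p).val G = normalPolar (φ p).val A (φ (β G)).val := by
  apply polar_eq
  rw [toFilter_eq_nhds hGS]
  have h1 := exists_ne_of_notMem had hG hGS
  have h2 : IsOpen {x : ℝ^m | 0 < ∑ j ∈ A, (x j - (φ p).val j) ^ 2} :=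
    isOpen_lt continuous_const (by fun_prop)
  exact ((contDiffOn_normalPolar.continuousOn.continuousAt
    (h2.mem_nhds (sum_sq_sub_pos h1))).tendsto).comp
    (φ.contMDiffOn_val.continuousOn.continuousAt (φ.open_source.mem_nhds hG)).tendsto

/-- The polar coordinates are the normalization of any smooth non-degenerate lift to polar
coordinates. -/
lemma polar_eq_normalize {b : ProjIdx I m S} {w : ℝ₊^m} {c : ℝ^m} {O : Set ℝ^m} {θ : ℝ^m → ℝ × ℝ^m}
    (L : b.PolarLift φ A c w O θ) {G : Space I m hS} (hG : G.1 = (𝒢).pt (Sum.inr b) w) :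
    polar φ A c G = polarNormalize A (θ w.val) := by
  apply polar_eq
  rw [hG, gluing_pt, Filter.tendsto_map'_iff]
  have hOQ : IsOpen {z : ℝ₊^m | z.val ∈ O} := L.isOpen.preimage continuous_subtype_val
  have hpos : 0 < ∑ j ∈ A, (θ w.val).2 j ^ 2 := by
    obtain ⟨j, hj, hne⟩ := L.ne_zero
    exact Finset.sum_pos' (fun j _ => sq_nonneg _) ⟨j, hj, by positivity⟩
  have h2 : IsOpen {y : ℝ × ℝ^m | 0 < ∑ j ∈ A, y.2 j ^ 2} :=
    isOpen_lt continuous_const (by fun_prop)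
  have h3 : Filter.Tendsto (fun z : ℝ₊^m => polarNormalize A (θ z.val)) (𝓝 w)
      (𝓝 (polarNormalize A (θ w.val))) :=
    (contDiffOn_polarNormalize.continuousOn.continuousAt (h2.mem_nhds hpos)).tendsto.comp
      (L.continuousOn.continuousAt (hOQ.mem_nhds L.mem)).tendsto
  refine (h3.mono_left nhdsWithin_le_nhds).congr' ?_
  filter_upwards [self_mem_nhdsWithin, mem_nhdsWithin_of_mem_nhds (hOQ.mem_nhds L.mem)] with z hz hzO
  have hz' : z ∈ b.W₀ := hz
  show _ = normalPolar c A (φ (b.P z)).val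
  rw [L.eq_polarMap z hzO, normalPolar_polarMap (L.radius_pos z hzO hz'.2)]

lemma polar_chart {a : ProjIdx I m S} {G : Space I m hS}
    (hG : G ∈ χ[Sum.inr a].source) : polar a.φ a.A a.c G = polarOfProj[a] (χ[Sum.inr a] G).val := by
  apply polar_eq
  have hw : χ[Sum.inr a] G ∈ a.W := chart_mem_W hG
  rw [(𝒢).val_eq_pt_chart hG, gluing_pt, Filter.tendsto_map'_iff]
  set w := χ[Sum.inr a] G
  have h3 : Filter.Tendsto (fun z : ℝ₊^m => polarOfProj[a] z.val) (𝓝 w)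
      (𝓝 (polarOfProj[a] w.val)) :=
    ((contDiffOn_polarOfProj a.sign a.i_mem).continuousOn.continuousAt
      (isOpen_projPos.mem_nhds hw.1.1)).tendsto.comp (continuous_subtype_val.tendsto _)
  refine (h3.mono_left nhdsWithin_le_nhds).congr' ?_
  filter_upwards [self_mem_nhdsWithin] with z hz
  have hz' : z ∈ a.W₀ := hz
  show _ = normalPolar a.c a.A (a.φ (a.P z)).val
  rw [a.φ_P hz'.1]
  exact (normalPolar_projMap (c := a.c) a.sign a.i_mem a.inward z.2 hz'.2).symm

/-- Over the centre, a point lies in the projective chart of a direction `±e_i` as soon as the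
component of its direction along `±e_i` is positive. -/
lemma mem_source_of_polar_pos {a : ProjIdx I m S} {G : Space I m hS}
    (hGφ : β G ∈ a.φ.source) (hGS : β G ∈ S) (hpos : 0 < a.σ * (polar a.φ a.A a.c G).2 a.i) :
    G ∈ χ[Sum.inr a].source := by
  obtain ⟨b | b, hGb⟩ := (𝒢).exists_mem_source G
  · rw [down_mem_source hGb] at hGS
    exact absurd hGS (chart_mem_W hGb).2
  have hw : χ[Sum.inr b] G ∈ b.W := chart_mem_W hGb
  have hGw := (𝒢).val_eq_pt_chart hGb
  rw [down_mem_source hGb] at hGS hGφ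
  set w := χ[Sum.inr b] G
  obtain ⟨O, θ, L⟩ := b.exists_polarLift hw hGS a.adapted hGφ
  change b.PolarLift a.φ a.A a.c w O θ at L
  rw [polar_eq_normalize L hGw] at hpos
  have hpos' : 0 < a.σ * (θ w.val).2 a.i := by
    simp only [polarNormalize, a.i_mem, if_true, ← mul_div_assoc] at hpos
    by_contra h
    exact absurd hpos (not_lt.2 (div_nonpos_of_nonpos_of_nonneg (not_lt.1 h) (Real.sqrt_nonneg _)))
  obtain ⟨U, hU, hwU, hτ, hUO⟩ := L.exists_smooth hpos'
  have hmem := L.transition_mem L.mem hpos'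
  have hle : (𝒢).pt (Sum.inr b) w ≤ (𝒢).pt (Sum.inr a) (a.transition θ w) :=
    (𝒢).pt_le_pt hU hτ.continuousOn (fun v hv hvb => by
      have h2 := L.transition_mem (hUO v hv).1 (hUO v hv).2
      exact ⟨h2.2.2 hvb, h2.2.1⟩) hwU
  refine ⟨a.transition θ w, hmem.1, ?_⟩
  rw [hGw]
  refine (𝒢).pt_eq_of_neBot (a := Sum.inr b) (b := Sum.inr a) hw hmem.1 ?_
  rw [inf_eq_left.2 hle]
  exact (𝒢).neBot_pt (a := Sum.inr b) hw

lemma exists_mem_source_proj (had : IsAdaptedChart S p φ A) (hp : p ∈ S) {G : Space I m hS}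
    (hGφ : β G ∈ φ.source) (hGS : β G ∈ S) : ∃ a : ProjIdx I m S, a.φ = φ ∧ a.A = A ∧ a.pt = p ∧
      G ∈ χ[Sum.inr a].source := by
  obtain ⟨b | b, hGb⟩ := (𝒢).exists_mem_source G
  · rw [down_mem_source hGb] at hGS
    exact absurd hGS (chart_mem_W hGb).2
  have hw : χ[Sum.inr b] G ∈ b.W := chart_mem_W hGb
  have hGw := (𝒢).val_eq_pt_chart hGb
  have hsrc := hGφ
  have hctr := hGS
  rw [down_mem_source hGb] at hGS hGφ
  set w := χ[Sum.inr b] G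
  obtain ⟨O, θ, L⟩ := b.exists_polarLift hw hGS had hGφ
  obtain ⟨j, hj, hne⟩ := L.ne_zero
  have hsq : 0 < √(∑ j ∈ A, (θ w.val).2 j ^ 2) :=
    Real.sqrt_pos.2 (Finset.sum_pos' (fun j _ => sq_nonneg _) ⟨j, hj, by positivity⟩)
  have hpol : ∀ j ∈ A, (polar φ A (φ p).val G).2 j = (θ w.val).2 j / √(∑ j ∈ A, (θ w.val).2 j ^ 2) :=
    fun j hj => by rw [polar_eq_normalize L hGw]; simp only [polarNormalize, hj, if_true]
  obtain ⟨a, rfl, rfl, rfl, h⟩ := exists_projIdx had hp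
    ⟨j, hj, by rw [hpol j hj]; exact div_ne_zero hne hsq.ne'⟩
    fun j hj hc => by rw [hpol j hj]; exact div_nonneg (L.inward w L.mem j hj hc) hsq.le
  exact ⟨a, rfl, rfl, rfl, mem_source_of_polar_pos hsrc hctr h⟩

lemma polar_spec (had : IsAdaptedChart S p φ A) (hp : p ∈ S) {G : Space I m hS}
    (hGφ : β G ∈ φ.source) : polar φ A (φ p).val G ∈ 𝒟 ∧
      (φ (β G)).val = polarMap (φ p).val A (polar φ A (φ p).val G) := by
  have hV : (φ (β G)).val ∈ Subtype.val '' φ.target := ⟨_, φ.map_source hGφ, rfl⟩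
  by_cases hGS : β G ∈ S
  · obtain ⟨a, rfl, rfl, rfl, hGa⟩ := exists_mem_source_proj had hp hGφ hGS
    have hw : χ[Sum.inr a] G ∈ a.W := chart_mem_W hGa
    have h1 := polar_chart hGa
    change polar a.φ a.A (a.φ a.pt).val G = _ at h1
    have h2 : (a.φ (β G)).val = projMap[a]
        (χ[Sum.inr a] G).val := by rw [down_mem_source hGa]; exact a.φ_P hw
    rw [h1]
    refine ⟨polarOfProj_mem a.sign a.i_mem a.inward (Subtype.prop _) ?_, ?_⟩
    · rwa [h2] at hV
    · rw [h2]; exact (polarMap_polarOfProj a.sign a.i_mem _).symm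
  · rw [polar_off had hGφ hGS]
    have h := exists_ne_of_notMem had hGφ hGS
    exact ⟨normalPolar_mem h (Subtype.prop _) hV, (polarMap_normalPolar h).symm⟩

lemma injOn_polar (had : IsAdaptedChart S p φ A) (hp : p ∈ S)
    (hM : ∀ q : M, ∃ φ : CornerChart I M m, q ∈ φ.source) :
    InjOn (polar φ A (φ p).val) (β ⁻¹' φ.source) := by
  intro G hG G' hG' h
  have h1 : β G = β G' := by
    apply φ.injOn hG hG'
    apply Subtype.ext
    rw [(polar_spec had hp hG).2, (polar_spec had hp hG').2, h]
  by_cases hGS : β G ∈ S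
  · obtain ⟨a, rfl, rfl, rfl, hGa⟩ := exists_mem_source_proj had hp hG hGS
    change polar a.φ a.A a.c G = polar a.φ a.A a.c G' at h
    have hw : χ[Sum.inr a] G ∈ a.W := chart_mem_W hGa
    have hpos : 0 < a.σ * (polar a.φ a.A a.c G).2 a.i := by
      rw [polar_chart hGa, sign_mul_polarOfProj a.sign a.i_mem]
      exact inv_pos.2 (projNorm_pos a.sign a.i_mem _)
    have hGa' := mem_source_of_polar_pos hG' (h1 ▸ hGS) (h ▸ hpos)
    have hw' : χ[Sum.inr a] G' ∈ a.W := chart_mem_W hGa'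
    rw [polar_chart hGa, polar_chart hGa'] at h
    apply χ[Sum.inr a].injOn hGa hGa'
    apply Subtype.ext
    rw [← projOfPolar_polarOfProj a.sign a.i_mem hw.1.1, h,
      projOfPolar_polarOfProj a.sign a.i_mem hw'.1.1]
  · exact (bijOn_down hM).injOn hGS (by show _ ∉ S; rwa [← h1]) h1

lemma polar_symm {a : ProjIdx I m S} {y : ℝ × ℝ^m}
    (hy : y ∈ polarDomain a.c a.A (Subtype.val '' a.φ.target)) (hpos : 0 < a.σ * y.2 a.i)
    (hint : ∀ j ∈ a.A, a.c j ≠ 0 → 0 < polarMap a.c a.A y j) :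
    χ[Sum.inr a].symm (toQuad (projOfPolar[a] y)) ∈
        β ⁻¹' a.φ.source ∧ polar a.φ a.A a.c (χ[Sum.inr a].symm
        (toQuad (projOfPolar[a] y))) = y := by
  obtain ⟨hq, hW⟩ := projOfPolar_mem_W hy hpos hint
  have hs := χ[Sum.inr a].map_target (show _ ∈ χ[Sum.inr a].target from hW)
  refine ⟨?_, ?_⟩
  · rw [mem_preimage, down_mem_source hs]
    exact a.P_mem (chart_mem_W hs)
  · rw [polar_chart hs, χ[Sum.inr a].right_inv
      (show _ ∈ χ[Sum.inr a].target from hW), toQuad_val hq,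
      polarOfProj_projOfPolar a.sign a.i_mem hpos hy.2.1]

lemma surjOn_polar (had : IsAdaptedChart S p φ A) (hp : p ∈ S)
    (hM : ∀ q : M, ∃ φ : CornerChart I M m, q ∈ φ.source) :
    SurjOn (polar φ A (φ p).val) (β ⁻¹' φ.source)
      𝒟 := by
  intro y hy
  obtain ⟨z, hz, hzy⟩ := hy.2.2.2
  rcases hy.1.eq_or_lt with h0 | h0
  · obtain ⟨a, rfl, rfl, rfl, hpos⟩ := exists_projIdx had hp (exists_ne_zero_of_sum_sq hy.2.1) hy.2.2.1
    have hint : ∀ j ∈ a.A, a.c j ≠ 0 → 0 < polarMap a.c a.A y j := by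
      intro j hj hc
      simp only [polarMap, hj, if_true, ← h0, zero_mul, add_zero]
      exact lt_of_le_of_ne (a.c_nonneg j) (Ne.symm hc)
    have := polar_symm (hS := hS) (a := a) hy hpos hint
    exact ⟨_, this.1, this.2⟩
  · have hqφ := φ.symm_mem hz
    have hφq : (φ (φ.symm z)).val = polarMap (φ p).val A y := by rw [φ.apply_symm hz, hzy]
    have hqS : φ.symm z ∉ S := by
      rw [had.2 _ hqφ]
      intro h
      obtain ⟨j, hj, hne⟩ := exists_ne_zero_of_sum_sq hy.2.1
      have h1 : (φ (φ.symm z)).val j = (φ p).val j := h j hj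
      rw [hφq] at h1
      simp only [polarMap, hj, if_true, add_eq_left, mul_eq_zero] at h1
      exact h1.elim h0.ne' hne
    obtain ⟨G, hG, hGq⟩ := (bijOn_down (hS := hS) hM).surjOn hqS
    refine ⟨G, by rw [mem_preimage, hGq]; exact hqφ, ?_⟩
    rw [polar_off had (by rw [hGq]; exact hqφ) hG, hGq, hφq, normalPolar_polarMap h0,
      polarNormalize_eq hy.2.1]

lemma contMDiffOn_polar (had : IsAdaptedChart S p φ A) (hp : p ∈ S) :
    ContMDiffOn (𝓠 m) 𝓘(ℝ, ℝ × ℝ^m) ∞ (polar (hS := hS) φ A (φ p).val) (β ⁻¹' φ.source) := by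
  intro G hG
  refine ContMDiffAt.contMDiffWithinAt ?_
  by_cases hGS : β G ∈ S
  · obtain ⟨a, rfl, rfl, rfl, hGa⟩ := exists_mem_source_proj had hp hG hGS
    have h1 : ContMDiffOn (𝓠 m) 𝓘(ℝ, ℝ × ℝ^m) ∞ (fun G => polarOfProj[a] (χ[Sum.inr a] G).val)
        χ[Sum.inr a].source := (contDiffOn_polarOfProj a.sign a.i_mem).contMDiffOn.comp
        ((contMDiff_quadrant_val m).comp_contMDiffOn
          (contMDiffOn_of_mem_maximalAtlas ((𝒢).chart_mem_maximalAtlas (Sum.inr a))))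
        fun G hG => (chart_mem_W hG).1.1
    exact (h1.congr fun G hG => polar_chart hG).contMDiffAt (χ[Sum.inr a].open_source.mem_nhds hGa)
  · have hopen : IsOpen (β ⁻¹' (φ.source \ S)) :=
      (φ.open_source.sdiff hS).preimage contMDiff_down.continuous
    have h1 : ContMDiffOn (𝓠 m) 𝓘(ℝ, ℝ × ℝ^m) ∞ (fun G => normalPolar (φ p).val A (φ (β G)).val)
        (β ⁻¹' (φ.source \ S)) := contDiffOn_normalPolar.contMDiffOn.comp
        ((φ.contMDiffOn_val).comp contMDiff_down.contMDiffOn fun G hG => hG.1)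
        fun G hG => sum_sq_sub_pos (exists_ne_of_notMem had hG.1 hG.2)
    exact (h1.congr fun G hG => polar_off had hG.1 hG.2).contMDiffAt (hopen.mem_nhds ⟨hG, hGS⟩)

lemma contMDiffOn_of_polar_rightInv (had : IsAdaptedChart S p φ A) (hp : p ∈ S)
    (hM : ∀ q : M, ∃ φ : CornerChart I M m, q ∈ φ.source) {Θ : ℝ × ℝ^m → Space I m hS}
    (hΘm : MapsTo Θ 𝒟 (β ⁻¹' φ.source)) (hΘ : ∀ y ∈ 𝒟, polar φ A (φ p).val (Θ y) = y) :
    ContMDiffOn 𝓘(ℝ, ℝ × ℝ^m) (𝓠 m) ∞ Θ 𝒟 := by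
  have hpmd : ContDiff ℝ ∞ (polarMap (φ p).val A) := by
    rw [contDiff_euclidean]
    intro j
    have hc : ContDiff ℝ ∞ fun w : ℝ × ℝ^m => w.2 j := (contDiff_coord j).comp contDiff_snd
    by_cases hj : j ∈ A
    · simp only [polarMap, hj, if_true]; exact contDiff_const.add (contDiff_fst.mul hc)
    · simp only [polarMap, hj, if_false]; exact hc
  intro y hy
  by_cases hyS : β (Θ y) ∈ S
  · obtain ⟨a, rfl, rfl, rfl, hpos⟩ := exists_projIdx had hp (exists_ne_zero_of_sum_sq hy.2.1) hy.2.2.1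
    set N : Set (ℝ × ℝ^m) := {y | 0 < a.σ * y.2 a.i} ∩
      ⋂ j ∈ a.A, {y | a.c j ≠ 0 → 0 < polarMap a.c a.A y j} with hN
    have hNo : IsOpen N := (isOpen_lt continuous_const (by fun_prop)).inter
      (isOpen_forall_imp_pos _ fun j => (continuous_coord j).comp hpmd.continuous)
    have hyN : y ∈ N := by
      refine ⟨hpos, ?_⟩
      simp only [mem_iInter]
      intro j hj hc
      have h1 := (polar_spec had hp (hΘm hy)).2
      rw [hΘ y hy] at h1
      change 0 < polarMap (a.φ a.pt).val a.A y j
      rw [← h1]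
      have h2 : (a.φ (β (Θ y))).val j = a.c j := (had.2 _ (hΘm hy)).1 hyS j hj
      rw [h2]
      exact lt_of_le_of_ne (a.c_nonneg j) (Ne.symm hc)
    have hint : ∀ y ∈ N, ∀ j ∈ a.A, a.c j ≠ 0 → 0 < polarMap a.c a.A y j := by
      intro y hy
      simpa only [mem_iInter, mem_ofPred_eq] using hy.2
    have h1 : ContMDiffOn 𝓘(ℝ, ℝ × ℝ^m) (𝓠 m) ∞
        (fun y => χ[Sum.inr a].symm (toQuad (projOfPolar[a] y)))
        (polarDomain a.c a.A (Subtype.val '' a.φ.target) ∩ N) := by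
      refine (contMDiffOn_symm_of_mem_maximalAtlas
        ((𝒢).chart_mem_maximalAtlas (Sum.inr a))).comp ((contMDiffOn_toQuad m).comp
        (contDiffOn_projOfPolar.contMDiffOn.mono fun y hy => hy.2.1) fun y hy => ?_) fun y hy => ?_
      · exact (projOfPolar_mem_W hy.1 hy.2.1 (hint y hy.2)).1
      · exact (projOfPolar_mem_W hy.1 hy.2.1 (hint y hy.2)).2
    refine ContMDiffWithinAt.mono_of_mem_nhdsWithin ((h1.congr fun y hy => ?_) y ⟨hy, hyN⟩)
      (Filter.inter_mem self_mem_nhdsWithin (mem_nhdsWithin_of_mem_nhds (hNo.mem_nhds hyN)))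
    have h2 := polar_symm (hS := hS) hy.1 hy.2.1 (hint y hy.2)
    exact injOn_polar had hp hM (hΘm hy.1) h2.1 ((hΘ y hy.1).trans h2.2.symm)
  · obtain ⟨b, hb⟩ := (𝒢).exists_mem_source (Θ y)
    set ζ : ℝ × ℝ^m → M := fun y => φ.symm (toQuad (polarMap (φ p).val A y))
    set Ψ := offCentre (hS := hS) b
    have hbs : Θ y ∈ Ψ.source := by
      refine ⟨hb, (mem_W₀_iff (chart_mem_W hb)).2 ?_⟩
      rwa [← down_mem_source hb]
    -- near `y`, the inverse is the inverse of the blow-down map off the centre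
    have hdown : ∀ y ∈ 𝒟, β (Θ y) = ζ y := by
      intro y hy
      show _ = φ.symm (toQuad (polarMap (φ p).val A y))
      rw [← hΘ y hy, ← (polar_spec had hp (hΘm hy)).2, hΘ y hy, val_toQuad, φ.symm_apply (hΘm hy)]
    have hsm : ContMDiffOn 𝓘(ℝ, ℝ × ℝ^m) I ∞ ζ 𝒟 :=
      φ.contMDiffOn_symm_toQuad.comp hpmd.contMDiff.contMDiffOn fun y hy => hy.2.2.2
    have htar : ζ y ∈ Ψ.target := by rw [← hdown y hy]; exact Ψ.map_source hbs
    have hev := (hsm y hy).continuousWithinAt.preimage_mem_nhdsWithin (Ψ.open_target.mem_nhds htar)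
    have h1 : ContMDiffWithinAt 𝓘(ℝ, ℝ × ℝ^m) (𝓠 m) ∞ (fun y => Ψ.symm (ζ y)) 𝒟 y :=
      (Ψ.contMDiffOn_invFun.contMDiffAt (Ψ.open_target.mem_nhds htar)).comp_contMDiffWithinAt y (hsm y hy)
    refine h1.congr_of_eventuallyEq_of_mem ?_ hy
    filter_upwards [hev, self_mem_nhdsWithin] with y' hy' hy'd
    have h2 : Ψ.symm (ζ y') ∈ Ψ.source := Ψ.map_target hy'
    have h3 : β (Ψ.symm (ζ y')) = ζ y' := Ψ.right_inv hy'
    have h4 : β (Ψ.symm (ζ y')) ∉ S := by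
      rw [down_mem_source h2.1]
      exact (mem_W₀_iff (chart_mem_W h2.1)).1 h2.2
    refine (bijOn_down hM).injOn ?_ h4 ?_
    · show β (Θ y') ∉ S
      rw [hdown y' hy'd, ← h3]; exact h4
    · rw [h3, hdown y' hy'd]

end Polar

lemma isBlowup_down (hpS : IsPSubmanifold I m S)
    (hM : ∀ q : M, ∃ φ : CornerChart I M m, q ∈ φ.source) (hne : S.Nonempty → Sᶜ.Nonempty) :
    IsBlowup (m := m) I S (β) where
  isPSubmanifold := hpS
  contMDiff := contMDiff_down
  bijOn := bijOn_down hM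
  isLocalDiffeomorphOn := isLocalDiffeomorphOn_down
  polar p hp φ A had := by
    obtain ⟨q, hq⟩ := hne ⟨p, hp⟩
    obtain ⟨G, -⟩ := (bijOn_down (hS := hS) hM).surjOn hq
    have : Nonempty (Space I m hS) := ⟨G⟩
    have hbij : BijOn (polar (hS := hS) φ A (φ p).val) (β ⁻¹' φ.source)
        (polarDomain (φ p).val A (Subtype.val '' φ.target)) :=
      ⟨fun G hG => (polar_spec had hp hG).1, injOn_polar had hp hM, surjOn_polar had hp hM⟩
    refine ⟨polar φ A (φ p).val, Function.invFunOn (polar φ A (φ p).val)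
      (β ⁻¹' φ.source), ⟨contMDiffOn_polar had hp, ?_, hbij.mapsTo,
      hbij.surjOn.mapsTo_invFunOn, hbij.invOn_invFunOn⟩, fun G hG => (polar_spec had hp hG).2⟩
    exact contMDiffOn_of_polar_rightInv had hp hM hbij.surjOn.mapsTo_invFunOn hbij.invOn_invFunOn.2

lemma secondCountableTopology_space [SecondCountableTopology M] (hpS : IsPSubmanifold I m S)
    (hM : ∀ q : M, ∃ φ : CornerChart I M m, q ∈ φ.source) :
    SecondCountableTopology (Space I m hS) := by
  have hch : ∀ q : M, ∃ (φ : CornerChart I M m) (A : Finset (Fin m)), q ∈ φ.source ∧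
      (q ∈ S → IsAdaptedChart S q φ A) := by
    intro q
    by_cases hq : q ∈ S
    · obtain ⟨φ, A, h⟩ := hpS.2 q hq
      exact ⟨φ, A, h.1, fun _ => h⟩
    · obtain ⟨φ, h⟩ := hM q
      exact ⟨φ, ∅, h, fun h => absurd h hq⟩
  choose φ A hφ had using hch
  classical
  obtain ⟨T, hT, hcov⟩ := TopologicalSpace.countable_cover_nhds
    (f := fun q => if q ∈ S then (φ q).source else (φ q).source \ S) (fun q => by
      by_cases hq : q ∈ S
      · simp only [hq, if_true]; exact (φ q).open_source.mem_nhds (hφ q)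
      · simp only [hq, if_false]; exact ((φ q).open_source.sdiff hS).mem_nhds ⟨hφ q, hq⟩)
  refine (𝒢).secondCountableTopology
    (s := ⋃ q ∈ T, ((⋃ h : ((φ q).source \ S).Nonempty, {Sum.inl ⟨φ q, h⟩}) ∪
      ⋃ hq : q ∈ S, ⋃ i : Fin m, ⋃ hi : i ∈ A q, ⋃ b : Bool,
        ⋃ hσ : ((φ q q).val i = 0 → (if b then (1 : ℝ) else -1) = 1),
        {Sum.inr ⟨q, φ q, A q, i, if b then 1 else -1, hq, had q hq, hi,
          by cases b <;> simp, hσ⟩})) ?_ ?_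
  · refine hT.biUnion fun q _ => Countable.union ?_ ?_
    · exact countable_iUnion fun _ => countable_singleton _
    · refine countable_iUnion fun _ => countable_iUnion fun _ => countable_iUnion fun _ =>
        countable_iUnion fun _ => countable_iUnion fun _ => countable_singleton _
  · intro G
    have hG := hcov.symm.subset (mem_univ (β G))
    obtain ⟨q, hq, hGq⟩ := mem_iUnion₂.1 hG
    have hGφ : β G ∈ (φ q).source := by
      by_cases h : q ∈ S
      · simpa [h] using hGq
      · simp only [h, if_false] at hGq; exact hGq.1
    by_cases hGS : β G ∈ S
    · have hqS : q ∈ S := by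
        by_contra h
        simp only [h, if_false] at hGq
        exact hGq.2 hGS
      obtain ⟨a, h1, h2, h3, hGa⟩ := exists_mem_source_proj (had q hqS) hqS hGφ hGS
      refine ⟨Sum.inr a, mem_iUnion₂.2 ⟨q, hq, Or.inr ?_⟩, hGa⟩
      obtain ⟨pt, φ', A', i, σ, h4, h5, h6, h7, h8⟩ := a
      dsimp only at h1 h2 h3
      subst h3
      subst h1
      subst h2
      simp only [mem_iUnion]
      rcases h7 with rfl | rfl
      · exact ⟨hqS, i, h6, true, fun _ => by simp, by simp⟩
      · refine ⟨hqS, i, h6, false, fun h => by simpa using h8 h, by simp⟩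
    · refine ⟨Sum.inl ⟨φ q, _, hGφ, hGS⟩, mem_iUnion₂.2 ⟨q, hq, Or.inl ?_⟩,
        mem_chart_source ⟨hGφ, hGS⟩ hGS⟩
      simp only [mem_iUnion]
      exact ⟨⟨_, hGφ, hGS⟩, rfl⟩

end BlowupIdx

/-- Blow-ups of p-submanifolds exist. -/
theorem nonempty_blowup [T2Space M] [SecondCountableTopology M] {S : Set M}
    (hS : IsPSubmanifold I m S) (hM : ∀ q : M, ∃ φ : CornerChart I M m, q ∈ φ.source)
    (hne : S.Nonempty → Sᶜ.Nonempty) : Nonempty (Blowup I m S) := by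
  have := BlowupIdx.secondCountableTopology_space (hS := hS.1) hS hM
  exact ⟨⟨⟨BlowupIdx.Space I m hS.1⟩, BlowupIdx.down I m hS.1, BlowupIdx.isBlowup_down hS hM hne⟩⟩

end Existence

/-! ### Charts and lifts on an arbitrary blow-up -/

section Lifts

variable {E : Type*} [NormedAddCommGroup E] [NormedSpace ℝ E] {H : Type*} [TopologicalSpace H]
  {I : ModelWithCorners ℝ E H} {M : Type u} [TopologicalSpace M] [ChartedSpace H M] {m : ℕ}

lemma CornerChart.mem_of_mem_closure {ψ : CornerChart I M m} {s : Set M}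
    {C : Set ℝ^m} (hC : IsClosed C)
    (h : ∀ y ∈ ψ.source, y ∈ s → (ψ y).val ∈ C) {x : M} (hx : x ∈ ψ.source)
    (hxs : x ∈ closure s) : (ψ x).val ∈ C := by
  by_contra hn
  obtain ⟨y, ⟨hy, hyC⟩, hys⟩ := mem_closure_iff.1 hxs _
    (ψ.contMDiffOn_val.continuousOn.isOpen_inter_preimage ψ.open_source hC.isOpen_compl) ⟨hx, hn⟩
  exact hyC (h y hy hys)

lemma CornerChart.mem_closure_of {ψ : CornerChart I M m} {s : Set M} (L : Finset (Fin m))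
    {x : M} (hx : x ∈ ψ.source) (h : ∀ y ∈ ψ.source, (∀ l ∈ L, 0 < ψ.coord l y) →
      (∀ j ∉ L, ψ.coord j y = ψ.coord j x) → y ∈ s) : x ∈ closure s := by
  have h1 := EuclideanQuadrant.mem_closure_pos ψ.open_target L (ψ.map_source hx)
  have hc : ContinuousAt ψ.symm (ψ x) :=
    ψ.contMDiffOn_invFun.continuousOn.continuousAt (ψ.open_target.mem_nhds (ψ.map_source hx))
  have h2 := hc.continuousWithinAt.mem_closure_image h1
  rw [ψ.symm_apply hx] at h2
  refine closure_mono ?_ h2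
  rintro _ ⟨z, ⟨hz, hz1, hz2⟩, rfl⟩
  have hzc : ∀ j, ψ.coord j (ψ.symm z) = z.val j := fun j => by rw [← ψ.val_apply, ψ.apply_symm hz]
  refine h _ (ψ.symm_mem hz) (fun l hl => ?_) fun j hj => ?_
  · rw [hzc]; exact hz1 l hl
  · rw [hzc]; exact hz2 j hj

/-- In a chart where `s` is the part with some positive coordinates of a closed set that does not
depend on these coordinates, the closure of `s` is this closed set. -/
lemma CornerChart.mem_closure_iff {ψ : CornerChart I M m} {s : Set M} (L : Finset (Fin m))
    {C : Set ℝ^m} (hC : IsClosed C) (hind : ∀ z z' : ℝ^m, (∀ j ∉ L, z' j = z j) → z ∈ C → z' ∈ C)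
    (h : ∀ y ∈ ψ.source, y ∈ s ↔ (∀ l ∈ L, 0 < ψ.coord l y) ∧ (ψ y).val ∈ C)
    {x : M} (hx : x ∈ ψ.source) : x ∈ closure s ↔ (ψ x).val ∈ C := by
  refine ⟨CornerChart.mem_of_mem_closure hC (fun y hy hys => ((h y hy).1 hys).2) hx, fun hxC => ?_⟩
  exact CornerChart.mem_closure_of L hx fun y hy h1 h2 => (h y hy).2 ⟨h1, hind _ _ h2 hxC⟩

lemma IsAdaptedChart.compl_nonempty {S : Set M} {p : M} {φ : CornerChart I M m}
    {A : Finset (Fin m)} (had : IsAdaptedChart S p φ A) {i : Fin m} (hi : i ∈ A)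
    (h0 : φ.coord i p = 0) : Sᶜ.Nonempty := by
  by_contra hne
  have hS : S = univ := by rwa [not_nonempty_iff_eq_empty, compl_empty_iff] at hne
  have h1 : p ∈ closure {q | q ∈ φ.source ∧ 0 < φ.coord i q} :=
    CornerChart.mem_closure_of {i} had.1 fun y hy h1 _ => ⟨hy, h1 i (by simp)⟩
  obtain ⟨q, hq, hq0⟩ := closure_nonempty_iff.1 ⟨p, h1⟩
  have := (had.2 q hq).1 (hS ▸ mem_univ q) i hi
  rw [h0] at this
  exact hq0.ne' this

lemma exists_cornerChart {M : Type*} [TopologicalSpace M] [ChartedSpace ℝ₊^m M]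
    [IsManifold (𝓠 m) ∞ M] (q : M) : ∃ φ : 𝓒[m] M, q ∈ φ.source :=
  ⟨{ toPartialEquiv := (chartAt ℝ₊^m q).toPartialEquiv
     open_source := (chartAt ℝ₊^m q).open_source
     open_target := (chartAt ℝ₊^m q).open_target
     contMDiffOn_toFun := contMDiffOn_chart
     contMDiffOn_invFun := contMDiffOn_chart_symm }, mem_chart_source _ q⟩

lemma CornerChart.exists_ofMaps {M : Type*} [TopologicalSpace M] [ChartedSpace H M]
    (U : Set M) (hU : IsOpen U) (O : Set ℝ^m) (hO : IsOpen O) (f : M → ℝ^m) (g : ℝ^m → M)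
    (hf : ContMDiffOn I 𝓘(ℝ, ℝ^m) ∞ f U) (hg : ContMDiffOn 𝓘(ℝ, ℝ^m) I ∞ g (quad m ∩ O))
    (hfm : MapsTo f U (quad m ∩ O)) (hgm : MapsTo g (quad m ∩ O) U)
    (hgf : ∀ q ∈ U, g (f q) = q) (hfg : ∀ z ∈ quad m ∩ O, f (g z) = z) :
    ∃ ψ : CornerChart I M m, ψ.source = U ∧ ψ.target = Subtype.val ⁻¹' O ∧
      ∀ q ∈ U, (ψ q).val = f q := ⟨CornerChart.ofMaps U hU O hO f g hf hg hfm hgm hgf hfg, rfl, rfl,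
    fun _ hq => CornerChart.ofMaps_val hq⟩

namespace Blowup

variable {S : Set M} (B : Blowup I m S)

lemma isClosed (B : Blowup I m S) : IsClosed S := B.isBlowup.isPSubmanifold.1

lemma continuous_down : Continuous B.down := B.isBlowup.contMDiff.continuous

/-- A chart away from the centre, as a chart of the blow-up. -/
lemma exists_offCentreChart (φ : CornerChart I M m) {q : B.total} (hq : B.down q ∈ φ.source)
    (hqS : B.down q ∉ S) : ∃ ψ : 𝓒[m] B.total, q ∈ ψ.source ∧
      ∀ x ∈ ψ.source, B.down x ∈ φ.source ∧ B.down x ∉ S ∧ ψ x = φ (B.down x) := by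
  obtain ⟨Φ, hqΦ, hΦ⟩ := B.isBlowup.isLocalDiffeomorphOn ⟨q, hqS⟩
  refine ⟨CornerChart.restrOpen (Φ.trans φ) (B.down ⁻¹' Sᶜ)
    (B.isClosed.isOpen_compl.preimage B.continuous_down), ⟨⟨hqΦ, ?_⟩, hqS⟩, ?_⟩
  · show Φ q ∈ φ.source
    rw [← hΦ hqΦ]; exact hq
  · rintro x ⟨⟨hx1, hx2⟩, hx3⟩
    have hx2' : Φ x ∈ φ.source := hx2
    rw [← hΦ hx1] at hx2'
    refine ⟨hx2', hx3, ?_⟩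
    show φ (Φ x) = _
    rw [← hΦ hx1]

/-- The lift of a closure does not require taking closures twice. -/
lemma lift_closure (T : Set M) : B.lift (closure T) = closure (B.down ⁻¹' (T \ S)) := by
  refine subset_antisymm (closure_minimal ?_ isClosed_closure)
    (closure_mono (preimage_mono (sdiff_subset_sdiff_left subset_closure)))
  rintro x ⟨hxT, hxS⟩
  obtain ⟨Φ, hxΦ, hΦ⟩ := B.isBlowup.isLocalDiffeomorphOn ⟨x, hxS⟩
  rw [mem_closure_iff]
  intro U hU hxU
  have hS : IsOpen (B.down ⁻¹' Sᶜ) := B.isClosed.isOpen_compl.preimage B.continuous_down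
  have hV : IsOpen (Φ '' (Φ.source ∩ (U ∩ B.down ⁻¹' Sᶜ))) :=
    Φ.toOpenPartialHomeomorph.isOpen_image_source_inter (hU.inter hS)
  obtain ⟨y, ⟨w, ⟨hw1, hw2, hw3⟩, rfl⟩, hyT⟩ := mem_closure_iff.1 hxT _ hV
    ⟨x, ⟨hxΦ, hxU, hxS⟩, (hΦ hxΦ).symm⟩
  rw [← hΦ hw1] at hyT
  exact ⟨w, hw2, hyT, hw3⟩

/-- Polar coordinates give projective charts, with known target. -/
lemma exists_chart_of_polar (a : ProjIdx I m S) {Ψ : B.total → ℝ × ℝ^m} {Θ : ℝ × ℝ^m → B.total}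
    (hΨ : IsDiffeoOn (𝓠 m) 𝓘(ℝ, ℝ × ℝ^m) Ψ Θ (B.down ⁻¹' a.φ.source)
        (polarDomain a.c a.A (Subtype.val '' a.φ.target)))
    (hpm : ∀ q ∈ B.down ⁻¹' a.φ.source, (a.φ (B.down q)).val = polarMap a.c a.A (Ψ q)) :
    ∃ ψ : 𝓒[m] B.total, ψ.target = a.W ∧
      (ψ.source = {q | B.down q ∈ a.φ.source ∧ 0 < a.σ * (Ψ q).2 a.i ∧
        ∀ j ∈ a.A, a.c j ≠ 0 → 0 < a.φ.coord j (B.down q)}) ∧ ∀ q ∈ ψ.source, a.P (ψ q) = B.down q ∧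
        (ψ q).val = projOfPolar[a] (Ψ q) := by
  obtain ⟨hΨd, hΘd, hΨm, hΘm, hinv⟩ := hΨ
  obtain ⟨O, hO, hOW⟩ := isOpen_induced_iff.1 a.isOpen_W
  have hOiff : ∀ z ∈ quad m, z ∈ O ↔ toQuad z ∈ a.W := by
    intro z hz
    rw [← hOW]
    show _ ↔ (toQuad z).val ∈ O
    rw [toQuad_val hz]
  have hs : IsOpen (B.down ⁻¹' a.φ.source) := a.φ.open_source.preimage B.continuous_down
  set U : Set B.total := {q | B.down q ∈ a.φ.source ∧ 0 < a.σ * (Ψ q).2 a.i ∧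
        ∀ j ∈ a.A, a.c j ≠ 0 → 0 < a.φ.coord j (B.down q)} with hUdef
  have hU : IsOpen U := by
    have h1 : U = (B.down ⁻¹' a.φ.source ∩ Ψ ⁻¹' {w | 0 < a.σ * w.2 a.i}) ∩
        (B.down ⁻¹' a.φ.source ∩ (fun q => (a.φ (B.down q)).val) ⁻¹'
          ⋂ j ∈ a.A, {x : ℝ^m | a.c j ≠ 0 → 0 < x j}) := by
      ext q; simp [hUdef, CornerChart.coord]; tauto
    rw [h1]
    refine (hΨd.continuousOn.isOpen_inter_preimage hs
      (isOpen_lt continuous_const (by fun_prop))).inter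
      ((a.φ.contMDiffOn_val.continuousOn.comp B.continuous_down.continuousOn
        fun q hq => hq).isOpen_inter_preimage hs (isOpen_forall_imp_pos _ continuous_coord))
  have hmap : ∀ q ∈ U, projOfPolar[a] (Ψ q) ∈ quad m ∧ toQuad (projOfPolar[a] (Ψ q)) ∈ a.W := by
    intro q hq
    refine BlowupIdx.projOfPolar_mem_W (hΨm hq.1) hq.2.1 fun j hj hc => ?_
    rw [← hpm q hq.1]; exact hq.2.2 j hj hc
  have hpol : ∀ z ∈ quad m ∩ O, z ∈ projDom[a] ∧ polarOfProj[a] z ∈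
      polarDomain a.c a.A (Subtype.val '' a.φ.target) := by
    intro z hz
    have hzW := (hOiff z hz.1).1 hz.2
    have h1 := hzW.1
    rw [toQuad_val hz.1] at h1
    refine ⟨h1, polarOfProj_mem a.sign a.i_mem a.inward hz.1 ⟨_, hzW.2, ?_⟩⟩
    rw [a.mapQ_val hzW.1, toQuad_val hz.1]
    rfl
  have hgm : MapsTo (fun z => Θ (polarOfProj[a] z)) (quad m ∩ O) U := by
    intro z hz
    have h1 := hpol z hz
    have h2 : Ψ (Θ (polarOfProj[a] z)) = _ := hinv.2 h1.2
    have h3 := hΘm h1.2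
    refine ⟨h3, ?_, fun j hj hc => ?_⟩
    · show 0 < a.σ * (Ψ (Θ (polarOfProj[a] z))).2 a.i
      rw [h2, sign_mul_polarOfProj a.sign a.i_mem]
      exact inv_pos.2 (projNorm_pos a.sign a.i_mem _)
    · show 0 < (a.φ (B.down (Θ (polarOfProj[a] z)))).val j
      rw [hpm _ h3, h2, polarMap_polarOfProj a.sign a.i_mem]
      exact h1.1.2 j hj hc
  obtain ⟨ψ, hs, ht, hv⟩ := CornerChart.exists_ofMaps (I := 𝓠 m) U hU O hO
    (fun q => projOfPolar[a] (Ψ q)) (fun z => Θ (polarOfProj[a] z))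
    (contDiffOn_projOfPolar.contMDiffOn.comp (hΨd.mono fun q hq => hq.1) fun q hq => hq.2.1)
    (hΘd.comp ((contDiffOn_polarOfProj a.sign a.i_mem).contMDiffOn.mono
      fun z hz => (hpol z hz).1.1) fun z hz => (hpol z hz).2)
    (fun q hq => ⟨(hmap q hq).1, (hOiff _ (hmap q hq).1).2 (hmap q hq).2⟩) hgm (fun q hq => by
      have h1 := hΨm hq.1
      rw [polarOfProj_projOfPolar a.sign a.i_mem hq.2.1 h1.2.1]
      exact hinv.1 hq.1) (fun z hz => by
      have h1 := hpol z hz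
      rw [show Ψ (Θ (polarOfProj[a] z)) = _ from hinv.2 h1.2,
        projOfPolar_polarOfProj a.sign a.i_mem h1.1.1])
  refine ⟨ψ, ht.trans hOW, hs, fun q hq => ?_⟩
  rw [hs] at hq
  refine ⟨?_, hv q hq⟩
  rw [ProjIdx.P, ProjIdx.mapQ, hv q hq, projMap_projOfPolar a.sign a.i_mem hq.2.1]
  have h1 := hpm q hq.1
  change _ = polarMap a.c a.A (Ψ q) at h1
  rw [← h1, val_toQuad, a.φ.symm_apply hq.1]

/-- The projective chart of a direction has the expected target. -/
lemma exists_projChart (a : ProjIdx I m S) : ∃ ψ : 𝓒[m] B.total, ψ.target = a.W ∧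
      ∀ q ∈ ψ.source, ψ q ∈ a.W ∧ a.P (ψ q) = B.down q := by
  obtain ⟨Ψ, Θ, hΨ, hpm⟩ := B.isBlowup.polar a.pt a.pt_mem a.φ a.A a.adapted
  obtain ⟨ψ, h1, -, h2⟩ := B.exists_chart_of_polar a hΨ hpm
  exact ⟨ψ, h1, fun q hq => ⟨h1 ▸ ψ.map_source hq, (h2 q hq).1⟩⟩

/-- Each point over the centre lies in the projective chart of a preferred boundary direction, or
in another projective chart where its slope in the preferred direction vanishes. -/
lemma exists_projChart_mem {p : M} (hp : p ∈ S) {φ : CornerChart I M m} {A : Finset (Fin m)}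
    (had : IsAdaptedChart S p φ A) {q : B.total} (hq : B.down q ∈ φ.source)
    (hqS : B.down q ∈ S) {i₀ : Fin m} (hi₀ : i₀ ∈ A) (h0 : φ.coord i₀ p = 0) :
    ∃ (a : ProjIdx I m S) (ψ : 𝓒[m] B.total), a.pt = p ∧ a.φ = φ ∧ a.A = A ∧
      q ∈ ψ.source ∧ (∀ x ∈ ψ.source, ψ x ∈ a.W ∧ a.P (ψ x) = B.down x) ∧
      (a.i = i₀ ∨ a.i ≠ i₀ ∧ ψ.coord i₀ q = 0) := by
  obtain ⟨Ψ, Θ, hΨ, hpm⟩ := B.isBlowup.polar p hp φ A had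
  have hΨq := hΨ.2.2.1 hq
  have key : ∀ a : ProjIdx I m S, a.pt = p → a.φ = φ → a.A = A → 0 < a.σ * (Ψ q).2 a.i →
      ∃ ψ : 𝓒[m] B.total, q ∈ ψ.source ∧ (∀ x ∈ ψ.source, ψ x ∈ a.W ∧ a.P (ψ x) = B.down x) ∧
        (ψ q).val = projOfPolar[a] (Ψ q) := by
    rintro a rfl rfl rfl hpos
    obtain ⟨ψ, h1, h2, h3⟩ := B.exists_chart_of_polar a hΨ hpm
    have hqs : q ∈ ψ.source := by
      rw [h2]
      refine ⟨hq, hpos, fun j hj hc => ?_⟩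
      rw [(had.2 _ hq).1 hqS j hj]
      exact lt_of_le_of_ne (a.c_nonneg j) (Ne.symm hc)
    exact ⟨ψ, hqs, fun x hx => ⟨h1 ▸ ψ.map_source hx, (h3 x hx).1⟩, (h3 q hqs).2⟩
  by_cases hu : (Ψ q).2 i₀ = 0
  · obtain ⟨a, h1, h2, h3, hpos⟩ := BlowupIdx.exists_projIdx had hp (exists_ne_zero_of_sum_sq hΨq.2.1) hΨq.2.2.1
    obtain ⟨ψ, h4, h5, h6⟩ := key a h3 h1 h2 hpos
    have hne : a.i ≠ i₀ := by intro h; rw [h, hu, mul_zero] at hpos; exact lt_irrefl _ hpos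
    refine ⟨a, ψ, h3, h1, h2, h4, h5, Or.inr ⟨hne, ?_⟩⟩
    subst h1; subst h2; subst h3
    have h0' : a.c i₀ = 0 := h0
    rw [← ψ.val_apply, h6]
    simp [projOfPolar, Ne.symm hne, hi₀, h0', hu]
  · have hpos : 0 < (Ψ q).2 i₀ := lt_of_le_of_ne (hΨq.2.2.1 i₀ hi₀ h0) (Ne.symm hu)
    obtain ⟨ψ, h4, h5, h6⟩ := key ⟨p, φ, A, i₀, 1, hp, had, hi₀, Or.inl rfl, fun _ => rfl⟩ rfl rfl
      rfl (by show 0 < 1 * (Ψ q).2 i₀; rwa [one_mul])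
    exact ⟨_, ψ, rfl, rfl, rfl, h4, h5, Or.inl rfl⟩

variable {B} {a : ProjIdx I m S} {ψ : 𝓒[m] B.total}
  (hψ : ∀ x ∈ ψ.source, ψ x ∈ a.W ∧ a.P (ψ x) = B.down x) {x : B.total} (hx : x ∈ ψ.source)

include hψ hx

/-- The coordinates of the blow-down map in a projective chart. -/
lemma coord_down (j : Fin m) : a.φ.coord j (B.down x) = projMap[a] (ψ x).val j := by
  rw [← (hψ x hx).2, a.coord_P (hψ x hx).1]

lemma mem_centre_iff : B.down x ∈ S ↔ ψ.coord a.i x = 0 := by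
  rw [← (hψ x hx).2, a.P_mem_S_iff (hψ x hx).1]; rfl

lemma coord_down_bdry {i : Fin m} (hi : i ≠ a.i) (hiA : i ∈ a.A) (hc : a.c i = 0) :
    a.φ.coord i (B.down x) = ψ.coord a.i x * ψ.coord i x := by
  rw [coord_down hψ hx, projMap_mem hiA, projSlope_bdry hi hc, hc, zero_add]; rfl

lemma coord_down_bdry_self (hc : a.c a.i = 0) : a.φ.coord a.i (B.down x) = ψ.coord a.i x := by
  rw [coord_down hψ hx, projMap_mem a.i_mem, projSlope_self, hc, zero_add, a.inward hc, mul_one]; rfl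

lemma coord_down_notMem {i : Fin m} (hi : i ∉ a.A) : a.φ.coord i (B.down x) = ψ.coord i x := by
  rw [coord_down hψ hx, projMap_notMem hi]; rfl

/-- An equation `i = 1`, satisfied on the centre or transverse to it, lifts to an equation of the same
form in the projective charts of the other directions, off the exceptional divisor. -/
lemma coord_down_eq_one_iff (hpos : 0 < ψ.coord a.i x) {i : Fin m} (hi : i ≠ a.i)
    (hc : i ∈ a.A → a.c i = 1) : a.φ.coord i (B.down x) = 1 ↔ ψ.coord i x = 1 := by
  rw [coord_down hψ hx i]
  by_cases hiA : i ∈ a.A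
  · have hc1 := hc hiA
    have hc0 : a.c i ≠ 0 := by rw [hc1]; exact one_ne_zero
    rw [projMap_mem hiA, projSlope_int hi hc0, hc1]
    have h1 : (0 : ℝ) < (ψ x).val i := (hψ x hx).1.1.1 i hiA hi hc0
    have h2 : (ψ x).val a.i ≠ 0 := hpos.ne'
    rw [add_eq_left, mul_eq_zero, or_iff_right h2]
    show _ ↔ (ψ x).val i = 1
    rw [Real.log_eq_zero]
    refine ⟨fun h => ?_, fun h => Or.inr (Or.inl h)⟩
    rcases h with h | h | h
    · exact absurd h h1.ne'
    · exact h
    · rw [h] at h1; linarith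
  · rw [projMap_notMem hiA]; rfl

/-- The coordinate of the leading direction is not constant off the centre. -/
lemma coord_down_self_ne (hpos : 0 < ψ.coord a.i x) : a.φ.coord a.i (B.down x) ≠ a.c a.i := by
  rw [coord_down hψ hx, projMap_mem a.i_mem, projSlope_self]
  have h2 : (ψ x).val a.i ≠ 0 := hpos.ne'
  have h3 : a.σ ≠ 0 := by rcases a.sign with h | h <;> rw [h] <;> norm_num
  intro h
  rw [add_eq_left] at h
  exact mul_ne_zero h2 h3 h

end Blowup

end Lifts

/-! ### Maps given by monomials, and b-fibrations -/

section Mono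

variable {m k : ℕ} {M : Type*} [TopologicalSpace M] [ChartedSpace ℝ₊^m M]
  {T : Type*} [TopologicalSpace T] [ChartedSpace ℝ₊^k T] {Base : Type*}

/-- The map `f : M → Base` lifts through `κ : T → Base`, over the domain of the chart `φ`, to a smooth
map which is given in a chart of `T` by monomials: the `j`-th coordinate is the product of the
coordinates `φ_i` with `ρ i = j`. The part of that chart with positive coordinates is mapped by `κ` to
the complement of `Sb`. -/
def MonoLift (κ : T → Base) (Sb : Set Base) (f : M → Base) (φ : 𝓒[m] M)
    (ρ : Fin m → Option (Fin k)) : Prop :=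
  ∃ (g : M → T) (ψ : CornerChart (𝓠 k) T k), ContMDiffOn (𝓠 m) (𝓠 k) ∞ g φ.source ∧
    (∀ x ∈ φ.source, g x ∈ ψ.source ∧ κ (g x) = f x ∧
      ∀ j, ψ.coord j (g x) = ∏ i with ρ i = some j, φ.coord i x) ∧
    ∀ y ∈ ψ.source, (∀ j, 0 < ψ.coord j y) → κ y ∉ Sb

variable {κ : T → Base} {Sb : Set Base} {f : M → Base} {φ : 𝓒[m] M} {ρ : Fin m → Option (Fin k)}

/-- Monomial maps are preserved under blow-down maps that are monomial in the relevant
coordinates. -/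
lemma MonoLift.comp {M' : Type*} [TopologicalSpace M'] [ChartedSpace ℝ₊^m M']
    (h : MonoLift κ Sb f φ ρ) {β : M' → M} (hβ : ContMDiff (𝓠 m) (𝓠 m) ∞ β)
    {φ' : 𝓒[m] M'} {ρ' : Fin m → Option (Fin k)} (hm : ∀ x ∈ φ'.source, β x ∈ φ.source)
    (hρ : ∀ x ∈ φ'.source, ∀ j, ∏ i with ρ i = some j, φ.coord i (β x) =
      ∏ i with ρ' i = some j, φ'.coord i x) : MonoLift κ Sb (f ∘ β) φ' ρ' := by
  obtain ⟨g, ψ, h1, h2, h3⟩ := h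
  refine ⟨g ∘ β, ψ, h1.comp hβ.contMDiffOn hm, fun x hx => ?_, h3⟩
  obtain ⟨h4, h5, h6⟩ := h2 _ (hm x hx)
  exact ⟨h4, h5, fun j => (h6 j).trans (hρ x hx j)⟩

/-- A monomial lift exists near a point as soon as the values of the monomials at that point are the
coordinates of a point of a chart of `T` in which `κ` corresponds to `f`. -/
lemma MonoLift.of_chart {q : M} (hq : q ∈ φ.source) {ψ : CornerChart (𝓠 k) T k}
    {z : ℝ₊^k} (hz : z ∈ ψ.target)
    (hzq : ∀ j, z.val j = ∏ i with ρ i = some j, φ.coord i q) (hκ : ∀ x ∈ φ.source, ∀ y ∈ ψ.source,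
      (∀ j, ψ.coord j y = ∏ i with ρ i = some j, φ.coord i x) → κ y = f x)
    (hpos : ∀ y ∈ ψ.source, (∀ j, 0 < ψ.coord j y) → κ y ∉ Sb) :
    ∃ (O : Set M) (hO : IsOpen O), q ∈ O ∧ MonoLift κ Sb f (φ.restrOpen O hO) ρ := by
  set F : M → ℝ^k := fun x => WithLp.toLp 2 fun j => ∏ i with ρ i = some j, φ.coord i x with hF
  have hFd : ContMDiffOn (𝓠 m) 𝓘(ℝ, ℝ^k) ∞ F φ.source := contMDiffOn_euclidean_iff.2 fun j =>
      contMDiffOn_finsetProd (t := Finset.univ.filter fun i => ρ i = some j)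
        (f := fun i => φ.coord i) fun i _ => φ.contMDiffOn_coord i
  have hFq : ∀ x, F x ∈ quad k := fun x j =>
    Finset.prod_nonneg (s := Finset.univ.filter fun i => ρ i = some j) fun i _ => φ.coord_nonneg i x
  have hG : ContMDiffOn (𝓠 m) (𝓠 k) ∞ (fun x => toQuad (F x)) φ.source :=
    (contMDiffOn_toQuad k).comp hFd fun x _ => hFq x
  have hO : IsOpen (φ.source ∩ (fun x => toQuad (F x)) ⁻¹' ψ.target) :=
    hG.continuousOn.isOpen_inter_preimage φ.open_source ψ.open_target
  have hzF : z = toQuad (F q) := by rw [← val_toQuad z]; congr 1; ext j; exact hzq j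
  have hco : ∀ x ∈ φ.source ∩ (φ.source ∩ (fun x => toQuad (F x)) ⁻¹' ψ.target), ∀ j,
      ψ.coord j (ψ.symm (toQuad (F x))) = ∏ i with ρ i = some j, φ.coord i x := by
    intro x hx j
    rw [← ψ.val_apply, ψ.apply_symm hx.2.2, toQuad_val (hFq x)]
  refine ⟨_, hO, ⟨hq, by show toQuad (F q) ∈ ψ.target; rwa [← hzF]⟩, fun x => ψ.symm (toQuad (F x)), ψ, ?_,
    fun x hx => ⟨ψ.symm_mem hx.2.2, ?_, hco x hx⟩, hpos⟩
  · exact ψ.contMDiffOn_invFun.comp (hG.mono inter_subset_left) fun x hx => hx.2.2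
  · exact hκ x hx.1 _ (ψ.symm_mem hx.2.2) (hco x hx)

/-- Local monomial lifts agree, since they agree where `κ` is injective, and thus glue to a global
smooth lift. -/
lemma exists_lift_of_monoLift [T2Space T] (hκ : InjOn κ (κ ⁻¹' Sb)ᶜ)
    (h : ∀ q : M, ∃ (φ : 𝓒[m] M) (ρ : Fin m → Option (Fin k)), q ∈ φ.source ∧ MonoLift κ Sb f φ ρ) :
    ∃ π : M → T, (∀ q, κ (π q) = f q) ∧ ContMDiff (𝓠 m) (𝓠 k) ∞ π ∧
      ∀ (φ : 𝓒[m] M) (ρ : Fin m → Option (Fin k)), MonoLift κ Sb f φ ρ →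
        ∃ ψ : CornerChart (𝓠 k) T k, ∀ x ∈ φ.source, π x ∈ ψ.source ∧
          ∀ j, ψ.coord j (π x) = ∏ i with ρ i = some j, φ.coord i x := by
  choose φ ρ hφ g ψ hg hgψ hpos using h
  have key : ∀ (q : M) (φ' : 𝓒[m] M) (ρ' : Fin m → Option (Fin k)) (g' : M → T)
      (ψ' : CornerChart (𝓠 k) T k), ContMDiffOn (𝓠 m) (𝓠 k) ∞ g' φ'.source →
      (∀ x ∈ φ'.source, g' x ∈ ψ'.source ∧ κ (g' x) = f x ∧
        ∀ j, ψ'.coord j (g' x) = ∏ i with ρ' i = some j, φ'.coord i x) →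
      (∀ y ∈ ψ'.source, (∀ j, 0 < ψ'.coord j y) → κ y ∉ Sb) →
      ∀ x ∈ φ'.source, x ∈ (φ q).source → g' x = g q x := by
    intro q φ' ρ' g' ψ' h1 h2 h3 x hx hxq
    have hcl : x ∈ closure {y | y ∈ φ'.source ∧ y ∈ (φ q).source ∧ g' y = g q y} := by
      refine CornerChart.mem_closure_of (ψ := φ'.restrOpen _ (φ q).open_source) Finset.univ
        ⟨hx, hxq⟩ fun y hy hy1 _ => ⟨hy.1, hy.2, ?_⟩
      obtain ⟨h4, h5, h6⟩ := h2 y hy.1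
      have h7 : κ (g' y) ∉ Sb := h3 _ h4 fun j => by
        rw [h6 j]; exact Finset.prod_pos fun i _ => hy1 i (Finset.mem_univ i)
      have h8 := (hgψ q y hy.2).2.1
      refine hκ h7 ?_ (h5.trans h8.symm)
      show κ (g q y) ∉ Sb
      rw [h8, ← h5]; exact h7
    have := mem_closure_iff_nhdsWithin_neBot.1 hcl
    refine tendsto_nhds_unique_of_eventuallyEq
      ((h1.continuousOn.continuousAt (φ'.open_source.mem_nhds hx)).tendsto.mono_left
        (nhdsWithin_le_nhds (s := {y | y ∈ φ'.source ∧ y ∈ (φ q).source ∧ g' y = g q y})))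
      (((hg q).continuousOn.continuousAt ((φ q).open_source.mem_nhds hxq)).tendsto.mono_left
        nhdsWithin_le_nhds) ?_
    filter_upwards [self_mem_nhdsWithin] with y hy using hy.2.2
  refine ⟨fun q => g q q, fun q => (hgψ q q (hφ q)).2.1, fun q => ?_, ?_⟩
  · refine ((hg q).congr fun x hx => ?_).contMDiffAt ((φ q).open_source.mem_nhds (hφ q))
    exact (key x (φ q) (ρ q) (g q) (ψ q) (hg q) (hgψ q) (hpos q) x hx (hφ x)).symm
  · rintro φ' ρ' ⟨g', ψ', h1, h2, h3⟩
    refine ⟨ψ', fun x hx => ?_⟩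
    have h4 := key x φ' ρ' g' ψ' h1 h2 h3 x hx (hφ x)
    dsimp only
    rw [← h4]
    exact ⟨(h2 x hx).1, (h2 x hx).2.2⟩

/-! #### The b-differential of a monomial map -/

lemma CornerChart.partialDeriv_prod {q : M} (hq : q ∈ φ.source) {g : M → ℝ} (R : Finset (Fin m))
    (hg : ∀ x ∈ φ.source, g x = ∏ i ∈ R, φ.coord i x) (l : Fin m) :
    φ.partialDeriv g q l = if l ∈ R then ∏ i ∈ R.erase l, φ.coord i q else 0 := by
  have h1 : (fun z => g (φ.symm ((𝓠 m).symm z))) =ᶠ[𝓝[range (𝓠 m)] (φ q).val]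
      fun z : ℝ^m => ∏ i ∈ R, z i := by
    obtain ⟨O, hO, hOt⟩ := φ.exists_open_target
    have hqO : (φ q).val ∈ O := by
      have : φ q ∈ Subtype.val ⁻¹' O := hOt ▸ φ.map_source hq
      exact this
    filter_upwards [self_mem_nhdsWithin, mem_nhdsWithin_of_mem_nhds (hO.mem_nhds hqO)] with z hz hzO
    rw [range_model_quadrant] at hz
    have hzt : toQuad z ∈ φ.target := by rw [hOt]; show (toQuad z).val ∈ O; rwa [toQuad_val hz]
    show g (φ.symm (toQuad z)) = _
    rw [hg _ (φ.symm_mem hzt)]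
    refine Finset.prod_congr rfl fun i _ => ?_
    rw [← φ.val_apply, φ.apply_symm hzt, toQuad_val hz]
  have h2 : HasFDerivAt (fun z : ℝ^m => ∏ i ∈ R, z i) (∑ i ∈ R, (∏ j ∈ R.erase i, (φ q).val j) •
        (EuclideanSpace.proj i : ℝ^m →L[ℝ] ℝ)) (φ q).val := HasFDerivAt.finsetProd fun i _ =>
      (EuclideanSpace.proj i : ℝ^m →L[ℝ] ℝ).hasFDerivAt
  have hmem : (φ q).val ∈ range (𝓠 m) := by rw [range_model_quadrant]; exact (φ q).2
  have hu : UniqueDiffWithinAt ℝ (range (𝓠 m)) (φ q).val := (𝓠 m).uniqueDiffOn _ hmem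
  rw [CornerChart.partialDeriv, h1.fderivWithin_eq_of_mem hmem, h2.hasFDerivWithinAt.fderivWithin hu]
  have h3 : ∀ i, (EuclideanSpace.proj i : ℝ^m →L[ℝ] ℝ)
      (EuclideanSpace.single l 1) = if i = l then 1 else 0 := fun i => by simp
  simp only [sum_apply, smul_apply, h3, smul_eq_mul, mul_ite, mul_one, mul_zero, Finset.sum_ite_eq']
  rfl

/-- A map given by monomials in disjoint sets of coordinates is an interior b-map, whose
b-differential is given in each row by non-zero multiples of the corresponding components. -/
lemma exists_hasBDifferentialAt {π : M → T} {ψ : CornerChart (𝓠 k) T k}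
    (hπ : ∀ x ∈ φ.source, π x ∈ ψ.source ∧
      ∀ j, ψ.coord j (π x) = ∏ i with ρ i = some j, φ.coord i x) {q : M} (hq : q ∈ φ.source) :
    ∃ (C : Fin m → ℝ) (L : (Fin m → ℝ) →ₗ[ℝ] (Fin k → ℝ)), (∀ i, C i ≠ 0) ∧
      (∀ v j, L v j = ∑ i, if ρ i = some j then C i * v i else 0) ∧
      HasBDifferentialAt φ ψ π q L := by
  classical
  have hb : ∀ i, i ∈ φ.bdryIdx q ↔ φ.coord i q = 0 := fun i => by simp [CornerChart.bdryIdx]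
  have hb' : ∀ j, j ∈ ψ.bdryIdx (π q) ↔ ψ.coord j (π q) = 0 := fun i => by
    simp [CornerChart.bdryIdx]
  set R : Fin k → Finset (Fin m) := fun j => Finset.univ.filter fun i => ρ i = some j with hR
  have hRm : ∀ i j, i ∈ R j ↔ ρ i = some j := fun i j => by simp [hR]
  set C : Fin m → ℝ := fun i => (ρ i).elim 1 fun j =>
    if ψ.coord j (π q) = 0 then (if φ.coord i q = 0 then 1 else (φ.coord i q)⁻¹)
    else ∏ l ∈ (R j).erase i, φ.coord l q with hC
  have hCj : ∀ i j, ρ i = some j → C i = if ψ.coord j (π q) = 0 then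
      (if φ.coord i q = 0 then 1 else (φ.coord i q)⁻¹)
    else ∏ l ∈ (R j).erase i, φ.coord l q := fun i j h => by simp only [hC, h, Option.elim_some]
  have hne : ∀ j, ψ.coord j (π q) ≠ 0 → ∀ i ∈ R j, φ.coord i q ≠ 0 := by
    intro j hj i hi h0
    exact hj (by rw [(hπ q hq).2 j]; exact Finset.prod_eq_zero hi h0)
  refine ⟨C, ⟨⟨fun v j => ∑ i, if ρ i = some j then C i * v i else 0, fun v w => ?_⟩,
    fun a v => ?_⟩, fun i => ?_, fun v j => rfl, hq, (hπ q hq).1, fun j hj v => ?_, fun j hj => ?_⟩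
  · ext j
    simp only [Pi.add_apply, ← Finset.sum_add_distrib]
    refine Finset.sum_congr rfl fun i _ => ?_
    split_ifs <;> ring
  · ext j
    simp only [Pi.smul_apply, smul_eq_mul, RingHom.id_apply, Finset.mul_sum]
    refine Finset.sum_congr rfl fun i _ => ?_
    split_ifs <;> ring
  · rcases h : ρ i with _ | j
    · simp [hC, h]
    · rw [hCj i j h]
      split_ifs with h1 h2
      · exact one_ne_zero
      · exact inv_ne_zero h2
      · exact Finset.prod_ne_zero_iff.2 fun l hl => hne j h1 l (Finset.mem_of_mem_erase hl)
  · rw [hb'] at hj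
    show ∑ i, (if ρ i = some j then C i * v i else 0) = _
    rw [← Finset.sum_add_sum_compl (φ.bdryIdx q), Finset.sum_eq_zero, zero_add]
    · refine Finset.sum_congr rfl fun i _ => ?_
      rw [φ.partialDeriv_prod hq (R j) fun x hx => (hπ x hx).2 j]
      by_cases h : ρ i = some j
      · rw [if_pos h, if_pos ((hRm i j).2 h), hCj i j h, if_neg hj]
      · rw [if_neg h, if_neg (fun h' => h ((hRm i j).1 h')), zero_mul]
    · intro i hi
      rw [if_neg fun h => hne j hj i ((hRm i j).2 h) ((hb i).1 hi)]
  · rw [hb'] at hj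
    refine ⟨fun i => if ρ i = some j then 1 else 0,
      fun x => ∏ i ∈ (R j).filter (· ∉ φ.bdryIdx q), φ.coord i x, ?_, ?_, ?_, fun v => ?_⟩
    · exact (contMDiffOn_finsetProd fun i _ => φ.contMDiffOn_coord i).contMDiffAt
        (φ.open_source.mem_nhds hq)
    · refine Finset.prod_pos fun i hi => lt_of_le_of_ne (φ.coord_nonneg i q) fun h => ?_
      exact (Finset.mem_filter.1 hi).2 ((hb i).2 h.symm)
    · filter_upwards [φ.open_source.mem_nhds hq] with x hx
      rw [(hπ x hx).2 j, mul_comm]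
      rw [← Finset.prod_filter_mul_prod_filter_not (R j) (· ∈ φ.bdryIdx q)]
      congr 1
      simp only [pow_ite, pow_one, pow_zero]
      rw [← Finset.prod_filter]
      refine Finset.prod_congr ?_ fun _ _ => rfl
      ext i; simp only [Finset.mem_filter, hRm]; tauto
    · show ∑ i, (if ρ i = some j then C i * v i else 0) = _
      rw [← Finset.sum_add_sum_compl (φ.bdryIdx q)]
      congr 1
      · refine Finset.sum_congr rfl fun i hi => ?_
        by_cases h : ρ i = some j
        · simp [h, hCj i j h, hj, (hb i).1 hi]
        · simp [h]
      · refine Finset.sum_congr rfl fun i hi => ?_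
        rw [Finset.mem_compl] at hi
        have hi' : φ.coord i q ≠ 0 := fun h => hi ((hb i).2 h)
        rw [φ.partialDeriv_prod hq ((R j).filter (· ∉ φ.bdryIdx q)) fun x hx => rfl]
        by_cases h : ρ i = some j
        · have hmem : i ∈ (R j).filter (· ∉ φ.bdryIdx q) := Finset.mem_filter.2 ⟨(hRm i j).2 h, hi⟩
          have hsplit : ∏ l ∈ (R j).filter (· ∉ φ.bdryIdx q), φ.coord l q = φ.coord i q *
              ∏ l ∈ ((R j).filter (· ∉ φ.bdryIdx q)).erase i, φ.coord l q :=
            (Finset.mul_prod_erase _ _ hmem).symm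
          rw [if_pos h, if_pos hmem, hCj i j h, if_pos hj, if_neg hi']
          dsimp only
          rw [hsplit]
          have hp : ∏ l ∈ ((R j).filter (· ∉ φ.bdryIdx q)).erase i, φ.coord l q ≠ 0 :=
            Finset.prod_ne_zero_iff.2 fun l hl h0 =>
              (Finset.mem_filter.1 (Finset.mem_of_mem_erase hl)).2 ((hb l).2 h0)
          field_simp
        · rw [if_neg h, if_neg (fun h' => h ((hRm i j).1 (Finset.mem_filter.1 h').1)), zero_div,
            zero_mul]

/-- Solutions of `L v = w` with vanishing components in the unused directions. -/
lemma exists_preimage_of_rows {C : Fin m → ℝ} {L : (Fin m → ℝ) →ₗ[ℝ] (Fin k → ℝ)}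
    (hC : ∀ i, C i ≠ 0) (hL : ∀ v j, L v j = ∑ i, if ρ i = some j then C i * v i else 0)
    (hρ : ∀ j, ∃ i, ρ i = some j) (w : Fin k → ℝ) : ∃ v, L v = w ∧ ∀ i, ρ i = none → v i = 0 := by
  classical
  choose c hc using hρ
  refine ⟨fun i => (ρ i).elim 0 fun j => if i = c j then w j / C i else 0, ?_, fun i hi => ?_⟩
  · ext j
    rw [hL, Finset.sum_eq_single (c j)]
    · simp [hc j, mul_div_cancel₀ _ (hC (c j))]
    · intro i _ hi
      by_cases h : ρ i = some j
      · simp [h, hi]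
      · simp [h]
    · simp
  · simp [hi]

lemma isBFibration_of_monoLift {π : M → T} (hπ : ContMDiff (𝓠 m) (𝓠 k) ∞ π)
    (h : ∀ q : M, ∃ (φ : 𝓒[m] M) (ρ : Fin m → Option (Fin k))
      (ψ : CornerChart (𝓠 k) T k), q ∈ φ.source ∧ (∀ j, ∃ i, ρ i = some j) ∧
      ∀ x ∈ φ.source, π x ∈ ψ.source ∧ ∀ j, ψ.coord j (π x) = ∏ i with ρ i = some j, φ.coord i x) :
    IsBFibration m k π := by
  refine ⟨hπ, fun q => ?_⟩
  obtain ⟨φ, ρ, ψ, hq, hρ, hψ⟩ := h q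
  obtain ⟨C, L, hC, hL, hB⟩ := exists_hasBDifferentialAt hψ hq
  refine ⟨φ, ψ, L, hB, fun w => ?_, fun h1 => ?_⟩
  · obtain ⟨v, hv, -⟩ := exists_preimage_of_rows hC hL hρ w
    exact ⟨v, hv⟩
  · obtain ⟨i₀, hi₀⟩ := Finset.card_eq_one.1 h1
    have key : ∀ j ∈ ψ.bdryIdx (π q), ρ i₀ = some j := by
      intro j hj
      have h2 : ψ.coord j (π q) = 0 := by simpa [CornerChart.bdryIdx] using hj
      rw [(hψ q hq).2 j, Finset.prod_eq_zero_iff] at h2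
      obtain ⟨i, hi, hi0⟩ := h2
      have h3 : i ∈ φ.bdryIdx q := by simpa [CornerChart.bdryIdx] using hi0
      rw [hi₀, Finset.mem_singleton] at h3
      rw [← h3]; simpa using hi
    refine Finset.card_le_one.2 fun j hj j' hj' => ?_
    have := (key j hj).symm.trans (key j' hj')
    exact Option.some.inj this

lemma isBTransverse_of_monoLift {π : M → T} {S : Set M}
    (h : ∀ q ∈ S, ∃ (φ : 𝓒[m] M) (ρ : Fin m → Option (Fin k))
      (ψ : CornerChart (𝓠 k) T k) (A : Finset (Fin m)), IsAdaptedChart S q φ A ∧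
      (∀ i ∈ A, φ.coord i q ≠ 0) ∧ (∀ i ∈ A, ρ i = none) ∧ (∀ j, ∃ i, ρ i = some j) ∧
      ∀ x ∈ φ.source, π x ∈ ψ.source ∧ ∀ j, ψ.coord j (π x) = ∏ i with ρ i = some j, φ.coord i x) :
    IsBTransverse m k π S := by
  intro q hq
  obtain ⟨φ, ρ, ψ, A, had, hA, hAρ, hρ, hψ⟩ := h q hq
  obtain ⟨C, L, hC, hL, hB⟩ := exists_hasBDifferentialAt hψ had.1
  refine ⟨φ, A, ψ, L, had, hA, hB, fun v => ?_⟩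
  obtain ⟨t, ht, ht0⟩ := exists_preimage_of_rows hC hL hρ (L v)
  exact ⟨t, v - t, by abel, fun i hi => ht0 i (hAρ i hi), by rw [map_sub, ht, sub_self]⟩

end Mono

/-! ### Monomial maps and blow-ups of adapted centres -/

section Core

variable {n m k : ℕ}

/-- Names for the coordinates of a double space: those of the left factor, of the right factor, and
one that plays the role of the parameter. -/
structure DoubleIdx (n m : ℕ) where
  l : Fin n → Fin m
  r : Fin n → Fin m
  e : Fin m
  l_inj : Function.Injective l
  r_inj : Function.Injective r
  l_ne_r : ∀ j j', l j ≠ r j'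
  l_ne_e : ∀ j, l j ≠ e
  r_ne_e : ∀ j, r j ≠ e

namespace DoubleIdx

/-- Exchange the two factors. -/
def swap (ix : DoubleIdx n m) : DoubleIdx n m :=
  ⟨ix.r, ix.l, ix.e, ix.r_inj, ix.l_inj, fun j j' => (ix.l_ne_r j' j).symm, ix.r_ne_e, ix.l_ne_e⟩

open Classical in
/-- The monomials of the projection to the left factor. -/
noncomputable def std (ix : DoubleIdx n m) (i : Fin m) : Option (Fin (n + 1)) :=
  if h : ∃ j, i = ix.l j then some h.choose.castSucc else if i = ix.e then some (Fin.last n) else none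

variable (ix : DoubleIdx n m)

lemma std_l (j : Fin n) : ix.std (ix.l j) = some j.castSucc := by
  have h : ∃ j', ix.l j = ix.l j' := ⟨j, rfl⟩
  rw [std, dif_pos h, ix.l_inj h.choose_spec.symm]

lemma std_e : ix.std ix.e = some (Fin.last n) := by
  rw [std, dif_neg (fun ⟨j, hj⟩ => ix.l_ne_e j hj.symm), if_pos rfl]

lemma std_r (j : Fin n) : ix.std (ix.r j) = none := by
  rw [std, dif_neg (fun ⟨j', hj⟩ => ix.l_ne_r j' j hj.symm), if_neg (ix.r_ne_e j)]

lemma std_eq_castSucc {i : Fin m} {j : Fin n} : ix.std i = some j.castSucc ↔ i = ix.l j := by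
  refine ⟨fun h => ?_, fun h => h ▸ ix.std_l j⟩
  rw [std] at h
  split_ifs at h with h1 h2
  · have := Fin.castSucc_injective n (Option.some.inj h)
    rw [← this]; exact h1.choose_spec
  · exact absurd (Option.some.inj h).symm (Fin.castSucc_ne_last j)

lemma std_eq_last {i : Fin m} : ix.std i = some (Fin.last n) ↔ i = ix.e := by
  refine ⟨fun h => ?_, fun h => h ▸ ix.std_e⟩
  rw [std] at h
  split_ifs at h with h1 h2
  · exact absurd (Option.some.inj h) (Fin.castSucc_ne_last _)
  · exact h2

lemma std_onto (j : Fin (n + 1)) : ∃ i, ix.std i = some j := by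
  induction j using Fin.lastCases with
  | last => exact ⟨_, ix.std_e⟩
  | cast j => exact ⟨_, ix.std_l j⟩

lemma prod_std_castSucc (c : Fin m → ℝ) (j : Fin n) :
    ∏ i with ix.std i = some j.castSucc, c i = c (ix.l j) := by
  rw [Finset.prod_congr (s₂ := {ix.l j}) (by ext i; simp [std_eq_castSucc]) fun _ _ => rfl,
    Finset.prod_singleton]

lemma prod_std_last (c : Fin m → ℝ) : ∏ i with ix.std i = some (Fin.last n), c i = c ix.e := by
  rw [Finset.prod_congr (s₂ := {ix.e}) (by ext i; simp [std_eq_last]) fun _ _ => rfl,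
    Finset.prod_singleton]

end DoubleIdx

lemma prod_update {ρ : Fin m → Option (Fin k)} {i' : Fin m} (h : ρ i' = none) (o : Option (Fin k))
    (j : Fin k) (c : Fin m → ℝ) : ∏ i with Function.update ρ i' o i = some j, c i =
      (if o = some j then c i' else 1) * ∏ i with ρ i = some j, c i := by
  classical
  by_cases ho : o = some j
  · rw [if_pos ho, ← Finset.prod_insert (s := Finset.univ.filter fun i => ρ i = some j)
      (by simp [h])]
    refine Finset.prod_congr ?_ fun _ _ => rfl
    ext i
    by_cases hi : i = i'
    · subst hi; simp [ho]
    · simp [hi]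
  · rw [if_neg ho, one_mul]
    refine Finset.prod_congr ?_ fun _ _ => rfl
    ext i
    by_cases hi : i = i'
    · subst hi; simp [ho, h]
    · simp [hi]

lemma onto_update {ρ : Fin m → Option (Fin k)} {i' : Fin m} (h : ρ i' = none) (o : Option (Fin k))
    (hρ : ∀ j, ∃ i, ρ i = some j) (j : Fin k) : ∃ i, Function.update ρ i' o i = some j := by
  obtain ⟨i, hi⟩ := hρ j
  have hne : i ≠ i' := fun h' => by rw [h', h] at hi; cases hi
  exact ⟨i, by rw [Function.update_of_ne hne, hi]⟩

variable {N : Type u} [TopologicalSpace N] [ChartedSpace ℝ₊^m N]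
  {T : Type*} [TopologicalSpace T] [ChartedSpace ℝ₊^k T] {Base : Type*}
  {κ : T → Base} {Sb : Set Base} {f : N → Base}

namespace Blowup

variable {S : Set N} (B : Blowup (𝓠 m) m S)

lemma lift_subset {F : Set N} (hF : IsClosed F) : B.lift F ⊆ B.down ⁻¹' F :=
  closure_minimal (preimage_mono sdiff_subset) (hF.preimage B.continuous_down)

lemma mem_lift_iff_of_notMem {F : Set N} (hF : IsClosed F) {x : B.total} (hx : B.down x ∉ S) :
    x ∈ B.lift F ↔ B.down x ∈ F := ⟨fun h => B.lift_subset hF h, fun h => subset_closure ⟨h, hx⟩⟩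

lemma exists_offCentre_monoLift {φ : 𝓒[m] N} {ρ : Fin m → Option (Fin k)}
    (h : MonoLift κ Sb f φ ρ) {q : B.total} (hq : B.down q ∈ φ.source) (hqS : B.down q ∉ S) :
    ∃ ψ : 𝓒[m] B.total, q ∈ ψ.source ∧ MonoLift κ Sb (f ∘ B.down) ψ ρ ∧
      ∀ x ∈ ψ.source, B.down x ∈ φ.source ∧ B.down x ∉ S ∧
        ∀ i, ψ.coord i x = φ.coord i (B.down x) := by
  obtain ⟨ψ, h1, h2⟩ := B.exists_offCentreChart φ hq hqS
  have h3 : ∀ x ∈ ψ.source, ∀ i, ψ.coord i x = φ.coord i (B.down x) := fun x hx i => by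
    rw [← ψ.val_apply, (h2 x hx).2.2]; rfl
  exact ⟨ψ, h1, h.comp B.isBlowup.contMDiff (fun x hx => (h2 x hx).1) fun x hx j =>
    Finset.prod_congr rfl fun i _ => (h3 x hx i).symm,
    fun x hx => ⟨(h2 x hx).1, (h2 x hx).2.1, h3 x hx⟩⟩

/-- Monomial maps stay monomial under the blow-up of a centre that involves only one of the
relevant coordinates. -/
lemma monoLift_proj {a : ProjIdx (𝓠 m) m S} {ψ : 𝓒[m] B.total}
    (hψ : ∀ x ∈ ψ.source, ψ x ∈ a.W ∧ a.P (ψ x) = B.down x) {ρ : Fin m → Option (Fin k)}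
    (h : MonoLift κ Sb f a.φ ρ) {i₀ : Fin m} (hi₀ : i₀ ∈ a.A) (h0 : a.c i₀ = 0)
    (hρ : ∀ i ∈ a.A, i ≠ i₀ → ρ i = none) :
    MonoLift κ Sb (f ∘ B.down) ψ (if a.i = i₀ then ρ else Function.update ρ a.i (ρ i₀)) := by
  classical
  have hcd : ∀ x ∈ ψ.source, ∀ i, (ρ i ≠ none) →
      a.φ.coord i (B.down x) = (if a.i ≠ i₀ ∧ i = i₀ then ψ.coord a.i x else 1) * ψ.coord i x := by
    intro x hx i hi
    rw [Blowup.coord_down hψ hx i]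
    by_cases hiA : i ∈ a.A
    · have hii : i = i₀ := by by_contra hne; exact hi (hρ i hiA hne)
      subst hii
      rw [projMap_mem hiA, h0, zero_add]
      by_cases hai : a.i = i
      · subst hai
        rw [projSlope_self, a.inward h0]
        simp [CornerChart.coord]
      · rw [projSlope_bdry (Ne.symm hai) h0]
        simp [hai, CornerChart.coord]
    · have hii : i ≠ i₀ := fun h => hiA (h ▸ hi₀)
      rw [projMap_notMem hiA]
      simp [hii, CornerChart.coord]
  refine h.comp B.isBlowup.contMDiff (fun x hx => ?_) fun x hx j => ?_
  · rw [← (hψ x hx).2]; exact a.P_mem (hψ x hx).1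
  · by_cases hai : a.i = i₀
    · rw [if_pos hai]
      refine Finset.prod_congr rfl fun i hi => ?_
      have hi' : ρ i = some j := by simpa using hi
      rw [hcd x hx i (by rw [hi']; simp)]
      simp [hai]
    · rw [if_neg hai, prod_update (hρ _ a.i_mem hai)]
      have h1 : ∏ i with ρ i = some j, a.φ.coord i (B.down x) =
          ∏ i with ρ i = some j, ((if i = i₀ then ψ.coord a.i x else 1) * ψ.coord i x) := by
        refine Finset.prod_congr rfl fun i hi => ?_
        have hi' : ρ i = some j := by simpa using hi
        rw [hcd x hx i (by rw [hi']; simp)]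
        simp [hai]
      rw [h1, Finset.prod_mul_distrib]
      congr 1
      rw [Finset.prod_ite_eq']
      simp

/-- Monomial charts on a blow-up. -/
lemma exists_monoLift (hN : ∀ q : N, ∃ (φ : 𝓒[m] N) (ρ : Fin m → Option (Fin k)),
      q ∈ φ.source ∧ (∀ j, ∃ i, ρ i = some j) ∧ MonoLift κ Sb f φ ρ)
    (hS : ∀ q ∈ S, ∃ (φ : 𝓒[m] N) (ρ : Fin m → Option (Fin k)) (A : Finset (Fin m))
      (i₀ : Fin m), IsAdaptedChart S q φ A ∧ (∀ j, ∃ i, ρ i = some j) ∧ MonoLift κ Sb f φ ρ ∧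
      i₀ ∈ A ∧ φ.coord i₀ q = 0 ∧ ∀ i ∈ A, i ≠ i₀ → ρ i = none) (q : B.total) :
    ∃ (ψ : 𝓒[m] B.total) (ρ : Fin m → Option (Fin k)),
      q ∈ ψ.source ∧ (∀ j, ∃ i, ρ i = some j) ∧ MonoLift κ Sb (f ∘ B.down) ψ ρ := by
  by_cases hq : B.down q ∈ S
  · obtain ⟨φ, ρ, A, i₀, had, hρ, hm, hi₀, h0, hA⟩ := hS _ hq
    obtain ⟨a, ψ, hpt, rfl, rfl, hqψ, hψ, -⟩ := B.exists_projChart_mem hq had had.1 hq hi₀ h0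
    have h0' : a.c i₀ = 0 := by rw [ProjIdx.c, hpt]; exact h0
    refine ⟨ψ, _, hqψ, ?_, B.monoLift_proj hψ hm hi₀ h0' hA⟩
    split_ifs with hai
    · exact hρ
    · exact onto_update (hA _ a.i_mem hai) _ hρ
  · obtain ⟨φ, ρ, hφ, hρ, hm⟩ := hN (B.down q)
    obtain ⟨ψ, h1, h2, -⟩ := B.exists_offCentre_monoLift hm hφ hq
    exact ⟨ψ, ρ, h1, hρ, h2⟩

end Blowup

/-! #### Charts adapted to the fibred diagonals -/

/-- The coordinates that are fixed on a fibred diagonal. -/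
def diagIdx (ix : DoubleIdx n m) (h : ℕ) (i₀ : Fin m) : Finset (Fin m) :=
  insert i₀ ((Finset.univ.filter fun j : Fin n => j.val ≤ h).image ix.r)

lemma mem_diagIdx {ix : DoubleIdx n m} {h : ℕ} {i₀ i : Fin m} :
    i ∈ diagIdx ix h i₀ ↔ i = i₀ ∨ ∃ j : Fin n, j.val ≤ h ∧ ix.r j = i := by simp [diagIdx]

lemma forall_mem_diagIdx {ix : DoubleIdx n m} {h : ℕ} {i₀ : Fin m} {p : Fin m → Prop} :
    (∀ i ∈ diagIdx ix h i₀, p i) ↔ p i₀ ∧ ∀ j : Fin n, j.val ≤ h → p (ix.r j) := by simp [diagIdx]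

lemma isClosed_forall_coord_eq {J : Fin n → Prop} {r : Fin n → Fin m} :
    IsClosed {z : ℝ^m | ∀ j, J j → z (r j) = 1} := by
  simp only [ofPred_forall]
  exact isClosed_iInter fun j => isClosed_iInter fun _ =>
    isClosed_eq (continuous_coord _) continuous_const

variable [NeZero n]

lemma forall_iff_zero {p : Fin n → Prop} : (∀ j, p j) ↔ p 0 ∧ ∀ j, j ≠ 0 → p j :=
  ⟨fun h => ⟨h 0, fun j _ => h j⟩,
    fun h j => (eq_or_ne j 0).elim (fun hj => hj ▸ h.1) fun hj => h.2 j hj⟩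

lemma forall_le_iff_zero {h : ℕ} {p : Fin n → Prop} :
    (∀ j : Fin n, j.val ≤ h → p j) ↔ p 0 ∧ ∀ j, j ≠ 0 → j.val ≤ h → p j := by
  rw [forall_iff_zero]
  simp

/-- Coordinates near the lift `S` of the boundary fibre diagonal, away from the sides: with the
boundary coordinates `l 0` and `r 0` of the two factors, and the quotients `r j` of the other
coordinates, of which those with index at most `h` belong to the base of the fibration. `F` is the
fibre diagonal of the front face `{e = 0}`, and `Δ` is the diagonal. -/
structure BdryDiagChart (ix : DoubleIdx n m) (h : ℕ) (S F Δ : Set N) (φ : 𝓒[m] N)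
    (fl fl' : Prop) : Prop where
  mem_S : ∀ x ∈ φ.source, x ∈ S ↔ φ.coord (ix.l 0) x = 0 ∧ φ.coord (ix.r 0) x = 0 ∧
    ∀ j, j ≠ 0 → j.val ≤ h → φ.coord (ix.r j) x = 1
  mem_F : ∀ x ∈ φ.source, x ∈ F ↔ fl ∧ φ.coord ix.e x = 0 ∧
    φ.coord (ix.l 0) x = φ.coord (ix.r 0) x ∧ ∀ j, j ≠ 0 → j.val ≤ h → φ.coord (ix.r j) x = 1
  mem_Δ : ∀ x ∈ φ.source, x ∈ Δ ↔ fl' ∧ φ.coord (ix.l 0) x = φ.coord (ix.r 0) x ∧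
    ∀ j, j ≠ 0 → φ.coord (ix.r j) x = 1

/-- Coordinates near the fibre diagonal `F` of the front face `{i₀ = 0}`, or near the diagonal `Δ`,
in which both are given by equations `r j = 1`. -/
structure FrontDiagChart (ix : DoubleIdx n m) (h : ℕ) (F Δ : Set N) (φ : 𝓒[m] N)
    (i₀ : Fin m) (fl fl' : Prop) : Prop where
  ne_r : ∀ j, i₀ ≠ ix.r j
  mem_F : ∀ x ∈ φ.source, x ∈ F ↔ fl ∧ φ.coord i₀ x = 0 ∧
    ∀ j : Fin n, j.val ≤ h → φ.coord (ix.r j) x = 1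
  mem_Δ : ∀ x ∈ φ.source, x ∈ Δ ↔ fl' ∧ ∀ j, φ.coord (ix.r j) x = 1

end Core

/-! ### The blow-ups of the fibred diagonals -/

section DiagBlowups

variable {n m h : ℕ} {N : Type u} [TopologicalSpace N] [ChartedSpace ℝ₊^m N]
  {T : Type*} [TopologicalSpace T] [ChartedSpace ℝ₊^(n + 1) T] {Base : Type*}
  {κ : T → Base} {Sb : Set Base} {f : N → Base} {ix : DoubleIdx n m} {S F Δ : Set N}
  {φ : 𝓒[m] N} {fl fl' : Prop} {i₀ : Fin m} {q : N}

lemma FrontDiagChart.isAdaptedChart (D : FrontDiagChart ix h F Δ φ i₀ fl fl') (hq : q ∈ φ.source)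
    (hqF : q ∈ F) : IsAdaptedChart F q φ (diagIdx ix h i₀) ∧ φ.coord i₀ q = 0 := by
  obtain ⟨h1, h2, h3⟩ := (D.mem_F q hq).1 hqF
  refine ⟨⟨hq, fun x hx => ?_⟩, h2⟩
  rw [D.mem_F x hx, forall_mem_diagIdx, h2]
  exact ⟨fun h => ⟨h.2.1, fun j hj => by rw [h.2.2 j hj, h3 j hj]⟩,
    fun h => ⟨h1, h.1, fun j hj => by rw [h.2 j hj, h3 j hj]⟩⟩

lemma FrontDiagChart.comp_down {N' : Type*} [TopologicalSpace N']
    [ChartedSpace ℝ₊^m N'] {F' Δ' : Set N'} {β : N' → N}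
    {ψ : 𝓒[m] N'} (D : FrontDiagChart ix h F Δ φ i₀ fl fl')
    (hψ : ∀ x ∈ ψ.source, β x ∈ φ.source ∧ ∀ i, ψ.coord i x = φ.coord i (β x))
    (hF : ∀ x ∈ ψ.source, x ∈ F' ↔ β x ∈ F) (hΔ : ∀ x ∈ ψ.source, x ∈ Δ' ↔ β x ∈ Δ) :
    FrontDiagChart ix h F' Δ' ψ i₀ fl fl' where
  ne_r := D.ne_r
  mem_F x hx := by rw [hF x hx, D.mem_F _ (hψ x hx).1]; simp only [(hψ x hx).2]
  mem_Δ x hx := by rw [hΔ x hx, D.mem_Δ _ (hψ x hx).1]; simp only [(hψ x hx).2]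

lemma BdryDiagChart.isAdaptedChart [NeZero n] (D : BdryDiagChart ix h S F Δ φ fl fl') (hq : q ∈ φ.source)
    (hqS : q ∈ S) : IsAdaptedChart S q φ (diagIdx ix h (ix.l 0)) ∧ φ.coord (ix.l 0) q = 0 := by
  obtain ⟨h1, h2, h3⟩ := (D.mem_S q hq).1 hqS
  refine ⟨⟨hq, fun x hx => ?_⟩, h1⟩
  rw [D.mem_S x hx, forall_mem_diagIdx, h1, forall_le_iff_zero, h2]
  exact and_congr_right fun _ => and_congr_right fun _ => forall_congr' fun j =>
    forall_congr' fun hj0 => forall_congr' fun hj => by rw [h3 j hj0 hj]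

namespace Blowup

/-- After the blow-up of the fibre diagonal of the front face, the lift of the diagonal is given
by equations `r j = 1`. -/
lemma exists_diagChart (B : Blowup (𝓠 m) m F) (D : FrontDiagChart ix h F Δ φ i₀ fl fl')
    (hm : MonoLift κ Sb f φ ix.std) {q : B.total} (hq : B.down q ∈ φ.source) (hqF : B.down q ∈ F)
    (hqΔ : q ∈ B.lift Δ) : ∃ ψ : 𝓒[m] B.total, q ∈ ψ.source ∧ MonoLift κ Sb (f ∘ B.down) ψ ix.std ∧
      ∀ x ∈ ψ.source, x ∈ B.lift Δ ↔ fl' ∧ ∀ j, ψ.coord (ix.r j) x = 1 := by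
  obtain ⟨had, h0⟩ := D.isAdaptedChart hq hqF
  obtain ⟨-, -, hr1⟩ := (D.mem_F _ hq).1 hqF
  obtain ⟨a, ψ, hpt, rfl, hA, hqψ, hψ, -⟩ := B.exists_projChart_mem hqF had hq hqF
    (mem_diagIdx.2 (Or.inl rfl)) h0
  have hcl : a.c i₀ = 0 := by rw [ProjIdx.c, hpt]; exact h0
  have hcj : ∀ j : Fin n, j.val ≤ h → a.c (ix.r j) = 1 := fun j hjh => by
    rw [ProjIdx.c, hpt]; exact hr1 j hjh
  have hmA : ∀ i, i ∈ a.A ↔ i = i₀ ∨ ∃ j : Fin n, j.val ≤ h ∧ ix.r j = i := fun i => by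
    rw [hA, mem_diagIdx]
  have hrA : ∀ j, ix.r j ∈ a.A → j.val ≤ h := fun j hj =>
    ((hmA _).1 hj).elim (fun h => absurd h.symm (D.ne_r j)) fun ⟨j', h1, h2⟩ => ix.r_inj h2 ▸ h1
  have hS : ∀ x ∈ ψ.source, B.down x ∉ F ↔ 0 < ψ.coord a.i x := fun x hx => by
    rw [mem_centre_iff hψ hx, (ψ.coord_nonneg _ _).lt_iff_ne', ne_eq]
  have hdx : ∀ x ∈ ψ.source, B.down x ∈ a.φ.source := fun x hx => by
    rw [← (hψ x hx).2]; exact a.P_mem (hψ x hx).1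
  have hai : a.i = i₀ := by
    by_contra hai
    obtain ⟨j, hj, hji⟩ := ((hmA _).1 a.i_mem).resolve_left hai
    refine CornerChart.mem_of_mem_closure (ψ := ψ) (C := ∅) isClosed_empty
      (fun y hy hys => ?_) hqψ hqΔ
    refine absurd (((D.mem_Δ _ (hdx y hy)).1 hys.1).2 j) ?_
    rw [← hcj j hj, hji]
    exact coord_down_self_ne hψ hy ((hS y hy).1 hys.2)
  have hne : ∀ j, ix.r j ≠ a.i := fun j h => D.ne_r j (hai.symm.trans h.symm)
  refine ⟨ψ, hqψ, ?_, fun x hx => ?_⟩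
  · have := B.monoLift_proj hψ hm ((hmA _).2 (Or.inl rfl)) hcl fun i hi hil => by
      obtain ⟨j, -, rfl⟩ := ((hmA i).1 hi).resolve_left hil
      exact ix.std_r j
    rwa [if_pos hai] at this
  · refine CornerChart.mem_closure_iff (ψ := ψ) {a.i} (C := {z | fl' ∧
      ∀ j : Fin n, True → z (ix.r j) = 1}) ?_ ?_ (fun y hy => ?_) hx |>.trans ?_
    · exact (isClosed_const (p := fl')).inter isClosed_forall_coord_eq
    · rintro z z' hz ⟨h1, h3⟩
      exact ⟨h1, fun j hj => by rw [hz _ (by simpa using hne j), h3 j hj]⟩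
    · rw [mem_preimage, mem_sdiff, and_comm, hS y hy]
      simp only [Finset.mem_singleton, forall_eq]
      refine and_congr_right fun hpos => ?_
      rw [D.mem_Δ _ (hdx y hy)]
      exact and_congr_right fun _ => forall_congr' fun j => (coord_down_eq_one_iff hψ hy hpos (hne j)
        fun hjA => hcj j (hrA j hjA)).trans ⟨fun h _ => h, fun h => h trivial⟩
    · simp [CornerChart.coord]

variable [NeZero n]

/-- The blow-up of the lift of the boundary fibre diagonal `S`: over it, near the lifts of `F` and
`Δ`, the quotient of the two boundary coordinates is a coordinate, equal to `1` on the lifts. -/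
lemma exists_frontDiagChart (B : Blowup (𝓠 m) m S) (D : BdryDiagChart ix h S F Δ φ fl fl')
    (hm : MonoLift κ Sb f φ ix.std) {q : B.total} (hq : B.down q ∈ φ.source) (hqS : B.down q ∈ S)
    (hqF : q ∈ B.lift F ∪ B.lift Δ) :
    ∃ ψ : 𝓒[m] B.total, q ∈ ψ.source ∧ MonoLift κ Sb (f ∘ B.down) ψ ix.std ∧
      FrontDiagChart ix h (B.lift F) (B.lift Δ) ψ ix.e fl fl' := by
  obtain ⟨had, h0⟩ := D.isAdaptedChart hq hqS
  obtain ⟨-, hr0, hr1⟩ := (D.mem_S _ hq).1 hqS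
  obtain ⟨a, ψ, hpt, rfl, hA, hqψ, hψ, hai⟩ := B.exists_projChart_mem hqS had hq hqS
    (mem_diagIdx.2 (Or.inl rfl)) h0
  have hcl : a.c (ix.l 0) = 0 := by rw [ProjIdx.c, hpt]; exact h0
  have hcr : a.c (ix.r 0) = 0 := by rw [ProjIdx.c, hpt]; exact hr0
  have hcj : ∀ j, j ≠ 0 → j.val ≤ h → a.c (ix.r j) = 1 := fun j hj hjh => by
    rw [ProjIdx.c, hpt]; exact hr1 j hj hjh
  have hmA : ∀ i, i ∈ a.A ↔ i = ix.l 0 ∨ ∃ j : Fin n, j.val ≤ h ∧ ix.r j = i := fun i => by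
    rw [hA, mem_diagIdx]
  have hlA : ix.l 0 ∈ a.A := (hmA _).2 (Or.inl rfl)
  have hrA : ∀ j, ix.r j ∈ a.A ↔ j.val ≤ h := fun j => by
    rw [hmA]
    exact ⟨fun h => h.elim (fun h => absurd h.symm (ix.l_ne_r 0 j))
      fun ⟨j', h1, h2⟩ => ix.r_inj h2 ▸ h1, fun h => Or.inr ⟨j, h, rfl⟩⟩
  have heA : ix.e ∉ a.A := fun h => by
    rcases (hmA _).1 h with h | ⟨j, -, h⟩
    · exact ix.l_ne_e 0 h.symm
    · exact ix.r_ne_e j h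
  have hS : ∀ x ∈ ψ.source, B.down x ∉ S ↔ 0 < ψ.coord a.i x := fun x hx => by
    rw [mem_centre_iff hψ hx, (ψ.coord_nonneg _ _).lt_iff_ne', ne_eq]
  have hdx : ∀ x ∈ ψ.source, B.down x ∈ a.φ.source := fun x hx => by
    rw [← (hψ x hx).2]; exact a.P_mem (hψ x hx).1
  rcases hai with hai | ⟨hai, hq0⟩
  · have hne : ∀ j, ix.r j ≠ a.i := fun j h => ix.l_ne_r 0 j (hai.symm.trans h.symm)
    have key0 : ∀ x ∈ ψ.source, 0 < ψ.coord a.i x →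
        (a.φ.coord (ix.l 0) (B.down x) = a.φ.coord (ix.r 0) (B.down x) ↔
          ψ.coord (ix.r 0) x = 1) := by
      intro x hx hpos
      rw [coord_down_bdry hψ hx (hne 0) ((hrA 0).2 (by simp)) hcr, ← hai,
        coord_down_bdry_self hψ hx (hai ▸ hcl), eq_comm, mul_eq_left₀ hpos.ne']
    have key1 : ∀ x ∈ ψ.source, 0 < ψ.coord a.i x → ∀ j, j ≠ 0 →
        (a.φ.coord (ix.r j) (B.down x) = 1 ↔ ψ.coord (ix.r j) x = 1) := fun x hx hpos j hj =>
      coord_down_eq_one_iff hψ hx hpos (hne j) fun hjA => hcj j hj ((hrA j).1 hjA)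
    have hL : ∀ j, ix.r j ∉ ({a.i} : Finset (Fin m)) := fun j => by simpa using hne j
    have hLe : ix.e ∉ ({a.i} : Finset (Fin m)) := by
      rw [Finset.mem_singleton, hai]; exact (ix.l_ne_e 0).symm
    refine ⟨ψ, hqψ, ?_, ⟨fun j => (ix.r_ne_e j).symm, fun x hx => ?_, fun x hx => ?_⟩⟩
    · have := B.monoLift_proj hψ hm hlA hcl fun i hi hil => by
        obtain ⟨j, -, rfl⟩ := ((hmA i).1 hi).resolve_left hil
        exact ix.std_r j
      rwa [if_pos hai] at this
    · refine CornerChart.mem_closure_iff (ψ := ψ) {a.i} (C := {z | fl ∧ z ix.e = 0 ∧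
        ∀ j : Fin n, j.val ≤ h → z (ix.r j) = 1}) ?_ ?_ (fun y hy => ?_) hx
      · exact (isClosed_const (p := fl)).inter
          ((isClosed_eq (continuous_coord ix.e) (continuous_const (y := (0 : ℝ)))).inter
          isClosed_forall_coord_eq)
      · rintro z z' hz ⟨h1, h2, h3⟩
        exact ⟨h1, by rw [hz _ hLe, h2], fun j hj => by rw [hz _ (hL j), h3 j hj]⟩
      · rw [mem_preimage, mem_sdiff, and_comm, hS y hy]
        simp only [Finset.mem_singleton, forall_eq]
        refine and_congr_right fun hpos => ?_
        rw [D.mem_F _ (hdx y hy), coord_down_notMem hψ hy heA, key0 y hy hpos]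
        refine and_congr_right fun _ => and_congr_right fun _ => Iff.trans ?_
          (forall_le_iff_zero (p := fun j => ψ.coord (ix.r j) y = 1)).symm
        exact and_congr_right fun _ => forall_congr' fun j => forall_congr' fun hj0 =>
          forall_congr' fun _ => key1 y hy hpos j hj0
    · refine CornerChart.mem_closure_iff (ψ := ψ) {a.i} (C := {z | fl' ∧
        ∀ j : Fin n, True → z (ix.r j) = 1}) ?_ ?_ (fun y hy => ?_) hx |>.trans ?_
      · exact (isClosed_const (p := fl')).inter isClosed_forall_coord_eq
      · rintro z z' hz ⟨h1, h3⟩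
        exact ⟨h1, fun j hj => by rw [hz _ (hL j), h3 j hj]⟩
      · rw [mem_preimage, mem_sdiff, and_comm, hS y hy]
        simp only [Finset.mem_singleton, forall_eq]
        refine and_congr_right fun hpos => ?_
        rw [D.mem_Δ _ (hdx y hy), key0 y hy hpos]
        simp only [true_imp_iff]
        refine and_congr_right fun _ => Iff.trans ?_
          (forall_iff_zero (p := fun j => ψ.coord (ix.r j) y = 1)).symm
        exact and_congr_right fun _ => forall_congr' fun j => forall_congr' fun hj0 =>
          key1 y hy hpos j hj0
      · simp [CornerChart.coord]
  · -- The slope of `l 0` vanishes at `q`, but it would be `1` on the lifts.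
    exfalso
    obtain ⟨j, hj, hji⟩ := ((hmA _).1 a.i_mem).resolve_left hai
    have key : ∀ s : Set N, (∀ x ∈ a.φ.source, x ∈ s → a.φ.coord (ix.l 0) x = a.φ.coord (ix.r 0) x ∧
        ∀ j, j ≠ 0 → j.val ≤ h → a.φ.coord (ix.r j) x = 1) → q ∉ B.lift s := by
      intro s hs hqs
      have h1 := CornerChart.mem_of_mem_closure (ψ := ψ) (C := {z | z (ix.l 0) = 1})
        (isClosed_eq (continuous_coord _) continuous_const) (fun y hy hys => ?_) hqψ hqs
      · exact zero_ne_one (hq0.symm.trans h1)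
      · have hpos := (hS y hy).1 hys.2
        obtain ⟨h2, h3⟩ := hs _ (hdx y hy) hys.1
        by_cases hj0 : j = 0
        · subst hj0
          rw [coord_down_bdry hψ hy hai.symm hlA hcl, hji,
            coord_down_bdry_self hψ hy (hji ▸ hcr), mul_eq_left₀ hpos.ne'] at h2
          exact h2
        · refine absurd (h3 j hj0 hj) ?_
          rw [← hcj j hj0 hj, hji]
          exact coord_down_self_ne hψ hy hpos
    rcases hqF with hqF | hqF
    · exact key F (fun x hx hxF => ((D.mem_F x hx).1 hxF).2.2) hqF
    · exact key Δ (fun x hx hxF => ⟨((D.mem_Δ x hx).1 hxF).2.1,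
        fun j hj _ => ((D.mem_Δ x hx).1 hxF).2.2 j hj⟩) hqF

end Blowup

/-- The situation before the blow-up of the boundary fibre diagonal `S`, for the projection to one
factor: the projection `f` is given by monomials, of the standard form near `S`, near the fibre
diagonal `F` of the front face and near the diagonal `Δ`, where there are adapted coordinates. -/
structure FibredDiagonals [NeZero n] (κ : T → Base) (Sb : Set Base) (f : N → Base)
    (ix : DoubleIdx n m) (h : ℕ) (S F Δ : Set N) : Prop where
  isClosed_S : IsClosed S
  isClosed_F : IsClosed F
  isClosed_Δ : IsClosed Δ
  mono : ∀ q : N, ∃ (φ : 𝓒[m] N) (ρ : Fin m → Option (Fin (n + 1))),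
    q ∈ φ.source ∧ (∀ j, ∃ i, ρ i = some j) ∧ MonoLift κ Sb f φ ρ
  bdry : ∀ q ∈ S, ∃ (φ : 𝓒[m] N) (fl fl' : Prop), q ∈ φ.source ∧
    MonoLift κ Sb f φ ix.std ∧ BdryDiagChart ix h S F Δ φ fl fl'
  front : ∀ q ∈ F ∪ Δ, q ∉ S → ∃ (φ : 𝓒[m] N) (i₀ : Fin m) (fl fl' : Prop),
    q ∈ φ.source ∧ MonoLift κ Sb f φ ix.std ∧ FrontDiagChart ix h F Δ φ i₀ fl fl'

namespace FibredDiagonals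

variable [NeZero n] (D : FibredDiagonals κ Sb f ix h S F Δ)
include D

lemma isPSubmanifold : IsPSubmanifold (𝓠 m) m S ∧ (S.Nonempty → Sᶜ.Nonempty) := by
  refine ⟨⟨D.isClosed_S, fun q hq => ?_⟩, fun ⟨q, hq⟩ => ?_⟩
  · obtain ⟨φ, fl, fl', h1, -, h2⟩ := D.bdry q hq
    exact ⟨φ, _, (h2.isAdaptedChart h1 hq).1⟩
  · obtain ⟨φ, fl, fl', h1, -, h2⟩ := D.bdry q hq
    obtain ⟨had, h0⟩ := h2.isAdaptedChart h1 hq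
    exact had.compl_nonempty (mem_diagIdx.2 (Or.inl rfl)) h0

variable (B : Blowup (𝓠 m) m S)

lemma exists_monoLift_lift (q : B.total) : ∃ (φ : 𝓒[m] B.total) (ρ : Fin m → Option (Fin (n + 1))),
      q ∈ φ.source ∧ (∀ j, ∃ i, ρ i = some j) ∧ MonoLift κ Sb (f ∘ B.down) φ ρ := by
  refine B.exists_monoLift D.mono (fun q hq => ?_) q
  obtain ⟨φ, fl, fl', h1, hm, h2⟩ := D.bdry q hq
  obtain ⟨had, h0⟩ := h2.isAdaptedChart h1 hq
  exact ⟨φ, _, _, _, had, ix.std_onto, hm, mem_diagIdx.2 (Or.inl rfl), h0, fun i hi hil => by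
    obtain ⟨j, -, rfl⟩ := (mem_diagIdx.1 hi).resolve_left hil
    exact ix.std_r j⟩

lemma exists_frontDiagChart_lift {q : B.total} (hq : q ∈ B.lift F ∪ B.lift Δ) :
    ∃ (φ : 𝓒[m] B.total) (i₀ : Fin m) (fl fl' : Prop),
      q ∈ φ.source ∧ MonoLift κ Sb (f ∘ B.down) φ ix.std ∧
      FrontDiagChart ix h (B.lift F) (B.lift Δ) φ i₀ fl fl' := by
  by_cases hqS : B.down q ∈ S
  · obtain ⟨φ, fl, fl', h1, hm, h2⟩ := D.bdry _ hqS
    obtain ⟨ψ, h3, h4, h5⟩ := B.exists_frontDiagChart h2 hm h1 hqS hq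
    exact ⟨ψ, _, _, _, h3, h4, h5⟩
  · have hq' : B.down q ∈ F ∪ Δ := hq.imp (fun h => B.lift_subset D.isClosed_F h)
      fun h => B.lift_subset D.isClosed_Δ h
    obtain ⟨φ, i₀, fl, fl', h1, hm, h2⟩ := D.front _ hq' hqS
    obtain ⟨ψ, h3, h4, h5⟩ := B.exists_offCentre_monoLift hm h1 hqS
    exact ⟨ψ, i₀, fl, fl', h3, h4, h2.comp_down (fun x hx => ⟨(h5 x hx).1, (h5 x hx).2.2⟩)
      (fun x hx => B.mem_lift_iff_of_notMem D.isClosed_F (h5 x hx).2.1)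
      fun x hx => B.mem_lift_iff_of_notMem D.isClosed_Δ (h5 x hx).2.1⟩

lemma isPSubmanifold_lift : IsPSubmanifold (𝓠 m) m (B.lift F) ∧
    ((B.lift F).Nonempty → (B.lift F)ᶜ.Nonempty) := by
  refine ⟨⟨isClosed_closure, fun q hq => ?_⟩, fun ⟨q, hq⟩ => ?_⟩
  · obtain ⟨φ, i₀, fl, fl', h1, -, h2⟩ := D.exists_frontDiagChart_lift B (Or.inl hq)
    exact ⟨φ, _, (h2.isAdaptedChart h1 hq).1⟩
  · obtain ⟨φ, i₀, fl, fl', h1, -, h2⟩ := D.exists_frontDiagChart_lift B (Or.inl hq)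
    obtain ⟨had, h0⟩ := h2.isAdaptedChart h1 hq
    exact had.compl_nonempty (mem_diagIdx.2 (Or.inl rfl)) h0

variable (B' : Blowup (𝓠 m) m (B.lift F))

lemma exists_diagChart_lift {q : B'.total} (hq : q ∈ B'.lift (B.lift Δ)) :
    ∃ (φ : 𝓒[m] B'.total) (fl' : Prop),
      q ∈ φ.source ∧ MonoLift κ Sb (f ∘ B.down ∘ B'.down) φ ix.std ∧
      ∀ x ∈ φ.source, x ∈ B'.lift (B.lift Δ) ↔ fl' ∧ ∀ j, φ.coord (ix.r j) x = 1 := by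
  have hqΔ : B'.down q ∈ B.lift Δ := B'.lift_subset isClosed_closure hq
  obtain ⟨φ, i₀, fl, fl', h1, hm, h2⟩ := D.exists_frontDiagChart_lift B (Or.inr hqΔ)
  by_cases hqF : B'.down q ∈ B.lift F
  · obtain ⟨ψ, h3, h4, h5⟩ := B'.exists_diagChart h2 hm h1 hqF hq
    exact ⟨ψ, fl', h3, h4, h5⟩
  · obtain ⟨ψ, h3, h4, h5⟩ := B'.exists_offCentre_monoLift hm h1 hqF
    refine ⟨ψ, fl', h3, h4, fun x hx => ?_⟩
    rw [B'.mem_lift_iff_of_notMem (F := B.lift Δ) isClosed_closure (h5 x hx).2.1, h2.mem_Δ _ (h5 x hx).1]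
    simp only [(h5 x hx).2.2]

lemma isInteriorPSubmanifold : IsInteriorPSubmanifold (𝓠 m) m (B'.lift (B.lift Δ)) := by
  refine ⟨isClosed_closure, fun q hq => ?_⟩
  obtain ⟨φ, fl', h1, -, h2⟩ := D.exists_diagChart_lift B B' hq
  obtain ⟨h3, h4⟩ := (h2 q h1).1 hq
  refine ⟨φ, Finset.univ.image ix.r, ⟨h1, fun x hx => ?_⟩, ?_⟩
  · rw [h2 x hx]
    simp only [Finset.mem_image, Finset.mem_univ, true_and, forall_exists_index,
      forall_apply_eq_imp_iff, h4, and_iff_right h3]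
  · simp [h4]

/-- The projection lifts to a b-fibration that is transverse to the lifted diagonal. -/
lemma exists_bFibration [T2Space T] (hκ : InjOn κ (κ ⁻¹' Sb)ᶜ) : ∃ π : B'.total → T,
    (∀ q, κ (π q) = f (B.down (B'.down q))) ∧ IsBFibration m (n + 1) π ∧
      IsBTransverse m (n + 1) π (B'.lift (B.lift Δ)) := by
  have hmono : ∀ q, ∃ (φ : 𝓒[m] B'.total) (ρ : Fin m → Option (Fin (n + 1))),
      q ∈ φ.source ∧ (∀ j, ∃ i, ρ i = some j) ∧ MonoLift κ Sb (f ∘ B.down ∘ B'.down) φ ρ := by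
    refine B'.exists_monoLift (D.exists_monoLift_lift B) fun q hq => ?_
    obtain ⟨φ, i₀, fl, fl', h1, hm, h2⟩ := D.exists_frontDiagChart_lift B (Or.inl hq)
    obtain ⟨had, h0⟩ := h2.isAdaptedChart h1 hq
    exact ⟨φ, _, _, _, had, ix.std_onto, hm, mem_diagIdx.2 (Or.inl rfl), h0, fun i hi hil => by
      obtain ⟨j, -, rfl⟩ := (mem_diagIdx.1 hi).resolve_left hil
      exact ix.std_r j⟩
  obtain ⟨π, h1, h2, h3⟩ := exists_lift_of_monoLift hκ fun q => by
    obtain ⟨φ, ρ, hq, -, hm⟩ := hmono q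
    exact ⟨φ, ρ, hq, hm⟩
  refine ⟨π, h1, isBFibration_of_monoLift h2 fun q => ?_, isBTransverse_of_monoLift fun q hq => ?_⟩
  · obtain ⟨φ, ρ, hq, hρ, hm⟩ := hmono q
    obtain ⟨ψ, hψ⟩ := h3 φ ρ hm
    exact ⟨φ, ρ, ψ, hq, hρ, hψ⟩
  · obtain ⟨φ, fl', hq1, hm, h4⟩ := D.exists_diagChart_lift B B' hq
    obtain ⟨ψ, hψ⟩ := h3 φ _ hm
    obtain ⟨h5, h6⟩ := (h4 q hq1).1 hq
    refine ⟨φ, _, ψ, Finset.univ.image ix.r, ⟨hq1, fun x hx => ?_⟩, ?_, ?_, ix.std_onto, hψ⟩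
    · rw [h4 x hx]
      simp only [Finset.mem_image, Finset.mem_univ, true_and, forall_exists_index,
        forall_apply_eq_imp_iff, h6, and_iff_right h5]
    · simp [h6]
    · simp [ix.std_r]

end FibredDiagonals

end DiagBlowups

/-! ### Boundary defining functions as coordinates -/

section Straighten

/-- A continuous right inverse of a smooth map with injective derivative is smooth. -/
lemma contDiffOn_of_rightInvOn {E : Type*} [NormedAddCommGroup E] [NormedSpace ℝ E]
    [FiniteDimensional ℝ E] {f g : E → E} {s t : Set E} (hs : UniqueDiffOn ℝ s)
    (ht : UniqueDiffOn ℝ t) (hf : ContDiffOn ℝ ∞ f s) (hg : ContinuousOn g t) (hgm : MapsTo g t s)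
    (hfg : ∀ y ∈ t, f (g y) = y) (hinj : ∀ x ∈ s, Function.Injective (fderivWithin ℝ f s x)) :
    ContDiffOn ℝ ∞ g t := by
  have : CompleteSpace E := FiniteDimensional.complete ℝ E
  have hequiv : ∀ x ∈ s, ∃ L : E ≃L[ℝ] E, (L : E →L[ℝ] E) = fderivWithin ℝ f s x := fun x hx =>
    ⟨(LinearEquiv.ofInjectiveEndo (fderivWithin ℝ f s x : E →ₗ[ℝ] E)
      (hinj x hx)).toContinuousLinearEquiv, by ext v; rfl⟩
  have hder : ∀ y ∈ t, HasFDerivWithinAt g (ContinuousLinearMap.inverse (fderivWithin ℝ f s (g y)))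
      t y := by
    intro y hy
    obtain ⟨L, hL⟩ := hequiv _ (hgm hy)
    rw [← hL, ContinuousLinearMap.inverse_equiv]
    refine HasFDerivWithinAt.of_local_left_inverse (f := f) (t := s)
      (tendsto_nhdsWithin_iff.2 ⟨hg y hy, eventually_mem_nhdsWithin.mono fun z hz => hgm hz⟩) ?_ hy
      (eventually_mem_nhdsWithin.mono fun z hz => hfg z hz)
    rw [hL]
    exact ((hf.differentiableOn (by simp)) _ (hgm hy)).hasFDerivWithinAt
  rw [contDiffOn_infty]
  intro k
  induction k with
  | zero => exact contDiffOn_zero.2 hg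
  | succ k ih =>
    push_cast
    rw [contDiffOn_succ_iff_fderivWithin ht]
    refine ⟨fun y hy => (hder y hy).differentiableWithinAt, by simp, ?_⟩
    have h1 : ContDiffOn ℝ k (fun y => fderivWithin ℝ f s (g y)) t :=
      (hf.fderivWithin hs (m := k) (by exact_mod_cast (le_top : ((k + 1 : ℕ) : ℕ∞) ≤ ⊤))).comp ih hgm
    have h2 : ContDiffOn ℝ k
        (fun y => ContinuousLinearMap.inverse (fderivWithin ℝ f s (g y))) t := by
      intro y hy
      obtain ⟨L, hL⟩ := hequiv _ (hgm hy)
      have h3 := contDiffAt_map_inverse (𝕜 := ℝ) (n := k) L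
      rw [hL] at h3
      exact h3.comp_contDiffWithinAt y (h1 y hy)
    exact h2.congr fun y hy => (hder y hy).fderivWithin (ht y hy)

variable {m : ℕ}

/-- The point `z` with its `i`-th coordinate replaced by `s`. -/
noncomputable def setCoord (i : Fin m) (z : ℝ^m) (s : ℝ) :
    ℝ^m := z + (s - z i) • EuclideanSpace.single i 1

lemma setCoord_self (i : Fin m) (z : ℝ^m) (s : ℝ) : setCoord i z s i = s := by simp [setCoord]

lemma setCoord_of_ne {i j : Fin m} (h : j ≠ i) (z : ℝ^m) (s : ℝ) : setCoord i z s j = z j := by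
  simp [setCoord, h]

lemma setCoord_eq_iff {i : Fin m} {z w : ℝ^m} {s : ℝ} :
    setCoord i z s = w ↔ w i = s ∧ ∀ j ≠ i, w j = z j := by
  refine ⟨?_, fun ⟨h1, h2⟩ => ?_⟩
  · rintro rfl; exact ⟨setCoord_self i z s, fun j hj => setCoord_of_ne hj z s⟩
  · ext j
    by_cases hj : j = i
    · subst hj; rw [setCoord_self, h1]
    · rw [setCoord_of_ne hj, h2 j hj]

lemma setCoord_mem_quad {i : Fin m} {z : ℝ^m} (hz : z ∈ quad m) {s : ℝ}
    (hs : 0 ≤ s) : setCoord i z s ∈ quad m := by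
  intro j
  by_cases hj : j = i
  · subst hj; rwa [setCoord_self]
  · rw [setCoord_of_ne hj]; exact hz j

lemma continuous_setCoord (i : Fin m) : Continuous fun p : ℝ^m × ℝ => setCoord i p.1 p.2 := by
  have := continuous_coord i
  unfold setCoord
  fun_prop

/-- The closed box of radius `δ`. -/
def coordBox (z : ℝ^m) (δ : ℝ) : Set ℝ^m := {w | ∀ j, |w j - z j| ≤ δ}

/-- The open box of radius `δ`. -/
def openCoordBox (z : ℝ^m) (δ : ℝ) : Set ℝ^m := {w | ∀ j, |w j - z j| < δ}

lemma isOpen_openCoordBox (z : ℝ^m) (δ : ℝ) : IsOpen (openCoordBox z δ) := by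
  simp only [openCoordBox, ofPred_forall]
  exact isOpen_iInter_of_finite fun j =>
    isOpen_lt ((continuous_coord j).sub continuous_const).abs continuous_const

lemma isClosed_coordBox (z : ℝ^m) (δ : ℝ) : IsClosed (coordBox z δ) := by
  simp only [coordBox, ofPred_forall]
  exact isClosed_iInter fun j =>
    isClosed_le ((continuous_coord j).sub continuous_const).abs continuous_const

lemma openCoordBox_subset (z : ℝ^m) (δ : ℝ) :
    openCoordBox z δ ⊆ coordBox z δ := fun _ hw j => (hw j).le

lemma isCompact_coordBox (z : ℝ^m) (δ : ℝ) : IsCompact (coordBox z δ) := by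
  have h : IsCompact (Set.pi univ fun j => Icc (z j - δ) (z j + δ)) :=
    isCompact_univ_pi fun j => isCompact_Icc
  have h2 := h.image (PiLp.continuous_toLp 2 (fun _ : Fin m => ℝ))
  refine h2.of_isClosed_subset (isClosed_coordBox z δ) fun w hw => ⟨w.ofLp, fun j _ => ?_, rfl⟩
  have := abs_le.1 (hw j)
  exact ⟨by linarith [this.1], by linarith [this.2]⟩

lemma exists_coordBox_subset {z : ℝ^m} {O : Set ℝ^m}
    (hO : IsOpen O) (hz : z ∈ O) : ∃ δ > 0, coordBox z δ ⊆ O := by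
  have h1 : IsOpen ((WithLp.toLp 2 : (Fin m → ℝ) → ℝ^m) ⁻¹' O) :=
    hO.preimage (PiLp.continuous_toLp 2 _)
  obtain ⟨r, hr, hb⟩ := Metric.isOpen_iff.1 h1 z.ofLp hz
  refine ⟨r / 2, half_pos hr, fun w hw => ?_⟩
  have : w.ofLp ∈ Metric.ball z.ofLp r := by
    rw [Metric.mem_ball, dist_pi_lt_iff hr]
    exact fun j => (hw j).trans_lt (half_lt_self hr)
  exact hb this

/-- The inverse function theorem for a change of a single boundary coordinate: if `f` vanishes on
the face `{z i = 0}`, is non-negative and has a non-zero differential at a point of this face, then it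
can replace the coordinate `z i` near this point. -/
theorem exists_setCoord_inverse {i : Fin m} {f : ℝ^m → ℝ} {O : Set ℝ^m} (hO : IsOpen O) {z₀ : ℝ^m}
    (hz₀ : z₀ ∈ quad m) (hz₀O : z₀ ∈ O) (hi : z₀ i = 0) (hf : ContDiffOn ℝ ∞ f (quad m ∩ O))
    (hf0 : ∀ z ∈ quad m ∩ O, 0 ≤ f z) (hfi : ∀ z ∈ quad m ∩ O, z i = 0 → f z = 0)
    (hd : fderivWithin ℝ f (quad m) z₀ ≠ 0) : ∃ (O₁ O₂ : Set ℝ^m) (g : ℝ^m → ℝ^m),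
      IsOpen O₁ ∧ IsOpen O₂ ∧ z₀ ∈ O₁ ∧ O₁ ⊆ O ∧ ContDiffOn ℝ ∞ g (quad m ∩ O₂) ∧
      MapsTo (fun z => setCoord i z (f z)) (quad m ∩ O₁) (quad m ∩ O₂) ∧
      MapsTo g (quad m ∩ O₂) (quad m ∩ O₁) ∧ (∀ z ∈ quad m ∩ O₁, g (setCoord i z (f z)) = z) ∧
      ∀ z ∈ quad m ∩ O₂, setCoord i (g z) (f (g z)) = z := by
  set e : ℝ^m := EuclideanSpace.single i 1 with he
  have hsO : UniqueDiffOn ℝ (quad m ∩ O) := (uniqueDiffOn_quad m).inter hO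
  have hDeq : ∀ z ∈ O, fderivWithin ℝ f (quad m ∩ O) z = fderivWithin ℝ f (quad m) z :=
    fun z hz => fderivWithin_inter (hO.mem_nhds hz)
  -- the derivative in the direction `i` at the base point
  have hpos : 0 < fderivWithin ℝ f (quad m ∩ O) z₀ e := by
    obtain ⟨O', G, hO', hzO', hO'O, hG, hfG⟩ := exists_hadamard_quad {i} hO hz₀ hz₀O hf
      (fun z hz h => hfi z hz (by simpa [hi] using h))
    have hfG' : ∀ z ∈ quad m ∩ O', f z = z i * G i z := fun z hz => by rw [hfG z hz]; simp [hi]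
    have hGd := ((hG i).differentiableOn (by simp) z₀ ⟨hz₀, hzO'⟩).hasFDerivWithinAt
    have h1 : HasFDerivWithinAt (fun z : ℝ^m => z i)
        (EuclideanSpace.proj i : ℝ^m →L[ℝ] ℝ) (quad m ∩ O') z₀ :=
      (EuclideanSpace.proj i : ℝ^m →L[ℝ] ℝ).hasFDerivWithinAt
    have h2 := (h1.mul hGd).congr hfG' (hfG' z₀ ⟨hz₀, hzO'⟩)
    have h3 : fderivWithin ℝ f (quad m) z₀ = G i z₀ • EuclideanSpace.proj i := by
      rw [← fderivWithin_inter (hO'.mem_nhds hzO'),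
        h2.fderivWithin ((uniqueDiffOn_quad m).inter hO' _ ⟨hz₀, hzO'⟩), hi, zero_smul, zero_add]
    have hne : G i z₀ ≠ 0 := fun h => hd (by rw [h3, h, zero_smul])
    rw [hDeq z₀ hz₀O, h3]
    have hval : (G i z₀ • (EuclideanSpace.proj i : ℝ^m →L[ℝ] ℝ)) e = G i z₀ := by simp [he]
    rw [hval]
    by_contra hlt
    have hlt' : G i z₀ < 0 := lt_of_le_of_ne (not_lt.1 hlt) hne
    -- otherwise `f` would take negative values near the base point
    have hc : Filter.Tendsto (fun t : ℝ => setCoord i z₀ t) (𝓝[>] 0) (𝓝[quad m ∩ O'] z₀) := by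
      have h4 : Continuous fun t : ℝ => setCoord i z₀ t :=
        (continuous_setCoord i).comp (continuous_const.prodMk continuous_id)
      have h5 : setCoord i z₀ 0 = z₀ := setCoord_eq_iff.2 ⟨hi, fun _ _ => rfl⟩
      have h6 := h4.tendsto 0
      rw [h5] at h6
      refine tendsto_nhdsWithin_iff.2 ⟨h6.mono_left nhdsWithin_le_nhds, ?_⟩
      filter_upwards [self_mem_nhdsWithin, (h6.mono_left nhdsWithin_le_nhds).eventually
        (hO'.mem_nhds hzO')] with t ht ht'
      exact ⟨setCoord_mem_quad hz₀ (le_of_lt ht), ht'⟩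
    have h7 := (((hG i).continuousOn z₀ ⟨hz₀, hzO'⟩).tendsto.comp hc).eventually (gt_mem_nhds hlt')
    obtain ⟨t, ht, ht0, htm⟩ := (h7.and (eventually_mem_nhdsWithin.and
      (tendsto_nhdsWithin_iff.1 hc).2)).exists
    have ht0' : (0 : ℝ) < t := ht0
    have h8 := hf0 _ ⟨htm.1, hO'O htm.2⟩
    rw [hfG' _ htm, setCoord_self] at h8
    have ht' : G i (setCoord i z₀ t) < 0 := ht
    nlinarith
  -- a box on which it stays positive
  have hDc : ContinuousOn (fun z => fderivWithin ℝ f (quad m ∩ O) z e) (quad m ∩ O) :=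
    (hf.continuousOn_fderivWithin hsO (by simp)).clm_apply continuousOn_const
  obtain ⟨U, hU, hUeq⟩ := continuousOn_iff'.1 hDc (Ioi 0) isOpen_Ioi
  have hz₀U : z₀ ∈ U := by
    have : z₀ ∈ U ∩ (quad m ∩ O) := hUeq ▸ ⟨hpos, hz₀, hz₀O⟩
    exact this.1
  obtain ⟨δ, hδ, hbox⟩ := exists_coordBox_subset (hU.inter hO) ⟨hz₀U, hz₀O⟩
  have hDpos : ∀ z ∈ quad m ∩ coordBox z₀ δ, 0 < fderivWithin ℝ f (quad m ∩ O) z e := by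
    intro z hz
    have : z ∈ U ∩ (quad m ∩ O) := ⟨(hbox hz.2).1, hz.1, (hbox hz.2).2⟩
    rw [← hUeq] at this
    exact this.1
  set K := quad m ∩ coordBox z₀ δ with hK
  have hKO : K ⊆ quad m ∩ O := fun z hz => ⟨hz.1, (hbox hz.2).2⟩
  have hclosed : IsClosed (quad m) := by rw [← range_model_quadrant]; exact (𝓠 m).isClosed_range
  have hKc : IsCompact K := (isCompact_coordBox z₀ δ).inter_left hclosed
  have hKset : ∀ z ∈ K, ∀ s ∈ Icc 0 δ, setCoord i z s ∈ K := by
    intro z hz s hs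
    refine ⟨setCoord_mem_quad hz.1 hs.1, fun j => ?_⟩
    by_cases hj : j = i
    · subst hj; rw [setCoord_self, hi, sub_zero, abs_of_nonneg hs.1]; exact hs.2
    · rw [setCoord_of_ne hj]; exact hz.2 j
  have hKi : ∀ z ∈ K, z i ∈ Icc 0 δ := fun z hz => by
    have := hz.2 i
    rw [hi, sub_zero] at this
    exact ⟨hz.1 i, (le_abs_self _).trans this⟩
  set F : ℝ^m → ℝ^m := fun z => setCoord i z (f z) with hF
  have hFd : ContDiffOn ℝ ∞ F (quad m ∩ O) := by
    have : ContDiffOn ℝ ∞ (fun z : ℝ^m => z i) (quad m ∩ O) := (contDiff_coord i).contDiffOn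
    exact contDiffOn_id.add ((hf.sub this).smul contDiffOn_const)
  have hmono : ∀ z ∈ K, StrictMonoOn (fun s => f (setCoord i z s)) (Icc 0 δ) := by
    intro z hz
    have hder : ∀ s ∈ Icc 0 δ, HasDerivWithinAt (fun s => f (setCoord i z s))
        (fderivWithin ℝ f (quad m ∩ O) (setCoord i z s) e) (Icc 0 δ) s := by
      intro s hs
      have h1 : HasDerivAt (fun s : ℝ => setCoord i z s) e s := by
        simpa [setCoord, he] using (((hasDerivAt_id s).sub_const (z i)).smul_const e).const_add z
      exact ((hf.differentiableOn (by simp) _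
        (hKO (hKset z hz s hs))).hasFDerivWithinAt.comp_hasDerivWithinAt s h1.hasDerivWithinAt
          fun s' hs' => hKO (hKset z hz s' hs'))
    refine strictMonoOn_of_deriv_pos (convex_Icc 0 δ)
      (fun s hs => (hder s hs).continuousWithinAt) fun s hs => ?_
    rw [interior_Icc] at hs
    rw [((hder s (Ioo_subset_Icc_self hs)).hasDerivAt (Icc_mem_nhds hs.1 hs.2)).deriv]
    exact hDpos _ (hKset z hz s (Ioo_subset_Icc_self hs))
  have hFinj : InjOn F K := by
    intro z hz z' hz' h
    obtain ⟨h1, h2⟩ := setCoord_eq_iff.1 h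
    rw [setCoord_self] at h1
    have h3 : z' = setCoord i z (z' i) := (setCoord_eq_iff.2 ⟨rfl, fun j hj => by
      have := h2 j hj
      rwa [setCoord_of_ne hj] at this⟩).symm
    have h4 : setCoord i z (z i) = z := setCoord_eq_iff.2 ⟨rfl, fun _ _ => rfl⟩
    have h5 := (hmono z hz).injOn (hKi z hz) (hKi z' hz') (by
      show f (setCoord i z (z i)) = f (setCoord i z (z' i))
      rw [h4, ← h3, h1])
    rw [h3, ← h5, h4]
  set g := Function.invFunOn F K with hg
  have hgF : ∀ z ∈ K, g (F z) = z := fun z hz => hFinj.leftInvOn_invFunOn hz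
  have hgc : ContinuousOn g (F '' K) := by
    rw [continuousOn_iff_isClosed]
    intro C hC
    refine ⟨F '' (K ∩ C), ((hKc.inter_right hC).image_of_continuousOn
      (hFd.continuousOn.mono fun z hz => hKO hz.1)).isClosed, ?_⟩
    ext w
    constructor
    · rintro ⟨hw, z, hz, rfl⟩
      rw [mem_preimage, hgF z hz] at hw
      exact ⟨⟨z, ⟨hz, hw⟩, rfl⟩, z, hz, rfl⟩
    · rintro ⟨⟨z, hz, rfl⟩, -⟩
      exact ⟨by rw [mem_preimage, hgF z hz.1]; exact hz.2, z, hz.1, rfl⟩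
  -- the new coordinates fill a neighbourhood, by the intermediate value theorem
  have hz₀K : z₀ ∈ K := ⟨hz₀, fun j => by simpa using hδ.le⟩
  have hset0 : setCoord i z₀ 0 = z₀ := setCoord_eq_iff.2 ⟨hi, fun _ _ => rfl⟩
  have hf00 : f z₀ = 0 := hfi z₀ ⟨hz₀, hz₀O⟩ hi
  set c := f (setCoord i z₀ δ) with hc
  have hcpos : 0 < c := by
    have := hmono z₀ hz₀K (left_mem_Icc.2 hδ.le) (right_mem_Icc.2 hδ.le) hδ
    simpa only [hset0, hf00] using this
  have hcon : ContinuousOn (fun z => f (setCoord i z δ)) K :=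
    hf.continuousOn.comp ((continuous_setCoord i).comp
      (continuous_id.prodMk continuous_const)).continuousOn
      fun z hz => hKO (hKset z hz δ (right_mem_Icc.2 hδ.le))
  obtain ⟨V, hV, hVeq⟩ := continuousOn_iff'.1 hcon (Ioi (c / 2)) isOpen_Ioi
  have hz₀V : z₀ ∈ V := by
    have : z₀ ∈ V ∩ K := hVeq ▸ ⟨half_lt_self hcpos, hz₀K⟩
    exact this.1
  set O₂ := V ∩ openCoordBox z₀ δ ∩ {w | w i < c / 2} with hO₂
  have hO₂o : IsOpen O₂ := (hV.inter (isOpen_openCoordBox _ _)).inter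
    (isOpen_lt (continuous_coord i) continuous_const)
  have hsurj : ∀ w ∈ quad m ∩ O₂, ∃ z ∈ quad m ∩ openCoordBox z₀ δ, F z = w := by
    rintro w ⟨hw, ⟨hwV, hwb⟩, hwc⟩
    have hwK : w ∈ K := ⟨hw, openCoordBox_subset _ _ hwb⟩
    have h1 : c / 2 < f (setCoord i w δ) := by
      have : w ∈ V ∩ K := ⟨hwV, hwK⟩
      rw [← hVeq] at this
      exact this.1
    have h2 : f (setCoord i w 0) = 0 :=
      hfi _ (hKO (hKset w hwK 0 (left_mem_Icc.2 hδ.le))) (setCoord_self i w 0)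
    have h3 : ContinuousOn (fun s => f (setCoord i w s)) (Icc 0 δ) :=
      hf.continuousOn.comp ((continuous_setCoord i).comp
        (continuous_const.prodMk continuous_id)).continuousOn fun s hs => hKO (hKset w hwK s hs)
    obtain ⟨s, hs, hsw⟩ := intermediate_value_Icc hδ.le h3
      (show w i ∈ Icc _ _ from ⟨by rw [h2]; exact hw i, (lt_trans hwc h1).le⟩)
    have hsw' : f (setCoord i w s) = w i := hsw
    have hsδ : s < δ := lt_of_le_of_ne hs.2 fun h => by
      rw [h] at hsw'
      have : w i < c / 2 := hwc
      linarith
    refine ⟨setCoord i w s, ⟨setCoord_mem_quad hw hs.1, fun j => ?_⟩, ?_⟩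
    · by_cases hj : j = i
      · subst hj; rw [setCoord_self, hi, sub_zero, abs_of_nonneg hs.1]; exact hsδ
      · rw [setCoord_of_ne hj]; exact hwb j
    · refine setCoord_eq_iff.2 ⟨hsw'.symm, fun j hj => (setCoord_of_ne hj w s).symm⟩
  set s := quad m ∩ openCoordBox z₀ δ with hs
  have hsK : s ⊆ K := fun z hz => ⟨hz.1, openCoordBox_subset _ _ hz.2⟩
  obtain ⟨U₁, hU₁, hU₁eq⟩ := continuousOn_iff'.1 (hFd.continuousOn.mono (hsK.trans hKO)) O₂ hO₂o
  have hgt : ∀ w ∈ quad m ∩ O₂, g w ∈ s ∧ F (g w) = w := by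
    intro w hw
    obtain ⟨z, hz, rfl⟩ := hsurj w hw
    rw [hgF z (hsK hz)]
    exact ⟨hz, rfl⟩
  have hFq : ∀ z ∈ quad m ∩ O, F z ∈ quad m := fun z hz => setCoord_mem_quad hz.1 (hf0 z hz)
  refine ⟨U₁ ∩ openCoordBox z₀ δ, O₂, g, hU₁.inter (isOpen_openCoordBox _ _), hO₂o, ?_,
    fun z hz => (hbox (openCoordBox_subset _ _ hz.2)).2, ?_, ?_, ?_, ?_, fun w hw => (hgt w hw).2⟩
  · have hzb : z₀ ∈ openCoordBox z₀ δ := fun j => by simpa using hδ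
    have hFz : F z₀ = z₀ := setCoord_eq_iff.2 ⟨hi.trans hf00.symm, fun _ _ => rfl⟩
    have : z₀ ∈ U₁ ∩ s := by
      rw [← hU₁eq]
      refine ⟨?_, hz₀, hzb⟩
      rw [mem_preimage, hFz]
      exact ⟨⟨hz₀V, hzb⟩, by show z₀ i < c / 2; rw [hi]; exact half_pos hcpos⟩
    exact ⟨this.1, hzb⟩
  · refine contDiffOn_of_rightInvOn (f := F) (s := s)
      ((uniqueDiffOn_quad m).inter (isOpen_openCoordBox _ _)) ((uniqueDiffOn_quad m).inter hO₂o)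
      (hFd.mono (hsK.trans hKO)) (hgc.mono fun w hw => ?_) (fun w hw => (hgt w hw).1)
      (fun w hw => (hgt w hw).2) fun z hz => ?_
    · obtain ⟨z, hz, rfl⟩ := hsurj w hw
      exact ⟨z, hsK hz, rfl⟩
    · have hu : UniqueDiffWithinAt ℝ s z := (uniqueDiffOn_quad m).inter (isOpen_openCoordBox _ _) z hz
      have h1 := ((hFd.mono (hsK.trans hKO)).differentiableOn (by simp) z hz).hasFDerivWithinAt
      have h2 : fderivWithin ℝ f s z = fderivWithin ℝ f (quad m ∩ O) z := by
        rw [fderivWithin_inter ((isOpen_openCoordBox _ _).mem_nhds hz.2), hDeq z (hKO (hsK hz)).2]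
      have h3 : ∀ j, HasFDerivWithinAt (fun z => F z j)
          ((EuclideanSpace.proj j : ℝ^m →L[ℝ] ℝ).comp (fderivWithin ℝ F s z)) s z :=
        fun j => (EuclideanSpace.proj j : ℝ^m →L[ℝ] ℝ).hasFDerivAt.comp_hasFDerivWithinAt z h1
      have h4 : ∀ v j, j ≠ i → fderivWithin ℝ F s z v j = v j := by
        intro v j hj
        have h5 : HasFDerivWithinAt (fun z => F z j) (EuclideanSpace.proj j : ℝ^m →L[ℝ] ℝ) s z := by
          refine (EuclideanSpace.proj j :
            ℝ^m →L[ℝ] ℝ).hasFDerivWithinAt.congr (fun z' _ => ?_) ?_ <;>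
          exact setCoord_of_ne hj _ _
        exact congrArg (fun L => L v) (hu.eq (h3 j) h5)
      have h6 : ∀ v, fderivWithin ℝ F s z v i = fderivWithin ℝ f (quad m ∩ O) z v := by
        intro v
        have h5 : HasFDerivWithinAt (fun z => F z i) (fderivWithin ℝ f s z) s z := by
          refine ((hf.mono (hsK.trans hKO)).differentiableOn (by simp) z hz).hasFDerivWithinAt.congr
            (fun z' _ => ?_) ?_ <;>
          exact setCoord_self _ _ _
        rw [← h2]
        exact congrArg (fun L => L v) (hu.eq (h3 i) h5)
      refine (injective_iff_map_eq_zero _).2 fun v hv => ?_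
      have hvj : ∀ j, j ≠ i → v j = 0 := fun j hj => by rw [← h4 v j hj, hv]; rfl
      have hve : v = v i • e := by
        ext j
        by_cases hj : j = i
        · subst hj; simp [he]
        · simp [he, hj, hvj j hj]
      have hvi : v i * fderivWithin ℝ f (quad m ∩ O) z e = 0 := by
        rw [← smul_eq_mul, ← map_smul, ← hve, ← h6, hv]; rfl
      rw [hve, (mul_eq_zero.1 hvi).resolve_right (hDpos z (hsK hz)).ne', zero_smul]
  · rintro z ⟨hz, hz1, hz2⟩
    have : z ∈ U₁ ∩ s := ⟨hz1, hz, hz2⟩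
    rw [← hU₁eq] at this
    exact ⟨hFq z (hKO (hsK this.2)), this.1⟩
  · intro w hw
    have := hgt w hw
    have h1 : g w ∈ U₁ ∩ s := by
      rw [← hU₁eq]
      exact ⟨by rw [mem_preimage, this.2]; exact hw.2, this.1⟩
    exact ⟨this.1.1, h1.1, this.1.2⟩
  · exact fun z hz => hgF z (hsK ⟨hz.1, hz.2.2⟩)

variable {E : Type*} [NormedAddCommGroup E] [NormedSpace ℝ E] {H : Type*} [TopologicalSpace H]
  {I : ModelWithCorners ℝ E H} {M : Type*} [TopologicalSpace M] [ChartedSpace H M]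

/-- A boundary coordinate may be replaced by a boundary defining function. -/
lemma CornerChart.exists_setCoord (φ : CornerChart I M m) {i : Fin m} {p : M} (hp : p ∈ φ.source)
    {x : M → ℝ} (hx : ContMDiffOn I 𝓘(ℝ) ∞ x φ.source) (hx0 : ∀ q ∈ φ.source, 0 ≤ x q)
    (hxi : ∀ q ∈ φ.source, φ.coord i q = 0 → x q = 0) (hi : φ.coord i p = 0)
    (hd : fderivWithin ℝ (fun z => x (φ.symm (toQuad z))) (quad m) (φ p).val ≠ 0) :
    ∃ ψ : CornerChart I M m, p ∈ ψ.source ∧ ψ.source ⊆ φ.source ∧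
      (∀ q ∈ ψ.source, ψ.coord i q = x q) ∧ ∀ q ∈ ψ.source, ∀ j ≠ i, ψ.coord j q = φ.coord j q := by
  obtain ⟨O, hO, hOt⟩ := φ.exists_open_target
  have ht : ∀ z ∈ quad m ∩ O, toQuad z ∈ φ.target := fun z hz => by
    rw [hOt, mem_preimage, toQuad_val hz.1]; exact hz.2
  have htO : ∀ q ∈ φ.source, (φ q).val ∈ O := fun q hq => by
    have h : φ q ∈ φ.target := φ.map_source hq
    rw [hOt] at h; exact h
  have hs : ContMDiffOn 𝓘(ℝ, ℝ^m) 𝓘(ℝ) ∞ (fun z => x (φ.symm (toQuad z))) (quad m ∩ O) :=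
    hx.comp (φ.contMDiffOn_symm_toQuad.mono fun z hz => ⟨toQuad z, ht z hz, toQuad_val hz.1⟩)
      fun z hz => φ.symm_mem (ht z hz)
  obtain ⟨O₁, O₂, g, h1, h2, h3, h4, h5, h6, h7, h8, h9⟩ := exists_setCoord_inverse (i := i) hO
    (φ p).2 (htO p hp) hi hs.contDiffOn (fun z hz => hx0 _ (φ.symm_mem (ht z hz)))
    (fun z hz hzi => hxi _ (φ.symm_mem (ht z hz)) (by
      rw [← φ.val_apply, φ.apply_symm (ht z hz), toQuad_val hz.1]; exact hzi)) hd
  have hsm : ContDiffOn ℝ ∞ (fun z => setCoord i z (x (φ.symm (toQuad z)))) (quad m ∩ O₁) :=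
    contDiffOn_id.add (((hs.contDiffOn.mono (inter_subset_inter_right _ h4)).sub
      (contDiff_coord i).contDiffOn).smul contDiffOn_const)
  obtain ⟨ψ, hψ, hψv⟩ := φ.exists_change O₁ O₂ h1 h2 _ g hsm h5 h6 h7 h8 h9
  have hsub : ψ.source ⊆ φ.source := by rw [hψ]; exact fun q hq => hq.1
  refine ⟨ψ, by rw [hψ]; exact ⟨hp, h3⟩, hsub, fun q hq => ?_, fun q hq j hj => ?_⟩
  · rw [← ψ.val_apply, hψv q hq, setCoord_self, val_toQuad, φ.symm_apply (hsub hq)]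
  · rw [← ψ.val_apply, hψv q hq, setCoord_of_ne hj]; rfl

end Straighten

/-! ### Charts near the boundary, compatible with the fibration -/

section BdryCharts

variable {d : ℕ}

/-- A hyperplane given as the kernel of the first coordinate, together with this coordinate, splits
the space. -/
lemma exists_hyperplane_splitting {C : Type*} [NormedAddCommGroup C] [NormedSpace ℝ C]
    (L : (ℝ^d × C) ≃L[ℝ] ℝ^(d + 1)) (hL : ∀ u, L (u, 0) 0 = 0) : ∃ Λ : ℝ^(d + 1) ≃L[ℝ] ℝ × ℝ^d,
      ∀ z, Λ z = (z 0, (L.symm z).1) := by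
  have hfin : FiniteDimensional ℝ C := Module.Finite.of_surjective ((LinearMap.snd ℝ ℝ^d C).comp
      L.symm.toLinearEquiv.toLinearMap) fun c => ⟨L (0, c), by simp⟩
  have hdim : Module.finrank ℝ C = 1 := by
    have h := L.toLinearEquiv.finrank_eq
    rw [Module.finrank_prod] at h
    simp at h
    omega
  set f : ℝ^(d + 1) →ₗ[ℝ] ℝ × ℝ^d := ((EuclideanSpace.proj 0 : ℝ^(d + 1) →L[ℝ] ℝ) :
      ℝ^(d + 1) →ₗ[ℝ] ℝ).prod
      ((LinearMap.fst ℝ ℝ^d C).comp L.symm.toLinearEquiv.toLinearMap) with hf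
  have hfz : ∀ z, f z = (z 0, (L.symm z).1) := fun z => rfl
  have hinj : Function.Injective f := by
    refine (injective_iff_map_eq_zero f).2 fun z hz => ?_
    rw [hfz] at hz
    have h0 : z 0 = 0 := congrArg Prod.fst hz
    have h1 : (L.symm z).1 = 0 := congrArg Prod.snd hz
    have hzc : L (0, (L.symm z).2) = z := by rw [← h1]; exact L.apply_symm_apply z
    by_cases hc : (L.symm z).2 = 0
    · rw [← hzc, hc]; exact map_zero L
    · -- otherwise the first coordinate would vanish identically
      exfalso
      have hspan := (finrank_eq_one_iff_of_nonzero' _ hc).1 hdim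
      have hall : ∀ w, L w 0 = 0 := by
        rintro ⟨u, c⟩
        obtain ⟨t, rfl⟩ := hspan c
        have : ((u, t • (L.symm z).2) : ℝ^d × C) = (u, 0) + t • (0, (L.symm z).2) := by simp
        rw [this, map_add, map_smul, hzc]
        simp [hL, h0]
      have := hall (L.symm (EuclideanSpace.single 0 1))
      simp at this
  refine ⟨(LinearMap.linearEquivOfInjective f hinj ?_).toContinuousLinearEquiv, fun z => rfl⟩
  rw [Module.finrank_prod]
  simp [add_comm]

variable {X : Type u} [TopologicalSpace X] [ChartedSpace (EuclideanHalfSpace (d + 1)) X]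
  [IsManifold (𝓡∂ (d + 1)) ∞ X] {D : Type*} [TopologicalSpace D] [ChartedSpace ℝ^d D]

lemma isBoundaryPoint_iff_of_mem_maximalAtlas {n : ℕ} [NeZero n] {X : Type*} [TopologicalSpace X]
    [ChartedSpace (EuclideanHalfSpace n) X] [IsManifold (𝓡∂ n) ∞ X]
    {e : OpenPartialHomeomorph X (EuclideanHalfSpace n)}
    (he : e ∈ IsManifold.maximalAtlas (𝓡∂ n) ∞ X) {q : X} (hq : q ∈ e.source) :
    q ∈ ∂[n]X ↔ (e q).val 0 = 0 := by
  have hn : (∞ : ℕ∞ω) ≠ 0 := by simp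
  let φ : PartialDiffeomorph (𝓡∂ n) (𝓡∂ n) X (EuclideanHalfSpace n) ∞ :=
    { toPartialEquiv := e.toPartialEquiv
      open_source := e.open_source
      open_target := e.open_target
      contMDiffOn_toFun := contMDiffOn_of_mem_maximalAtlas he
      contMDiffOn_invFun := contMDiffOn_symm_of_mem_maximalAtlas he }
  have h1 : IsLocalDiffeomorphAt (𝓡∂ n) (𝓡∂ n) ∞ e q := ⟨φ, hq, fun _ _ => rfl⟩
  have : IsManifold (𝓡∂ n) 1 X := IsManifold.of_le (n := ∞) (by simp)
  have h2 := h1.isBoundaryPoint_iff hn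
  show (𝓡∂ n).IsBoundaryPoint q ↔ _
  rw [h2, ModelWithCorners.isBoundaryPoint_iff, frontier_range_modelWithCornersEuclideanHalfSpace]
  exact eq_comm

/-- The logarithms of the coordinates other than the first. -/
noncomputable def tailLog (z : ℝ^(d + 1)) : ℝ^d := WithLp.toLp 2 fun j => Real.log (z j.succ)

/-- Coordinates on the boundary extend to coordinates on a neighbourhood of the boundary point (up to
the exponential, which makes them positive). -/
lemma exists_chart_extending {ι : D → X} (hι : Manifold.IsSmoothEmbedding (𝓡 d) (𝓡∂ (d + 1)) ∞ ι)
    (hιX : Set.range ι = ∂[d + 1]X) (δ : PartialDiffeomorph (𝓡 d) (𝓡 d) D ℝ^d ∞) {d₀ : D}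
    (hd₀ : d₀ ∈ δ.source) : ∃ χ : CornerChart (𝓡∂ (d + 1)) X (d + 1), ι d₀ ∈ χ.source ∧
      (∀ q ∈ χ.source, ∀ j : Fin d, 0 < χ.coord j.succ q) ∧
      (∀ q ∈ χ.source, q ∈ ∂[d + 1]X ↔ χ.coord 0 q = 0) ∧ ∀ d', ι d' ∈ χ.source → d' ∈ δ.source ∧
        ∀ j : Fin d, χ.coord j.succ (ι d') = Real.exp (δ d' j) := by
  have him := hι.isImmersion.isImmersionAt d₀
  set dc := him.domChart with hdc
  set cc := him.codChart with hcc
  set L := him.equiv with hLdef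
  have hcca : cc ∈ IsManifold.maximalAtlas (𝓡∂ (d + 1)) ∞ X := him.codChart_mem_maximalAtlas
  have hdca : dc ∈ IsManifold.maximalAtlas (𝓡 d) ∞ D := him.domChart_mem_maximalAtlas
  have hmaps : ∀ d' ∈ dc.source, ι d' ∈ cc.source := fun d' hd' =>
    him.source_subset_preimage_source hd'
  have hloc : ∀ d' ∈ dc.source, (cc (ι d')).val = L (dc d', 0) := by
    intro d' hd'
    have h1 : dc.extend (𝓡 d) d' ∈ (dc.extend (𝓡 d)).target :=
      (dc.extend (𝓡 d)).map_source (by rwa [dc.extend_source])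
    have h2 := him.writtenInCharts h1
    simp only [Function.comp_apply] at h2
    rw [(dc.extend (𝓡 d)).left_inv (by rwa [dc.extend_source])] at h2
    exact h2
  have hbd : ∀ q ∈ cc.source, q ∈ ∂[d + 1]X ↔ (cc q).val 0 = 0 := fun q hq =>
    isBoundaryPoint_iff_of_mem_maximalAtlas hcca hq
  have hL0 : ∀ u, L (u, 0) 0 = 0 := by
    set ℓ : ℝ^d →L[ℝ] ℝ := ((EuclideanSpace.proj 0 : ℝ^(d + 1) →L[ℝ] ℝ).comp
        (L : (ℝ^d × him.complement) →L[ℝ] _)).comp (ContinuousLinearMap.inl ℝ _ _) with hℓ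
    have h1 : ∀ u ∈ dc.target, ℓ u = 0 := by
      intro u hu
      have h2 := hloc _ (dc.map_target hu)
      rw [dc.right_inv hu] at h2
      show L (u, 0) 0 = 0
      rw [← h2]
      exact (hbd _ (hmaps _ (dc.map_target hu))).1 (hιX ▸ mem_range_self _)
    have hu₀ : dc d₀ ∈ dc.target := dc.map_source him.mem_domChart_source
    have h3 : HasFDerivAt ℓ (0 : ℝ^d →L[ℝ] ℝ) (dc d₀) :=
      (hasFDerivAt_const (0 : ℝ) (dc d₀)).congr_of_eventuallyEq
        (Filter.eventually_of_mem (dc.open_target.mem_nhds hu₀) h1)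
    have h4 := ℓ.hasFDerivAt.unique h3
    intro u
    exact congrArg (fun T => T u) h4
  obtain ⟨Λ, hΛ⟩ := exists_hyperplane_splitting L hL0
  -- the transition between the chart of the immersion and the prescribed coordinates
  set τ : OpenPartialHomeomorph ℝ^d ℝ^d := dc.symm.trans δ.toOpenPartialHomeomorph with hτ
  have hτd : ContMDiffOn (𝓡 d) (𝓡 d) ∞ τ τ.source :=
    δ.contMDiffOn_toFun.comp ((contMDiffOn_symm_of_mem_maximalAtlas hdca).mono fun u hu => hu.1)
      fun u hu => hu.2
  have hτs : ContMDiffOn (𝓡 d) (𝓡 d) ∞ τ.symm τ.target :=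
    (contMDiffOn_of_mem_maximalAtlas hdca).comp (δ.contMDiffOn_invFun.mono fun u hu => hu.1)
      fun u hu => hu.2
  have hcv : ContMDiffOn (𝓡∂ (d + 1)) 𝓘(ℝ, ℝ^(d + 1)) ∞
      (fun q => (cc q).val) cc.source := cc.contMDiffOn_extend hcca
  set R : X → ℝ^d := fun q => (Λ (cc q).val).2 with hR
  have hRd : ContMDiffOn (𝓡∂ (d + 1)) (𝓡 d) ∞ R cc.source :=
    (((ContinuousLinearMap.snd ℝ ℝ ℝ^d).comp
      Λ.toContinuousLinearMap).contMDiff (n := ∞)).comp_contMDiffOn hcv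
  set U : Set X := cc.source ∩ R ⁻¹' τ.source with hU
  have hUo : IsOpen U := hRd.continuousOn.isOpen_inter_preimage cc.open_source τ.open_source
  set f : X → ℝ^(d + 1) := fun q =>
    WithLp.toLp 2 (Fin.cons ((cc q).val 0) fun j => Real.exp (τ (R q) j)) with hf
  have hfd : ContMDiffOn (𝓡∂ (d + 1)) 𝓘(ℝ, ℝ^(d + 1)) ∞ f U := by
    refine contMDiffOn_euclidean_iff.2 fun j => ?_
    induction j using Fin.cases with
    | zero => exact (contMDiffOn_euclidean_iff.1 hcv 0).mono inter_subset_left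
    | succ j =>
      have h1 : ContMDiffOn (𝓡∂ (d + 1)) 𝓘(ℝ, ℝ^d) ∞ (fun q => τ (R q)) U :=
        hτd.comp (hRd.mono inter_subset_left) fun q hq => hq.2
      exact Real.contDiff_exp.contMDiff.comp_contMDiffOn (contMDiffOn_euclidean_iff.1 h1 j)
  set P : Set ℝ^(d + 1) := {z | ∀ j : Fin d, 0 < z j.succ} with hP
  have hPo : IsOpen P := by
    rw [hP, ofPred_forall]
    exact isOpen_iInter_of_finite fun j => isOpen_lt continuous_const (continuous_coord _)
  have htl : ContDiffOn ℝ ∞ (tailLog (d := d)) P := by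
    rw [← contMDiffOn_iff_contDiffOn, contMDiffOn_euclidean_iff]
    exact fun j => ((contDiff_coord j.succ).contDiffOn.log fun z hz => (hz j).ne').contMDiffOn
  set G : ℝ^(d + 1) → ℝ^(d + 1) := fun z => Λ.symm (z 0, τ.symm (tailLog z)) with hG
  have hP1o : IsOpen (P ∩ tailLog ⁻¹' τ.target) :=
    htl.continuousOn.isOpen_inter_preimage hPo τ.open_target
  have hGd : ContDiffOn ℝ ∞ G (P ∩ tailLog ⁻¹' τ.target) := by
    refine Λ.symm.contDiff.comp_contDiffOn ?_
    exact (contDiff_coord 0).contDiffOn.prodMk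
      ((contMDiffOn_iff_contDiffOn.1 hτs).comp (htl.mono inter_subset_left) fun z hz => hz.2)
  obtain ⟨V, hV, hVeq⟩ := isOpen_induced_iff.1 cc.open_target
  set O : Set ℝ^(d + 1) := (P ∩ tailLog ⁻¹' τ.target) ∩ G ⁻¹' V with hO
  have hOo : IsOpen O := hGd.continuousOn.isOpen_inter_preimage hP1o hV
  have hG0 : ∀ z, G z 0 = z 0 := fun z => by
    have := hΛ (G z)
    rw [hG, Λ.apply_symm_apply] at this
    exact (congrArg Prod.fst this).symm
  set half : ℝ^(d + 1) → EuclideanHalfSpace (d + 1) := fun z => (𝓡∂ (d + 1)).symm z with hhalfdef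
  have hhalf : ∀ z : ℝ^(d + 1), 0 ≤ z 0 → (half z).val = z := fun z hz =>
    (𝓡∂ (d + 1)).right_inv (by rw [range_modelWithCornersEuclideanHalfSpace]; exact hz)
  have hGt : ∀ z ∈ quad (d + 1) ∩ O, half (G z) ∈ cc.target ∧ (half (G z)).val = G z := by
    intro z hz
    have h1 := hhalf (G z) (by rw [hG0]; exact hz.1 0)
    refine ⟨?_, h1⟩
    rw [← hVeq]
    show (half (G z)).val ∈ V
    rw [h1]; exact hz.2.2
  have hRG : ∀ z ∈ quad (d + 1) ∩ O, R (cc.symm (half (G z))) = τ.symm (tailLog z) := by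
    intro z hz
    show (Λ (cc (cc.symm (half (G z)))).val).2 = _
    rw [cc.right_inv (hGt z hz).1, (hGt z hz).2, hG, Λ.apply_symm_apply]
  have htf : ∀ q ∈ U, tailLog (f q) = τ (R q) := fun q hq => by
    ext j
    show Real.log (f q j.succ) = _
    simp [hf]
  have hGf : ∀ q ∈ U, G (f q) = (cc q).val := by
    intro q hq
    rw [hG]
    dsimp only
    rw [htf q hq, τ.left_inv hq.2, Λ.symm_apply_eq, hΛ]
    refine Prod.ext ?_ ?_
    · simp [hf]
    · show R q = _
      rw [hR]; dsimp only; rw [hΛ]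
  have hex : ∃ χ : CornerChart (𝓡∂ (d + 1)) X (d + 1), χ.source = U ∧
      χ.target = Subtype.val ⁻¹' O ∧ ∀ q ∈ U, (χ q).val = f q := by
    refine CornerChart.exists_ofMaps U hUo O hOo f (fun z => cc.symm (half (G z))) hfd ?_ ?_ ?_ ?_ ?_
    · have h1 : ContMDiffOn 𝓘(ℝ, ℝ^(d + 1)) (𝓡∂ (d + 1)) ∞
          (fun w => cc.symm (half w)) ((𝓡∂ (d + 1)) '' cc.target) := contMDiffOn_extend_symm hcca
      refine h1.comp ((hGd.mono fun z hz => hz.1).contMDiffOn.mono inter_subset_right) ?_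
      exact fun z hz => ⟨_, (hGt z hz).1, (hGt z hz).2⟩
    · intro q hq
      refine ⟨fun j => ?_, ⟨⟨fun j => ?_, ?_⟩, ?_⟩⟩
      · induction j using Fin.cases with
        | zero => simpa [hf] using (cc q).2
        | succ j => simpa [hf] using (Real.exp_pos (τ (R q) j)).le
      · simpa [hf] using Real.exp_pos (τ (R q) j)
      · rw [mem_preimage, htf q hq]; exact τ.map_source hq.2
      · rw [mem_preimage, hGf q hq]
        have h : cc q ∈ cc.target := cc.map_source hq.1
        rw [← hVeq] at h; exact h
    · intro z hz
      refine ⟨cc.map_target (hGt z hz).1, ?_⟩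
      rw [mem_preimage, hRG z hz]
      exact τ.map_target hz.2.1.2
    · intro q hq
      show cc.symm (half (G (f q))) = q
      rw [hGf q hq]
      have : half (cc q).val = cc q := (𝓡∂ (d + 1)).left_inv (cc q)
      rw [this, cc.left_inv hq.1]
    · intro z hz
      ext j
      induction j using Fin.cases with
      | zero =>
        show f (cc.symm (half (G z))) 0 = z 0
        have : f (cc.symm (half (G z))) 0 = (cc (cc.symm (half (G z)))).val 0 := by simp [hf]
        rw [this, cc.right_inv (hGt z hz).1, (hGt z hz).2, hG0]
      | succ j =>
        have : f (cc.symm (half (G z))) j.succ = Real.exp (τ (R (cc.symm (half (G z)))) j) := by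
          simp [hf]
        rw [this, hRG z hz, τ.right_inv hz.2.1.2]
        exact Real.exp_log (hz.2.1.1 j)
  obtain ⟨χ, hs, ht, hv⟩ := hex
  -- near the boundary point, the preimage under `ι` lies in the domain of the chart of `D`
  obtain ⟨U', hU', hU'eq⟩ := hι.isEmbedding.isInducing.isOpen_iff.1
    (dc.open_source.inter δ.open_source)
  have hU'm : ∀ d', ι d' ∈ U' ↔ d' ∈ dc.source ∧ d' ∈ δ.source := fun d' => by
    rw [← mem_preimage, hU'eq]; rfl
  have hRι : ∀ d' ∈ dc.source, R (ι d') = dc d' := by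
    intro d' hd'
    show (Λ (cc (ι d')).val).2 = _
    rw [hΛ, hloc d' hd', L.symm_apply_apply]
  have hco : ∀ q ∈ U, χ.coord 0 q = (cc q).val 0 ∧
      ∀ j : Fin d, χ.coord j.succ q = Real.exp (τ (R q) j) := by
    intro q hq
    refine ⟨?_, fun j => ?_⟩ <;> rw [← χ.val_apply, hv q hq]
    · simp [hf]
    · simp [hf]
  refine ⟨χ.restrOpen U' hU', ⟨?_, (hU'm d₀).2 ⟨him.mem_domChart_source, hd₀⟩⟩,
    fun q hq j => ?_, fun q hq => ?_, fun d' hd' => ?_⟩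
  · show ι d₀ ∈ χ.source
    rw [hs]
    refine ⟨him.mem_codChart_source, ?_⟩
    rw [mem_preimage, hRι d₀ him.mem_domChart_source]
    refine ⟨dc.map_source him.mem_domChart_source, ?_⟩
    show dc.symm (dc d₀) ∈ δ.source
    rwa [dc.left_inv him.mem_domChart_source]
  · have hqU : q ∈ U := hs ▸ hq.1
    rw [CornerChart.restrOpen_coord, (hco q hqU).2]
    exact Real.exp_pos _
  · have hqU : q ∈ U := hs ▸ hq.1
    rw [CornerChart.restrOpen_coord, (hco q hqU).1]
    exact hbd q hqU.1
  · have hqU : ι d' ∈ U := hs ▸ hd'.1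
    obtain ⟨h1, h2⟩ := (hU'm d').1 hd'.2
    refine ⟨h2, fun j => ?_⟩
    have h3 : τ (dc d') = δ d' := by
      show δ (dc.symm (dc d')) = δ d'
      rw [dc.left_inv h1]
    rw [CornerChart.restrOpen_coord, (hco _ hqU).2, hRι d' h1, h3]

/-- The differential of a function does not vanish in a chart where it does not vanish. -/
lemma fderivWithin_chart_ne_zero {n : ℕ} [NeZero n] {X : Type*} [TopologicalSpace X]
    [ChartedSpace (EuclideanHalfSpace n) X] {m : ℕ}
    (χ : CornerChart (𝓡∂ n) X m) {x : X → ℝ} (hx : ContMDiff (𝓡∂ n) 𝓘(ℝ) ∞ x) {p : X}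
    (hp : p ∈ χ.source) (hd : mfderiv (𝓡∂ n) 𝓘(ℝ) x p ≠ 0) :
    fderivWithin ℝ (fun z => x (χ.symm (toQuad z))) (quad m) (χ p).val ≠ 0 := by
  intro h0
  obtain ⟨O, hO, hOt⟩ := χ.exists_open_target
  have hpO : (χ p).val ∈ O := by
    have h : χ p ∈ χ.target := χ.map_source hp
    rw [hOt] at h; exact h
  have ht : ∀ z ∈ quad m ∩ O, toQuad z ∈ χ.target := fun z hz => by
    rw [hOt, mem_preimage, toQuad_val hz.1]; exact hz.2
  have hs : ContDiffOn ℝ ∞ (fun z => x (χ.symm (toQuad z))) (quad m ∩ O) :=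
    (hx.comp_contMDiffOn (χ.contMDiffOn_symm_toQuad.mono
      fun z hz => ⟨toQuad z, ht z hz, toQuad_val hz.1⟩)).contDiffOn
  have h1 : HasFDerivWithinAt (fun z => x (χ.symm (toQuad z)))
      (0 : ℝ^m →L[ℝ] ℝ) (quad m) (χ p).val := by
    have := (hs.differentiableOn (by simp) _ ⟨(χ p).2, hpO⟩).hasFDerivWithinAt
    rw [fderivWithin_inter (hO.mem_nhds hpO), h0] at this
    exact this.mono_of_mem_nhdsWithin (inter_mem_nhdsWithin _ (hO.mem_nhds hpO))
  have h2 : MDifferentiableAt (𝓡∂ n) 𝓘(ℝ, ℝ^m) (fun q => (χ q).val) p :=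
    (χ.contMDiffOn_val.contMDiffAt (χ.open_source.mem_nhds hp)).mdifferentiableAt (by simp)
  have h3 := HasMFDerivWithinAt.comp p
    (hasMFDerivWithinAt_iff_hasFDerivWithinAt.2 h1) (h2.hasMFDerivAt.hasMFDerivWithinAt (s := univ))
    (fun q _ => (χ q).2)
  rw [hasMFDerivWithinAt_univ] at h3
  have h4 := h3.congr_of_eventuallyEq (f₁ := x) (by
    filter_upwards [χ.open_source.mem_nhds hp] with q hq
    show x q = x (χ.symm (toQuad (χ q).val))
    rw [val_toQuad, χ.symm_apply hq])
  exact hd (h4.mfderiv.trans (ContinuousLinearMap.zero_comp _))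

end BdryCharts

/-! ### Pairs of charts, compatible with the fibration -/

section FibreCharts

variable {h v : ℕ} {D : Type*} [TopologicalSpace D] [ChartedSpace ℝ^(h + v) D]
  {Y : Type*} [TopologicalSpace Y] [ChartedSpace ℝ^h Y] [IsManifold (𝓡 h) ∞ Y]
  {Z : Type*} [TopologicalSpace Z] [ChartedSpace ℝ^v Z] [IsManifold (𝓡 v) ∞ Z]

/-- Coordinates on the total space of a fibration, of which the first are those of a given chart of
the base. -/
lemma exists_fibreCoordinates {Φ : D → Y} {V : Set Y}
    (e : PartialDiffeomorph (𝓡 (h + v)) ((𝓡 h).prod (𝓡 v)) D (Y × Z) ∞)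
    (hes : e.source = Φ ⁻¹' V) (heΦ : ∀ q ∈ e.source, (e q).1 = Φ q) {d₀ : D} (hd₀ : Φ d₀ ∈ V) :
    ∃ δ : PartialDiffeomorph (𝓡 (h + v)) (𝓡 (h + v)) D ℝ^(h + v) ∞,
      d₀ ∈ δ.source ∧ ∀ d' ∈ δ.source, Φ d' ∈ V ∧ Φ d' ∈ (chartAt ℝ^h (Φ d₀)).source ∧
        ∀ i, δ d' (Fin.castAdd v i) = chartAt ℝ^h (Φ d₀) (Φ d') i := by
  set η := chartAt ℝ^h (Φ d₀) with hη
  set ζ := chartAt ℝ^v (e d₀).2 with hζ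
  have hηd : ContMDiffOn (𝓡 h) (𝓡 h) ∞ η η.source := contMDiffOn_chart
  have hζd : ContMDiffOn (𝓡 v) (𝓡 v) ∞ ζ ζ.source := contMDiffOn_chart
  have hηs : ContMDiffOn (𝓡 h) (𝓡 h) ∞ η.symm η.target := contMDiffOn_chart_symm
  have hζs : ContMDiffOn (𝓡 v) (𝓡 v) ∞ ζ.symm ζ.target := contMDiffOn_chart_symm
  have hed : ContMDiffOn (𝓡 (h + v)) ((𝓡 h).prod (𝓡 v)) ∞ e e.source := e.contMDiffOn_toFun
  have h1 : ContMDiffOn (𝓡 (h + v)) (𝓡 h) ∞ (fun q => (e q).1) e.source :=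
    contMDiff_fst.comp_contMDiffOn hed
  have h2 : ContMDiffOn (𝓡 (h + v)) (𝓡 v) ∞ (fun q => (e q).2) e.source :=
    contMDiff_snd.comp_contMDiffOn hed
  set S : Set D := e.source ∩ e ⁻¹' (η.source ×ˢ ζ.source) with hS
  set fst : ℝ^(h + v) → ℝ^h := fun w => WithLp.toLp 2 fun i => w (Fin.castAdd v i) with hfst
  set snd : ℝ^(h + v) → ℝ^v := fun w => WithLp.toLp 2 fun i => w (Fin.natAdd h i) with hsnd
  have hfd : ContMDiff (𝓡 (h + v)) (𝓡 h) ∞ fst :=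
    ContDiff.contMDiff (f := fst) (contDiff_euclidean.2 fun i => contDiff_coord _)
  have hsd : ContMDiff (𝓡 (h + v)) (𝓡 v) ∞ snd :=
    ContDiff.contMDiff (f := snd) (contDiff_euclidean.2 fun i => contDiff_coord _)
  set T : Set ℝ^(h + v) := fst ⁻¹' η.target ∩ snd ⁻¹' ζ.target with hT
  have hTo : IsOpen T := (η.open_target.preimage hfd.continuous).inter
    (ζ.open_target.preimage hsd.continuous)
  have hg : ContMDiffOn (𝓡 (h + v)) ((𝓡 h).prod (𝓡 v)) ∞
      (fun w => ((η.symm (fst w), ζ.symm (snd w)) : Y × Z)) T :=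
    (hηs.comp hfd.contMDiffOn fun w hw => hw.1).prodMk (hζs.comp hsd.contMDiffOn fun w hw => hw.2)
  set join : D → ℝ^(h + v) := fun q => WithLp.toLp 2 (Fin.append (η (e q).1) (ζ (e q).2)) with hjoin
  have hj1 : ∀ q, fst (join q) = η (e q).1 := fun q => by ext i; simp [hfst, hjoin]
  have hj2 : ∀ q, snd (join q) = ζ (e q).2 := fun q => by ext i; simp [hsnd, hjoin]
  have hjd : ContMDiffOn (𝓡 (h + v)) (𝓡 (h + v)) ∞ join S := by
    refine contMDiffOn_euclidean_iff.2 fun i => ?_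
    induction i using Fin.addCases with
    | left i =>
      have h3 : ContMDiffOn (𝓡 (h + v)) (𝓡 h) ∞ (fun q => η (e q).1) S :=
        hηd.comp (h1.mono inter_subset_left) fun q hq => hq.2.1
      exact (contMDiffOn_euclidean_iff.1 h3 i).congr fun q _ => by simp [hjoin]
    | right i =>
      have h3 : ContMDiffOn (𝓡 (h + v)) (𝓡 v) ∞ (fun q => ζ (e q).2) S :=
        hζd.comp (h2.mono inter_subset_left) fun q hq => hq.2.2
      exact (contMDiffOn_euclidean_iff.1 h3 i).congr fun q _ => by simp [hjoin]
  refine ⟨{ toFun := join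
            invFun := fun w => e.symm (η.symm (fst w), ζ.symm (snd w))
            source := S
            target := T ∩ (fun w => ((η.symm (fst w), ζ.symm (snd w)) : Y × Z)) ⁻¹' e.target
            map_source' := fun q hq => ?_
            map_target' := fun w hw => ?_
            left_inv' := fun q hq => ?_
            right_inv' := fun w hw => ?_
            open_source := hed.continuousOn.isOpen_inter_preimage e.open_source
              (η.open_source.prod ζ.open_source)
            open_target := hg.continuousOn.isOpen_inter_preimage hTo e.open_target
            contMDiffOn_toFun := hjd
            contMDiffOn_invFun := e.contMDiffOn_invFun.comp (hg.mono inter_subset_left)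
              fun w hw => hw.2 }, ?_, fun d' hd' => ?_⟩
  · have h3 : (η.symm (fst (join q)), ζ.symm (snd (join q))) = e q := by
      rw [hj1, hj2, η.left_inv hq.2.1, ζ.left_inv hq.2.2]
    refine ⟨⟨?_, ?_⟩, ?_⟩
    · rw [mem_preimage, hj1]; exact η.map_source hq.2.1
    · rw [mem_preimage, hj2]; exact ζ.map_source hq.2.2
    · rw [mem_preimage, h3]; exact e.map_source hq.1
  · refine ⟨e.map_target hw.2, ?_⟩
    have h3 : e (e.symm (η.symm (fst w), ζ.symm (snd w))) = (η.symm (fst w), ζ.symm (snd w)) :=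
      e.right_inv hw.2
    rw [mem_preimage, h3]
    exact ⟨η.map_target hw.1.1, ζ.map_target hw.1.2⟩
  · show e.symm (η.symm (fst (join q)), ζ.symm (snd (join q))) = q
    rw [hj1, hj2, η.left_inv hq.2.1, ζ.left_inv hq.2.2]
    exact e.left_inv hq.1
  · have h3 : e (e.symm (η.symm (fst w), ζ.symm (snd w))) = (η.symm (fst w), ζ.symm (snd w)) :=
      e.right_inv hw.2
    show join (e.symm (η.symm (fst w), ζ.symm (snd w))) = w
    ext i
    induction i using Fin.addCases with
    | left i => simp only [hjoin, h3, Fin.append_left, η.right_inv hw.1.1]; rfl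
    | right i => simp only [hjoin, h3, Fin.append_right, ζ.right_inv hw.1.2]; rfl
  · have h3 : d₀ ∈ e.source := by rw [hes]; exact hd₀
    refine ⟨h3, ?_, mem_chart_source _ _⟩
    rw [heΦ d₀ h3]; exact mem_chart_source _ _
  · obtain ⟨h3, h4, -⟩ := hd'
    rw [heΦ d' h3] at h4
    refine ⟨by rw [hes] at h3; exact h3, h4, fun i => ?_⟩
    show join d' _ = _
    simp [hjoin, heΦ d' h3]

variable {X : Type u} [TopologicalSpace X] [ChartedSpace (EuclideanHalfSpace (h + v + 1)) X]
  [IsManifold (𝓡∂ (h + v + 1)) ∞ X]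

/-- Charts of `X` at the points of a fibre of `Φ`: the boundary defining function is the first
coordinate, and the next `h` are, on the boundary, given by the same coordinates of `Y`. -/
lemma exists_bdryCharts {ι : D → X}
    (hι : Manifold.IsSmoothEmbedding (𝓡 (h + v)) (𝓡∂ (h + v + 1)) ∞ ι)
    (hιX : Set.range ι = ∂[h + v + 1]X) {Φ : D → Y}
    (hΦ : IsSmoothFibration (h + v) h v Z Φ) {x : X → ℝ}
    (hx : IsBdryDefiningFunction (h + v + 1) x) (y : Y) {V₁ : Set Y} (hV₁ : IsOpen V₁)
    (hy : y ∈ V₁) : ∃ (V : Set Y) (η : Y → Fin (h + v + 1) → ℝ), V ⊆ V₁ ∧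
      (∀ z ∈ V, ∀ z' ∈ V, z = z' ↔ ∀ j, j ≠ 0 → j.val ≤ h → η z j = η z' j) ∧
      ∀ d, Φ d = y → ∃ χ : CornerChart (𝓡∂ (h + v + 1)) X (h + v + 1), ι d ∈ χ.source ∧
        (∀ q ∈ χ.source, χ.coord 0 q = x q) ∧ (∀ q ∈ χ.source, ∀ j, j ≠ 0 → 0 < χ.coord j q) ∧
        ∀ d', ι d' ∈ χ.source → Φ d' ∈ V ∧
          ∀ j, j ≠ 0 → j.val ≤ h → χ.coord j (ι d') = η (Φ d') j := by
  obtain ⟨V, e, hV, hyV, hes, -, heΦ⟩ := hΦ y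
  set κ := chartAt ℝ^h y with hκ
  refine ⟨V ∩ V₁ ∩ κ.source,
    fun z => Fin.cons 0 fun i => Real.exp (Fin.append (κ z) (0 : Fin v → ℝ) i),
    fun z hz => hz.1.2, fun z hz z' hz' => ⟨fun h => by rw [h]; simp, fun hzz => ?_⟩,
    fun d hd => ?_⟩
  · refine κ.injOn hz.2 hz'.2 ?_
    ext i
    have := hzz (Fin.castAdd v i).succ (Fin.succ_ne_zero _) (by simp)
    simpa using this
  · subst hd
    obtain ⟨δ, hd₀, hδ⟩ := exists_fibreCoordinates e hes heΦ hyV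
    -- the coordinates of `D` are restricted to the part over `V₁`
    have hΦc : ContinuousOn Φ e.source := by
      have h1 : ContinuousOn (fun q => (e q).1) e.source :=
        continuous_fst.comp_continuousOn e.contMDiffOn_toFun.continuousOn
      exact h1.congr fun q hq => (heΦ q hq).symm
    obtain ⟨U', hU', hU'eq⟩ := hι.isEmbedding.isInducing.isOpen_iff.1
      (hΦc.isOpen_inter_preimage e.open_source hV₁)
    obtain ⟨χ, h1, h2, h3, h4⟩ := exists_chart_extending hι hιX δ hd₀
    have hp : ι d ∈ ∂[h + v + 1]X := hιX ▸ mem_range_self d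
    obtain ⟨ψ, h5, h6, h7, h8⟩ := χ.exists_setCoord (i := 0) h1 hx.1.contMDiffOn
      (fun q _ => hx.2.1 q) (fun q hq hq0 => (hx.2.2.1 q).2 ((h3 q hq).2 hq0))
      ((h3 _ h1).1 hp) (fderivWithin_chart_ne_zero χ hx.1 h1 (hx.2.2.2 _ hp))
    refine ⟨ψ.restrOpen U' hU', ⟨h5, ?_⟩, fun q hq => h7 q hq.1, fun q hq j hj => ?_,
      fun d' hd' => ?_⟩
    · have : d ∈ ι ⁻¹' U' := by
        rw [hU'eq]
        exact ⟨by rw [hes]; exact hyV, hy⟩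
      exact this
    · rw [CornerChart.restrOpen_coord, h8 q hq.1 j hj]
      obtain ⟨i, rfl⟩ := Fin.exists_succ_eq.2 hj
      exact h2 q (h6 hq.1) i
    · obtain ⟨h9, h10⟩ := h4 d' (h6 hd'.1)
      obtain ⟨h11, h12, h13⟩ := hδ d' h9
      have h14 : d' ∈ ι ⁻¹' U' := hd'.2
      rw [hU'eq] at h14
      refine ⟨⟨⟨h11, h14.2⟩, h12⟩, fun j hj hjh => ?_⟩
      rw [CornerChart.restrOpen_coord, h8 _ hd'.1 j hj]
      obtain ⟨i, rfl⟩ := Fin.exists_succ_eq.2 hj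
      rw [h10 i]
      induction i using Fin.addCases with
      | left i => rw [h13 i]; simp [hκ]
      | right i => simp at hjh

/-- Charts at interior points, with positive coordinates. -/
lemma exists_interiorChart {n : ℕ} [NeZero n] {X : Type*} [TopologicalSpace X]
    [ChartedSpace (EuclideanHalfSpace n) X] [IsManifold (𝓡∂ n) ∞ X] {x : X → ℝ}
    (hx : IsBdryDefiningFunction n x) {p : X} (hp : p ∉ ∂[n]X) :
    ∃ χ : CornerChart (𝓡∂ n) X n, p ∈ χ.source ∧ (∀ q ∈ χ.source, ∀ j, 0 < χ.coord j q) ∧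
      ∀ q ∈ χ.source, 0 < x q := by
  have hca := IsManifold.chart_mem_maximalAtlas (I := 𝓡∂ n) (n := ∞) p
  set c := chartAt (EuclideanHalfSpace n) p with hc
  have hcv : ContMDiffOn (𝓡∂ n) 𝓘(ℝ, ℝ^n) ∞ (fun q => (c q).val) c.source :=
    c.contMDiffOn_extend hca
  obtain ⟨V, hV, hVeq⟩ := isOpen_induced_iff.1 c.open_target
  have hpc : p ∈ c.source := mem_chart_source _ p
  have hp0 : 0 < (c p).val 0 := lt_of_le_of_ne (c p).2 fun h =>
    hp ((isBoundaryPoint_iff_of_mem_maximalAtlas hca hpc).2 h.symm)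
  set L : ℝ^n → ℝ^n := fun z => WithLp.toLp 2 fun j => Real.log (z j) with hL
  set P : Set ℝ^n := {z | ∀ j, 0 < z j} with hP
  have hPo : IsOpen P := by
    rw [hP, ofPred_forall]
    exact isOpen_iInter_of_finite fun j => isOpen_lt continuous_const (continuous_coord _)
  have hLd : ContDiffOn ℝ ∞ L P :=
    contDiffOn_toLp fun j => (contDiff_coord j).contDiffOn.log fun z hz => (hz j).ne'
  have hV' : IsOpen (V ∩ {z | 0 < z 0}) := hV.inter (isOpen_lt continuous_const (continuous_coord 0))
  set half : ℝ^n → EuclideanHalfSpace n := fun z => (𝓡∂ n).symm z with hhalfdef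
  have hhalf : ∀ z : ℝ^n, 0 ≤ z 0 → (half z).val = z := fun z hz =>
    (𝓡∂ n).right_inv (by rw [range_modelWithCornersEuclideanHalfSpace]; exact hz)
  have hLt : ∀ z ∈ P ∩ L ⁻¹' (V ∩ {z | 0 < z 0}), half (L z) ∈ c.target ∧ (half (L z)).val = L z := by
    intro z hz
    have h1 := hhalf (L z) (le_of_lt hz.2.2)
    refine ⟨?_, h1⟩
    rw [← hVeq]
    show (half (L z)).val ∈ V
    rw [h1]; exact hz.2.1
  have hexp : ∀ q, L (WithLp.toLp 2 fun j => Real.exp ((c q).val j)) = (c q).val := fun q => by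
    ext j; simp [hL]
  have hU : IsOpen (c.source ∩ (fun q => (c q).val) ⁻¹' {z | 0 < z 0}) :=
    hcv.continuousOn.isOpen_inter_preimage c.open_source
      (isOpen_lt continuous_const (continuous_coord 0))
  have hex : ∃ χ : CornerChart (𝓡∂ n) X n,
      χ.source = c.source ∩ (fun q => (c q).val) ⁻¹' {z | 0 < z 0} ∧
      χ.target = Subtype.val ⁻¹' (P ∩ L ⁻¹' (V ∩ {z | 0 < z 0})) ∧
      ∀ q ∈ c.source ∩ (fun q => (c q).val) ⁻¹' {z | 0 < z 0},
        (χ q).val = WithLp.toLp 2 fun j => Real.exp ((c q).val j) := by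
    refine CornerChart.exists_ofMaps _ hU _ (hLd.continuousOn.isOpen_inter_preimage hPo hV') _
      (fun z => c.symm (half (L z))) ?_ ?_ (fun q hq => ⟨fun j => ?_, fun j => ?_, ?_⟩) ?_ ?_ ?_
    · exact contMDiffOn_euclidean_iff.2 fun j => Real.contDiff_exp.contMDiff.comp_contMDiffOn
        ((contMDiffOn_euclidean_iff.1 hcv j).mono inter_subset_left)
    · have h1 : ContMDiffOn 𝓘(ℝ, ℝ^n) (𝓡∂ n) ∞ (fun w => c.symm (half w))
          ((𝓡∂ n) '' c.target) := contMDiffOn_extend_symm hca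
      refine h1.comp ((hLd.mono fun z hz => hz.1).contMDiffOn.mono inter_subset_right) ?_
      exact fun z hz => ⟨_, (hLt z hz.2).1, (hLt z hz.2).2⟩
    · exact (Real.exp_pos _).le
    · exact Real.exp_pos _
    · rw [mem_preimage, hexp]
      refine ⟨?_, hq.2⟩
      have h : c q ∈ c.target := c.map_source hq.1
      rw [← hVeq] at h; exact h
    · intro z hz
      refine ⟨c.map_target (hLt z hz.2).1, ?_⟩
      show 0 < (c (c.symm (half (L z)))).val 0
      rw [c.right_inv (hLt z hz.2).1, (hLt z hz.2).2]
      exact hz.2.2.2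
    · intro q hq
      have : half (c q).val = c q := (𝓡∂ n).left_inv (c q)
      rw [hexp, this, c.left_inv hq.1]
    · intro z hz
      ext j
      show Real.exp ((c (c.symm (half (L z)))).val j) = z j
      rw [c.right_inv (hLt z hz.2).1, (hLt z hz.2).2]
      exact Real.exp_log (hz.2.1 j)
  obtain ⟨χ, hs, -, hv⟩ := hex
  have hO : IsOpen {q | 0 < x q} := isOpen_lt continuous_const hx.1.continuous
  refine ⟨χ.restrOpen _ hO, ⟨?_, ?_⟩, fun q hq j => ?_, fun q hq => hq.2⟩
  · show p ∈ χ.source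
    rw [hs]; exact ⟨hpc, hp0⟩
  · exact lt_of_le_of_ne (hx.2.1 p) fun h => hp ((hx.2.2.1 p).1 h.symm)
  · have h1 : q ∈ χ.source := hq.1
    rw [hs] at h1
    rw [CornerChart.restrOpen_coord, ← χ.val_apply, hv q h1]
    exact Real.exp_pos _

end FibreCharts

section FibrePairs

variable {n : ℕ} [NeZero n] {X : Type u} [TopologicalSpace X]
  [ChartedSpace (EuclideanHalfSpace n) X] {D Y : Type*}

/-- A pair of charts of `X`, in whose domains the boundary, the fibre diagonal, the diagonal and the
hypersurface `x = x'` are given by equalities of coordinates, or are empty (as recorded by the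
propositions `fl` for the fibre diagonal and `fl'` for the diagonal). -/
structure FibrePair (ι : D → X) (Φ : D → Y) (x : X → ℝ) (h : ℕ) (χ χ' : CornerChart (𝓡∂ n) X n)
    (fl fl' : Prop) : Prop where
  pos : ∀ q ∈ χ.source, ∀ j, j ≠ 0 → 0 < χ.coord j q
  pos' : ∀ q ∈ χ'.source, ∀ j, j ≠ 0 → 0 < χ'.coord j q
  bdry : ∀ q ∈ χ.source, q ∈ ∂[n]X ↔ χ.coord 0 q = 0
  bdry' : ∀ q ∈ χ'.source, q ∈ ∂[n]X ↔ χ'.coord 0 q = 0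
  fib : ∀ q ∈ χ.source, ∀ q' ∈ χ'.source, (∃ d d', ι d = q ∧ ι d' = q' ∧ Φ d = Φ d') ↔
    fl ∧ χ.coord 0 q = 0 ∧ χ'.coord 0 q' = 0 ∧ ∀ j, j ≠ 0 → j.val ≤ h → χ.coord j q = χ'.coord j q'
  diag : ∀ q ∈ χ.source, ∀ q' ∈ χ'.source, q = q' ↔ fl' ∧ ∀ j, χ.coord j q = χ'.coord j q'
  level : fl → ∀ q ∈ χ.source, ∀ q' ∈ χ'.source, x q = x q' ↔ χ.coord 0 q = χ'.coord 0 q'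

lemma FibrePair.symm {ι : D → X} {Φ : D → Y} {x : X → ℝ} {h : ℕ}
    {χ χ' : CornerChart (𝓡∂ n) X n} {fl fl' : Prop} (P : FibrePair ι Φ x h χ χ' fl fl') :
    FibrePair ι Φ x h χ' χ fl fl' where
  pos := P.pos'
  pos' := P.pos
  bdry := P.bdry'
  bdry' := P.bdry
  fib q hq q' hq' := by
    have h1 := P.fib q' hq' q hq
    constructor
    · rintro ⟨d, d', h2, h3, h4⟩
      obtain ⟨h5, h6, h7, h8⟩ := h1.1 ⟨d', d, h3, h2, h4.symm⟩
      exact ⟨h5, h7, h6, fun j hj hj' => (h8 j hj hj').symm⟩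
    · rintro ⟨h5, h6, h7, h8⟩
      obtain ⟨d, d', h2, h3, h4⟩ := h1.2 ⟨h5, h7, h6, fun j hj hj' => (h8 j hj hj').symm⟩
      exact ⟨d', d, h3, h2, h4.symm⟩
  diag q hq q' hq' := by
    rw [eq_comm, P.diag q' hq' q hq]
    exact and_congr_right fun _ => forall_congr' fun j => eq_comm
  level hfl q hq q' hq' := by rw [eq_comm, P.level hfl q' hq' q hq, eq_comm]

end FibrePairs

section FibrePairsExist

variable {h v : ℕ} {D : Type*} [TopologicalSpace D] [ChartedSpace ℝ^(h + v) D]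
  {Y : Type*} [TopologicalSpace Y] [ChartedSpace ℝ^h Y] [IsManifold (𝓡 h) ∞ Y] [T2Space Y]
  {Z : Type*} [TopologicalSpace Z] [ChartedSpace ℝ^v Z] [IsManifold (𝓡 v) ∞ Z]
  {X : Type u} [TopologicalSpace X] [ChartedSpace (EuclideanHalfSpace (h + v + 1)) X]
  [IsManifold (𝓡∂ (h + v + 1)) ∞ X] [T2Space X]

lemma exists_fibrePair {ι : D → X}
    (hι : Manifold.IsSmoothEmbedding (𝓡 (h + v)) (𝓡∂ (h + v + 1)) ∞ ι)
    (hιX : Set.range ι = ∂[h + v + 1]X) {Φ : D → Y}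
    (hΦ : IsSmoothFibration (h + v) h v Z Φ) {x : X → ℝ}
    (hx : IsBdryDefiningFunction (h + v + 1) x) (p p' : X) :
    ∃ (χ χ' : CornerChart (𝓡∂ (h + v + 1)) X (h + v + 1)) (fl fl' : Prop),
      p ∈ χ.source ∧ p' ∈ χ'.source ∧ FibrePair ι Φ x h χ χ' fl fl' := by
  have hbx : ∀ d, x (ι d) = 0 := fun d => (hx.2.2.1 _).2 (hιX ▸ mem_range_self d)
  -- it suffices to treat the conditions other than the one on the diagonal
  suffices hs : ∃ (χ χ' : CornerChart (𝓡∂ (h + v + 1)) X (h + v + 1)) (fl : Prop),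
      p ∈ χ.source ∧ p' ∈ χ'.source ∧ (p = p' → χ = χ') ∧
      (∀ q ∈ χ.source, ∀ j, j ≠ 0 → 0 < χ.coord j q) ∧
      (∀ q ∈ χ'.source, ∀ j, j ≠ 0 → 0 < χ'.coord j q) ∧
      (∀ q ∈ χ.source, x q = 0 ↔ χ.coord 0 q = 0) ∧ (∀ q ∈ χ'.source, x q = 0 ↔ χ'.coord 0 q = 0) ∧
      (∀ q ∈ χ.source, ∀ q' ∈ χ'.source, (∃ d d', ι d = q ∧ ι d' = q' ∧ Φ d = Φ d') ↔
        fl ∧ χ.coord 0 q = 0 ∧ χ'.coord 0 q' = 0 ∧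
          ∀ j, j ≠ 0 → j.val ≤ h → χ.coord j q = χ'.coord j q') ∧
      (fl → ∀ q ∈ χ.source, ∀ q' ∈ χ'.source, x q = x q' ↔ χ.coord 0 q = χ'.coord 0 q') by
    obtain ⟨χ, χ', fl, h1, h2, h3, h4, h5, h6, h7, h8, h9⟩ := hs
    by_cases hpp : p = p'
    · obtain rfl := h3 hpp
      exact ⟨χ, χ, fl, True, h1, h2, h4, h4, fun q hq => by rw [← hx.2.2.1, h6 q hq],
        fun q hq => by rw [← hx.2.2.1, h6 q hq], h8, fun q hq q' hq' =>
        ⟨fun h => ⟨trivial, fun j => by rw [h]⟩, fun h => χ.ext_coord hq hq' h.2⟩, h9⟩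
    · obtain ⟨O, O', hO, hO', hpO, hpO', hd⟩ := t2_separation hpp
      refine ⟨χ.restrOpen O hO, χ'.restrOpen O' hO', fl, False, ⟨h1, hpO⟩, ⟨h2, hpO'⟩,
        fun q hq => h4 q hq.1, fun q hq => h5 q hq.1,
        fun q hq => by rw [← hx.2.2.1, h6 q hq.1]; rfl,
        fun q hq => by rw [← hx.2.2.1, h7 q hq.1]; rfl,
        fun q hq q' hq' => h8 q hq.1 q' hq'.1, fun q hq q' hq' => ⟨fun h => ?_, fun h => h.1.elim⟩,
        fun hfl q hq q' hq' => h9 hfl q hq.1 q' hq'.1⟩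
      exact (disjoint_left.1 hd hq.2 (h ▸ hq'.2)).elim
  have hone : ∀ p, ∃ χ : CornerChart (𝓡∂ (h + v + 1)) X (h + v + 1), p ∈ χ.source ∧
      (∀ q ∈ χ.source, ∀ j, j ≠ 0 → 0 < χ.coord j q) ∧ (∀ q ∈ χ.source, x q = 0 ↔ χ.coord 0 q = 0) ∧
      (p ∉ ∂[h + v + 1]X → ∀ q ∈ χ.source, x q ≠ 0) := by
    intro p
    by_cases hp : p ∈ ∂[h + v + 1]X
    · obtain ⟨d, rfl⟩ : p ∈ range ι := hιX ▸ hp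
      obtain ⟨V, η, -, -, hch⟩ := exists_bdryCharts hι hιX hΦ hx (Φ d) isOpen_univ (mem_univ _)
      obtain ⟨χ, hc1, hc2, hc3, -⟩ := hch d rfl
      exact ⟨χ, hc1, hc3, fun q hq => by rw [hc2 q hq], fun h => (h hp).elim⟩
    · obtain ⟨χ, h1, h2, h3⟩ := exists_interiorChart hx hp
      exact ⟨χ, h1, fun q hq j _ => h2 q hq j,
        fun q hq => iff_of_false (h3 q hq).ne' (h2 q hq 0).ne', fun _ q hq => (h3 q hq).ne'⟩
  by_cases hpp : p ∈ ∂[h + v + 1]X ∧ p' ∈ ∂[h + v + 1]X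
  · obtain ⟨d, rfl⟩ : p ∈ range ι := hιX ▸ hpp.1
    obtain ⟨d', rfl⟩ : p' ∈ range ι := hιX ▸ hpp.2
    by_cases hdd : Φ d = Φ d'
    · -- two boundary points in the same fibre
      obtain ⟨V, η, -, hη, hch⟩ := exists_bdryCharts hι hιX hΦ hx (Φ d) isOpen_univ (mem_univ _)
      choose χ hc1 hc2 hc3 hc4 using hch
      refine ⟨χ d rfl, χ d' hdd.symm, True, hc1 d rfl, hc1 d' _, fun h => ?_, hc3 d rfl, hc3 d' _,
        fun q hq => by rw [hc2 d rfl q hq], fun q hq => by rw [hc2 d' _ q hq], ?_,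
        fun _ q hq q' hq' => by rw [hc2 d rfl q hq, hc2 d' _ q' hq']⟩
      · obtain rfl := hι.isEmbedding.injective h; rfl
      · intro q hq q' hq'
        constructor
        · rintro ⟨e, e', rfl, rfl, hee⟩
          refine ⟨trivial, by rw [hc2 d rfl _ hq, hbx], by rw [hc2 d' _ _ hq', hbx],
            fun j hj hjh => ?_⟩
          rw [(hc4 d rfl e hq).2 j hj hjh, (hc4 d' _ e' hq').2 j hj hjh, hee]
        · rintro ⟨-, h0, h0', hj⟩
          rw [hc2 d rfl _ hq, hx.2.2.1, ← hιX] at h0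
          rw [hc2 d' _ _ hq', hx.2.2.1, ← hιX] at h0'
          obtain ⟨e, rfl⟩ := h0
          obtain ⟨e', rfl⟩ := h0'
          refine ⟨e, e', rfl, rfl, (hη _ (hc4 d rfl e hq).1 _ (hc4 d' _ e' hq').1).2
            fun j hj0 hjh => ?_⟩
          rw [← (hc4 d rfl e hq).2 j hj0 hjh, ← (hc4 d' _ e' hq').2 j hj0 hjh, hj j hj0 hjh]
    · -- two boundary points in different fibres
      obtain ⟨O, O', hO, hO', hdO, hdO', hdis⟩ := t2_separation hdd
      obtain ⟨V, η, hVO, -, hch⟩ := exists_bdryCharts hι hιX hΦ hx (Φ d) hO hdO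
      obtain ⟨V', η', hVO', -, hch'⟩ := exists_bdryCharts hι hιX hΦ hx (Φ d') hO' hdO'
      obtain ⟨χ, hc1, hc2, hc3, hc4⟩ := hch d rfl
      obtain ⟨χ', hc1', hc2', hc3', hc4'⟩ := hch' d' rfl
      refine ⟨χ, χ', False, hc1, hc1', fun h => (hdd ?_).elim, hc3, hc3',
        fun q hq => by rw [hc2 q hq], fun q hq => by rw [hc2' q hq],
        fun q hq q' hq' => ⟨?_, fun h => h.1.elim⟩, fun h => h.elim⟩
      · rw [hι.isEmbedding.injective h]
      · rintro ⟨e, e', rfl, rfl, hee⟩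
        have h1 := hVO (hc4 e hq).1
        rw [hee] at h1
        exact (disjoint_left.1 hdis h1 (hVO' (hc4' e' hq').1)).elim
  · -- away from the boundary the fibre diagonal is empty
    choose χ hc1 hc3 hc4 hc5 using hone
    refine ⟨χ p, χ p', False, hc1 p, hc1 p', fun h => by rw [h], hc3 p, hc3 p', hc4 p, hc4 p',
      fun q hq q' hq' => ⟨?_, fun h => h.1.elim⟩, fun h => h.elim⟩
    rintro ⟨e, e', rfl, rfl, -⟩
    rw [not_and_or] at hpp
    exact (hpp.elim (fun h => hc5 p h _ hq (hbx e)) fun h => hc5 p' h _ hq' (hbx e')).elim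

end FibrePairsExist

/-! ### Charts of products and of intervals -/

section Products

variable {E : Type*} [NormedAddCommGroup E] [NormedSpace ℝ E] {H : Type*} [TopologicalSpace H]
  {I : ModelWithCorners ℝ E H} {M : Type*} [TopologicalSpace M] [ChartedSpace H M]
  {E' : Type*} [NormedAddCommGroup E'] [NormedSpace ℝ E'] {H' : Type*} [TopologicalSpace H']
  {J : ModelWithCorners ℝ E' H'} {N : Type*} [TopologicalSpace N] [ChartedSpace H' N] {m k : ℕ}

/-- The product of two charts. -/
lemma CornerChart.exists_prod (φ : CornerChart I M m) (ψ : CornerChart J N k) :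
    ∃ θ : CornerChart (I.prod J) (M × N) (m + k), θ.source = φ.source ×ˢ ψ.source ∧
      (∀ q ∈ θ.source, ∀ i, θ.coord (Fin.castAdd k i) q = φ.coord i q.1) ∧
      ∀ q ∈ θ.source, ∀ i, θ.coord (Fin.natAdd m i) q = ψ.coord i q.2 := by
  obtain ⟨O, hO, hOt⟩ := φ.exists_open_target
  obtain ⟨O', hO', hOt'⟩ := ψ.exists_open_target
  set fst : ℝ^(m + k) → ℝ^m := fun w => WithLp.toLp 2 fun i => w (Fin.castAdd k i) with hfst
  set snd : ℝ^(m + k) → ℝ^k := fun w => WithLp.toLp 2 fun i => w (Fin.natAdd m i) with hsnd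
  have hfd : ContMDiff 𝓘(ℝ, ℝ^(m + k)) 𝓘(ℝ, ℝ^m) ∞ fst :=
    ContDiff.contMDiff (f := fst) (contDiff_euclidean.2 fun i => contDiff_coord _)
  have hsd : ContMDiff 𝓘(ℝ, ℝ^(m + k)) 𝓘(ℝ, ℝ^k) ∞ snd :=
    ContDiff.contMDiff (f := snd) (contDiff_euclidean.2 fun i => contDiff_coord _)
  have hfq : ∀ w ∈ quad (m + k), fst w ∈ quad m := fun w hw i => hw _
  have hsq : ∀ w ∈ quad (m + k), snd w ∈ quad k := fun w hw i => hw _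
  set join : M × N → ℝ^(m + k) := fun q =>
    WithLp.toLp 2 (Fin.append (fun i => φ.coord i q.1) fun i => ψ.coord i q.2) with hjoin
  have hj1 : ∀ q, fst (join q) = (φ q.1).val := fun q => by
    ext i; simp [hfst, hjoin, CornerChart.coord]
  have hj2 : ∀ q, snd (join q) = (ψ q.2).val := fun q => by
    ext i; simp [hsnd, hjoin, CornerChart.coord]
  have ht : ∀ w ∈ quad (m + k) ∩ (fst ⁻¹' O ∩ snd ⁻¹' O'), toQuad (fst w) ∈ φ.target ∧
      toQuad (snd w) ∈ ψ.target := by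
    intro w hw
    rw [hOt, hOt', mem_preimage, mem_preimage, toQuad_val (hfq w hw.1), toQuad_val (hsq w hw.1)]
    exact hw.2
  have hex : ∃ θ : CornerChart (I.prod J) (M × N) (m + k), θ.source = φ.source ×ˢ ψ.source ∧
      θ.target = Subtype.val ⁻¹' (fst ⁻¹' O ∩ snd ⁻¹' O') ∧
      ∀ q ∈ φ.source ×ˢ ψ.source, (θ q).val = join q := by
    refine CornerChart.exists_ofMaps _ (φ.open_source.prod ψ.open_source) _
      ((hO.preimage hfd.continuous).inter (hO'.preimage hsd.continuous)) join
      (fun w => (φ.symm (toQuad (fst w)), ψ.symm (toQuad (snd w)))) ?_ ?_ ?_ ?_ ?_ ?_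
    · refine contMDiffOn_euclidean_iff.2 fun i => ?_
      induction i using Fin.addCases with
      | left i =>
        exact ((φ.contMDiffOn_coord i).comp contMDiff_fst.contMDiffOn fun q hq => hq.1).congr
          fun q _ => by simp [hjoin]
      | right i =>
        exact ((ψ.contMDiffOn_coord i).comp contMDiff_snd.contMDiffOn fun q hq => hq.2).congr
          fun q _ => by simp [hjoin]
    · exact (φ.contMDiffOn_symm_toQuad.comp hfd.contMDiffOn fun w hw =>
        ⟨_, (ht w hw).1, toQuad_val (hfq w hw.1)⟩).prodMk
        (ψ.contMDiffOn_symm_toQuad.comp hsd.contMDiffOn fun w hw =>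
        ⟨_, (ht w hw).2, toQuad_val (hsq w hw.1)⟩)
    · intro q hq
      refine ⟨fun i => ?_, ?_, ?_⟩
      · induction i using Fin.addCases with
        | left i => simpa [hjoin] using φ.coord_nonneg i q.1
        | right i => simpa [hjoin] using ψ.coord_nonneg i q.2
      · rw [mem_preimage, hj1]
        have h : φ q.1 ∈ φ.target := φ.map_source hq.1
        rw [hOt] at h; exact h
      · rw [mem_preimage, hj2]
        have h : ψ q.2 ∈ ψ.target := ψ.map_source hq.2
        rw [hOt'] at h; exact h
    · exact fun w hw => ⟨φ.symm_mem (ht w hw).1, ψ.symm_mem (ht w hw).2⟩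
    · intro q hq
      rw [hj1, hj2, val_toQuad, val_toQuad, φ.symm_apply hq.1, ψ.symm_apply hq.2]
    · intro w hw
      ext i
      induction i using Fin.addCases with
      | left i =>
        simp only [hjoin, Fin.append_left, CornerChart.coord, φ.apply_symm (ht w hw).1,
          toQuad_val (hfq w hw.1)]
        rfl
      | right i =>
        simp only [hjoin, Fin.append_right, CornerChart.coord, ψ.apply_symm (ht w hw).2,
          toQuad_val (hsq w hw.1)]
        rfl
  obtain ⟨θ, hs, -, hv⟩ := hex
  refine ⟨θ, hs, fun q hq i => ?_, fun q hq i => ?_⟩ <;>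
    rw [← θ.val_apply, hv q (hs ▸ hq)] <;> simp [hjoin]

variable {ε₀ : ℝ} [hε : Fact (0 < ε₀)]

/-- The coordinates `t` and `ε₀ - t` of `[0,ε₀]`. -/
lemma exists_iccChart (s c : ℝ) (hs : s = 1 ∧ c = 0 ∨ s = -1 ∧ c = ε₀) :
    ∃ θ : CornerChart (𝓡∂ 1) (Icc (0 : ℝ) ε₀) 1, θ.source = {t | c + s * t.val < ε₀} ∧
      ∀ t ∈ θ.source, θ.coord 0 t = c + s * t.val := by
  have hss : s * s = 1 := by rcases hs with ⟨h, -⟩ | ⟨h, -⟩ <;> rw [h] <;> norm_num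
  have hsc : c + s * c = 0 ∨ s = 1 ∧ c = 0 := by
    rcases hs with ⟨h, h'⟩ | ⟨h, h'⟩
    · right; exact ⟨h, h'⟩
    · left; rw [h]; ring
  have hscc : c * (1 + s) = 0 := by rcases hs with ⟨h, h'⟩ | ⟨h, h'⟩ <;> rw [h, h'] <;> ring
  have hinv : ∀ t : ℝ, c + s * (c + s * t) = t := fun t => by linear_combination hscc + t * hss
  have hmem : ∀ t : ℝ, t ∈ Icc 0 ε₀ → c + s * t ∈ Icc 0 ε₀ := by
    rintro t ⟨h0, h1⟩
    rcases hs with ⟨h, h'⟩ | ⟨h, h'⟩ <;> rw [h, h'] <;> constructor <;> linarith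
  set g : ℝ → ℝ := fun t => c + s * t with hg
  have hgd : ContDiff ℝ ∞ g := by fun_prop
  have hval : ContMDiff (𝓡∂ 1) 𝓘(ℝ) ∞ fun t : Icc (0 : ℝ) ε₀ => t.val := contMDiff_subtypeVal_Icc
  have hU : IsOpen {t : Icc (0 : ℝ) ε₀ | c + s * t.val < ε₀} :=
    isOpen_lt (hgd.continuous.comp continuous_subtype_val) continuous_const
  have hO : IsOpen {z : ℝ^1 | z 0 < ε₀} := isOpen_lt (continuous_coord 0) continuous_const
  have hin : ∀ z ∈ quad 1 ∩ {z : ℝ^1 | z 0 < ε₀}, g (z 0) ∈ Icc 0 ε₀ :=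
    fun z hz => hmem _ ⟨hz.1 0, le_of_lt hz.2⟩
  have hex : ∃ θ : CornerChart (𝓡∂ 1) (Icc (0 : ℝ) ε₀) 1, θ.source = {t | c + s * t.val < ε₀} ∧
      θ.target = Subtype.val ⁻¹' {z : ℝ^1 | z 0 < ε₀} ∧
      ∀ t ∈ {t : Icc (0 : ℝ) ε₀ | c + s * t.val < ε₀}, (θ t).val = WithLp.toLp 2 fun _ => g t.val := by
    refine CornerChart.exists_ofMaps _ hU _ hO _
      (fun z => projIcc 0 ε₀ hε.out.le (g (z 0))) ?_ ?_ ?_ ?_ ?_ ?_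
    · exact contMDiffOn_euclidean_iff.2 fun _ => (hgd.contMDiff.comp hval).contMDiffOn
    · exact contMDiffOn_projIcc.comp
        (hgd.comp (contDiff_coord 0)).contMDiff.contMDiffOn fun z hz => hin z hz
    · exact fun t ht => ⟨fun _ => (hmem _ t.2).1, ht⟩
    · intro z hz
      show c + s * (projIcc 0 ε₀ hε.out.le (g (z 0))).val < ε₀
      rw [projIcc_of_mem _ (hin z hz)]
      show c + s * (c + s * z 0) < ε₀
      rw [hinv]; exact hz.2
    · intro t ht
      show projIcc 0 ε₀ hε.out.le (g (g t.val)) = t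
      rw [show g (g t.val) = t.val from hinv _, projIcc_val]
    · intro z hz
      ext i
      have : i = 0 := Subsingleton.elim _ _
      subst this
      show g (projIcc 0 ε₀ hε.out.le (g (z 0))).val = z 0
      rw [projIcc_of_mem _ (hin z hz)]
      exact hinv _
  obtain ⟨θ, hs', -, hv⟩ := hex
  exact ⟨θ, hs', fun t ht => by rw [← θ.val_apply, hv t (hs' ▸ ht)]⟩

end Products

/-! ### Charts of the single space -/

section SingleSpace

variable {n : ℕ} [NeZero n] {X : Type u} [TopologicalSpace X]
  [ChartedSpace (EuclideanHalfSpace n) X] {ε₀ : ℝ} [hε : Fact (0 < ε₀)]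

/-- The product of a chart of `X` and one of the charts `t`, `ε₀ - t` of `[0,ε₀]`. -/
lemma exists_singleBaseChart (χ : CornerChart (𝓡∂ n) X n) (s c : ℝ)
    (hs : s = 1 ∧ c = 0 ∨ s = -1 ∧ c = ε₀) :
    ∃ θ : CornerChart ((𝓡∂ n).prod (𝓡∂ 1)) (X × Icc (0 : ℝ) ε₀) (n + 1),
      (∀ w, w ∈ θ.source ↔ w.1 ∈ χ.source ∧ c + s * w.2.val < ε₀) ∧
      (∀ w ∈ θ.source, ∀ j : Fin n, θ.coord j.castSucc w = χ.coord j w.1) ∧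
      ∀ w ∈ θ.source, θ.coord (Fin.last n) w = c + s * w.2.val := by
  obtain ⟨η, hη, hη'⟩ := exists_iccChart (ε₀ := ε₀) s c hs
  obtain ⟨θ, h1, h2, h3⟩ := χ.exists_prod η
  refine ⟨θ, fun w => ?_, fun w hw j => h2 w hw j, fun w hw => ?_⟩
  · rw [h1, mem_prod, hη]; rfl
  · rw [← hη' _ (h1 ▸ hw).2]; exact h3 w hw 0

/-- A chart `ψ` over the domain of the chart `χ` of `X`, in which the boundary coordinate `χ_0` and
the parameter `ε` are given by the function `G` of the first and the last coordinate. -/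
structure SingleChart {T : Type*} [TopologicalSpace T] [ChartedSpace ℝ₊^(n + 1) T]
    (κ : T → X × Icc (0 : ℝ) ε₀) (χ : CornerChart (𝓡∂ n) X n) (G : ℝ → ℝ → ℝ × ℝ)
    (ψ : 𝓒[n + 1] T) : Prop where
  mem : ∀ y ∈ ψ.source, (κ y).1 ∈ χ.source
  coord : ∀ y ∈ ψ.source, ∀ j : Fin n, j ≠ 0 → χ.coord j (κ y).1 = ψ.coord j.castSucc y
  bdry : ∀ y ∈ ψ.source, (χ.coord 0 (κ y).1, (κ y).2.val) =
    G (ψ.coord (Fin.castSucc 0) y) (ψ.coord (Fin.last n) y)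

/-- The types of charts of the single space over a point with parameter `t`: away from the front
face, near the lift of `X × {0}`, and near the lift of `∂X × [0,ε₀]`. -/
inductive IsSingleForm (ε₀ t : ℝ) : (ℝ → ℝ → ℝ × ℝ) → Prop
  | int (ht : 0 < t) : IsSingleForm ε₀ t fun a k => (a, ε₀ - k)
  | left (ht : t = 0) : IsSingleForm ε₀ t fun a k => (a, a * k)
  | right (ht : t = 0) : IsSingleForm ε₀ t fun a k => (a * k, k)

variable (B : AdiabaticSingleSpace n X ε₀) {χ : CornerChart (𝓡∂ n) X n}
  (hχ : ∀ q ∈ χ.source, q ∈ ∂[n]X ↔ χ.coord 0 q = 0) {p : X} (hp : p ∈ χ.source)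
  {z : ℝ₊^(n + 1)} (hz : ∀ j : Fin n, j ≠ 0 → z.val j.castSucc = χ.coord j p)

include hχ hp hz

omit hχ in
lemma exists_singleChart_int {t : Icc (0 : ℝ) ε₀} (ht : 0 < t.val)
    (h0 : z.val (Fin.castSucc 0) = χ.coord 0 p) (h1 : z.val (Fin.last n) = ε₀ - t.val) :
    ∃ ψ : 𝓒[n + 1] B.total, SingleChart B.down χ (fun a k => (a, ε₀ - k)) ψ ∧ z ∈ ψ.target := by
  obtain ⟨θ, hs, hj, hl⟩ := exists_singleBaseChart (ε₀ := ε₀) χ (-1) ε₀ (Or.inr ⟨rfl, rfl⟩)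
  have hpS : (p, t) ∉ atZero ε₀ ∂[n]X := fun h => ht.ne' h.2
  obtain ⟨y, -, hy⟩ := B.isBlowup.bijOn.surjOn hpS
  have hpθ : (p, t) ∈ θ.source := (hs _).2 ⟨hp, by simp only; linarith⟩
  obtain ⟨ψ, hyψ, hψ⟩ := B.exists_offCentreChart θ (hy ▸ hpθ) (hy ▸ hpS)
  have hc : ∀ x ∈ ψ.source, ∀ i, ψ.coord i x = θ.coord i (B.down x) := fun x hx i => by
    rw [← ψ.val_apply, (hψ x hx).2.2]; rfl
  refine ⟨ψ, ⟨fun y hy => ((hs _).1 (hψ y hy).1).1, fun y hy j _ => ?_, fun y hy => ?_⟩, ?_⟩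
  · rw [hc y hy, hj _ (hψ y hy).1]
  · rw [hc y hy, hc y hy, hj _ (hψ y hy).1, hl _ (hψ y hy).1]
    simp
  · have : z = ψ y := by
      apply Subtype.ext
      ext i
      rw [ψ.val_apply, hc y hyψ, hy]
      induction i using Fin.lastCases with
      | last => rw [hl _ hpθ, h1]; ring
      | cast j =>
        rw [hj _ hpθ]
        by_cases hj0 : j = 0
        · rw [hj0, h0]
        · rw [hz j hj0]
    rw [this]
    exact ψ.map_source hyψ

/-- Charts of projective type on the single space, centred over a boundary point. -/
lemma exists_singleChart_proj (hp0 : χ.coord 0 p = 0) :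
    (z.val (Fin.castSucc 0) = 0 → ∃ ψ : 𝓒[n + 1] B.total,
      SingleChart B.down χ (fun a k => (a, a * k)) ψ ∧ z ∈ ψ.target) ∧
    (z.val (Fin.last n) = 0 → ∃ ψ : 𝓒[n + 1] B.total,
      SingleChart B.down χ (fun a k => (a * k, k)) ψ ∧ z ∈ ψ.target) := by
  obtain ⟨θ, hs, hj, hl⟩ := exists_singleBaseChart (ε₀ := ε₀) χ 1 0 (Or.inl ⟨rfl, rfl⟩)
  set t : Icc (0 : ℝ) ε₀ := ⟨0, le_rfl, hε.out.le⟩ with ht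
  have hpS : (p, t) ∈ atZero ε₀ ∂[n]X := ⟨(hχ p hp).2 hp0, rfl⟩
  have hpθ : (p, t) ∈ θ.source := (hs _).2 ⟨hp, by simpa [ht] using hε.out⟩
  have hl0 : (Fin.last n) ≠ Fin.castSucc (0 : Fin n) := (Fin.castSucc_ne_last _).symm
  have hc0 : θ.coord (Fin.castSucc 0) (p, t) = 0 := by rw [hj _ hpθ, hp0]
  have hcl : θ.coord (Fin.last n) (p, t) = 0 := by rw [hl _ hpθ]; simp [ht]
  have had : IsAdaptedChart (atZero ε₀ ∂[n]X) (p, t) θ {Fin.castSucc 0, Fin.last n} := by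
    refine ⟨hpθ, fun w hw => ?_⟩
    simp only [Finset.mem_insert, Finset.mem_singleton, forall_eq_or_imp, forall_eq, hc0, hcl]
    rw [hj w hw, hl w hw, zero_add, one_mul, ← hχ _ ((hs w).1 hw).1]
    rfl
  have key : ∀ i ∈ ({Fin.castSucc 0, Fin.last n} : Finset (Fin (n + 1))),
      θ.coord i (p, t) = 0 → z.val i = 0 → ∃ ψ : 𝓒[n + 1] B.total, z ∈ ψ.target ∧
        (∀ y ∈ ψ.source, B.down y ∈ θ.source) ∧
        (∀ y ∈ ψ.source, θ.coord i (B.down y) = ψ.coord i y) ∧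
        (∀ y ∈ ψ.source, ∀ i' ∈ ({Fin.castSucc 0, Fin.last n} : Finset (Fin (n + 1))), i' ≠ i →
          θ.coord i' (B.down y) = ψ.coord i y * ψ.coord i' y) ∧ ∀ y ∈ ψ.source, ∀ j : Fin n, j ≠ 0 →
          θ.coord j.castSucc (B.down y) = ψ.coord j.castSucc y := by
    intro i hi hi0 hzi
    let a : ProjIdx ((𝓡∂ n).prod (𝓡∂ 1)) (n + 1) (atZero ε₀ ∂[n]X) :=
      ⟨(p, t), θ, {Fin.castSucc 0, Fin.last n}, i, 1, hpS, had, hi, Or.inl rfl, fun _ => rfl⟩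
    obtain ⟨ψ, h1, h2⟩ := B.exists_projChart a
    have hca : ∀ i' ∈ a.A, a.c i' = 0 := by
      intro i' hi'
      rcases Finset.mem_insert.1 hi' with rfl | hi'
      · exact hc0
      · rw [Finset.mem_singleton.1 hi']; exact hcl
    refine ⟨ψ, ?_, fun y hy => ?_, fun y hy => Blowup.coord_down_bdry_self h2 hy (hca _ hi),
      fun y hy i' hi' hne => Blowup.coord_down_bdry h2 hy hne hi' (hca _ hi'),
      fun y hy j hj0 => Blowup.coord_down_notMem h2 hy ?_⟩
    · rw [h1, ← val_toQuad z]
      refine (a.exists_mem_W z.val z.2 hzi (fun j hj hc => absurd (hca j hj) hc) fun j hj' => ?_).1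
      induction j using Fin.lastCases with
      | last => exact absurd (by simp [a]) hj'
      | cast j =>
        have hj0 : j ≠ 0 := by rintro rfl; exact hj' (by simp [a])
        rw [hz j hj0, ← hj _ hpθ]; rfl
    · rw [← (h2 y hy).2]; exact a.P_mem (h2 y hy).1
    · show j.castSucc ∉ ({Fin.castSucc 0, Fin.last n} : Finset (Fin (n + 1)))
      simp [Fin.castSucc_ne_last, hj0]
  refine ⟨fun h => ?_, fun h => ?_⟩
  · obtain ⟨ψ, h1, h2, h3, h4, h5⟩ := key _ (by simp) hc0 h
    refine ⟨ψ, ⟨fun y hy => ((hs _).1 (h2 y hy)).1, fun y hy j hj0 => ?_, fun y hy => ?_⟩, h1⟩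
    · rw [← h5 y hy j hj0, hj _ (h2 y hy)]
    · have h6 := h3 y hy
      have h7 := h4 y hy _ (by simp) hl0
      rw [hj _ (h2 y hy)] at h6
      rw [hl _ (h2 y hy), zero_add, one_mul] at h7
      rw [h6, h7]
  · obtain ⟨ψ, h1, h2, h3, h4, h5⟩ := key _ (by simp) hcl h
    refine ⟨ψ, ⟨fun y hy => ((hs _).1 (h2 y hy)).1, fun y hy j hj0 => ?_, fun y hy => ?_⟩, h1⟩
    · rw [← h5 y hy j hj0, hj _ (h2 y hy)]
    · have h6 := h3 y hy
      have h7 := h4 y hy _ (by simp) hl0.symm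
      rw [hj _ (h2 y hy)] at h7
      rw [hl _ (h2 y hy), zero_add, one_mul] at h6
      rw [h6, h7, mul_comm]

lemma exists_singleChart_left (h0 : z.val (Fin.castSucc 0) = χ.coord 0 p)
    (h1 : z.val (Fin.castSucc 0) * z.val (Fin.last n) = 0) : ∃ ψ : 𝓒[n + 1] B.total,
      SingleChart B.down χ (fun a k => (a, a * k)) ψ ∧ z ∈ ψ.target := by
  by_cases hp0 : χ.coord 0 p = 0
  · exact (exists_singleChart_proj B hχ hp hz hp0).1 (h0.trans hp0)
  obtain ⟨θ, hs, hj, hl⟩ := exists_singleBaseChart (ε₀ := ε₀) χ 1 0 (Or.inl ⟨rfl, rfl⟩)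
  set t : Icc (0 : ℝ) ε₀ := ⟨0, le_rfl, hε.out.le⟩ with ht
  have hl0 : (Fin.last n) ≠ Fin.castSucc (0 : Fin n) := (Fin.castSucc_ne_last _).symm
  have hpS : (p, t) ∉ atZero ε₀ ∂[n]X := fun h => hp0 ((hχ p hp).1 h.1)
  obtain ⟨y, -, hy⟩ := B.isBlowup.bijOn.surjOn hpS
  have hpθ : (p, t) ∈ θ.source := (hs _).2 ⟨hp, by simpa [ht] using hε.out⟩
  obtain ⟨ψ', hyψ, hψ⟩ := B.exists_offCentreChart θ (hy ▸ hpθ) (hy ▸ hpS)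
  have hc : ∀ x ∈ ψ'.source, ∀ i, ψ'.coord i x = θ.coord i (B.down x) := fun x hx i => by
    rw [← ψ'.val_apply, (hψ x hx).2.2]; rfl
  obtain ⟨ψ, hψs, hψl, hψj⟩ := ψ'.exists_divide {Fin.last n} (fun _ => Fin.castSucc 0)
    (by simpa using hl0.symm)
  have hsub : ∀ x ∈ ψ.source, x ∈ ψ'.source ∧ 0 < ψ'.coord (Fin.castSucc 0) x := fun x hx => by
    rw [hψs] at hx; exact ⟨hx.1, hx.2 (Fin.last n) (by simp)⟩
  have hcj : ∀ x ∈ ψ.source, ∀ j : Fin n, ψ.coord j.castSucc x = χ.coord j (B.down x).1 := by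
    intro x hx j
    rw [hψj x hx _ (by simp [Fin.castSucc_ne_last]), hc x (hsub x hx).1,
      hj _ (hψ x (hsub x hx).1).1]
  have hcl : ∀ x ∈ ψ.source, ψ.coord (Fin.last n) x = (B.down x).2.val / χ.coord 0 (B.down x).1 := by
    intro x hx
    rw [hψl x hx _ (by simp), hc x (hsub x hx).1, hc x (hsub x hx).1,
      hj _ (hψ x (hsub x hx).1).1, hl _ (hψ x (hsub x hx).1).1, zero_add, one_mul]
  have hpos : ∀ x ∈ ψ.source, χ.coord 0 (B.down x).1 ≠ 0 := fun x hx => by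
    have := (hsub x hx).2
    rw [hc x (hsub x hx).1, hj _ (hψ x (hsub x hx).1).1] at this
    exact this.ne'
  have hyψ' : y ∈ ψ.source := by
    rw [hψs]
    refine ⟨hyψ, fun _ _ => ?_⟩
    rw [hc y hyψ, hy, hj _ hpθ]
    exact lt_of_le_of_ne (χ.coord_nonneg 0 p) (Ne.symm hp0)
  refine ⟨ψ, ⟨fun y hy => ((hs _).1 (hψ y (hsub y hy).1).1).1, fun y hy j _ => (hcj y hy j).symm,
    fun y hy => ?_⟩, ?_⟩
  · rw [hcj y hy, hcl y hy, mul_div_cancel₀ _ (hpos y hy)]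
  · have : z = ψ y := by
      apply Subtype.ext
      ext i
      rw [ψ.val_apply]
      induction i using Fin.lastCases with
      | last =>
        rw [hcl y hyψ', hy, (mul_eq_zero.1 h1).resolve_left (h0 ▸ hp0)]
        simp [ht]
      | cast j =>
        rw [hcj y hyψ', hy]
        by_cases hj0 : j = 0
        · rw [hj0, h0]
        · rw [hz j hj0]
    rw [this]
    exact ψ.map_source hyψ'

/-- There are charts of the single space of all types, with prescribed coordinates over a given
point. -/
lemma exists_singleChart {G : ℝ → ℝ → ℝ × ℝ} {t : Icc (0 : ℝ) ε₀} (hG : IsSingleForm ε₀ t.val G)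
    (h0 : (χ.coord 0 p, t.val) = G (z.val (Fin.castSucc 0)) (z.val (Fin.last n))) :
    ∃ ψ : 𝓒[n + 1] B.total, SingleChart B.down χ G ψ ∧ z ∈ ψ.target := by
  cases hG with
  | int ht =>
    obtain ⟨h1, h2⟩ := Prod.mk.inj h0
    exact exists_singleChart_int B hp hz ht h1.symm (by linarith)
  | left ht =>
    obtain ⟨h1, h2⟩ := Prod.mk.inj h0
    exact exists_singleChart_left B hχ hp hz h1.symm (by rw [← h2, ht])
  | right ht =>
    obtain ⟨h1, h2⟩ := Prod.mk.inj h0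
    have h3 : z.val (Fin.last n) = 0 := h2.symm.trans ht
    exact (exists_singleChart_proj B hχ hp hz (by rw [h1, h3, mul_zero])).2 h3

end SingleSpace

section SingleExists

variable {n : ℕ} [NeZero n] {X : Type u} [TopologicalSpace X]
  [ChartedSpace (EuclideanHalfSpace n) X] {ε₀ : ℝ} [hε : Fact (0 < ε₀)]

lemma nonempty_singleSpace [IsManifold (𝓡∂ n) ∞ X] [CompactSpace X] [T2Space X]
    (hX : ∀ p : X, ∃ χ : CornerChart (𝓡∂ n) X n, p ∈ χ.source ∧
      ∀ q ∈ χ.source, q ∈ ∂[n]X ↔ χ.coord 0 q = 0) : Nonempty (AdiabaticSingleSpace n X ε₀) := by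
  have := (𝓡∂ n).secondCountableTopology
  have := ChartedSpace.secondCountable_of_sigmaCompact (EuclideanHalfSpace n) X
  have had : ∀ w ∈ atZero ε₀ ∂[n]X,
      ∃ θ : CornerChart ((𝓡∂ n).prod (𝓡∂ 1)) (X × Icc (0 : ℝ) ε₀) (n + 1),
        IsAdaptedChart (atZero ε₀ ∂[n]X) w θ {Fin.castSucc 0, Fin.last n} ∧
        θ.coord (Fin.last n) w = 0 := by
    rintro ⟨p, t⟩ ⟨hp, ht⟩
    obtain ⟨χ, hpχ, hχ⟩ := hX p
    obtain ⟨θ, hs, hj, hl⟩ := exists_singleBaseChart (ε₀ := ε₀) χ 1 0 (Or.inl ⟨rfl, rfl⟩)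
    have ht' : t.val = 0 := ht
    have hpθ : (p, t) ∈ θ.source := (hs _).2 ⟨hpχ, by simpa [ht'] using hε.out⟩
    have hl0 : θ.coord (Fin.last n) (p, t) = 0 := by rw [hl _ hpθ]; simp [ht']
    refine ⟨θ, ⟨hpθ, fun w hw => ?_⟩, hl0⟩
    simp only [Finset.mem_insert, Finset.mem_singleton, forall_eq_or_imp, forall_eq, hl0]
    rw [hj w hw, hl w hw, zero_add, one_mul, hj _ hpθ, (hχ p hpχ).1 hp, ← hχ _ ((hs w).1 hw).1]
    rfl
  refine nonempty_blowup ⟨?_, fun w hw => ?_⟩ (fun w => ?_) fun ⟨w, hw⟩ => ?_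
  · exact (ModelWithCorners.isClosed_boundary (n := ∞) (by simp)).preimage continuous_fst |>.inter
      (isClosed_eq (continuous_subtype_val.comp continuous_snd) continuous_const)
  · obtain ⟨θ, h1, -⟩ := had w hw
    exact ⟨θ, _, h1⟩
  · obtain ⟨χ, hpχ, hχ⟩ := hX w.1
    by_cases hw : w.2.val = 0
    · obtain ⟨θ, hs, -⟩ := exists_singleBaseChart (ε₀ := ε₀) χ 1 0 (Or.inl ⟨rfl, rfl⟩)
      exact ⟨θ, (hs w).2 ⟨hpχ, by simpa [hw] using hε.out⟩⟩
    · obtain ⟨θ, hs, -⟩ := exists_singleBaseChart (ε₀ := ε₀) χ (-1) ε₀ (Or.inr ⟨rfl, rfl⟩)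
      exact ⟨θ, (hs w).2 ⟨hpχ, by have := lt_of_le_of_ne w.2.2.1 (Ne.symm hw); linarith⟩⟩
  · obtain ⟨θ, h1, h2⟩ := had w hw
    exact h1.compl_nonempty (by simp) h2

end SingleExists

/-! ### Monomial coordinates on the double spaces -/

lemma isClosed_coord_eq_zero {m : ℕ} (i : Fin m) : IsClosed {z : ℝ^m | z i = 0} :=
  isClosed_eq (continuous_coord i) continuous_const

section DoubleForms

variable {n m h : ℕ} [NeZero n] {X : Type u} [TopologicalSpace X]
  [ChartedSpace (EuclideanHalfSpace n) X] {ε₀ : ℝ} {D Y : Type*} {ι : D → X} {Φ : D → Y} {x : X → ℝ}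
  {ix : DoubleIdx n m} {χ χ' : CornerChart (𝓡∂ n) X n} {fl fl' : Prop}
  {F F' : ℝ → ℝ → ℝ → ℝ × ℝ × ℝ}

section HasForm

variable {E : Type*} [NormedAddCommGroup E] [NormedSpace ℝ E] {H : Type*} [TopologicalSpace H]
  {I : ModelWithCorners ℝ E H} {N : Type*} [TopologicalSpace N] [ChartedSpace H N]
  {b : N → X × X × Icc (0 : ℝ) ε₀} {φ : CornerChart I N m}
  {E' : Type*} [NormedAddCommGroup E'] [NormedSpace ℝ E'] {H' : Type*} [TopologicalSpace H']
  {I' : ModelWithCorners ℝ E' H'} {N' : Type*} [TopologicalSpace N'] [ChartedSpace H' N']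

/-- A chart `φ` of a space over `X × X × [0,ε₀]`, in which the interior coordinates of the charts `χ`,
`χ'` of the two factors are coordinates, and in which the function `F` of the coordinates `l 0`,
`r 0` and `e` gives the boundary coordinates of the two factors and the parameter. -/
structure HasForm (ix : DoubleIdx n m) (b : N → X × X × Icc (0 : ℝ) ε₀)
    (χ χ' : CornerChart (𝓡∂ n) X n) (F : ℝ → ℝ → ℝ → ℝ × ℝ × ℝ) (φ : CornerChart I N m) : Prop where
  mem : ∀ y ∈ φ.source, (b y).1 ∈ χ.source
  mem' : ∀ y ∈ φ.source, (b y).2.1 ∈ χ'.source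
  left : ∀ y ∈ φ.source, ∀ j, j ≠ 0 → χ.coord j (b y).1 = φ.coord (ix.l j) y
  right : ∀ y ∈ φ.source, ∀ j, j ≠ 0 → χ'.coord j (b y).2.1 = φ.coord (ix.r j) y
  bdry : ∀ y ∈ φ.source, (χ.coord 0 (b y).1, χ'.coord 0 (b y).2.1, (b y).2.2.val) =
    F (φ.coord (ix.l 0) y) (φ.coord (ix.r 0) y) (φ.coord ix.e y)

lemma HasForm.comp (hf : HasForm ix b χ χ' F φ) {β : N' → N} {ψ : CornerChart I' N' m}
    (hm : ∀ y ∈ ψ.source, β y ∈ φ.source)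
    (hl : ∀ y ∈ ψ.source, ∀ j, j ≠ 0 → φ.coord (ix.l j) (β y) = ψ.coord (ix.l j) y)
    (hr : ∀ y ∈ ψ.source, ∀ j, j ≠ 0 → φ.coord (ix.r j) (β y) = ψ.coord (ix.r j) y)
    (hF : ∀ y ∈ ψ.source, F (φ.coord (ix.l 0) (β y)) (φ.coord (ix.r 0) (β y)) (φ.coord ix.e (β y)) =
      F' (ψ.coord (ix.l 0) y) (ψ.coord (ix.r 0) y) (ψ.coord ix.e y)) :
    HasForm ix (b ∘ β) χ χ' F' ψ where
  mem y hy := hf.mem _ (hm y hy)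
  mem' y hy := hf.mem' _ (hm y hy)
  left y hy j hj := by rw [← hl y hy j hj]; exact hf.left _ (hm y hy) j hj
  right y hy j hj := by rw [← hr y hy j hj]; exact hf.right _ (hm y hy) j hj
  bdry y hy := by rw [← hF y hy]; exact hf.bdry _ (hm y hy)

lemma HasForm.comp_eq (hf : HasForm ix b χ χ' F φ) {β : N' → N} {ψ : CornerChart I' N' m}
    (hψ : ∀ y ∈ ψ.source, β y ∈ φ.source ∧ ∀ i, ψ.coord i y = φ.coord i (β y)) :
    HasForm ix (b ∘ β) χ χ' F ψ :=
  hf.comp (fun y hy => (hψ y hy).1) (fun y hy _ _ => ((hψ y hy).2 _).symm)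
    (fun y hy _ _ => ((hψ y hy).2 _).symm) fun y hy => by simp only [(hψ y hy).2]

/-- The map of `X × X × [0,ε₀]` that exchanges the two factors. -/
def swapPoints (w : X × X × Icc (0 : ℝ) ε₀) : X × X × Icc (0 : ℝ) ε₀ := (w.2.1, w.1, w.2.2)

lemma HasForm.swap (hf : HasForm ix b χ χ' F φ) : HasForm ix.swap (swapPoints ∘ b) χ' χ
    (fun a a' k => ((F a' a k).2.1, (F a' a k).1, (F a' a k).2.2)) φ where
  mem := hf.mem'
  mem' := hf.mem
  left := hf.right
  right := hf.left
  bdry y hy := by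
    have h1 := hf.bdry y hy
    show (χ'.coord 0 (b y).2.1, χ.coord 0 (b y).1, (b y).2.2.val) =
      ((F (φ.coord (ix.l 0) y) (φ.coord (ix.r 0) y) (φ.coord ix.e y)).2.1,
        (F (φ.coord (ix.l 0) y) (φ.coord (ix.r 0) y) (φ.coord ix.e y)).1,
        (F (φ.coord (ix.l 0) y) (φ.coord (ix.r 0) y) (φ.coord ix.e y)).2.2)
    rw [← h1]

/-- The blow-up of a centre on which some of the coordinates `l 0`, `r 0`, `e` vanish, in projective
coordinates. -/
lemma Blowup.exists_zeroChart {N : Type u} [TopologicalSpace N] [ChartedSpace H N] {S : Set N}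
    (B : Blowup I m S) {φ : CornerChart I N m} {A : Finset (Fin m)} {q : B.total}
    (hq : B.down q ∈ S) (had : IsAdaptedChart S (B.down q) φ A)
    (h0 : ∀ i ∈ A, φ.coord i (B.down q) = 0) (hA : A.Nonempty) :
    ∃ (i : Fin m) (ψ : 𝓒[m] B.total), i ∈ A ∧ q ∈ ψ.source ∧ ψ.coord i q = 0 ∧
      (∀ y ∈ ψ.source, B.down y ∈ φ.source) ∧ (∀ y ∈ ψ.source, φ.coord i (B.down y) = ψ.coord i y) ∧
      (∀ y ∈ ψ.source, ∀ j ∈ A, j ≠ i → φ.coord j (B.down y) = ψ.coord i y * ψ.coord j y) ∧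
      ∀ y ∈ ψ.source, ∀ j ∉ A, φ.coord j (B.down y) = ψ.coord j y := by
  obtain ⟨i₀, hi₀⟩ := hA
  obtain ⟨a, ψ, hpt, rfl, rfl, hqψ, hψ, -⟩ := B.exists_projChart_mem hq had had.1 hq hi₀ (h0 _ hi₀)
  have hca : ∀ i ∈ a.A, a.c i = 0 := fun i hi => by rw [ProjIdx.c, hpt]; exact h0 i hi
  refine ⟨a.i, ψ, a.i_mem, hqψ, (mem_centre_iff hψ hqψ).1 hq, fun y hy => ?_,
    fun y hy => coord_down_bdry_self hψ hy (hca _ a.i_mem),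
    fun y hy j hj hne => coord_down_bdry hψ hy hne hj (hca j hj),
    fun y hy j hj => coord_down_notMem hψ hy hj⟩
  rw [← (hψ y hy).2]; exact a.P_mem (hψ y hy).1

end HasForm

variable {N : Type u} [TopologicalSpace N] [ChartedSpace ℝ₊^m N]
  {b : N → X × X × Icc (0 : ℝ) ε₀} {φ : 𝓒[m] N} {cl cr : Prop} {U : Set N} {q : N}

/-- The types of charts near a point `q` of the double space: away from `ε = 0`; near the front face;
near the intersection of the front face with the lift of `X × ∂X × {0}` or of `X × X × {0}`, before
and (with two charts) after the blow-up of the former; and likewise with the factors exchanged. The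
propositions `cl`, `cr` record whether the lifts of `X × ∂X × {0}` and of `∂X × X × {0}` have been
blown up, and `U` is the set of the points at which these blow-ups are diffeomorphisms. -/
inductive DoubleForm (ix : DoubleIdx n m) (b : N → X × X × Icc (0 : ℝ) ε₀) (cl cr : Prop)
    (U : Set N) (φ : 𝓒[m] N) (q : N) : (ℝ → ℝ → ℝ → ℝ × ℝ × ℝ) → Prop
  | int (h : ∀ y ∈ φ.source, 0 < (b y).2.2.val) :
      DoubleForm ix b cl cr U φ q fun a a' k => (a, a', ε₀ - k)
  | front (h0 : (b q).2.2.val = 0) (hU : φ.source ⊆ U) :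
      DoubleForm ix b cl cr U φ q fun a a' k => (a * k, a' * k, k)
  | left (h0 : (b q).2.2.val = 0) (hU : φ.source ⊆ U)
      (hc : cl → ¬ (φ.coord (ix.r 0) q = 0 ∧ φ.coord ix.e q = 0)) :
      DoubleForm ix b cl cr U φ q fun a a' k => (a, a * a', a * k)
  | right (h0 : (b q).2.2.val = 0) (hU : φ.source ⊆ U)
      (hc : cr → ¬ (φ.coord (ix.l 0) q = 0 ∧ φ.coord ix.e q = 0)) :
      DoubleForm ix b cl cr U φ q fun a a' k => (a' * a, a', a' * k)
  | left₁ (h0 : (b q).2.2.val = 0) (hc : cl) (h : φ.coord (ix.r 0) q = 0) :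
      DoubleForm ix b cl cr U φ q fun a a' k => (a, a * a', a * (a' * k))
  | left₂ (h0 : (b q).2.2.val = 0) (hc : cl) (h : φ.coord ix.e q = 0) :
      DoubleForm ix b cl cr U φ q fun a a' k => (a, a * (k * a'), a * k)
  | right₁ (h0 : (b q).2.2.val = 0) (hc : cr) (h : φ.coord (ix.l 0) q = 0) :
      DoubleForm ix b cl cr U φ q fun a a' k => (a' * a, a', a' * (a * k))
  | right₂ (h0 : (b q).2.2.val = 0) (hc : cr) (h : φ.coord ix.e q = 0) :
      DoubleForm ix b cl cr U φ q fun a a' k => (a' * (k * a), a', a' * k)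

omit [TopologicalSpace X] [ChartedSpace (EuclideanHalfSpace n) X] in
lemma DoubleForm.swap (d : DoubleForm ix b cl cr U φ q F) :
    DoubleForm ix.swap (swapPoints ∘ b) cr cl U φ q
      (fun a a' k => ((F a' a k).2.1, (F a' a k).1, (F a' a k).2.2)) := by
  cases d with
  | int h => exact .int h
  | front h0 hU => exact .front h0 hU
  | left h0 hU hc => exact .right h0 hU hc
  | right h0 hU hc => exact .left h0 hU hc
  | left₁ h0 hc h => exact .right₁ h0 hc h
  | left₂ h0 hc h => exact .right₂ h0 hc h
  | right₁ h0 hc h => exact .left₁ h0 hc h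
  | right₂ h0 hc h => exact .left₂ h0 hc h

/-- There are charts of the given types near all points. -/
def DoubleForms (ι : D → X) (Φ : D → Y) (x : X → ℝ) (h : ℕ) (ix : DoubleIdx n m)
    (b : N → X × X × Icc (0 : ℝ) ε₀) (cl cr : Prop) (U : Set N) : Prop :=
  ∀ q, ∃ (χ χ' : CornerChart (𝓡∂ n) X n) (fl fl' : Prop) (φ : 𝓒[m] N)
    (F : ℝ → ℝ → ℝ → ℝ × ℝ × ℝ), FibrePair ι Φ x h χ χ' fl fl' ∧ q ∈ φ.source ∧
    HasForm ix b χ χ' F φ ∧ DoubleForm ix b cl cr U φ q F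

lemma DoubleForms.swap (d : DoubleForms ι Φ x h ix b cl cr U) :
    DoubleForms ι Φ x h ix.swap (swapPoints ∘ b) cr cl U := by
  intro q
  obtain ⟨χ, χ', fl, fl', φ, F, h1, h2, h3, h4⟩ := d q
  exact ⟨χ', χ, fl, fl', φ, _, h1.symm, h2, h3.swap, h4.swap⟩

/-! #### The blow-up of a side -/

section Side

variable {S : Set N} (hS : S = closure {y | (b y).1 ∉ ∂[n]X ∧ (b y).2.1 ∈ ∂[n]X ∧
    (b y).2.2.val = 0}) (P : FibrePair ι Φ x h χ χ' fl fl')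

include hS P

lemma HasForm.notMem_side (hf : HasForm ix b χ χ' F φ)
    (hF : ∀ y ∈ φ.source, χ'.coord 0 (b y).2.1 = 0 → (b y).2.2.val = 0 → χ.coord 0 (b y).1 = 0) :
    ∀ y ∈ φ.source, y ∉ S := by
  intro y hy hyS
  rw [hS] at hyS
  refine CornerChart.mem_of_mem_closure (ψ := φ) isClosed_empty (fun w hw hws => ?_) hy hyS
  obtain ⟨h1, h2, h3⟩ := hws
  exact h1 ((P.bdry _ (hf.mem w hw)).2 (hF w hw ((P.bdry' _ (hf.mem' w hw)).1 h2) h3))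

lemma HasForm.mem_side_iff (hf : HasForm ix b χ χ' (fun a a' k => (a, a * a', a * k)) φ) {y : N}
    (hy : y ∈ φ.source) : y ∈ S ↔ φ.coord (ix.r 0) y = 0 ∧ φ.coord ix.e y = 0 := by
  rw [hS]
  refine CornerChart.mem_closure_iff (ψ := φ) {ix.l 0}
    (C := {z | z (ix.r 0) = 0 ∧ z ix.e = 0}) ?_ ?_ ?_ hy
  · exact (isClosed_coord_eq_zero _).inter (isClosed_coord_eq_zero _)
  · rintro z z' hz ⟨h1, h2⟩
    exact ⟨by rw [hz _ (by simpa using (ix.l_ne_r _ _).symm), h1],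
      by rw [hz _ (by simpa using (ix.l_ne_e _).symm), h2]⟩
  · intro w hw
    obtain ⟨h1, h2, h3⟩ : _ ∧ _ ∧ _ := by simpa only [Prod.mk.injEq] using hf.bdry w hw
    show ((b w).1 ∉ _ ∧ (b w).2.1 ∈ _ ∧ (b w).2.2.val = 0) ↔ _
    rw [P.bdry _ (hf.mem w hw), P.bdry' _ (hf.mem' w hw), h1, h2, h3]
    simp only [Finset.mem_singleton, forall_eq, mem_ofPred_eq]
    show _ ↔ 0 < φ.coord (ix.l 0) w ∧ φ.coord (ix.r 0) w = 0 ∧ φ.coord ix.e w = 0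
    constructor
    · rintro ⟨h4, h5, h6⟩
      exact ⟨lt_of_le_of_ne (φ.coord_nonneg _ w) (Ne.symm h4), (mul_eq_zero.1 h5).resolve_left h4,
        (mul_eq_zero.1 h6).resolve_left h4⟩
    · rintro ⟨h4, h5, h6⟩
      exact ⟨h4.ne', by rw [h5, mul_zero], by rw [h6, mul_zero]⟩

/-- Before its blow-up, the side only meets the charts of left type. -/
lemma DoubleForm.notMem_side_or (hf : HasForm ix b χ χ' F φ)
    (d : DoubleForm ix b False cr U φ q F) :
    (F = fun a a' k => (a, a * a', a * k)) ∨ ∀ y ∈ φ.source, y ∉ S := by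
  have hb := hf.bdry
  cases d with
  | left h0 hU hc => exact Or.inl rfl
  | left₁ h0 hc h => exact hc.elim
  | left₂ h0 hc h => exact hc.elim
  | int h => exact Or.inr (hf.notMem_side hS P fun y hy _ h1 => absurd h1 (h y hy).ne')
  | _ =>
    refine Or.inr (hf.notMem_side hS P fun y hy h1 h2 => ?_)
    have h3 := hb y hy
    simp only [Prod.mk.injEq] at h3
    obtain ⟨h3, h4, h5⟩ := h3
    rw [h3]
    first
    | rw [h2] at h5; rw [← h5, mul_zero]
    | rw [h1] at h4; rw [← h4, zero_mul]

omit P in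
theorem DoubleForms.isPSubmanifold_side (d : DoubleForms ι Φ x h ix b False cr U) :
    IsPSubmanifold (𝓠 m) m S ∧ (S.Nonempty → Sᶜ.Nonempty) := by
  have key : ∀ q ∈ S, ∃ φ : 𝓒[m] N, IsAdaptedChart S q φ {ix.r 0, ix.e} ∧ φ.coord ix.e q = 0 := by
    intro q hq
    obtain ⟨χ, χ', fl, fl', φ, F, h1, h2, h3, h4⟩ := d q
    rcases h4.notMem_side_or hS h1 h3 with rfl | h5
    · have h5 := (h3.mem_side_iff hS h1 h2).1 hq
      refine ⟨φ, ⟨h2, fun y hy => ?_⟩, h5.2⟩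
      rw [h3.mem_side_iff hS h1 hy]
      simp [h5]
    · exact absurd hq (h5 q h2)
  refine ⟨⟨hS ▸ isClosed_closure, fun q hq => ?_⟩, fun ⟨q, hq⟩ => ?_⟩
  · obtain ⟨φ, h1, -⟩ := key q hq
    exact ⟨φ, _, h1⟩
  · obtain ⟨φ, h1, h2⟩ := key q hq
    exact h1.compl_nonempty (by simp) h2

omit P in
theorem DoubleForms.blowup_side (d : DoubleForms ι Φ x h ix b False cr U) (B : Blowup (𝓠 m) m S) :
    DoubleForms ι Φ x h ix (b ∘ B.down) True cr (B.down ⁻¹' (U \ S)) := by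
  intro q
  obtain ⟨χ, χ', fl, fl', φ, F, h1, h2, h3, h4⟩ := d (B.down q)
  by_cases hq : B.down q ∈ S
  · rcases h4.notMem_side_or hS h1 h3 with rfl | h5
    · have h5 := (h3.mem_side_iff hS h1 h2).1 hq
      have h0 : (b (B.down q)).2.2.val = 0 := by
        have := congrArg (fun w => w.2.2) (h3.bdry _ h2)
        simp only [h5.2, mul_zero] at this
        exact this
      have had : IsAdaptedChart S (B.down q) φ {ix.r 0, ix.e} := by
        refine ⟨h2, fun y hy => ?_⟩
        rw [h3.mem_side_iff hS h1 hy]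
        simp [h5]
      have hlA : ∀ j, ix.l j ∉ ({ix.r 0, ix.e} : Finset (Fin m)) := fun j => by
        simp [ix.l_ne_r, ix.l_ne_e]
      have hrA : ∀ j, j ≠ 0 → ix.r j ∉ ({ix.r 0, ix.e} : Finset (Fin m)) := fun j hj => by
        simp [ix.r_ne_e, ix.r_inj.eq_iff, hj]
      obtain ⟨i, ψ, hi, hqψ, hiq, hm, hii, hij, hin⟩ := B.exists_zeroChart hq had
        (by simp [h5]) ⟨_, Finset.mem_insert_self _ _⟩
      rcases Finset.mem_insert.1 hi with rfl | hi
      · refine ⟨χ, χ', fl, fl', ψ, _, h1, hqψ, h3.comp hm (fun y hy j _ => hin y hy _ (hlA j))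
          (fun y hy j hj => hin y hy _ (hrA j hj)) fun y hy => ?_, .left₁ h0 trivial hiq⟩
        rw [hin y hy _ (hlA 0), hii y hy, hij y hy ix.e (by simp) (ix.r_ne_e 0).symm]
      · obtain rfl := Finset.mem_singleton.1 hi
        refine ⟨χ, χ', fl, fl', ψ, _, h1, hqψ, h3.comp hm (fun y hy j _ => hin y hy _ (hlA j))
          (fun y hy j hj => hin y hy _ (hrA j hj)) fun y hy => ?_, .left₂ h0 trivial hiq⟩
        rw [hin y hy _ (hlA 0), hii y hy, hij y hy (ix.r 0) (by simp) (ix.r_ne_e 0)]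
    · exact absurd hq (h5 _ h2)
  · obtain ⟨ψ, hqψ, hψ⟩ := B.exists_offCentreChart φ h2 hq
    have hψ' : ∀ y ∈ ψ.source, B.down y ∈ φ.source ∧ ∀ i, ψ.coord i y = φ.coord i (B.down y) :=
      fun y hy => ⟨(hψ y hy).1, fun i => by rw [← ψ.val_apply, (hψ y hy).2.2]; rfl⟩
    refine ⟨χ, χ', fl, fl', ψ, F, h1, hqψ, h3.comp_eq hψ', ?_⟩
    have hc := (hψ' q hqψ).2
    have hU : φ.source ⊆ U → ψ.source ⊆ B.down ⁻¹' (U \ S) := fun hU y hy =>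
      ⟨hU (hψ y hy).1, (hψ y hy).2.1⟩
    cases h4 with
    | int h => exact .int fun y hy => h _ (hψ y hy).1
    | front h0 h => exact .front h0 (hU h)
    | left h0 h _ =>
      refine .left h0 (hU h) fun _ => ?_
      rw [hc, hc, ← h3.mem_side_iff hS h1 h2]
      exact hq
    | right h0 h h' => exact .right h0 (hU h) (by rw [hc, hc]; exact h')
    | left₁ h0 h _ => exact h.elim
    | left₂ h0 h _ => exact h.elim
    | right₁ h0 h h' => exact .right₁ h0 h ((hc _).trans h')
    | right₂ h0 h h' => exact .right₂ h0 h ((hc _).trans h')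

end Side

end DoubleForms

/-! ### The blow-up of the corner -/

section CornerBlowup

variable {n h : ℕ} [NeZero n] {X : Type u} [TopologicalSpace X]
  [ChartedSpace (EuclideanHalfSpace n) X] {ε₀ : ℝ} [hε : Fact (0 < ε₀)] {D Y : Type*} {ι : D → X}
  {Φ : D → Y} {x : X → ℝ}

/-- The model with corners of `X × X × [0,ε₀]`. -/
notation:max "𝓑[" n "]" =>
  ModelWithCorners.prod (𝓡∂ n) (ModelWithCorners.prod (𝓡∂ n) (modelWithCornersEuclideanHalfSpace 1))

/-- The corner `(∂X)² × {0}` of `X² × [0,ε₀]`. -/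
local notation "𝒞" => atZero₂ ε₀ ∂[n]X ∂[n]X

/-- The coordinates of `X × X × [0,ε₀]`. -/
def prodIdx (n : ℕ) : DoubleIdx n (n + n + 1) where
  l j := ⟨j.val, by omega⟩
  r j := ⟨n + j.val, by omega⟩
  e := ⟨n + n, by omega⟩
  l_inj j j' hj := by simpa [Fin.ext_iff] using hj
  r_inj j j' hj := by simpa [Fin.ext_iff] using hj
  l_ne_r j j' := by simp only [ne_eq, Fin.mk.injEq]; omega
  l_ne_e j := by simp only [ne_eq, Fin.mk.injEq]; omega
  r_ne_e j := by simp only [ne_eq, Fin.mk.injEq]; omega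

lemma exists_doubleBaseChart (χ χ' : CornerChart (𝓡∂ n) X n) (s c : ℝ)
    (hs : s = 1 ∧ c = 0 ∨ s = -1 ∧ c = ε₀) :
    ∃ θ : CornerChart 𝓑[n] (X × X × Icc (0 : ℝ) ε₀) (n + n + 1),
      (∀ w, w ∈ θ.source ↔ w.1 ∈ χ.source ∧ w.2.1 ∈ χ'.source ∧ c + s * w.2.2.val < ε₀) ∧
      (∀ w ∈ θ.source, ∀ j : Fin n, θ.coord ((prodIdx n).l j) w = χ.coord j w.1) ∧
      (∀ w ∈ θ.source, ∀ j : Fin n, θ.coord ((prodIdx n).r j) w = χ'.coord j w.2.1) ∧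
      ∀ w ∈ θ.source, θ.coord (prodIdx n).e w = c + s * w.2.2.val := by
  obtain ⟨η, hη1, hη2, hη3⟩ := exists_singleBaseChart (ε₀ := ε₀) χ' s c hs
  obtain ⟨θ, h1, h2, h3⟩ := χ.exists_prod η
  refine ⟨θ, fun w => ?_, fun w hw j => h2 w hw j, fun w hw j => ?_, fun w hw => ?_⟩
  · rw [h1, mem_prod, hη1]
  · rw [← hη2 _ (h1 ▸ hw).2]; exact h3 w hw j.castSucc
  · rw [← hη3 _ (h1 ▸ hw).2]; exact h3 w hw (Fin.last n)

lemma exists_doubleBaseChart_mem {χ χ' : CornerChart (𝓡∂ n) X n} {w : X × X × Icc (0 : ℝ) ε₀}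
    (hw : w.1 ∈ χ.source) (hw' : w.2.1 ∈ χ'.source) :
    ∃ θ : CornerChart 𝓑[n] (X × X × Icc (0 : ℝ) ε₀) (n + n + 1), w ∈ θ.source ∧
      (∀ y ∈ θ.source, y.1 ∈ χ.source ∧ y.2.1 ∈ χ'.source) ∧
      (∀ y ∈ θ.source, ∀ j : Fin n, θ.coord ((prodIdx n).l j) y = χ.coord j y.1) ∧
      ∀ y ∈ θ.source, ∀ j : Fin n, θ.coord ((prodIdx n).r j) y = χ'.coord j y.2.1 := by
  obtain ⟨s, c, hs, hc⟩ : ∃ s c : ℝ, (s = 1 ∧ c = 0 ∨ s = -1 ∧ c = ε₀) ∧ c + s * w.2.2.val < ε₀ := by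
    by_cases h0 : w.2.2.val = 0
    · exact ⟨1, 0, Or.inl ⟨rfl, rfl⟩, by simpa [h0] using hε.out⟩
    · have := lt_of_le_of_ne w.2.2.2.1 (Ne.symm h0)
      exact ⟨-1, ε₀, Or.inr ⟨rfl, rfl⟩, by linarith⟩
  obtain ⟨θ, hθ, hl, hr, -⟩ := exists_doubleBaseChart χ χ' s c hs
  exact ⟨θ, (hθ w).2 ⟨hw, hw', hc⟩, fun y hy => ⟨((hθ y).1 hy).1, ((hθ y).1 hy).2.1⟩, hl, hr⟩

omit hε in
lemma isClosed_atZero₂ {A A' : Set X} (hA : IsClosed A) (hA' : IsClosed A') :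
    IsClosed (atZero₂ ε₀ A A') :=
  (hA.preimage continuous_fst).inter ((hA'.preimage continuous_snd.fst).inter
    (isClosed_eq (continuous_subtype_val.comp continuous_snd.snd) continuous_const))

variable (hP : ∀ p p' : X, ∃ (χ χ' : CornerChart (𝓡∂ n) X n) (fl fl' : Prop),
  p ∈ χ.source ∧ p' ∈ χ'.source ∧ FibrePair ι Φ x h χ χ' fl fl')

/-- The coordinates on the product near a point with `ε = 0`. -/
lemma exists_zeroBaseChart {χ χ' : CornerChart (𝓡∂ n) X n} {fl fl' : Prop}
    (P : FibrePair ι Φ x h χ χ' fl fl') {w : X × X × Icc (0 : ℝ) ε₀} (hw : w.1 ∈ χ.source)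
    (hw' : w.2.1 ∈ χ'.source) (h0 : w.2.2.val = 0) :
    ∃ θ : CornerChart 𝓑[n] (X × X × Icc (0 : ℝ) ε₀) (n + n + 1),
      w ∈ θ.source ∧ HasForm (prodIdx n) id χ χ' (fun a a' k => (a, a', k)) θ ∧
      ∀ y ∈ θ.source, y ∈ 𝒞 ↔ θ.coord ((prodIdx n).l 0) y = 0 ∧ θ.coord ((prodIdx n).r 0) y = 0 ∧
          θ.coord (prodIdx n).e y = 0 := by
  obtain ⟨θ, hs, hl, hr, he⟩ := exists_doubleBaseChart (ε₀ := ε₀) χ χ' 1 0 (Or.inl ⟨rfl, rfl⟩)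
  refine ⟨θ, (hs w).2 ⟨hw, hw', by simpa [h0] using hε.out⟩, ⟨fun y hy => ((hs y).1 hy).1,
    fun y hy => ((hs y).1 hy).2.1, fun y hy j _ => (hl y hy j).symm,
    fun y hy j _ => (hr y hy j).symm, fun y hy => ?_⟩, fun y hy => ?_⟩
  · rw [hl y hy, hr y hy, he y hy, zero_add, one_mul]; rfl
  · rw [hl y hy, hr y hy, he y hy, zero_add, one_mul, ← P.bdry _ ((hs y).1 hy).1,
      ← P.bdry' _ ((hs y).1 hy).2.1]
    rfl

include hP

theorem isPSubmanifold_corner [IsManifold (𝓡∂ n) ∞ X] : IsPSubmanifold 𝓑[n] (n + n + 1) 𝒞 ∧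
    ((𝒞).Nonempty → (𝒞)ᶜ.Nonempty) ∧ ∀ w : X × X × Icc (0 : ℝ) ε₀, ∃ θ : CornerChart 𝓑[n]
      (X × X × Icc (0 : ℝ) ε₀) (n + n + 1), w ∈ θ.source := by
  have key : ∀ w ∈ 𝒞, ∃ θ : CornerChart 𝓑[n] (X × X × Icc (0 : ℝ) ε₀) (n + n + 1),
      IsAdaptedChart 𝒞 w θ
        {(prodIdx n).l 0, (prodIdx n).r 0, (prodIdx n).e} ∧ θ.coord (prodIdx n).e w = 0 := by
    intro w hw
    obtain ⟨χ, χ', fl, fl', h1, h2, P⟩ := hP w.1 w.2.1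
    obtain ⟨θ, hwθ, -, hθ⟩ := exists_zeroBaseChart P h1 h2 hw.2.2
    obtain ⟨h3, h4, h5⟩ := (hθ w hwθ).1 hw
    refine ⟨θ, ⟨hwθ, fun y hy => ?_⟩, h5⟩
    rw [hθ y hy]
    simp [h3, h4, h5]
  have hc : IsClosed ∂[n]X := ModelWithCorners.isClosed_boundary (n := ∞) (by simp)
  refine ⟨⟨isClosed_atZero₂ hc hc, fun w hw => ?_⟩, fun ⟨w, hw⟩ => ?_, fun w => ?_⟩
  · obtain ⟨θ, h1, -⟩ := key w hw
    exact ⟨θ, _, h1⟩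
  · obtain ⟨θ, h1, h2⟩ := key w hw
    exact h1.compl_nonempty (by simp) h2
  · obtain ⟨χ, χ', fl, fl', h1, h2, P⟩ := hP w.1 w.2.1
    obtain ⟨θ, h3, -⟩ := exists_doubleBaseChart_mem (ε₀ := ε₀) h1 h2
    exact ⟨θ, h3⟩

theorem doubleForms_corner (B : Blowup 𝓑[n] (n + n + 1)
    𝒞) : DoubleForms ι Φ x h (prodIdx n) B.down False False univ := by
  intro q
  obtain ⟨χ, χ', fl, fl', h1, h2, P⟩ := hP (B.down q).1 (B.down q).2.1
  have hoff : ∀ (θ : CornerChart 𝓑[n] (X × X × Icc (0 : ℝ) ε₀)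
      (n + n + 1)) (F : ℝ → ℝ → ℝ → ℝ × ℝ × ℝ), B.down q ∈ θ.source → B.down q ∉ 𝒞 →
      HasForm (prodIdx n) id χ χ' F θ → ∃ ψ : 𝓒[n + n + 1] B.total,
        q ∈ ψ.source ∧ HasForm (prodIdx n) B.down χ χ' F ψ ∧
        ∀ y ∈ ψ.source, B.down y ∈ θ.source ∧ ∀ i, ψ.coord i y = θ.coord i (B.down y) := by
    intro θ F hq hqS hf
    obtain ⟨ψ, hqψ, hψ⟩ := B.exists_offCentreChart θ hq hqS
    have hψ' : ∀ y ∈ ψ.source, B.down y ∈ θ.source ∧ ∀ i, ψ.coord i y = θ.coord i (B.down y) :=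
      fun y hy => ⟨(hψ y hy).1, fun i => by rw [← ψ.val_apply, (hψ y hy).2.2]; rfl⟩
    exact ⟨ψ, hqψ, hf.comp_eq hψ', hψ'⟩
  have hlr := (prodIdx n).l_ne_r
  have hle := (prodIdx n).l_ne_e
  have hre := (prodIdx n).r_ne_e
  by_cases h0 : (B.down q).2.2.val = 0
  swap
  · obtain ⟨θ, hs, hl, hr, he⟩ := exists_doubleBaseChart (ε₀ := ε₀) χ χ' (-1) ε₀ (Or.inr ⟨rfl, rfl⟩)
    have hpos := lt_of_le_of_ne (B.down q).2.2.2.1 (Ne.symm h0)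
    obtain ⟨ψ, hqψ, hf, hψ⟩ := hoff θ (fun a a' k => (a, a', ε₀ - k))
      ((hs _).2 ⟨h1, h2, by linarith⟩) (fun hqS => h0 hqS.2.2)
      ⟨fun y hy => ((hs y).1 hy).1, fun y hy => ((hs y).1 hy).2.1, fun y hy j _ => (hl y hy j).symm,
        fun y hy j _ => (hr y hy j).symm, fun y hy => by rw [hl y hy, hr y hy, he y hy]; simp⟩
    exact ⟨χ, χ', fl, fl', ψ, _, P, hqψ, hf, .int fun y hy => by
      have := ((hs _).1 (hψ y hy).1).2.2; linarith⟩
  obtain ⟨θ, hqθ, hf, hθ⟩ := exists_zeroBaseChart P h1 h2 h0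
  by_cases hqS : B.down q ∈ 𝒞
  · obtain ⟨h3, h4, h5⟩ := (hθ _ hqθ).1 hqS
    have had : IsAdaptedChart 𝒞 (B.down q) θ {(prodIdx n).l 0, (prodIdx n).r 0, (prodIdx n).e} := by
      refine ⟨hqθ, fun y hy => ?_⟩
      rw [hθ y hy]
      simp [h3, h4, h5]
    obtain ⟨i, ψ, hi, hqψ, hiq, hm, hii, hij, hin⟩ := B.exists_zeroChart hqS had
      (by simp [h3, h4, h5]) ⟨_, Finset.mem_insert_self _ _⟩
    have hl : ∀ y ∈ ψ.source, ∀ j, j ≠ 0 →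
        θ.coord ((prodIdx n).l j) (B.down y) = ψ.coord ((prodIdx n).l j) y := fun y hy j hj =>
      hin y hy _ (by simp [hlr, hle, (prodIdx n).l_inj.eq_iff, hj])
    have hr : ∀ y ∈ ψ.source, ∀ j, j ≠ 0 →
        θ.coord ((prodIdx n).r j) (B.down y) = ψ.coord ((prodIdx n).r j) y := fun y hy j hj =>
      hin y hy _ (by simp [(hlr _ _).symm, hre, (prodIdx n).r_inj.eq_iff, hj])
    simp only [Finset.mem_insert, Finset.mem_singleton] at hi hij
    rcases hi with rfl | rfl | rfl
    · refine ⟨χ, χ', fl, fl', ψ, _, P, hqψ, hf.comp hm hl hr fun y hy => ?_,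
        .left h0 (subset_univ _) False.elim⟩
      rw [hii y hy, hij y hy _ (by simp) (hlr _ _).symm, hij y hy _ (by simp) (hle _).symm]
    · refine ⟨χ, χ', fl, fl', ψ, _, P, hqψ, hf.comp hm hl hr fun y hy => ?_,
        .right h0 (subset_univ _) False.elim⟩
      rw [hii y hy, hij y hy _ (by simp) (hlr _ _), hij y hy _ (by simp) (hre _).symm]
    · refine ⟨χ, χ', fl, fl', ψ, _, P, hqψ, hf.comp hm hl hr fun y hy => ?_,
        .front h0 (subset_univ _)⟩
      rw [hii y hy, hij y hy _ (by simp) (hle _), hij y hy _ (by simp) (hre _), mul_comm,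
        mul_comm (ψ.coord (prodIdx n).e y)]
  · obtain ⟨ψ, hqψ, hf, hψ⟩ := hoff θ _ hqθ hqS hf
    -- one of the boundary coordinates is positive; the others are divided by it
    have hdiv : ∀ i i', i ≠ i' → i ≠ (prodIdx n).e → 0 < ψ.coord i q →
        ∃ ψ' : 𝓒[n + n + 1] B.total, q ∈ ψ'.source ∧
          ∀ y ∈ ψ'.source, y ∈ ψ.source ∧ ψ.coord i y = ψ'.coord i y ∧
            ψ.coord i' y = ψ'.coord i y * ψ'.coord i' y ∧
            ψ.coord (prodIdx n).e y = ψ'.coord i y * ψ'.coord (prodIdx n).e y ∧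
            ∀ j, j ≠ i' → j ≠ (prodIdx n).e → ψ.coord j y = ψ'.coord j y := by
      intro i i' hii' hie hpos
      obtain ⟨ψ', hs, hJ, hJ'⟩ := ψ.exists_divide {i', (prodIdx n).e} (fun _ => i)
        (by simp [hii', hie])
      refine ⟨ψ', by rw [hs]; exact ⟨hqψ, fun _ _ => hpos⟩, fun y hy => ?_⟩
      have hy' := hs ▸ hy
      have hne : ψ.coord i y ≠ 0 := (hy'.2 i' (by simp)).ne'
      have hi : ψ'.coord i y = ψ.coord i y := hJ' y hy i (by simp [hii', hie])
      refine ⟨hy'.1, hi.symm, ?_, ?_, fun j hj hj' => (hJ' y hy j (by simp [hj, hj'])).symm⟩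
      · rw [hi, hJ y hy i' (by simp), mul_div_cancel₀ _ hne]
      · rw [hi, hJ y hy _ (by simp), mul_div_cancel₀ _ hne]
    by_cases hl0 : ψ.coord ((prodIdx n).l 0) q = 0
    · have hr0 : ψ.coord ((prodIdx n).r 0) q ≠ 0 := by
        intro hr0
        refine hqS ((hθ _ hqθ).2 ?_)
        have he := (Prod.mk.inj (Prod.mk.inj (hf.bdry q hqψ)).2).2
        rw [← (hψ q hqψ).2, ← (hψ q hqψ).2, ← (hψ q hqψ).2, ← he]
        exact ⟨hl0, hr0, h0⟩
      obtain ⟨ψ', hqψ', hψ'⟩ := hdiv _ ((prodIdx n).l 0) (hlr _ _).symm (hre _)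
        (lt_of_le_of_ne (ψ.coord_nonneg _ q) (Ne.symm hr0))
      refine ⟨χ, χ', fl, fl', ψ', _, P, hqψ', hf.comp (β := id) (fun y hy => (hψ' y hy).1)
        (fun y hy j hj => (hψ' y hy).2.2.2.2 _ ?_ (hle _))
        (fun y hy j hj => (hψ' y hy).2.2.2.2 _ (hlr _ _).symm (hre _)) fun y hy => ?_,
        .right h0 (subset_univ _) False.elim⟩
      · rw [Ne, (prodIdx n).l_inj.eq_iff]; exact hj
      · obtain ⟨-, h3, h4, h5, -⟩ := hψ' y hy
        simp only [id, h3, h4, h5]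
    · obtain ⟨ψ', hqψ', hψ'⟩ := hdiv _ ((prodIdx n).r 0) (hlr _ _) (hle _)
        (lt_of_le_of_ne (ψ.coord_nonneg _ q) (Ne.symm hl0))
      refine ⟨χ, χ', fl, fl', ψ', _, P, hqψ', hf.comp (β := id) (fun y hy => (hψ' y hy).1)
        (fun y hy j hj => (hψ' y hy).2.2.2.2 _ (hlr _ _) (hle _))
        (fun y hy j hj => (hψ' y hy).2.2.2.2 _ ?_ (hre _)) fun y hy => ?_,
        .left h0 (subset_univ _) False.elim⟩
      · rw [Ne, (prodIdx n).r_inj.eq_iff]; exact hj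
      · obtain ⟨-, h3, h4, h5, -⟩ := hψ' y hy
        simp only [id, h3, h4, h5]

end CornerBlowup

/-! ### The projections and the fibred diagonals on the double space -/

section MonoLifts

variable {n m h : ℕ} [NeZero n] {X : Type u} [TopologicalSpace X]
  [ChartedSpace (EuclideanHalfSpace n) X] {ε₀ : ℝ} [hε : Fact (0 < ε₀)]
  {ix : DoubleIdx n m} {χ χ' : CornerChart (𝓡∂ n) X n}
  {N : Type u} [TopologicalSpace N] [ChartedSpace ℝ₊^m N]
  {b : N → X × X × Icc (0 : ℝ) ε₀} {φ : 𝓒[m] N} {q : N}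

/-- The projection to the left factor lifts to the single space as a monomial map, wherever the
boundary coordinate and the parameter have the form they have in a chart of the single space. The
index `o` says which of the monomials contains the coordinate `r 0`. -/
lemma exists_monoLift_singleSpace (B : AdiabaticSingleSpace n X ε₀)
    (hχ : ∀ p ∈ χ.source, p ∈ ∂[n]X ↔ χ.coord 0 p = 0) (hm : ∀ y ∈ φ.source, (b y).1 ∈ χ.source)
    (hl : ∀ y ∈ φ.source, ∀ j, j ≠ 0 → χ.coord j (b y).1 = φ.coord (ix.l j) y)
    (hq : q ∈ φ.source) {G : ℝ → ℝ → ℝ × ℝ} (hG : IsSingleForm ε₀ (b q).2.2.val G)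
    (o : Option (Fin (n + 1))) (ho : ∀ j : Fin n, j ≠ 0 → o ≠ some j.castSucc)
    (hF : ∀ y ∈ φ.source, (χ.coord 0 (b y).1, (b y).2.2.val) =
      G ((if o = some (Fin.castSucc 0) then φ.coord (ix.r 0) y else 1) * φ.coord (ix.l 0) y)
        ((if o = some (Fin.last n) then φ.coord (ix.r 0) y else 1) * φ.coord ix.e y)) :
    ∃ (O : Set N) (hO : IsOpen O), q ∈ O ∧
      MonoLift B.down (atZero ε₀ ∂[n]X) (fun y => ((b y).1, (b y).2.2))
        (φ.restrOpen O hO) (Function.update ix.std (ix.r 0) o) := by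
  set ρ := Function.update ix.std (ix.r 0) o with hρ
  have hrow : ∀ (y : N) (j : Fin n), ∏ i with ρ i = some j.castSucc, φ.coord i y =
      (if o = some j.castSucc then φ.coord (ix.r 0) y else 1) * φ.coord (ix.l j) y := fun y j => by
    rw [hρ, prod_update (ix.std_r 0), ix.prod_std_castSucc fun i => φ.coord i y]
  have hlast : ∀ y : N, ∏ i with ρ i = some (Fin.last n), φ.coord i y =
      (if o = some (Fin.last n) then φ.coord (ix.r 0) y else 1) * φ.coord ix.e y := fun y => by
    rw [hρ, prod_update (ix.std_r 0), ix.prod_std_last fun i => φ.coord i y]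
  have hrowj : ∀ y ∈ φ.source, ∀ j : Fin n, j ≠ 0 →
      ∏ i with ρ i = some j.castSucc, φ.coord i y = χ.coord j (b y).1 := fun y hy j hj => by
    rw [hrow, if_neg (ho j hj), one_mul, hl y hy j hj]
  set w : ℝ^(n + 1) := WithLp.toLp 2 fun j => ∏ i with ρ i = some j, φ.coord i q with hw
  have hwq : w ∈ quad (n + 1) := fun j =>
    Finset.prod_nonneg (s := Finset.univ.filter fun i => ρ i = some j) fun i _ => φ.coord_nonneg i q
  have hwj : ∀ j, (toQuad w).val j = ∏ i with ρ i = some j, φ.coord i q := fun j => by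
    rw [toQuad_val hwq]
  obtain ⟨ψ, hψ, hz⟩ := exists_singleChart B hχ (hm q hq) (z := toQuad w)
    (fun j hj => by rw [hwj, hrowj q hq j hj]) hG (by rw [hwj, hwj, hrow, hlast]; exact hF q hq)
  refine MonoLift.of_chart hq hz hwj (fun y hy t ht htj => ?_) fun t ht hpos htS => ?_
  · have h1 := hψ.bdry t ht
    rw [htj, htj, hrow, hlast, ← hF y hy] at h1
    obtain ⟨h2, h3⟩ := Prod.mk.inj h1
    refine Prod.ext (χ.ext_coord (hψ.mem t ht) (hm y hy) fun j => ?_) (Subtype.ext h3)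
    by_cases hj : j = 0
    · rw [hj, h2]
    · rw [hψ.coord t ht j hj, htj, hrowj y hy j hj]
  · have h1 := (hχ _ (hψ.mem t ht)).1 htS.1
    have h2 := congrArg Prod.fst (hψ.bdry t ht)
    have h3 := hpos (Fin.castSucc 0)
    have h4 := hpos (Fin.last n)
    cases hG with
    | int _ => exact h3.ne' (h2.symm.trans h1)
    | left _ => exact h3.ne' (h2.symm.trans h1)
    | right _ => exact (mul_pos h3 h4).ne' (h2.symm.trans h1)

/-- Replace coordinates `r j` by the quotients `r j / l j`. -/
lemma DoubleIdx.exists_quotientChart (ix : DoubleIdx n m) (φ : 𝓒[m] N)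
    (J : Finset (Fin n)) : ∃ ψ : 𝓒[m] N,
      ψ.source = {y ∈ φ.source | ∀ j ∈ J, 0 < φ.coord (ix.l j) y} ∧
      ∀ y ∈ ψ.source, (∀ j, ψ.coord (ix.l j) y = φ.coord (ix.l j) y) ∧
        ψ.coord ix.e y = φ.coord ix.e y ∧
        (∀ j ∈ J, ψ.coord (ix.r j) y = 1 ↔ φ.coord (ix.l j) y = φ.coord (ix.r j) y) ∧
        ∀ j ∉ J, ψ.coord (ix.r j) y = φ.coord (ix.r j) y := by
  have hinv : ∀ j, Function.invFun ix.r (ix.r j) = j := Function.leftInverse_invFun ix.r_inj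
  obtain ⟨ψ, hs, hJ, hJ'⟩ := φ.exists_divide (J.image ix.r) (fun i => ix.l (Function.invFun ix.r i))
    (fun i _ => by simpa using fun j _ => (ix.l_ne_r _ _).symm)
  have hs' : ψ.source = {y ∈ φ.source | ∀ j ∈ J, 0 < φ.coord (ix.l j) y} := by rw [hs]; simp [hinv]
  refine ⟨ψ, hs', fun y hy => ⟨fun j => hJ' y hy _ ?_, hJ' y hy _ ?_, fun j hj => ?_,
    fun j hj => hJ' y hy _ ?_⟩⟩
  · simpa using fun j' _ => (ix.l_ne_r _ _).symm
  · simpa using fun j' _ => ix.r_ne_e _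
  · rw [hJ y hy _ (Finset.mem_image_of_mem _ hj), hinv,
      div_eq_one_iff_eq ((hs' ▸ hy).2 j hj).ne', eq_comm]
  · simpa [ix.r_inj.eq_iff] using hj

omit hε in
/-- Where the quotient of the boundary coordinates of the factors is positive, the charts of right
type give charts of left type. -/
lemma HasForm.exists_left (hf : HasForm ix b χ χ' (fun a a' k => (a' * a, a', a' * k)) φ)
    (hq : q ∈ φ.source) (hpos : 0 < φ.coord (ix.l 0) q) :
    ∃ ψ : 𝓒[m] N, q ∈ ψ.source ∧ ψ.source ⊆ φ.source ∧
      HasForm ix b χ χ' (fun a a' k => (a, a * a', a * k)) ψ := by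
  classical
  have hlr := ix.l_ne_r 0 0
  have hle := ix.l_ne_e 0
  have hre := ix.r_ne_e 0
  set l := ix.l 0
  set r := ix.r 0
  set e := ix.e
  obtain ⟨ψ, hs, hψ⟩ := φ.exists_change {z | 0 < z l} {z | 0 < z r}
    (isOpen_lt continuous_const (continuous_coord _))
    (isOpen_lt continuous_const (continuous_coord _))
    (fun z => WithLp.toLp 2 fun i => if i = l then z l * z r else if i = r then (z l)⁻¹ else
      if i = e then z e * (z l)⁻¹ else z i)
    (fun z => WithLp.toLp 2 fun i => if i = l then (z r)⁻¹ else if i = r then z l * z r else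
      if i = e then z e * (z r)⁻¹ else z i) (contDiffOn_toLp fun i => by
      have h1 : ContDiffOn ℝ ∞ (fun z : ℝ^m => (z l)⁻¹)
          (quad m ∩ {z | 0 < z l}) := (contDiff_coord l).contDiffOn.inv fun z hz => hz.2.ne'
      split_ifs
      · exact ((contDiff_coord l).mul (contDiff_coord r)).contDiffOn
      · exact h1
      · exact (contDiff_coord e).contDiffOn.mul h1
      · exact (contDiff_coord i).contDiffOn) (contDiffOn_toLp fun i => by
      have h1 : ContDiffOn ℝ ∞ (fun z : ℝ^m => (z r)⁻¹)
          (quad m ∩ {z | 0 < z r}) := (contDiff_coord r).contDiffOn.inv fun z hz => hz.2.ne'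
      split_ifs
      · exact h1
      · exact ((contDiff_coord l).mul (contDiff_coord r)).contDiffOn
      · exact (contDiff_coord e).contDiffOn.mul h1
      · exact (contDiff_coord i).contDiffOn) (fun z hz => ⟨fun i => by
        have h1 := hz.1 l
        have h2 := hz.1 r
        have h3 := hz.1 e
        have h4 := hz.1 i
        simp only
        split_ifs <;> positivity, by
        have h1 : 0 < z l := hz.2
        simpa [hlr.symm] using h1⟩) (fun z hz => ⟨fun i => by
        have h1 := hz.1 l
        have h2 := hz.1 r
        have h3 := hz.1 e
        have h4 := hz.1 i
        simp only
        split_ifs <;> positivity, by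
        have h1 : 0 < z r := hz.2
        simpa using h1⟩) (fun z hz => by
      have h1 : z l ≠ 0 := (show 0 < z l from hz.2).ne'
      ext i
      by_cases hil : i = l
      · simp [hil, hlr.symm]
      by_cases hir : i = r
      · simp [hir, hlr.symm]; field_simp
      by_cases hie : i = e
      · simp [hie, hlr.symm, hle.symm, hre.symm, h1]
      · simp [hil, hir, hie]) (fun z hz => by
      have h1 : z r ≠ 0 := (show 0 < z r from hz.2).ne'
      ext i
      by_cases hil : i = l
      · simp [hil, hlr.symm]; field_simp
      by_cases hir : i = r
      · simp [hir, hlr.symm]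
      by_cases hie : i = e
      · simp [hie, hle.symm, hre.symm, h1]
      · simp [hil, hir, hie])
  have hsub : ∀ y ∈ ψ.source, y ∈ φ.source ∧ 0 < φ.coord l y := fun y hy => by
    rw [hs] at hy; exact hy
  have hc : ∀ y ∈ ψ.source, ∀ i, ψ.coord i y = if i = l then φ.coord l y * φ.coord r y else
      if i = r then (φ.coord l y)⁻¹ else if i = e then φ.coord e y * (φ.coord l y)⁻¹ else
      φ.coord i y := fun y hy i => by rw [← ψ.val_apply, hψ y hy]; rfl
  refine ⟨ψ, by rw [hs]; exact ⟨hq, hpos⟩, fun y hy => (hsub y hy).1,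
    hf.comp (β := id) (fun y hy => (hsub y hy).1) (fun y hy j hj => ?_) (fun y hy j hj => ?_)
      fun y hy => ?_⟩
  · rw [hc y hy, if_neg (fun h => hj (ix.l_inj h)), if_neg (ix.l_ne_r _ _), if_neg (ix.l_ne_e _)]
    rfl
  · rw [hc y hy, if_neg (ix.l_ne_r _ _).symm, if_neg (fun h => hj (ix.r_inj h)),
      if_neg (ix.r_ne_e _)]
    rfl
  · have h1 := (hsub y hy).2.ne'
    rw [hc y hy, hc y hy, hc y hy, if_pos rfl, if_neg hlr.symm, if_pos rfl, if_neg hle.symm,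
      if_neg hre.symm, if_pos rfl]
    simp only [id, Prod.mk.injEq]
    refine ⟨mul_comm _ _, ?_, ?_⟩
    · show φ.coord r y = _
      field_simp
    · show φ.coord r y * φ.coord e y = _
      field_simp

variable {D Y : Type*} {ι : D → X} {Φ : D → Y} {x : X → ℝ} {U : Set N}

/-- The projection to the left factor is given by monomials. -/
lemma DoubleForms.exists_monoLift (d : DoubleForms ι Φ x h ix b True True U)
    (B : AdiabaticSingleSpace n X ε₀) (q : N) :
    ∃ (φ : 𝓒[m] N) (ρ : Fin m → Option (Fin (n + 1))), q ∈ φ.source ∧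
      (∀ j, ∃ i, ρ i = some j) ∧ MonoLift B.down (atZero ε₀ ∂[n]X)
        (fun y => ((b y).1, (b y).2.2)) φ ρ := by
  obtain ⟨χ, χ', fl, fl', φ, F, P, hq, hf, d⟩ := d q
  have key : ∀ {φ : 𝓒[m] N} {F : ℝ → ℝ → ℝ → ℝ × ℝ × ℝ} {G : ℝ → ℝ → ℝ × ℝ},
      q ∈ φ.source → HasForm ix b χ χ' F φ → IsSingleForm ε₀ (b q).2.2.val G →
      ∀ (o : Option (Fin (n + 1))), (∀ j : Fin n, j ≠ 0 → o ≠ some j.castSucc) →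
      (∀ a a' k, ((F a a' k).1, (F a a' k).2.2) = G ((if o = some (Fin.castSucc 0) then a' else 1) * a)
        ((if o = some (Fin.last n) then a' else 1) * k)) →
      ∃ (φ : 𝓒[m] N) (ρ : Fin m → Option (Fin (n + 1))), q ∈ φ.source ∧
      (∀ j, ∃ i, ρ i = some j) ∧ MonoLift B.down (atZero ε₀ ∂[n]X)
        (fun y => ((b y).1, (b y).2.2)) φ ρ := by
    intro φ F G hq hf hG o ho hFG
    obtain ⟨O, hO, hqO, h1⟩ := exists_monoLift_singleSpace B P.bdry hf.mem hf.left hq hG o ho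
      fun y hy => by rw [← hFG, ← hf.bdry y hy]
    exact ⟨φ.restrOpen O hO, _, ⟨hq, hqO⟩, onto_update (ix.std_r 0) _ ix.std_onto, h1⟩
  have ho0 : ∀ j : Fin n, j ≠ 0 →
      (some (Fin.castSucc 0) : Option (Fin (n + 1))) ≠ some j.castSucc := fun j hj h =>
    hj (Fin.castSucc_injective n (Option.some.inj h)).symm
  have hol : ∀ j : Fin n, j ≠ 0 → (some (Fin.last n) : Option (Fin (n + 1))) ≠ some j.castSucc :=
    fun j _ h => Fin.castSucc_ne_last j (Option.some.inj h).symm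
  have h0l : ¬ (some (Fin.last n) : Option (Fin (n + 1))) = some (Fin.castSucc 0) := fun h =>
    Fin.castSucc_ne_last _ (Option.some.inj h).symm
  have hl0 : ¬ (some (Fin.castSucc 0) : Option (Fin (n + 1))) = some (Fin.last n) := fun h =>
    Fin.castSucc_ne_last _ (Option.some.inj h)
  cases d with
  | int h => exact key hq hf (.int (h q hq)) none (by simp) fun a a' k => by simp
  | front h0 _ => exact key hq hf (.right h0) none (by simp) fun a a' k => by simp
  | left h0 _ _ => exact key hq hf (.left h0) none (by simp) fun a a' k => by simp
  | left₁ h0 _ _ =>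
    exact key hq hf (.left h0) (some (Fin.last n)) hol fun a a' k => by simp only [if_neg h0l, if_true, one_mul]
  | left₂ h0 _ _ => exact key hq hf (.left h0) none (by simp) fun a a' k => by simp
  | right₁ h0 _ _ =>
    exact key hq hf (.left h0) (some (Fin.castSucc 0)) ho0 fun a a' k => by
      simp only [if_neg hl0, if_true, one_mul, mul_assoc]
  | right₂ h0 _ _ =>
    exact key hq hf (.right h0) (some (Fin.last n)) hol fun a a' k => by
          simp only [if_neg h0l, if_true, one_mul, Prod.mk.injEq, and_true]; ring
  | right h0 _ hc =>
    by_cases hl : φ.coord (ix.l 0) q = 0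
    · have he : 0 < φ.coord ix.e q :=
        lt_of_le_of_ne (φ.coord_nonneg _ q) fun h => hc trivial ⟨hl, h.symm⟩
      obtain ⟨ψ, hs, hJ, hJ'⟩ := φ.exists_divide {ix.l 0} (fun _ => ix.e)
        (by simpa using (ix.l_ne_e 0).symm)
      have hsub : ∀ y ∈ ψ.source, y ∈ φ.source ∧ φ.coord ix.e y ≠ 0 := fun y hy => by
        rw [hs] at hy; exact ⟨hy.1, (hy.2 (ix.l 0) (by simp)).ne'⟩
      have hψ : HasForm ix b χ χ' (fun a a' k => (a' * (k * a), a', a' * k)) ψ := by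
        refine hf.comp (β := id) (fun y hy => (hsub y hy).1)
          (fun y hy j hj => (hJ' y hy _ (by simpa [ix.l_inj.eq_iff] using hj)).symm)
          (fun y hy j hj => (hJ' y hy _ (by simpa using (ix.l_ne_r _ _).symm)).symm) fun y hy => ?_
        rw [hJ y hy (ix.l 0) (by simp), hJ' y hy (ix.r 0) (by simpa using (ix.l_ne_r _ _).symm),
          hJ' y hy ix.e (by simpa using (ix.l_ne_e _).symm), mul_div_cancel₀ _ (hsub y hy).2]
        rfl
      exact key (by rw [hs]; exact ⟨hq, fun _ _ => he⟩) hψ (.right h0) (some (Fin.last n)) hol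
        fun a a' k => by simp only [if_neg h0l, if_true, one_mul, Prod.mk.injEq, and_true]; ring
    · obtain ⟨ψ, h1, -, h2⟩ := hf.exists_left hq (lt_of_le_of_ne (φ.coord_nonneg _ q) (Ne.symm hl))
      exact key h1 h2 (.left h0) none (by simp) fun a a' k => by simp

end MonoLifts

section DoubleDiagonals

variable {n m h : ℕ} [NeZero n] {X : Type u} [TopologicalSpace X]
  [ChartedSpace (EuclideanHalfSpace n) X] {ε₀ : ℝ}
  {ix : DoubleIdx n m} {χ χ' : CornerChart (𝓡∂ n) X n}
  {N : Type u} [TopologicalSpace N] [ChartedSpace ℝ₊^m N]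
  {b : N → X × X × Icc (0 : ℝ) ε₀} {φ : 𝓒[m] N} {q : N}
  {D Y : Type*} {ι : D → X} {Φ : D → Y} {x : X → ℝ} {U S G H Δ : Set N} {fl fl' flF : Prop}
  {F : ℝ → ℝ → ℝ → ℝ × ℝ × ℝ}

variable (n) in
/-- The lifts of the fibre diagonal, of the front face, of the hypersurface `x = x'` and of the
diagonal to a space over `X × X × [0,ε₀]`, in which the side faces are blown up outside of `U`. -/
structure AreLifts (ι : D → X) (Φ : D → Y) (x : X → ℝ) (b : N → X × X × Icc (0 : ℝ) ε₀)
    (U S G H Δ : Set N) : Prop where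
  fib : S = closure {y | b y ∈ fibreDiagonal ε₀ ι Φ ∧ b y ∉ atZero₂ ε₀ ∂[n]X ∂[n]X}
  isClosed_front : IsClosed G
  front_subset : ∀ y ∈ G, b y ∈ atZero₂ ε₀ ∂[n]X ∂[n]X
  subset_front : ∀ y ∈ U, b y ∈ atZero₂ ε₀ ∂[n]X ∂[n]X → y ∈ G
  level : H = closure {y | x (b y).1 = x (b y).2.1 ∧ b y ∉ atZero₂ ε₀ ∂[n]X ∂[n]X}
  diag : Δ = closure {y | (b y).1 = (b y).2.1 ∧ b y ∉ atZero₂ ε₀ ∂[n]X ∂[n]X}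

omit [TopologicalSpace X] in
lemma fibreDiagonal_swap (w : X × X × Icc (0 : ℝ) ε₀) :
    swapPoints w ∈ fibreDiagonal ε₀ ι Φ ↔ w ∈ fibreDiagonal ε₀ ι Φ :=
  ⟨fun ⟨d, d', h1, h2, h3⟩ => ⟨d', d, h2, h1, h3.symm⟩,
    fun ⟨d, d', h1, h2, h3⟩ => ⟨d', d, h2, h1, h3.symm⟩⟩

lemma swap_mem_corner (w : X × X × Icc (0 : ℝ) ε₀) : swapPoints w ∈ atZero₂ ε₀ ∂[n]X ∂[n]X ↔
      w ∈ atZero₂ ε₀ ∂[n]X ∂[n]X :=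
  ⟨fun ⟨h1, h2, h3⟩ => ⟨h2, h1, h3⟩, fun ⟨h1, h2, h3⟩ => ⟨h2, h1, h3⟩⟩

lemma AreLifts.swap (L : AreLifts n ι Φ x b U S G H Δ) :
    AreLifts n ι Φ x (swapPoints ∘ b) U S G H Δ where
  fib := by
    rw [L.fib]
    congr 1
    ext y
    exact and_congr (fibreDiagonal_swap _).symm (swap_mem_corner _).symm.not
  isClosed_front := L.isClosed_front
  front_subset y hy := (swap_mem_corner _).2 (L.front_subset y hy)
  subset_front y hy h := L.subset_front y hy ((swap_mem_corner _).1 h)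
  level := by
    rw [L.level]
    congr 1
    ext y
    exact and_congr eq_comm (swap_mem_corner _).symm.not
  diag := by
    rw [L.diag]
    congr 1
    ext y
    exact and_congr eq_comm (swap_mem_corner _).symm.not

section Coordinates

variable (P : FibrePair ι Φ x h χ χ' fl fl') (hf : HasForm ix b χ χ' F φ)

include P hf

lemma HasForm.mem_corner_iff {y : N} (hy : y ∈ φ.source) : b y ∈ atZero₂ ε₀ ∂[n]X ∂[n]X ↔
      χ.coord 0 (b y).1 = 0 ∧ χ'.coord 0 (b y).2.1 = 0 ∧ (b y).2.2.val = 0 := by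
  rw [← P.bdry _ (hf.mem y hy), ← P.bdry' _ (hf.mem' y hy)]
  rfl

lemma HasForm.mem_fib_iff {y : N} (hy : y ∈ φ.source) : b y ∈ fibreDiagonal ε₀ ι Φ ↔
    fl ∧ χ.coord 0 (b y).1 = 0 ∧ χ'.coord 0 (b y).2.1 = 0 ∧
      ∀ j : Fin n, j ≠ 0 → j.val ≤ h → φ.coord (ix.l j) y = φ.coord (ix.r j) y := by
  refine (P.fib _ (hf.mem y hy) _ (hf.mem' y hy)).trans (and_congr_right fun _ =>
    and_congr_right fun _ => and_congr_right fun _ => forall_congr' fun j =>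
      forall_congr' fun hj => forall_congr' fun _ => ?_)
  rw [hf.left y hy j hj, hf.right y hy j hj]

lemma HasForm.mem_diag_iff {y : N} (hy : y ∈ φ.source) : (b y).1 = (b y).2.1 ↔
    fl' ∧ χ.coord 0 (b y).1 = χ'.coord 0 (b y).2.1 ∧
      ∀ j : Fin n, j ≠ 0 → φ.coord (ix.l j) y = φ.coord (ix.r j) y := by
  rw [P.diag _ (hf.mem y hy) _ (hf.mem' y hy)]
  rw [forall_iff_zero]
  exact and_congr_right fun _ => and_congr_right fun _ => forall_congr' fun j =>
    forall_congr' fun hj => by rw [hf.left y hy j hj, hf.right y hy j hj]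

/-- If the boundary coordinate of one factor divides the other one and the parameter, then the
quotient of the boundary coordinates is `1` on the hypersurface `x = x'` off the corner, and thus on
the fibre diagonal of the front face and on the diagonal. -/
lemma HasForm.eq_one_of_mem (L : AreLifts n ι Φ x b U S G H Δ) {g : ℝ^m → ℝ} (hg : Continuous g)
    (h0 : ∀ y ∈ φ.source, ∃ a c,
      F (φ.coord (ix.l 0) y) (φ.coord (ix.r 0) y) (φ.coord ix.e y) = (a, a * g (φ y).val, a * c) ∨
      F (φ.coord (ix.l 0) y) (φ.coord (ix.r 0) y) (φ.coord ix.e y) = (a * g (φ y).val, a, a * c))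
    (hq : q ∈ φ.source) (hqF : q ∈ G ∩ H ∩ b ⁻¹' fibreDiagonal ε₀ ι Φ ∪ Δ) : g (φ q).val = 1 := by
  have hC : IsClosed {z | g z = 1} := isClosed_eq hg continuous_const
  have h1 : ∀ y ∈ φ.source, χ.coord 0 (b y).1 = χ'.coord 0 (b y).2.1 →
      ¬ (χ.coord 0 (b y).1 = 0 ∧ χ'.coord 0 (b y).2.1 = 0 ∧ (b y).2.2.val = 0) →
      g (φ y).val = 1 := by
    intro y hy h1 h2
    obtain ⟨a, c, h3 | h3⟩ := h0 y hy
    all_goals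
      obtain ⟨h4, h5, h6⟩ : _ ∧ _ ∧ _ := by simpa only [Prod.mk.injEq] using (hf.bdry y hy).trans h3
      rw [h4, h5] at h1
      rw [h4, h5, h6] at h2
    · exact (mul_eq_left₀ fun ha => h2 (by simp [ha])).1 h1.symm
    · exact (mul_eq_left₀ fun ha => h2 (by simp [ha])).1 h1
  rcases hqF with ⟨⟨-, hqH⟩, hqb⟩ | hqΔ
  · have hfl := ((hf.mem_fib_iff P hq).1 hqb).1
    rw [L.level] at hqH
    refine CornerChart.mem_of_mem_closure hC (fun y hy hys => h1 y hy ?_ ?_) hq hqH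
    · exact (P.level hfl _ (hf.mem y hy) _ (hf.mem' y hy)).1 hys.1
    · rw [← hf.mem_corner_iff P hy]; exact hys.2
  · rw [L.diag] at hqΔ
    refine CornerChart.mem_of_mem_closure hC (fun y hy hys => h1 y hy ?_ ?_) hq hqΔ
    · exact ((hf.mem_diag_iff P hy).1 hys.1).2.1
    · rw [← hf.mem_corner_iff P hy]; exact hys.2

/-- In a chart in which the corner is a union of coordinate hypersurfaces, the lift of a subset is
given by the equations that give it off the corner, if these do not involve the hypersurfaces. -/
lemma HasForm.mem_lift_iff (L : Finset (Fin m)) {p : N → Prop} {C : Set ℝ^m} (hC : IsClosed C)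
    (hind : ∀ z z' : ℝ^m, (∀ j ∉ L, z' j = z j) → z ∈ C → z' ∈ C)
    (hL : ∀ y ∈ φ.source, ¬ (χ.coord 0 (b y).1 = 0 ∧ χ'.coord 0 (b y).2.1 = 0 ∧
      (b y).2.2.val = 0) ↔ ∀ l ∈ L, 0 < φ.coord l y)
    (hp : ∀ y ∈ φ.source, (∀ l ∈ L, 0 < φ.coord l y) → (p y ↔ (φ y).val ∈ C)) {y : N}
    (hy : y ∈ φ.source) : y ∈ closure {y | p y ∧ b y ∉ atZero₂ ε₀ ∂[n]X ∂[n]X} ↔ (φ y).val ∈ C := by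
  refine CornerChart.mem_closure_iff L hC hind (fun w hw => ?_) hy
  show _ ∧ _ ↔ _
  rw [hf.mem_corner_iff P hw, hL w hw]
  exact ⟨fun h => ⟨h.2, (hp w hw h.2).1 h.1⟩, fun h => ⟨(hp w hw h.1).2 h.2, h.1⟩⟩

end Coordinates

omit [NeZero n] in
lemma isClosed_coord_eq_coord {J : Fin n → Prop} {l r : Fin n → Fin m} :
    IsClosed {z : ℝ^m | ∀ j, J j → z (l j) = z (r j)} := by
  simp only [ofPred_forall]
  exact isClosed_iInter fun j => isClosed_iInter fun _ =>
    isClosed_eq (continuous_coord _) (continuous_coord _)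

/-- Coordinates in which the lift of the fibre diagonal, the fibre diagonal of the front face and
the diagonal are given by equalities of the coordinates of the two factors. -/
structure EqDiagChart (ix : DoubleIdx n m) (h : ℕ) (S F Δ : Set N) (φ : 𝓒[m] N)
    (fl flF fl' : Prop) : Prop where
  mem_S : ∀ y ∈ φ.source, y ∈ S ↔ fl ∧ φ.coord (ix.l 0) y = 0 ∧ φ.coord (ix.r 0) y = 0 ∧
    ∀ j : Fin n, (j ≠ 0 ∧ j.val ≤ h) → φ.coord (ix.l j) y = φ.coord (ix.r j) y
  mem_F : ∀ y ∈ φ.source, y ∈ F ↔ flF ∧ φ.coord ix.e y = 0 ∧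
    φ.coord (ix.l 0) y = φ.coord (ix.r 0) y ∧
    ∀ j : Fin n, (j ≠ 0 ∧ j.val ≤ h) → φ.coord (ix.l j) y = φ.coord (ix.r j) y
  mem_Δ : ∀ y ∈ φ.source, y ∈ Δ ↔ fl' ∧ φ.coord (ix.l 0) y = φ.coord (ix.r 0) y ∧
    ∀ j : Fin n, j ≠ 0 → φ.coord (ix.l j) y = φ.coord (ix.r j) y
  imp : flF → fl

section EqDiag

variable (P : FibrePair ι Φ x h χ χ' fl fl') (L : AreLifts n ι Φ x b U S G H Δ)

include P L

lemma HasForm.mem_eqDiag (hf : HasForm ix b χ χ' F φ) (K : Finset (Fin m))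
    (hKl : ∀ j, ix.l j ∉ K) (hKr : ∀ j, ix.r j ∉ K)
    (hK : ∀ y ∈ φ.source, ¬ (χ.coord 0 (b y).1 = 0 ∧ χ'.coord 0 (b y).2.1 = 0 ∧
      (b y).2.2.val = 0) ↔ ∀ l ∈ K, 0 < φ.coord l y)
    (hp : ∀ y ∈ φ.source, (∀ l ∈ K, 0 < φ.coord l y) →
      (χ.coord 0 (b y).1 = 0 ↔ φ.coord (ix.l 0) y = 0) ∧
      (χ'.coord 0 (b y).2.1 = 0 ↔ φ.coord (ix.r 0) y = 0) ∧
      (χ.coord 0 (b y).1 = χ'.coord 0 (b y).2.1 ↔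
        φ.coord (ix.l 0) y = φ.coord (ix.r 0) y)) {y : N} (hy : y ∈ φ.source) :
    (y ∈ S ↔ fl ∧ φ.coord (ix.l 0) y = 0 ∧ φ.coord (ix.r 0) y = 0 ∧
      ∀ j : Fin n, (j ≠ 0 ∧ j.val ≤ h) → φ.coord (ix.l j) y = φ.coord (ix.r j) y) ∧
    (fl → (y ∈ H ↔ φ.coord (ix.l 0) y = φ.coord (ix.r 0) y)) ∧
    (y ∈ Δ ↔ fl' ∧ φ.coord (ix.l 0) y = φ.coord (ix.r 0) y ∧
      ∀ j : Fin n, j ≠ 0 → φ.coord (ix.l j) y = φ.coord (ix.r j) y) := by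
  have hlr : IsClosed {z : ℝ^m | z (ix.l 0) = z (ix.r 0)} :=
    isClosed_eq (continuous_coord _) (continuous_coord _)
  refine ⟨?_, fun hfl => ?_, ?_⟩
  · rw [L.fib]
    refine hf.mem_lift_iff P K (C := {z | fl ∧ z (ix.l 0) = 0 ∧ z (ix.r 0) = 0 ∧
      ∀ j : Fin n, (j ≠ 0 ∧ j.val ≤ h) → z (ix.l j) = z (ix.r j)}) ?_ ?_ hK (fun w hw hpos => ?_) hy
    · exact isClosed_const.inter ((isClosed_coord_eq_zero _).inter
        ((isClosed_coord_eq_zero _).inter isClosed_coord_eq_coord))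
    · rintro z z' hz ⟨h1, h2, h3, h4⟩
      exact ⟨h1, by rw [hz _ (hKl _), h2], by rw [hz _ (hKr _), h3],
        fun j hj => by rw [hz _ (hKl _), hz _ (hKr _), h4 j hj]⟩
    · rw [hf.mem_fib_iff P hw, (hp w hw hpos).1, (hp w hw hpos).2.1]
      simp only [← and_imp]
      rfl
  · rw [L.level]
    refine hf.mem_lift_iff P K (C := {z | z (ix.l 0) = z (ix.r 0)}) ?_ ?_ hK
      (fun w hw hpos => ?_) hy
    · exact hlr
    · intro z z' hz h1
      show z' _ = z' _
      rw [hz _ (hKl _), hz _ (hKr _), h1]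
    · exact (P.level hfl _ (hf.mem w hw) _ (hf.mem' w hw)).trans (hp w hw hpos).2.2
  · rw [L.diag]
    refine hf.mem_lift_iff P K (C := {z | fl' ∧ z (ix.l 0) = z (ix.r 0) ∧
      ∀ j : Fin n, j ≠ 0 → z (ix.l j) = z (ix.r j)}) ?_ ?_ hK (fun w hw hpos => ?_) hy
    · exact isClosed_const.inter (hlr.inter isClosed_coord_eq_coord)
    · rintro z z' hz ⟨h1, h2, h3⟩
      exact ⟨h1, by rw [hz _ (hKl _), hz _ (hKr _), h2],
        fun j hj => by rw [hz _ (hKl _), hz _ (hKr _), h3 j hj]⟩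
    · rw [hf.mem_diag_iff P hw, (hp w hw hpos).2.2]
      rfl

lemma HasForm.eqDiagChart_int (hf : HasForm ix b χ χ' (fun a a' k => (a, a', ε₀ - k)) φ)
    (hε : ∀ y ∈ φ.source, 0 < (b y).2.2.val) :
    EqDiagChart ix h S (G ∩ H ∩ b ⁻¹' fibreDiagonal ε₀ ι Φ) Δ φ fl False fl' := by
  have hb := fun y hy => hf.bdry y hy
  simp only [Prod.mk.injEq] at hb
  have key := fun y (hy : y ∈ φ.source) => hf.mem_eqDiag P L ∅ (by simp) (by simp)
    (fun y hy => by simp [(hε y hy).ne']) (fun y hy _ => by rw [(hb y hy).1, (hb y hy).2.1]; simp) hy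
  refine ⟨fun y hy => (key y hy).1, fun y hy => ⟨fun hyF => ?_, fun h => h.1.elim⟩,
    fun y hy => (key y hy).2.2, False.elim⟩
  exact absurd (L.front_subset y hyF.1.1).2.2 (hε y hy).ne'

lemma HasForm.eqDiagChart_front (hf : HasForm ix b χ χ' (fun a a' k => (a * k, a' * k, k)) φ)
    (hU : φ.source ⊆ U) :
    EqDiagChart ix h S (G ∩ H ∩ b ⁻¹' fibreDiagonal ε₀ ι Φ) Δ φ fl fl fl' := by
  have hb := fun y hy => hf.bdry y hy
  simp only [Prod.mk.injEq] at hb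
  have hcorner : ∀ y ∈ φ.source, (χ.coord 0 (b y).1 = 0 ∧ χ'.coord 0 (b y).2.1 = 0 ∧
      (b y).2.2.val = 0) ↔ φ.coord ix.e y = 0 := fun y hy => by
    rw [(hb y hy).1, (hb y hy).2.1, (hb y hy).2.2]
    exact ⟨fun h => h.2.2, fun h => by simp [h]⟩
  have key := fun y (hy : y ∈ φ.source) => hf.mem_eqDiag P L {ix.e} (by simp [ix.l_ne_e])
    (by simp [ix.r_ne_e]) (fun y hy => by
      rw [hcorner y hy]
      simpa using (φ.coord_nonneg ix.e y).lt_iff_ne'.symm) (fun y hy hpos => by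
      have h1 : φ.coord ix.e y ≠ 0 := (hpos _ (by simp)).ne'
      rw [(hb y hy).1, (hb y hy).2.1]
      simp [h1]) hy
  refine ⟨fun y hy => (key y hy).1, fun y hy => ⟨?_, ?_⟩, fun y hy => (key y hy).2.2, id⟩
  · rintro ⟨⟨hyG, hyH⟩, hyb⟩
    obtain ⟨h1, -, -, h2⟩ := (hf.mem_fib_iff P hy).1 hyb
    exact ⟨h1, (hcorner y hy).1 ((hf.mem_corner_iff P hy).1 (L.front_subset y hyG)),
      ((key y hy).2.1 h1).1 hyH, fun j hj => h2 j hj.1 hj.2⟩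
  · rintro ⟨h1, h2, h3, h4⟩
    have h5 := (hcorner y hy).2 h2
    exact ⟨⟨L.subset_front y (hU hy) ((hf.mem_corner_iff P hy).2 h5),
      ((key y hy).2.1 h1).2 h3⟩, (hf.mem_fib_iff P hy).2 ⟨h1, h5.1, h5.2.1,
        fun j hj hj' => h4 j ⟨hj, hj'⟩⟩⟩

/-- Near the lift of `X × X × {0}`, the quotient of the boundary coordinates is `1` on the fibre
diagonal of the front face and on the diagonal. -/
lemma HasForm.mem_left (hf : HasForm ix b χ χ' (fun a a' k => (a, a * a', a * k)) φ)
    (hU : φ.source ⊆ U) {y : N} (hy : y ∈ φ.source) :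
    (y ∈ G ∩ H ∩ b ⁻¹' fibreDiagonal ε₀ ι Φ ↔ fl ∧ φ.coord (ix.l 0) y = 0 ∧ φ.coord (ix.r 0) y = 1 ∧
      ∀ j : Fin n, (j ≠ 0 ∧ j.val ≤ h) → φ.coord (ix.l j) y = φ.coord (ix.r j) y) ∧
    (y ∈ Δ ↔ fl' ∧ φ.coord (ix.r 0) y = 1 ∧
      ∀ j : Fin n, j ≠ 0 → φ.coord (ix.l j) y = φ.coord (ix.r j) y) := by
  have hb := fun y hy => hf.bdry y hy
  simp only [Prod.mk.injEq] at hb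
  have hcorner : ∀ y ∈ φ.source, (χ.coord 0 (b y).1 = 0 ∧ χ'.coord 0 (b y).2.1 = 0 ∧
      (b y).2.2.val = 0) ↔ φ.coord (ix.l 0) y = 0 := fun y hy => by
    rw [(hb y hy).1, (hb y hy).2.1, (hb y hy).2.2]
    exact ⟨fun h => h.1, fun h => by simp [h]⟩
  have hK : ∀ y ∈ φ.source, ¬ (χ.coord 0 (b y).1 = 0 ∧ χ'.coord 0 (b y).2.1 = 0 ∧
      (b y).2.2.val = 0) ↔ ∀ l ∈ ({ix.l 0} : Finset (Fin m)), 0 < φ.coord l y := fun y hy => by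
    rw [hcorner y hy]
    simpa using (φ.coord_nonneg (ix.l 0) y).lt_iff_ne'.symm
  have hlev : ∀ y ∈ φ.source, (∀ l ∈ ({ix.l 0} : Finset (Fin m)), 0 < φ.coord l y) →
      (χ.coord 0 (b y).1 = χ'.coord 0 (b y).2.1 ↔ φ.coord (ix.r 0) y = 1) := fun y hy hpos => by
    have h1 : φ.coord (ix.l 0) y ≠ 0 := (hpos _ (by simp)).ne'
    rw [(hb y hy).1, (hb y hy).2.1, eq_comm, mul_eq_left₀ h1]
  have hr : ∀ j, ix.r j ∉ ({ix.l 0} : Finset (Fin m)) := fun j => by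
    simpa using (ix.l_ne_r 0 j).symm
  have hl : ∀ j, j ≠ 0 → ix.l j ∉ ({ix.l 0} : Finset (Fin m)) := fun j hj => by
    simpa [ix.l_inj.eq_iff] using hj
  have hC : IsClosed {z : ℝ^m | z (ix.r 0) = 1} := isClosed_eq (continuous_coord _) continuous_const
  have hH : fl → ∀ y ∈ φ.source, y ∈ H ↔ φ.coord (ix.r 0) y = 1 := by
    intro hfl y hy
    rw [L.level]
    refine hf.mem_lift_iff P {ix.l 0} (C := {z | z (ix.r 0) = 1}) hC ?_ hK (fun w hw hpos => ?_) hy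
    · intro z z' hz h1
      show z' _ = 1
      rw [hz _ (hr _), h1]
    · exact (P.level hfl _ (hf.mem w hw) _ (hf.mem' w hw)).trans (hlev w hw hpos)
  refine ⟨⟨?_, ?_⟩, ?_⟩
  · rintro ⟨⟨hyG, hyH⟩, hyb⟩
    obtain ⟨h1, -, -, h2⟩ := (hf.mem_fib_iff P hy).1 hyb
    exact ⟨h1, (hcorner y hy).1 ((hf.mem_corner_iff P hy).1 (L.front_subset y hyG)),
      (hH h1 y hy).1 hyH, fun j hj => h2 j hj.1 hj.2⟩
  · rintro ⟨h1, h2, h3, h4⟩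
    have h5 := (hcorner y hy).2 h2
    exact ⟨⟨L.subset_front y (hU hy) ((hf.mem_corner_iff P hy).2 h5), (hH h1 y hy).2 h3⟩,
      (hf.mem_fib_iff P hy).2 ⟨h1, h5.1, h5.2.1, fun j hj hj' => h4 j ⟨hj, hj'⟩⟩⟩
  · rw [L.diag]
    refine hf.mem_lift_iff P {ix.l 0} (C := {z | fl' ∧ z (ix.r 0) = 1 ∧
      ∀ j : Fin n, j ≠ 0 → z (ix.l j) = z (ix.r j)}) ?_ ?_ hK (fun w hw hpos => ?_) hy
    · exact isClosed_const.inter (hC.inter isClosed_coord_eq_coord)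
    · rintro z z' hz ⟨h1, h2, h3⟩
      exact ⟨h1, by rw [hz _ (hr _), h2], fun j hj => by rw [hz _ (hl j hj), hz _ (hr _), h3 j hj]⟩
    · rw [hf.mem_diag_iff P hw, hlev w hw hpos]
      rfl

/-- The boundary fibre diagonal does not meet the side faces. -/
lemma HasForm.notMem_fib (hf : HasForm ix b χ χ' F φ) (h0 : ∀ y ∈ φ.source,
    χ.coord 0 (b y).1 = 0 → χ'.coord 0 (b y).2.1 = 0 → (b y).2.2.val = 0) (hq : q ∈ φ.source) :
    q ∉ S := by
  intro hqS
  rw [L.fib] at hqS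
  refine CornerChart.mem_of_mem_closure (ψ := φ) isClosed_empty (fun w hw hws => ?_) hq hqS
  obtain ⟨-, h1, h2, -⟩ := (hf.mem_fib_iff P hw).1 hws.1
  exact hws.2 ((hf.mem_corner_iff P hw).2 ⟨h1, h2, h0 w hw h1 h2⟩)

end EqDiag

variable {K : ℝ → ℝ → ℝ × ℝ}

/-- A chart of the double space with quotients of the coordinates of the two factors, in which the
projection to the left factor is of the standard form. -/
lemma HasForm.exists_stdChart [Fact (0 < ε₀)] (B : AdiabaticSingleSpace n X ε₀)
    (P : FibrePair ι Φ x h χ χ' fl fl') (hf : HasForm ix b χ χ' F φ) (hq : q ∈ φ.source)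
    (hK : IsSingleForm ε₀ (b q).2.2.val K) (hFK : ∀ a a' k, ((F a a' k).1, (F a a' k).2.2) = K a k)
    (J : Finset (Fin n)) (hJ : ∀ j ∈ J, 0 < φ.coord (ix.l j) q) : ∃ ψ : 𝓒[m] N, q ∈ ψ.source ∧
      MonoLift B.down (atZero ε₀ ∂[n]X) (fun y => ((b y).1, (b y).2.2)) ψ ix.std ∧
      ∀ y ∈ ψ.source, y ∈ φ.source ∧ (∀ j, ψ.coord (ix.l j) y = φ.coord (ix.l j) y) ∧
        ψ.coord ix.e y = φ.coord ix.e y ∧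
        (∀ j ∈ J, ψ.coord (ix.r j) y = 1 ↔ φ.coord (ix.l j) y = φ.coord (ix.r j) y) ∧
        ∀ j ∉ J, ψ.coord (ix.r j) y = φ.coord (ix.r j) y := by
  obtain ⟨ψ, hs, hψ⟩ := ix.exists_quotientChart φ J
  have hsub : ∀ y ∈ ψ.source, y ∈ φ.source := fun y hy => by rw [hs] at hy; exact hy.1
  have hqψ : q ∈ ψ.source := by rw [hs]; exact ⟨hq, hJ⟩
  obtain ⟨O, hO, hqO, h1⟩ := exists_monoLift_singleSpace B P.bdry (fun y hy => hf.mem y (hsub y hy))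
    (fun y hy j hj => by rw [hf.left y (hsub y hy) j hj, (hψ y hy).1]) hqψ hK none (by simp)
    fun y hy => by
      have h2 := congrArg (fun w => (w.1, w.2.2)) (hf.bdry y (hsub y hy))
      rw [hFK] at h2
      simpa [(hψ y hy).1, (hψ y hy).2.1] using h2
  refine ⟨ψ.restrOpen O hO, ⟨hqψ, hqO⟩, ?_, fun y hy => ⟨hsub y hy.1, hψ y hy.1⟩⟩
  rwa [← ix.std_r 0, Function.update_eq_self] at h1

/-- The fibred diagonals on the double space satisfy the hypotheses for the blow-ups of the lifts
of the fibre diagonal and of the fibre diagonal of the front face. -/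
theorem DoubleForms.fibredDiagonals [Fact (0 < ε₀)] (d : DoubleForms ι Φ x h ix b True True U)
    (L : AreLifts n ι Φ x b U S G H Δ) (hιX : range ι = ∂[n]X)
    (hb : IsClosed (b ⁻¹' fibreDiagonal ε₀ ι Φ)) (B : AdiabaticSingleSpace n X ε₀) :
    FibredDiagonals B.down (atZero ε₀ ∂[n]X) (fun y => ((b y).1, (b y).2.2)) ix h
      S (G ∩ H ∩ b ⁻¹' fibreDiagonal ε₀ ι Φ) Δ where
  isClosed_S := L.fib ▸ isClosed_closure
  isClosed_F := (L.isClosed_front.inter (L.level ▸ isClosed_closure)).inter hb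
  isClosed_Δ := L.diag ▸ isClosed_closure
  mono := d.exists_monoLift B
  bdry q hqS := by
    obtain ⟨χ, χ', fl, fl', φ, F, P, hq, hf, d⟩ := d q
    have key : ∀ {flF : Prop} {K : ℝ → ℝ → ℝ × ℝ},
        EqDiagChart ix h S (G ∩ H ∩ b ⁻¹' fibreDiagonal ε₀ ι Φ) Δ φ fl flF fl' →
        IsSingleForm ε₀ (b q).2.2.val K → (∀ a a' k, ((F a a' k).1, (F a a' k).2.2) = K a k) →
        ∃ (φ : 𝓒[m] N) (fl fl' : Prop), q ∈ φ.source ∧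
          MonoLift B.down (atZero ε₀ ∂[n]X) (fun y => ((b y).1, (b y).2.2)) φ ix.std ∧
          BdryDiagChart ix h S (G ∩ H ∩ b ⁻¹' fibreDiagonal ε₀ ι Φ) Δ φ fl fl' := by
      intro flF K hE hK hFK
      obtain ⟨ψ, h1, h2, h3⟩ := hf.exists_stdChart B P hq hK hFK (Finset.univ.erase 0) fun j hj => by
        have hj' := Finset.ne_of_mem_erase hj
        rw [← hf.left q hq j hj']; exact P.pos _ (hf.mem q hq) j hj'
      have hfl := ((hE.mem_S q hq).1 hqS).1
      have hj : ∀ y ∈ ψ.source, ∀ j : Fin n, j ≠ 0 →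
          (φ.coord (ix.l j) y = φ.coord (ix.r j) y ↔ ψ.coord (ix.r j) y = 1) := fun y hy j hj =>
        ((h3 y hy).2.2.2.1 j (by simpa using hj)).symm
      refine ⟨ψ, flF, fl', h1, h2, ⟨fun y hy => ?_, fun y hy => ?_, fun y hy => ?_⟩⟩
      all_goals
        obtain ⟨h4, h5, h6, -, h7⟩ := h3 y hy
        rw [h5 0, h7 0 (by simp)]
      · rw [hE.mem_S y h4, and_iff_right hfl]
        refine and_congr_right fun _ => and_congr_right fun _ => forall_congr' fun j => ?_
        rw [and_imp]
        exact forall_congr' fun hj0 => forall_congr' fun _ => hj y hy j hj0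
      · rw [hE.mem_F y h4, h6]
        refine and_congr_right fun _ => and_congr_right fun _ => and_congr_right fun _ =>
          forall_congr' fun j => ?_
        rw [and_imp]
        exact forall_congr' fun hj0 => forall_congr' fun _ => hj y hy j hj0
      · rw [hE.mem_Δ y h4]
        exact and_congr_right fun _ => and_congr_right fun _ => forall_congr' fun j =>
          forall_congr' fun hj0 => hj y hy j hj0
    have hbd := fun y hy => hf.bdry y hy
    cases d with
    | int h => exact key (hf.eqDiagChart_int P L h) (.int (h q hq)) fun a a' k => rfl
    | front h0 hU => exact key (hf.eqDiagChart_front P L hU) (.right h0) fun a a' k => rfl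
    | _ =>
      simp only [Prod.mk.injEq] at hbd
      refine absurd hqS (hf.notMem_fib P L (fun y hy h1 h2 => ?_) hq)
      rw [(hbd y hy).2.2]
      first
      | rw [← (hbd y hy).1, h1, zero_mul]
      | rw [← (hbd y hy).2.1, h2, zero_mul]
  front q hqF hqS := by
    obtain ⟨χ, χ', fl, fl', φ, F, P, hq, hf, d⟩ := d q
    have hpos : ∀ {φ : 𝓒[m] N} {F : ℝ → ℝ → ℝ → ℝ × ℝ × ℝ}, q ∈ φ.source →
        HasForm ix b χ χ' F φ → ∀ j : Fin n, j ≠ 0 → 0 < φ.coord (ix.l j) q := by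
      intro φ F hq hf j hj
      rw [← hf.left q hq j hj]; exact P.pos _ (hf.mem q hq) j hj
    have key : ∀ {flF : Prop} {K : ℝ → ℝ → ℝ × ℝ},
        EqDiagChart ix h S (G ∩ H ∩ b ⁻¹' fibreDiagonal ε₀ ι Φ) Δ φ fl flF fl' →
        IsSingleForm ε₀ (b q).2.2.val K → (∀ a a' k, ((F a a' k).1, (F a a' k).2.2) = K a k) →
        (∀ k, (F 0 0 k).1 = 0 ∧ (F 0 0 k).2.1 = 0) →
        ∃ (φ : 𝓒[m] N) (i₀ : Fin m) (fl fl' : Prop), q ∈ φ.source ∧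
          MonoLift B.down (atZero ε₀ ∂[n]X) (fun y => ((b y).1, (b y).2.2)) φ ix.std ∧
          FrontDiagChart ix h (G ∩ H ∩ b ⁻¹' fibreDiagonal ε₀ ι Φ) Δ φ i₀ fl fl' := by
      intro flF K hE hK hFK hF0
      have hlr : φ.coord (ix.l 0) q = φ.coord (ix.r 0) q := by
        rcases hqF with h1 | h1
        · exact ((hE.mem_F q hq).1 h1).2.2.1
        · exact ((hE.mem_Δ q hq).1 h1).2.1
      -- a point of the diagonals with vanishing boundary coordinates lies on the fibre diagonal
      have hl0 : φ.coord (ix.l 0) q ≠ 0 := by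
        intro hl0
        refine hqS ((hE.mem_S q hq).2 ?_)
        rcases hqF with h1 | h1
        · obtain ⟨h2, -, -, h3⟩ := (hE.mem_F q hq).1 h1
          exact ⟨hE.imp h2, hl0, hlr ▸ hl0, h3⟩
        · obtain ⟨h2, -, h3⟩ := (hE.mem_Δ q hq).1 h1
          have hbd := hf.bdry q hq
          rw [← hlr, hl0] at hbd
          have hbl : χ.coord 0 (b q).1 = 0 := (congrArg Prod.fst hbd).trans (hF0 _).1
          have hbr : χ'.coord 0 (b q).2.1 = 0 := (congrArg (fun w => w.2.1) hbd).trans (hF0 _).2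
          have hdiag := (hf.mem_diag_iff P hq).2 ⟨h2, by rw [hbl, hbr], h3⟩
          have hmem := (P.bdry _ (hf.mem q hq)).2 hbl
          rw [← hιX] at hmem
          obtain ⟨d, hd⟩ := hmem
          exact ⟨((hf.mem_fib_iff P hq).1 ⟨d, d, hd, hd.trans hdiag, rfl⟩).1, hl0, hlr ▸ hl0,
            fun j hj => h3 j hj.1⟩
      obtain ⟨ψ, h1, h2, h3⟩ := hf.exists_stdChart B P hq hK hFK Finset.univ fun j _ => by
        by_cases hj : j = 0
        · rw [hj]; exact lt_of_le_of_ne (φ.coord_nonneg _ q) (Ne.symm hl0)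
        · exact hpos hq hf j hj
      have hj : ∀ y ∈ ψ.source, ∀ j : Fin n,
          (φ.coord (ix.l j) y = φ.coord (ix.r j) y ↔ ψ.coord (ix.r j) y = 1) := fun y hy j =>
        ((h3 y hy).2.2.2.1 j (Finset.mem_univ j)).symm
      refine ⟨ψ, ix.e, flF, fl', h1, h2, fun j => (ix.r_ne_e j).symm, fun y hy => ?_,
        fun y hy => ?_⟩
      all_goals obtain ⟨h4, h5, h6, -⟩ := h3 y hy
      · rw [forall_le_iff_zero, hE.mem_F y h4, h6]
        simp only [hj y hy, and_imp]
      · rw [forall_iff_zero, hE.mem_Δ y h4]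
        simp only [hj y hy]
    have hleft : ∀ {φ : 𝓒[m] N}, q ∈ φ.source →
        HasForm ix b χ χ' (fun a a' k => (a, a * a', a * k)) φ → φ.source ⊆ U → (b q).2.2.val = 0 →
        ∃ (φ : 𝓒[m] N) (i₀ : Fin m) (fl fl' : Prop), q ∈ φ.source ∧
          MonoLift B.down (atZero ε₀ ∂[n]X) (fun y => ((b y).1, (b y).2.2)) φ ix.std ∧
          FrontDiagChart ix h (G ∩ H ∩ b ⁻¹' fibreDiagonal ε₀ ι Φ) Δ φ i₀ fl fl' := by
      intro φ hq hf hU h0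
      obtain ⟨ψ, h1, h2, h3⟩ := hf.exists_stdChart B P hq (.left h0) (fun a a' k => rfl)
        (Finset.univ.erase 0) fun j hj => hpos hq hf j (Finset.ne_of_mem_erase hj)
      have hj : ∀ y ∈ ψ.source, ∀ j : Fin n, j ≠ 0 →
          (φ.coord (ix.l j) y = φ.coord (ix.r j) y ↔ ψ.coord (ix.r j) y = 1) := fun y hy j hj =>
        ((h3 y hy).2.2.2.1 j (by simpa using hj)).symm
      refine ⟨ψ, ix.l 0, fl, fl', h1, h2, fun j => ix.l_ne_r 0 j, fun y hy => ?_, fun y hy => ?_⟩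
      all_goals
        obtain ⟨h4, h5, h6, -, h7⟩ := h3 y hy
        have h8 := hf.mem_left P L hU h4
        rw [← h7 0 (by simp)] at h8
      · rw [forall_le_iff_zero, h8.1, h5]
        simp +contextual only [hj y hy, and_imp, ne_eq, not_false_eq_true]
      · rw [forall_iff_zero, h8.2]
        simp +contextual only [hj y hy, ne_eq, not_false_eq_true]
    cases d with
    | int h =>
      exact key (hf.eqDiagChart_int P L h) (.int (h q hq)) (fun a a' k => rfl) fun k => ⟨rfl, rfl⟩
    | front h0 hU =>
      exact key (hf.eqDiagChart_front P L hU) (.right h0) (fun a a' k => rfl)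
        fun k => ⟨zero_mul k, zero_mul k⟩
    | left h0 hU hc => exact hleft hq hf hU h0
    | right h0 hU hc =>
      have h1 := hf.eq_one_of_mem P L (g := fun z => z (ix.l 0)) (continuous_coord _)
        (fun y hy => ⟨_, _, Or.inr rfl⟩) hq hqF
      obtain ⟨ψ, h2, h3, h4⟩ := hf.exists_left hq (one_pos.trans_eq h1.symm)
      exact hleft h2 h4 (h3.trans hU) h0
    | left₁ h0 _ hc =>
      exact absurd (hc.symm.trans (hf.eq_one_of_mem P L (g := fun z => z (ix.r 0))
        (continuous_coord _) (fun y hy => ⟨_, _, Or.inl rfl⟩) hq hqF)) zero_ne_one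
    | left₂ h0 _ hc =>
      have h1 := hf.eq_one_of_mem P L (g := fun z => z ix.e * z (ix.r 0))
        ((continuous_coord _).mul (continuous_coord _)) (fun y hy => ⟨_, _, Or.inl rfl⟩) hq hqF
      exact absurd ((mul_eq_zero_of_left hc _).symm.trans h1) zero_ne_one
    | right₁ h0 _ hc =>
      exact absurd (hc.symm.trans (hf.eq_one_of_mem P L (g := fun z => z (ix.l 0))
        (continuous_coord _) (fun y hy => ⟨_, _, Or.inr rfl⟩) hq hqF)) zero_ne_one
    | right₂ h0 _ hc =>
      have h1 := hf.eq_one_of_mem P L (g := fun z => z ix.e * z (ix.l 0))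
        ((continuous_coord _).mul (continuous_coord _)) (fun y hy => ⟨_, _, Or.inr rfl⟩) hq hqF
      exact absurd ((mul_eq_zero_of_left hc _).symm.trans h1) zero_ne_one

end DoubleDiagonals

/-! ### The double space -/

/-- The lift of the closure of the preimage of a set that lies away from the centre. -/
lemma Blowup.lift_closure_preimage {m : ℕ} {N : Type u} [TopologicalSpace N]
    [ChartedSpace ℝ₊^m N] {S : Set N} (B : Blowup (𝓠 m) m S) {Z : Type*}
    (b : N → Z) {T R : Set Z} (hS : S ⊆ b ⁻¹' R) (hTR : Disjoint T R) :
    B.lift (closure (b ⁻¹' T)) = closure ((b ∘ B.down) ⁻¹' T) := by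
  rw [B.lift_closure]
  congr 1
  ext y
  exact ⟨fun h => h.1, fun h => ⟨h, fun hy => disjoint_left.1 hTR h (hS hy)⟩⟩

section DoubleSpace

variable {n h : ℕ} [NeZero n] {X : Type u} [TopologicalSpace X]
  [ChartedSpace (EuclideanHalfSpace n) X] [IsManifold (𝓡∂ n) ∞ X] {ε₀ : ℝ} [hε : Fact (0 < ε₀)]
  {D Y : Type*} {ι : D → X} {Φ : D → Y} {x : X → ℝ}
  (hP : ∀ p p' : X, ∃ (χ χ' : CornerChart (𝓡∂ n) X n) (fl fl' : Prop),
    p ∈ χ.source ∧ p' ∈ χ'.source ∧ FibrePair ι Φ x h χ χ' fl fl')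

include hP in
omit [IsManifold (𝓡∂ n) ∞ X] in
lemma isClosed_fibreDiagonal : IsClosed (fibreDiagonal ε₀ ι Φ) := by
  refine isClosed_of_closure_subset fun w hw => ?_
  obtain ⟨χ, χ', fl, fl', h1, h2, P⟩ := hP w.1 w.2.1
  obtain ⟨θ, hwθ, hs, hl, hr⟩ := exists_doubleBaseChart_mem (ε₀ := ε₀) h1 h2
  have key : ∀ y ∈ θ.source, y ∈ fibreDiagonal ε₀ ι Φ ↔ (θ y).val ∈
      {z : ℝ^(n + n + 1) | fl ∧ z ((prodIdx n).l 0) = 0 ∧ z ((prodIdx n).r 0) = 0 ∧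
        ∀ j : Fin n, (j ≠ 0 ∧ j.val ≤ h) → z ((prodIdx n).l j) = z ((prodIdx n).r j)} := by
    intro y hy
    refine (P.fib _ (hs y hy).1 _ (hs y hy).2).trans ?_
    rw [← hl y hy, ← hr y hy]
    refine and_congr_right fun _ => and_congr_right fun _ => and_congr_right fun _ =>
      forall_congr' fun j => ?_
    rw [← hl y hy, ← hr y hy, and_imp]
    rfl
  refine (key w hwθ).2 (CornerChart.mem_of_mem_closure ?_ (fun y hy hyF => (key y hy).1 hyF) hwθ hw)
  exact isClosed_const.inter ((isClosed_coord_eq_zero _).inter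
    ((isClosed_coord_eq_zero _).inter isClosed_coord_eq_coord))

/-- The corner `(∂X)² × {0}` of `X² × [0,ε₀]`. -/
local notation "𝒞" => atZero₂ ε₀ ∂[n]X ∂[n]X

variable {B₁ : Blowup 𝓑[n] (n + n + 1) (atZero₂ ε₀ ∂[n]X ∂[n]X)}

lemma lift_side_subset : B₁.lift (atZero₂ ε₀ univ ∂[n]X) ⊆ B₁.down ⁻¹' atZero₂ ε₀ univ ∂[n]X :=
  closure_minimal (preimage_mono sdiff_subset) ((isClosed_atZero₂ isClosed_univ
    (ModelWithCorners.isClosed_boundary (n := ∞) (by simp))).preimage B₁.continuous_down)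

omit [IsManifold (𝓡∂ n) ∞ X] in
lemma lift_side_eq : B₁.lift (atZero₂ ε₀ univ ∂[n]X) =
    closure {y | (B₁.down y).1 ∉ ∂[n]X ∧ (B₁.down y).2.1 ∈ ∂[n]X ∧ (B₁.down y).2.2.val = 0} := by
  rw [Blowup.lift]
  congr 1
  ext y
  exact ⟨fun ⟨⟨_, h1, h2⟩, h3⟩ => ⟨fun h => h3 ⟨h, h1, h2⟩, h1, h2⟩,
    fun ⟨h0, h1, h2⟩ => ⟨⟨trivial, h1, h2⟩, fun h => h0 h.1⟩⟩

variable {B₂ : Blowup (𝓠 (n + n + 1)) (n + n + 1) (B₁.lift (atZero₂ ε₀ univ ∂[n]X))}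

/-- The lift to the second blow-up of a set that meets `X × ∂X × {0}` only in the corner. -/
lemma lift_lift_eq {T : Set (X × X × Icc (0 : ℝ) ε₀)}
    (hT : ∀ w ∈ T, w.2.1 ∈ ∂[n]X → w.2.2.val = 0 → w.1 ∈ ∂[n]X) :
    B₂.lift (B₁.lift T) = closure ((B₁.down ∘ B₂.down) ⁻¹' (T \ 𝒞)) :=
  B₂.lift_closure_preimage B₁.down lift_side_subset <| disjoint_left.2 fun w hw hw' =>
    hw.2 ⟨hT w hw.1 hw'.2.1 hw'.2.2, hw'.2⟩

lemma lift_lift_side_eq : B₂.lift (B₁.lift (atZero₂ ε₀ ∂[n]X univ)) =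
    closure {y | ((swapPoints ∘ B₁.down ∘ B₂.down) y).1 ∉ ∂[n]X ∧
      ((swapPoints ∘ B₁.down ∘ B₂.down) y).2.1 ∈ ∂[n]X ∧
      ((swapPoints ∘ B₁.down ∘ B₂.down) y).2.2.val = 0} := by
  rw [lift_lift_eq fun w hw _ _ => hw.1]
  congr 1
  ext y
  exact ⟨fun ⟨⟨h1, _, h2⟩, h3⟩ => ⟨fun h => h3 ⟨h1, h, h2⟩, h1, h2⟩,
    fun ⟨h0, h1, h2⟩ => ⟨⟨h1, trivial, h2⟩, fun h => h0 h.2.1⟩⟩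

lemma lift_lift_side_subset : B₂.lift (B₁.lift (atZero₂ ε₀ ∂[n]X univ)) ⊆
    (B₁.down ∘ B₂.down) ⁻¹' atZero₂ ε₀ ∂[n]X univ := by
  rw [lift_lift_eq fun w hw _ _ => hw.1]
  exact closure_minimal (preimage_mono sdiff_subset) ((isClosed_atZero₂
    (ModelWithCorners.isClosed_boundary (n := ∞) (by simp)) isClosed_univ).preimage
    (B₁.continuous_down.comp B₂.continuous_down))

variable {B₃ : Blowup (𝓠 (n + n + 1)) (n + n + 1) (B₂.lift (B₁.lift (atZero₂ ε₀ ∂[n]X univ)))}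

/-- The blow-down map of `X²_(2)`. -/
local notation "β₃" => B₁.down ∘ B₂.down ∘ B₃.down

/-- The lift to the third blow-up of a set that meets the sides only in the corner. -/
lemma lift_lift_lift_eq {T : Set (X × X × Icc (0 : ℝ) ε₀)}
    (hT : ∀ w ∈ T, w.1 ∈ ∂[n]X ↔ w.2.1 ∈ ∂[n]X) :
    B₃.lift (B₂.lift (B₁.lift T)) = closure {y | β₃ y ∈ T ∧ β₃ y ∉ 𝒞} := by
  rw [lift_lift_eq fun w hw h1 _ => (hT w hw).2 h1]
  exact B₃.lift_closure_preimage (B₁.down ∘ B₂.down) lift_lift_side_subset <|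
    disjoint_left.2 fun w hw hw' => hw.2 ⟨hw'.1, (hT w hw.1).1 hw'.1, hw'.2.2⟩

variable (B₃) in
/-- The part of the third blow-up over which the blow-ups of the two sides are diffeomorphisms. -/
def offSides : Set B₃.total := B₃.down ⁻¹' (B₂.down ⁻¹' (univ \ B₁.lift (atZero₂ ε₀ univ ∂[n]X)) \
    B₂.lift (B₁.lift (atZero₂ ε₀ ∂[n]X univ)))

/-- The lift `D_B` of the fibre diagonal to `X²_(2)`. -/
local notation "𝓢" => B₃.lift (B₂.lift (B₁.lift (fibreDiagonal ε₀ ι Φ)))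

/-- The centre `D_F`: the points of the front face on the lift of `{x = x'}` that lie over the fibre
diagonal. -/
local notation "𝓕" => B₃.lift (B₂.lift (Set.preimage B₁.down 𝒞)) ∩
  B₃.lift (B₂.lift (B₁.lift (Set.ofPred fun q => x (Prod.fst q) = x (Prod.fst (Prod.snd q))))) ∩
  Set.preimage β₃ (fibreDiagonal ε₀ ι Φ)

/-- The lift of the diagonal to `X²_(2)`. -/
local notation "𝓓" => B₃.lift (B₂.lift (B₁.lift (Set.ofPred fun q => Prod.fst q = Prod.fst (Prod.snd q))))

/-- The sets in the definition of the double space are given by closures in `X²_(2)`. -/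
lemma areLifts (hιX : range ι = ∂[n]X) (hx : IsBdryDefiningFunction n x) :
    AreLifts n ι Φ x β₃ (offSides B₃) 𝓢 (B₃.lift (B₂.lift (B₁.down ⁻¹' 𝒞)))
      (B₃.lift (B₂.lift (B₁.lift {q | x q.1 = x q.2.1}))) 𝓓 where
  fib := lift_lift_lift_eq <| by
    rintro w ⟨d, d', h1, h2, -⟩
    rw [← h1, ← h2, ← hιX]
    simp
  isClosed_front := isClosed_closure
  front_subset y hy := by
    refine closure_minimal (s := B₃.down ⁻¹' _) (t := β₃ ⁻¹' _) ?_
      ((B₁.isClosed).preimage (B₁.continuous_down.comp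
        (B₂.continuous_down.comp B₃.continuous_down))) hy
    rintro y ⟨hy, -⟩
    refine closure_minimal (s := B₂.down ⁻¹' _) (t := (B₁.down ∘ B₂.down) ⁻¹' _) ?_
      ((B₁.isClosed).preimage (B₁.continuous_down.comp B₂.continuous_down)) hy
    exact fun y hy => hy.1
  subset_front y hy hyc := subset_closure ⟨subset_closure ⟨hyc, hy.1.2⟩, hy.2⟩
  level := lift_lift_lift_eq <| by
    intro w (hw : x w.1 = x w.2.1)
    rw [← hx.2.2.1, ← hx.2.2.1, hw]
  diag := lift_lift_lift_eq <| by
    intro w (hw : w.1 = w.2.1)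
    rw [hw]

include hP

omit [IsManifold (𝓡∂ n) ∞ X] in
lemma isPSubmanifold_side :
    IsPSubmanifold (𝓠 (n + n + 1)) (n + n + 1) (B₁.lift (atZero₂ ε₀ univ ∂[n]X)) ∧
    ((B₁.lift (atZero₂ ε₀ univ ∂[n]X)).Nonempty → (B₁.lift (atZero₂ ε₀ univ ∂[n]X))ᶜ.Nonempty) :=
  (doubleForms_corner hP B₁).isPSubmanifold_side lift_side_eq

omit [IsManifold (𝓡∂ n) ∞ X] in
/-- The charts of the second blow-up, with the two factors exchanged. -/
lemma doubleForms_side : DoubleForms ι Φ x h (prodIdx n).swap (swapPoints ∘ B₁.down ∘ B₂.down)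
    False True (B₂.down ⁻¹' (univ \ B₁.lift (atZero₂ ε₀ univ ∂[n]X))) :=
  ((doubleForms_corner hP B₁).blowup_side lift_side_eq B₂).swap

lemma isPSubmanifold_side' : IsPSubmanifold (𝓠 (n + n + 1)) (n + n + 1)
      (B₂.lift (B₁.lift (atZero₂ ε₀ ∂[n]X univ))) ∧
    ((B₂.lift (B₁.lift (atZero₂ ε₀ ∂[n]X univ))).Nonempty →
      (B₂.lift (B₁.lift (atZero₂ ε₀ ∂[n]X univ)))ᶜ.Nonempty) :=
  (doubleForms_side hP).isPSubmanifold_side lift_lift_side_eq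

lemma doubleForms_sides : DoubleForms ι Φ x h (prodIdx n) β₃
    True True (offSides B₃) := ((doubleForms_side hP).blowup_side lift_lift_side_eq B₃).swap

omit [IsManifold (𝓡∂ n) ∞ X] in
lemma isClosed_preimage_fibreDiagonal : IsClosed (β₃ ⁻¹' fibreDiagonal ε₀ ι Φ) :=
  (isClosed_fibreDiagonal hP).preimage (B₁.continuous_down.comp
    (B₂.continuous_down.comp B₃.continuous_down))

/-- The fibred diagonals of the double space, with respect to the projection to the left factor. -/
theorem fibredDiagonals_left (hιX : range ι = ∂[n]X) (hx : IsBdryDefiningFunction n x)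
    (B : AdiabaticSingleSpace n X ε₀) : FibredDiagonals B.down (atZero ε₀ ∂[n]X)
      (fun y => ((β₃ y).1, (β₃ y).2.2)) (prodIdx n) h 𝓢 𝓕
      𝓓 :=
  (doubleForms_sides hP).fibredDiagonals (areLifts hιX hx) hιX (isClosed_preimage_fibreDiagonal hP) B

/-- The fibred diagonals of the double space, with respect to the projection to the right
factor. -/
theorem fibredDiagonals_right (hιX : range ι = ∂[n]X)
    (hx : IsBdryDefiningFunction n x) (B : AdiabaticSingleSpace n X ε₀) :
    FibredDiagonals B.down (atZero ε₀ ∂[n]X) (fun y => ((β₃ y).2.1, (β₃ y).2.2))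
      (prodIdx n).swap h 𝓢 𝓕
      𝓓 := by
  have hsw : (swapPoints ∘ β₃) ⁻¹' fibreDiagonal ε₀ ι Φ =
      β₃ ⁻¹' fibreDiagonal ε₀ ι Φ := ext fun y => fibreDiagonal_swap _
  have := (doubleForms_sides hP (B₃ := B₃)).swap.fibredDiagonals (areLifts hιX hx).swap hιX
    (by rw [hsw]; exact isClosed_preimage_fibreDiagonal hP) B
  rw [hsw] at this
  exact this

end DoubleSpace
theorem mainTheorem11 {n h v : ℕ} [NeZero n] (hn : n = h + v + 1)
    {X : Type u} [TopologicalSpace X] [ChartedSpace (EuclideanHalfSpace n) X]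
    [IsManifold (𝓡∂ n) ∞ X] [CompactSpace X] [T2Space X]
    {D : Type*} [TopologicalSpace D] [ChartedSpace (EuclideanSpace ℝ (Fin (h + v))) D]
    [IsManifold (𝓡 (h + v)) ∞ D]
    {Y : Type*} [TopologicalSpace Y] [ChartedSpace (EuclideanSpace ℝ (Fin h)) Y]
    [IsManifold (𝓡 h) ∞ Y] [T2Space Y]
    {Z : Type*} [TopologicalSpace Z] [ChartedSpace (EuclideanSpace ℝ (Fin v)) Z]
    [IsManifold (𝓡 v) ∞ Z]
    -- `ι` identifies `D` with the boundary of `X`, and `Φ` is the boundary fibration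
    (ι : D → X) (hι : Manifold.IsSmoothEmbedding (𝓡 (h + v)) (𝓡∂ n) ∞ ι)
    (hιX : Set.range ι = (𝓡∂ n).boundary X)
    (Φ : D → Y) (hΦ : IsSmoothFibration (h + v) h v Z Φ)
    (x : X → ℝ) (hx : IsBdryDefiningFunction n x)
    (ε₀ : ℝ) [Fact (0 < ε₀)] :
    -- the single and the double space exist (all centres are p-submanifolds)
    Nonempty (AdiabaticSingleSpace n X ε₀) ∧
    Nonempty (AdiabaticDoubleSpace n ε₀ ι Φ x) ∧
    ∀ (Xε : AdiabaticSingleSpace n X ε₀) (W : AdiabaticDoubleSpace n ε₀ ι Φ x),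
      IsInteriorPSubmanifold (𝓠 (n + n + 1)) (n + n + 1) W.diag ∧
      (∃ πL : W.total → Xε.total,
        (∀ q, Xε.down (πL q) = ((W.down q).1, (W.down q).2.2)) ∧
        IsBFibration (n + n + 1) (n + 1) πL ∧ IsBTransverse (n + n + 1) (n + 1) πL W.diag) ∧
      (∃ πR : W.total → Xε.total,
        (∀ q, Xε.down (πR q) = ((W.down q).2.1, (W.down q).2.2)) ∧
        IsBFibration (n + n + 1) (n + 1) πR ∧ IsBTransverse (n + n + 1) (n + 1) πR W.diag) := by
  subst hn
  have hP := fun p p' => exists_fibrePair hι hιX hΦ hx p p'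
  have hX : Nonempty (AdiabaticSingleSpace (h + v + 1) X ε₀) := nonempty_singleSpace fun p => by
    obtain ⟨χ, χ', fl, fl', h1, -, P⟩ := hP p p
    exact ⟨χ, h1, P.bdry⟩
  refine ⟨hX, ?_, fun Xε W => ⟨?_, ?_, ?_⟩⟩
  · have := (𝓡∂ (h + v + 1)).secondCountableTopology
    have := ChartedSpace.secondCountable_of_sigmaCompact (EuclideanHalfSpace (h + v + 1)) X
    obtain ⟨Xε⟩ := hX
    obtain ⟨h1, h2, h3⟩ := isPSubmanifold_corner (ε₀ := ε₀) hP
    obtain ⟨B₁⟩ := nonempty_blowup h1 h3 h2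
    obtain ⟨B₂⟩ := nonempty_blowup (isPSubmanifold_side hP (B₁ := B₁)).1 exists_cornerChart
      (isPSubmanifold_side hP).2
    obtain ⟨B₃⟩ := nonempty_blowup (isPSubmanifold_side' hP (B₂ := B₂)).1 exists_cornerChart
      (isPSubmanifold_side' hP).2
    have hD := fibredDiagonals_left hP hιX hx Xε (B₃ := B₃)
    obtain ⟨B₄⟩ := nonempty_blowup hD.isPSubmanifold.1 exists_cornerChart hD.isPSubmanifold.2
    obtain ⟨B₅⟩ := nonempty_blowup (hD.isPSubmanifold_lift B₄).1 exists_cornerChart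
      (hD.isPSubmanifold_lift B₄).2
    exact ⟨⟨B₁, B₂, B₃, B₄, B₅⟩⟩
  · exact (fibredDiagonals_left hP hιX hx Xε).isInteriorPSubmanifold W.B₄ W.B₅
  · exact (fibredDiagonals_left hP hιX hx Xε).exists_bFibration W.B₄ W.B₅ Xε.isBlowup.bijOn.injOn
  · exact (fibredDiagonals_right hP hιX hx Xε).exists_bFibration W.B₄ W.B₅ Xε.isBlowup.bijOn.injOn
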